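/- **Setting.** Write $(f*g)(t)=\int_0^t f(t-\tau)g(\tau)\,d\tau$ and $\dot k=dk/dt$. Assume on the kernels $k,l$: * (K0) $k,l\in L_{1,loc}([0,\infty))\cap C^1((0,\infty))$ are nonnegative and nonincreasing, $k$ is convex, and $k*l=1$ on $(0,\infty)$. * (K1) There are $p_0>1$, $\bar c>1$, $s_0>0$ with $l\in L_{p_0}((0,s_0))$ and $\frac1t\int_0^t l(s)^{p_0}ds\le \bar c\, l(t)^{p_0}$ for $0<t\le s_0$. * (K3) There are $c_0,\omega>0$ and a nondecreasing $c:(0,\infty)\to(0,\infty)$ such that $-\dot k(y)\le \frac{c_0}{y(1*l)(y)}$ for $0<y\le1$, and $-\dot k(xy)\le c(M)\,y^{-\omega}[-\dot k(x)]$ for all $M>0$ and all $x,y$ with $0<y\le1$, $0<x(1-y)\le M$. Let $k_1=1/(1*l)$ and $r_0=\left(\int_0^\infty l\right)^{1/2}\in(0,\infty]$. For $0<r<r_0$ let $\Phi(r)>0$ be the unique time with $k_1(\Phi(r))=r^{-2}$. Set $k(0):=k(0+)=\infty$, with $\infty\cdot0=0$. Let $T>0$ and let $\Omega\subset\mathbb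 R$ be a bounded open interval. Let $A$ be measurable on $\Omega_T=(0,T)\times\Omega$ with $\nu\le A$ and $|A|\le\Lambda$ a.e., where $\nu>0$, and let $u_0\in L_2(\Omega)$. For $0<S\le T$ and an open interval $I\subset\Omega$, a *weak subsolution* of $$\partial_t(k*(u-u_0))-(A\,u_x)_x=0\qquad\text{in }(0,S)\times I$$ is a function $u\in L_2((0,S);H^1_2(I))$ with $k*u\in C([0,S];L_2(I))$ and $(k*u)|_{t=0}=0$ such that $$\int_0^S\!\!\int_I\big(-\psi_t\,[k*(u-u_0)]+A\,u_x\,\psi_x\big)\,dx\,dt\le0$$ for every nonnegative $\psi\in H^1_2((0,S);L_2(I))\cap L_2((0,S);\mathring H^1_2(I))$ with $\psi|_{t=S}=0$, where $\mathring H^1_2(I)$ is the closure of $C_0^\infty(I)$ in $H^1_2(I)$. **Theorem.** There is an exponent $\tau_1=\tau_1(\omega,p_0)>0$ and, for $\eta>0$ and $\delta\in(0,1)$, a constant $C=C(\nu,\Lambda,\delta,\eta,\bar c,c_0,c(\eta))>0$ with the following property. Suppose that the assumptions above hold, with $\eta$ and $\delta$ fixed. Then there is $r^*\in(0,r_0)$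 such that for all $0<r\le r^*$, all $t_0\in(0,T]$ with $t_0-\eta\Phi(r)\ge0$, all balls $B_r(x_0)\subset\Omega$, all weak subsolutions $u\ge0$ in $(0,t_0)\times B_r(x_0)$ with $u_0\ge0$ in $B_r(x_0)$, and all $\delta\le\sigma'<\sigma\le1$, $$\operatorname*{ess\,sup}_{U_{\sigma'}}u\le C(\sigma-\sigma')^{-2\tau_1}\frac1{r\Phi(r)}\int_{t_0-\sigma\eta\Phi(r)}^{t_0}\int_{B_{r\sigma}(x_0)}u\,dx\,dt$$ $$\qquad+\frac{C}{(\sigma-\sigma')^{\tau_1}}\left(k(t_0-\sigma\eta\Phi(r))\,r\int_{B_{r\sigma}(x_0)}u_0\,dx+r\int_0^{t_0-\sigma\eta\Phi(r)}[-\dot k(t_0-\tau)]\int_{B_{r\sigma}(x_0)}u(\tau,x)\,dx\,d\tau\right),$$ where $U_{\sigma}=(t_0-\sigma\eta\Phi(r),t_0)\times B_{r\sigma}(x_0)$. -/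

import Mathlib

open MeasureTheory Set Filter Topology
open scoped ENNReal

noncomputable section

namespace Subdiffusion

/-! ### Kernels -/

/-- Convolution on the positive half-line, `(f * g)(t) = ∫₀ᵗ f(t - τ) g(τ) dτ`. -/
def conv (f g : ℝ → ℝ) (t : ℝ) : ℝ := ∫ τ in (0 : ℝ)..t, f (t - τ) * g τ

/-- The time derivative `k̇` of the kernel. -/
def kdot (k : ℝ → ℝ) (t : ℝ) : ℝ := deriv k t

/-- `k, l ∈ L_{1,loc}([0,∞)) ∩ C¹((0,∞))` are nonnegative and nonincreasing, `k` is convex and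
`k * l = 1` on `(0,∞)`. Only the values of `k` and `l` on `(0,∞)` matter. -/
structure IsKernelPair (k l : ℝ → ℝ) : Prop where
  integrable_k : ∀ R : ℝ, 0 < R → IntegrableOn k (Ioo 0 R)
  integrable_l : ∀ R : ℝ, 0 < R → IntegrableOn l (Ioo 0 R)
  contDiff_k : ContDiffOn ℝ 1 k (Ioi 0)
  contDiff_l : ContDiffOn ℝ 1 l (Ioi 0)
  nonneg_k : ∀ t : ℝ, 0 < t → 0 ≤ k t
  nonneg_l : ∀ t : ℝ, 0 < t → 0 ≤ l t
  antitone_k : AntitoneOn k (Ioi 0)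
  antitone_l : AntitoneOn l (Ioi 0)
  convex_k : ConvexOn ℝ (Ioi 0) k
  conv_eq_one : ∀ t : ℝ, 0 < t → conv k l t = 1

/-- Higher integrability of `l` and comparability with the average, with exponent `p₀` and
constant `cbar`, on some interval `(0, s₀]`. -/
def HigherIntegrability (p₀ cbar : ℝ) (l : ℝ → ℝ) : Prop :=
  1 < p₀ ∧ 1 < cbar ∧ ∃ s₀ : ℝ, 0 < s₀ ∧
    MemLp l (ENNReal.ofReal p₀) (volume.restrict (Ioo 0 s₀)) ∧
    ∀ t : ℝ, 0 < t → t ≤ s₀ →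
      1 / t * ∫ s in (0 : ℝ)..t, (l s) ^ p₀ ≤ cbar * (l t) ^ p₀

/-- Upper estimates for the derivative of `k`, with positive constants `c₀`, `ω` and a
nondecreasing function `c : (0,∞) → (0,∞)`. -/
structure DerivativeBounds (c₀ ω : ℝ) (c : ℝ → ℝ) (k l : ℝ → ℝ) : Prop where
  c₀_pos : 0 < c₀
  ω_pos : 0 < ω
  c_pos : ∀ M : ℝ, 0 < M → 0 < c M
  c_mono : MonotoneOn c (Ioi 0)
  bound : ∀ y : ℝ, 0 < y → y ≤ 1 → -kdot k y ≤ c₀ / (y * conv (fun _ => 1) l y)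
  scaling : ∀ M : ℝ, 0 < M → ∀ x y : ℝ, 0 < y → y ≤ 1 → 0 < x * (1 - y) → x * (1 - y) ≤ M →
    -kdot k (x * y) ≤ c M * y ^ (-ω) * (-kdot k x)

/-- `k₁(t) = 1 / (1 * l)(t)`. -/
def k₁ (l : ℝ → ℝ) (t : ℝ) : ℝ := 1 / conv (fun _ => 1) l t

/-- `r₀ = (∫₀^∞ l)^{1/2} ∈ [0,∞]`. -/
def r₀ (l : ℝ → ℝ) : ℝ≥0∞ := (∫⁻ s in Ioi (0 : ℝ), ENNReal.ofReal (l s)) ^ (1 / 2 : ℝ)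

/-- `Φ(r)` for `0 < r < r₀`: the time `t > 0` with `k₁(t) = r⁻²`. For a kernel pair this time
exists and is unique because `1 * l` is continuous, vanishes at `0`, and increases strictly as
long as it is below its limit `r₀²`; the infimum is then over a one-point set. -/
def Φ (l : ℝ → ℝ) (r : ℝ) : ℝ := sInf {t : ℝ | 0 < t ∧ k₁ l t = (r ^ 2)⁻¹}

/-- The value `k(t)` for `t ≥ 0` in `[0,∞]`, as the limit from the right of the nonincreasing
function `k`. It is `k t` for `t > 0`; at `t = 0` it is `k(0+)`, which is `∞` for a kernel pair. -/
def kRight (k : ℝ → ℝ) (t : ℝ) : ℝ≥0∞ := ⨆ s ∈ Ioi t, ENNReal.ofReal (k s)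

/-! ### Function spaces on an interval and on a space-time cylinder -/

/-- `C_0^∞(I)`. -/
def IsTest (I : Set ℝ) (φ : ℝ → ℝ) : Prop :=
  ContDiff ℝ ((⊤ : ℕ∞) : WithTop ℕ∞) φ ∧ HasCompactSupport φ ∧ tsupport φ ⊆ I

/-- `f ∈ H_2^1(I)` with weak derivative `f'`, for an open set `I`. -/
structure IsH1 (I : Set ℝ) (f f' : ℝ → ℝ) : Prop where
  memLp : MemLp f 2 (volume.restrict I)
  memLp_deriv : MemLp f' 2 (volume.restrict I)
  weak : ∀ φ : ℝ → ℝ, IsTest I φ → ∫ x in I, f x * deriv φ x = -∫ x in I, f' x * φ x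

/-- `f` lies in the closure of `C_0^∞(I)` in `H_2^1(I)`, and `f'` is its weak derivative. -/
structure IsH10 (I : Set ℝ) (f f' : ℝ → ℝ) : Prop where
  isH1 : IsH1 I f f'
  approx : ∃ φ : ℕ → ℝ → ℝ, (∀ n, IsTest I (φ n)) ∧
    Tendsto (fun n => eLpNorm (fun x => φ n x - f x) 2 (volume.restrict I)) atTop (𝓝 0) ∧
    Tendsto (fun n => eLpNorm (fun x => deriv (φ n) x - f' x) 2 (volume.restrict I)) atTop (𝓝 0)

/-- Lebesgue measure on the cylinder `(0,T) × I`; points are pairs `(t, x)`. -/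
def cyl (T : ℝ) (I : Set ℝ) : Measure (ℝ × ℝ) := volume.restrict (Ioo 0 T ×ˢ I)

/-- `v ∈ L_2((0,T); H_2^1(I))` with spatial weak derivative `Dv`. -/
structure IsL2H1 (T : ℝ) (I : Set ℝ) (v Dv : ℝ × ℝ → ℝ) : Prop where
  memLp : MemLp v 2 (cyl T I)
  memLp_deriv : MemLp Dv 2 (cyl T I)
  slice : ∀ᵐ t ∂(volume.restrict (Ioo 0 T)), IsH1 I (fun x => v (t, x)) (fun x => Dv (t, x))

/-- `v` (as a class of functions modulo null sets) belongs to `C([0,T]; L_2(I))` and its value at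
the time `s ∈ [0,T]` is zero. -/
def IsContinuousL2VanishingAt (T : ℝ) (I : Set ℝ) (s : ℝ) (v : ℝ × ℝ → ℝ) : Prop :=
  ∃ w : ℝ → Lp ℝ 2 (volume.restrict I), ContinuousOn w (Icc 0 T) ∧ w s = 0 ∧
    ∀ᵐ t ∂(volume.restrict (Ioo 0 T)), (fun x => v (t, x)) =ᵐ[volume.restrict I] w t

/-- Convolution of the kernel with a function of `(t, x)` in the time variable. -/
def timeConv (k : ℝ → ℝ) (v : ℝ × ℝ → ℝ) (z : ℝ × ℝ) : ℝ := conv k (fun τ => v (τ, z.2)) z.1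

/-- A nonnegative test function
`ψ ∈ H_2^1((0,T); L_2(I)) ∩ L_2((0,T); H̊_2^1(I))` with `ψ|_{t=T} = 0`, together with its weak
derivatives `ψt` in time and `Dψ` in space. -/
structure IsTestFunction (T : ℝ) (I : Set ℝ) (ψ ψt Dψ : ℝ × ℝ → ℝ) : Prop where
  memLp : MemLp ψ 2 (cyl T I)
  memLp_time : MemLp ψt 2 (cyl T I)
  memLp_space : MemLp Dψ 2 (cyl T I)
  time : ∀ᵐ x ∂(volume.restrict I), IsH1 (Ioo 0 T) (fun t => ψ (t, x)) (fun t => ψt (t, x))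
  space : ∀ᵐ t ∂(volume.restrict (Ioo 0 T)), IsH10 I (fun x => ψ (t, x)) (fun x => Dψ (t, x))
  final : IsContinuousL2VanishingAt T I T ψ
  nonneg : ∀ᵐ z ∂(cyl T I), 0 ≤ ψ z

/-- `u` is a weak subsolution in `(0,T) × I` of
`∂ₜ(k * (u - u₀)) - (A u_x)_x = 0` with initial datum `u₀`. -/
def IsWeakSubsolution (k : ℝ → ℝ) (A : ℝ × ℝ → ℝ) (u₀ : ℝ → ℝ) (T : ℝ) (I : Set ℝ)
    (u : ℝ × ℝ → ℝ) : Prop :=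
  ∃ Du : ℝ × ℝ → ℝ, IsL2H1 T I u Du ∧
    IsContinuousL2VanishingAt T I 0 (timeConv k u) ∧
    ∀ ψ ψt Dψ : ℝ × ℝ → ℝ, IsTestFunction T I ψ ψt Dψ →
      ∫ z, (-ψt z * timeConv k (fun y => u y - u₀ y.2) z + A z * Du z * Dψ z) ∂(cyl T I) ≤ 0

/-! ### Cylinders -/

/-- `U_σ = (t₀ - σ h, t₀) × B_{rσ}(x₀)`, where `h` is the time length `η Φ(r)`. -/
def U (t₀ x₀ r h σ : ℝ) : Set (ℝ × ℝ) :=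
  Ioo (t₀ - σ * h) t₀ ×ˢ Metric.ball x₀ (r * σ)

end Subdiffusion

end

/-!
# Local boundedness of subsolutions of a time-fractional diffusion equation

The proof is De Giorgi's iteration on backward cylinders whose length in time is `η Φ(r)`, followed
by an interpolation that replaces the mean square by the mean.

*Energy.* Let `L = 1 * l`. The weak formulation contains `k * (u - u₀)` only through a time
derivative that is tested with `ψ`. Testing with averages `ψ(t) = ∫₀ᵟ Ψ(t + s) ds` of a function `Ψ`
that need not be regular in time gives an inequality between correlations `lag`. Its difference
quotients are paired with the nonnegative kernel `resolventKernel`, the kernel `h` with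
`k * h = k(· + ε)`; this produces the energy inequality for the bounded decreasing kernel `k(· + ε)`
(`ExtendedSubsolution.resolvent_inequality`). For `Ψ = φ(t) ζ² (u - λ)₊` convexity of the square
turns the memory into a nonnegative term, except for the contribution of times before the base time,
which is the `memory`. As `ε → 0` the kernels `h` concentrate at zero.

*The choice of the weight.* The gain of integrability in time comes from
`φ = χ (c₁ + ∫ l(ρ) g(· + ρ) dρ)`: the second summand solves the backward equation with right-hand
side `g`, because `k * l = 1`. With `g` the indicator function of the times `t` at which the set
`{u(t, ·) > λ}` is longer than `ρ`, the energy controls `∫ ζ² (u - λ)₊²` over these times by `c₁`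
times the right-hand side, where `c₁ ≥ L(|{g = 1}|)`. At the other times the one-dimensional bound
`sup |v|² ≤ |{v ≠ 0}| ∫ |v'|²` controls it by `ρ²` times the energy of the gradient
(`ExtendedSubsolution.levelEnergy_step`). By Chebyshev's inequality there are few times of the first
kind, and the higher integrability of `l` gives `L(τ) ≤ C (τ / Φ)^β r²` with `β = 1 - 1 / p₀`
(`IsKernelPair.conv_one_le_rpow`), so that a suitable `ρ` makes the step superlinear. Of the memory
only the integral in space matters, because the truncation is bounded in space by its gradient; it
is estimated by the tail, with the scaling property of `k̇`, and by the mass, with the upper bound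
of `k̇` (`LocalSetting.lintegral_memory_le`).

*From the mean square to the mean.* The iteration bounds `u` on the cylinder with parameter `σ'` by
`(C₄ / (σ - σ'))^m` times the sum of the root mean square, the mean and the tail
(`LocalSetting.le_rpow_mul_add`). Since the mean square is at most the supremum times the mean, a
bound `M` for `(σ - s)^(2m) u` on the cylinders with parameter `s < σ` improves to `M / 2 + c`, and
this can be repeated (`LocalSetting.le_mean_add_tail`). The constant `D ^ m` obtained in this way
depends on `ω` and `p₀` through `m` only, and `D ^ m (σ - σ') ^ (m²)` is bounded independently of
`m` because `σ - σ' ≤ 1 - δ < 1` (`rpow_mul_rpow_sq_le`); this is why `τ₁ = m + m²` allows a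
constant that does not depend on `ω` and `p₀`.
-/

noncomputable section

namespace Subdiffusion

/-! ### Kernels -/

/-- The function `f` on `(0,T)`, extended by zero. Integrals over the line of products with
truncated kernels replace convolutions on the half-line. -/
def ext (T : ℝ) (f : ℝ → ℝ) : ℝ → ℝ := (Ioo 0 T).indicator f

lemma ext_of_mem {T s : ℝ} {f : ℝ → ℝ} (h : s ∈ Ioo 0 T) : ext T f s = f s :=
  indicator_of_mem h f

lemma ext_of_notMem {T s : ℝ} {f : ℝ → ℝ} (h : s ∉ Ioo 0 T) : ext T f s = 0 :=
  indicator_of_notMem h f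

/-- Pairing a convolution on the line with a bounded function, as an iterated integral. -/
lemma integral_convolution_mul {p q f : ℝ → ℝ} (hp : Integrable p) (hq : Integrable q)
    (hf : Measurable f) {C : ℝ} (hC : ∀ x, |f x| ≤ C) :
    ∫ s, (∫ ρ, p ρ * q (s - ρ)) * f s = ∫ ρ, p ρ * ∫ s, q s * f (s + ρ) := by
  have h1 : Integrable (fun z : ℝ × ℝ => p z.2 * q (z.1 - z.2)) (volume.prod volume) := by
    simpa using hp.convolution_integrand (ContinuousLinearMap.mul ℝ ℝ) hq
  have h2 : Integrable (fun z : ℝ × ℝ => p z.2 * q (z.1 - z.2) * f z.1) (volume.prod volume) :=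
    h1.mul_bdd (c := C) (hf.comp measurable_fst).aestronglyMeasurable (ae_of_all _ fun z => hC z.1)
  calc ∫ s, (∫ ρ, p ρ * q (s - ρ)) * f s = ∫ s, ∫ ρ, p ρ * q (s - ρ) * f s := by
        simp_rw [integral_mul_const]
    _ = ∫ ρ, ∫ s, p ρ * q (s - ρ) * f s := integral_integral_swap h2
    _ = ∫ ρ, p ρ * ∫ s, q s * f (s + ρ) := by
        congr 1; ext ρ
        rw [← integral_const_mul,
          ← integral_add_right_eq_self (fun s => p ρ * q (s - ρ) * f s) ρ]
        simp only [add_sub_cancel_right, mul_assoc]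

variable {k l : ℝ → ℝ}

namespace IsKernelPair

lemma differentiableAt_k (H : IsKernelPair k l) {t : ℝ} (ht : 0 < t) : DifferentiableAt ℝ k t :=
  (H.contDiff_k.differentiableOn one_ne_zero t ht).differentiableAt (Ioi_mem_nhds ht)

lemma hasDerivAt_k (H : IsKernelPair k l) {t : ℝ} (ht : 0 < t) : HasDerivAt k (kdot k t) t :=
  (H.differentiableAt_k ht).hasDerivAt

lemma continuousOn_kdot (H : IsKernelPair k l) : ContinuousOn (kdot k) (Ioi 0) :=
  H.contDiff_k.continuousOn_deriv_of_isOpen isOpen_Ioi le_rfl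

lemma monotoneOn_kdot (H : IsKernelPair k l) : MonotoneOn (kdot k) (Ioi 0) := by
  refine H.convex_k.monotoneOn_deriv fun x hx => H.differentiableAt_k hx

lemma kdot_nonpos (H : IsKernelPair k l) {t : ℝ} (ht : 0 < t) : kdot k t ≤ 0 := by
  have h := H.antitone_k.derivWithin_nonpos (x := t)
  rwa [derivWithin_of_isOpen isOpen_Ioi ht] at h

lemma integral_kdot (H : IsKernelPair k l) {a b : ℝ} (ha : 0 < a) (hab : a ≤ b) :
    ∫ t in a..b, -kdot k t = k a - k b := by
  have hpos : ∀ x ∈ uIcc a b, 0 < x := fun x hx => by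
    rw [uIcc_of_le hab] at hx; exact ha.trans_le hx.1
  rw [intervalIntegral.integral_neg,
    intervalIntegral.integral_eq_sub_of_hasDerivAt (fun x hx => H.hasDerivAt_k (hpos x hx))]
  · ring
  · exact (H.continuousOn_kdot.mono fun x hx => hpos x hx).intervalIntegrable

lemma integrable_ext_k (H : IsKernelPair k l) (T : ℝ) : Integrable (ext T k) := by
  rcases le_or_gt T 0 with h | h
  · simp [ext, Ioo_eq_empty (not_lt.2 h)]
  · exact (H.integrable_k T h).integrable_indicator measurableSet_Ioo

lemma integrable_ext_l (H : IsKernelPair k l) (T : ℝ) : Integrable (ext T l) := by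
  rcases le_or_gt T 0 with h | h
  · simp [ext, Ioo_eq_empty (not_lt.2 h)]
  · exact (H.integrable_l T h).integrable_indicator measurableSet_Ioo

lemma ext_k_nonneg (H : IsKernelPair k l) (T s : ℝ) : 0 ≤ ext T k s :=
  indicator_nonneg (fun _ hx => H.nonneg_k _ hx.1) s

lemma ext_l_nonneg (H : IsKernelPair k l) (T s : ℝ) : 0 ≤ ext T l s :=
  indicator_nonneg (fun _ hx => H.nonneg_l _ hx.1) s

lemma intervalIntegrable_l (H : IsKernelPair k l) {a b : ℝ} (ha : 0 ≤ a) (hb : 0 ≤ b) :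
    IntervalIntegrable l volume a b := by
  have : ∀ {a b : ℝ}, 0 ≤ a → a ≤ b → IntervalIntegrable l volume a b := fun {a b} ha hab => by
    rw [intervalIntegrable_iff_integrableOn_Ioo_of_le hab]
    exact (H.integrable_l (b + 1) (by linarith)).mono_set
      (Ioo_subset_Ioo ha (by linarith))
  rcases le_total a b with h | h
  · exact this ha h
  · exact (this hb h).symm

lemma intervalIntegrable_k (H : IsKernelPair k l) {a b : ℝ} (ha : 0 ≤ a) (hb : 0 ≤ b) :
    IntervalIntegrable k volume a b := by
  have : ∀ {a b : ℝ}, 0 ≤ a → a ≤ b → IntervalIntegrable k volume a b := fun {a b} ha hab => by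
    rw [intervalIntegrable_iff_integrableOn_Ioo_of_le hab]
    exact (H.integrable_k (b + 1) (by linarith)).mono_set
      (Ioo_subset_Ioo ha (by linarith))
  rcases le_total a b with h | h
  · exact this ha h
  · exact (this hb h).symm

/-- On `(0,T)` the convolution of the truncated kernels is one. -/
lemma conv_ext (H : IsKernelPair k l) {T s : ℝ} (hs : s < T) :
    ∫ ρ, ext T l ρ * ext T k (s - ρ) = if 0 < s then 1 else 0 := by
  split_ifs with h0
  · rw [← H.conv_eq_one s h0, conv, intervalIntegral.integral_of_le h0.le,
      integral_Ioc_eq_integral_Ioo, ← integral_indicator measurableSet_Ioo]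
    congr 1; ext ρ
    by_cases hρ : ρ ∈ Ioo 0 s
    · rw [indicator_of_mem hρ, ext_of_mem ⟨hρ.1, hρ.2.trans hs⟩,
        ext_of_mem ⟨by linarith [hρ.2], by linarith [hρ.1]⟩, mul_comm]
    · rw [indicator_of_notMem hρ]
      by_cases h1 : 0 < ρ
      · rw [ext_of_notMem (s := s - ρ), mul_zero]
        exact fun h => hρ ⟨h1, by linarith [h.1]⟩
      · rw [ext_of_notMem (s := ρ), zero_mul]
        exact fun h => h1 h.1
  · rw [integral_eq_zero_of_ae]
    refine ae_of_all _ fun ρ => ?_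
    by_cases h1 : 0 < ρ
    · simp [ext_of_notMem (T := T) (s := s - ρ) (f := k) fun h => h0 (by linarith [h.1])]
    · simp [ext_of_notMem (T := T) (s := ρ) (f := l) fun h => h1 h.1]

/-- The primitive `1 * l` as an interval integral. -/
lemma conv_one (l : ℝ → ℝ) (t : ℝ) : conv (fun _ => 1) l t = ∫ s in (0 : ℝ)..t, l s := by
  simp [conv]

lemma conv_one_mono (H : IsKernelPair k l) {s t : ℝ} (hs : 0 ≤ s) (hst : s ≤ t) :
    conv (fun _ => 1) l s ≤ conv (fun _ => 1) l t := by
  simp only [conv_one]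
  refine intervalIntegral.integral_mono_interval le_rfl hs hst ?_
    (H.intervalIntegrable_l le_rfl (hs.trans hst))
  filter_upwards [ae_restrict_mem measurableSet_Ioc] with x hx using H.nonneg_l x hx.1

lemma conv_one_nonneg (H : IsKernelPair k l) {t : ℝ} (ht : 0 ≤ t) :
    0 ≤ conv (fun _ => 1) l t := by
  rw [conv_one]
  rw [intervalIntegral.integral_of_le ht]
  exact setIntegral_nonneg measurableSet_Ioc fun x hx => H.nonneg_l x hx.1

/-- The mean value of `l` over `(0,t)` is nonincreasing in `t`. -/
lemma mul_conv_one_le (H : IsKernelPair k l) {s t : ℝ} (hs : 0 < s) (hst : s ≤ t) :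
    s * conv (fun _ => 1) l t ≤ t * conv (fun _ => 1) l s := by
  simp only [conv_one]
  have h1 : s * l s ≤ ∫ x in (0 : ℝ)..s, l x := by
    have : ∫ x in (0 : ℝ)..s, l s ≤ ∫ x in (0 : ℝ)..s, l x := by
      refine intervalIntegral.integral_mono_on_of_le_Ioo hs.le (by simp)
        (H.intervalIntegrable_l le_rfl hs.le) fun x hx => H.antitone_l hx.1 hs hx.2.le
    simpa using this
  have h2 : ∫ x in s..t, l x ≤ (t - s) * l s := by
    have : ∫ x in s..t, l x ≤ ∫ x in s..t, l s := by
      refine intervalIntegral.integral_mono_on hst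
        (H.intervalIntegrable_l hs.le (hs.le.trans hst)) (by simp)
        fun x hx => H.antitone_l hs (hs.trans_le hx.1) hx.1
    simpa using this
  rw [← intervalIntegral.integral_add_adjacent_intervals (H.intervalIntegrable_l le_rfl hs.le)
    (H.intervalIntegrable_l hs.le (hs.le.trans hst))]
  nlinarith [H.nonneg_l s hs]

/-- Integrating `k * l = 1` over `(0,2t)` and discarding the part outside a square. -/
lemma integral_k_mul_conv_one_le (H : IsKernelPair k l) {t : ℝ} (ht : 0 < t) :
    (∫ s in (0 : ℝ)..t, k s) * conv (fun _ => 1) l t ≤ 2 * t := by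
  set f : ℝ → ℝ := (Iio (2 * t)).indicator 1 with hf
  have hfm : Measurable f := measurable_one.indicator measurableSet_Iio
  have hfb : ∀ x, |f x| ≤ 1 := fun x => by
    by_cases hx : x ∈ Iio (2 * t) <;> simp [hf, hx]
  have hf0 : ∀ x, 0 ≤ f x := fun x => indicator_nonneg (fun _ _ => zero_le_one) x
  have key := integral_convolution_mul (H.integrable_ext_l (2 * t)) (H.integrable_ext_k (2 * t))
    hfm hfb
  have hL : ∫ s, (∫ ρ, ext (2 * t) l ρ * ext (2 * t) k (s - ρ)) * f s = 2 * t := by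
    have : ∀ s, (∫ ρ, ext (2 * t) l ρ * ext (2 * t) k (s - ρ)) * f s
        = (Ioo 0 (2 * t)).indicator 1 s := fun s => by
      by_cases hs : s < 2 * t
      · rw [H.conv_ext hs]
        by_cases h0 : 0 < s <;> simp [hf, hs, h0]
      · simp [hf, hs]
    simp_rw [this]
    rw [integral_indicator_one measurableSet_Ioo]
    simp [measureReal_def, ht.le]
  rw [hL] at key
  rw [key]
  have e1 : ∫ s in (0 : ℝ)..t, k s = ∫ s, ext t k s := by
    rw [intervalIntegral.integral_of_le ht.le, integral_Ioc_eq_integral_Ioo, ext,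
      integral_indicator measurableSet_Ioo]
  have e2 : conv (fun _ => 1) l t = ∫ s, ext t l s := by
    rw [conv_one, intervalIntegral.integral_of_le ht.le, integral_Ioc_eq_integral_Ioo, ext,
      integral_indicator measurableSet_Ioo]
  rw [e1, e2, mul_comm, ← integral_mul_const]
  have hbd : ∀ ρ, Integrable fun s => ext (2 * t) k s * f (s + ρ) := fun ρ =>
    (H.integrable_ext_k (2 * t)).mul_bdd (c := 1)
      (hfm.comp (measurable_id.add_const ρ)).aestronglyMeasurable (ae_of_all _ fun s => hfb _)
  refine integral_mono_of_nonneg (ae_of_all _ fun ρ => mul_nonneg (H.ext_l_nonneg _ _)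
    (integral_nonneg fun s => H.ext_k_nonneg _ _)) ?_ (ae_of_all _ fun ρ => ?_)
  · have hm : Measurable fun ρ => ∫ s, ext (2 * t) k s * f (s + ρ) := by
      have : AEStronglyMeasurable (ext (2 * t) k) volume := (H.integrable_ext_k _).1
      have h2 : ∀ ρ, ∫ s, ext (2 * t) k s * f (s + ρ) = ∫ s, this.mk _ s * f (s + ρ) := fun ρ =>
        integral_congr_ae (by filter_upwards [this.ae_eq_mk] with s hs; rw [hs])
      simp_rw [h2]
      refine (StronglyMeasurable.integral_prod_right' (f := fun z : ℝ × ℝ =>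
        this.mk _ z.2 * f (z.2 + z.1)) ?_).measurable
      refine StronglyMeasurable.mul (this.stronglyMeasurable_mk.comp_measurable measurable_snd)
        (hfm.comp (measurable_snd.add measurable_fst)).stronglyMeasurable
    refine (H.integrable_ext_l (2 * t)).mul_bdd (c := ∫ s, ext (2 * t) k s) hm.aestronglyMeasurable
      (ae_of_all _ fun ρ => ?_)
    rw [Real.norm_of_nonneg (integral_nonneg fun s => mul_nonneg (H.ext_k_nonneg _ _) (hf0 _))]
    refine integral_mono (hbd ρ) (H.integrable_ext_k _) fun s => ?_
    exact mul_le_of_le_one_right (H.ext_k_nonneg _ _) ((abs_le.1 (hfb _)).2)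
  · by_cases hρ : ρ ∈ Ioo 0 t
    · have hρ' : ρ ∈ Ioo 0 (2 * t) := ⟨hρ.1, by linarith [hρ.2]⟩
      simp only [ext_of_mem hρ, ext_of_mem hρ']
      refine mul_le_mul_of_nonneg_left ?_ (H.nonneg_l _ hρ.1)
      refine integral_mono (H.integrable_ext_k _) (hbd ρ) fun s => ?_
      by_cases hs : s ∈ Ioo 0 t
      · have : s + ρ ∈ Iio (2 * t) := by simp only [mem_Iio]; linarith [hs.2, hρ.2]
        simp [ext_of_mem hs, ext_of_mem (f := k) (T := 2 * t) (s := s)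
          ⟨hs.1, by linarith [hs.2]⟩, hf, indicator_of_mem this]
      · rw [ext_of_notMem hs]
        exact mul_nonneg (H.ext_k_nonneg _ _) (hf0 _)
    · simp only [ext_of_notMem hρ, zero_mul]
      exact mul_nonneg (H.ext_l_nonneg _ _) (integral_nonneg fun s =>
        mul_nonneg (H.ext_k_nonneg _ _) (hf0 _))

/-- Integration by parts for the first moment of the shifted derivative. -/
lemma integral_mul_kdot_le (H : IsKernelPair k l) {ε h : ℝ} (hε : 0 < ε) (hh : 0 ≤ h) :
    ∫ s in (0 : ℝ)..h, s * -kdot k (s + ε) ≤ ∫ s in (0 : ℝ)..h, k s := by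
  have hpos : ∀ x ∈ uIcc 0 h, 0 < x + ε := fun x hx => by
    rw [uIcc_of_le hh] at hx; linarith [hx.1]
  have hd : ∀ x ∈ uIcc 0 h, HasDerivAt (fun s => k (s + ε)) (kdot k (x + ε)) x := fun x hx => by
    simpa using (H.hasDerivAt_k (hpos x hx)).comp_add_const x ε
  have hc : ContinuousOn (fun s => kdot k (s + ε)) (uIcc 0 h) :=
    H.continuousOn_kdot.comp (by fun_prop) fun x hx => hpos x hx
  have hck : ContinuousOn (fun s => k (s + ε)) (uIcc 0 h) := fun x hx =>
    (hd x hx).continuousAt.continuousWithinAt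
  have := intervalIntegral.integral_mul_deriv_eq_deriv_mul (fun x hx => hasDerivAt_id x) hd
    (by simp) hc.intervalIntegrable
  simp only [id, one_mul, zero_mul, sub_zero] at this
  simp only [mul_neg, intervalIntegral.integral_neg, this]
  have h1 : ∫ s in (0 : ℝ)..h, k (s + ε) ≤ ∫ s in (0 : ℝ)..h, k s := by
    refine intervalIntegral.integral_mono_on_of_le_Ioo hh hck.intervalIntegrable
      (H.intervalIntegrable_k le_rfl hh) fun x hx => H.antitone_k hx.1 ?_ (by linarith)
    simp only [mem_Ioi]; linarith [hx.1]
  have h2 : 0 ≤ h * k (h + ε) := mul_nonneg hh (H.nonneg_k _ (by linarith))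
  linarith

end IsKernelPair

/-! ### The regularized kernel and its approximate identity -/

/-- `-k̇(· + ε)` on `(0,T)`, extended by zero. -/
def shiftedDeriv (k : ℝ → ℝ) (T ε : ℝ) : ℝ → ℝ := ext T fun s => -kdot k (s + ε)

/-- The nonnegative kernel `h` with `k * h = k(· + ε)` on `(0,T)`, written as the derivative of
`k(· + ε) * l`. -/
def resolventKernel (k l : ℝ → ℝ) (T ε s : ℝ) : ℝ :=
  k ε * ext T l s - ∫ ρ, ext T l ρ * shiftedDeriv k T ε (s - ρ)

lemma integral_convolution_comm (p q : ℝ → ℝ) (s : ℝ) :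
    ∫ ρ, p ρ * q (s - ρ) = ∫ ρ, q ρ * p (s - ρ) := by
  rw [← integral_sub_left_eq_self _ volume s]
  simp [mul_comm]

lemma integrable_conv {p q : ℝ → ℝ} (hp : Integrable p) (hq : Integrable q) :
    Integrable fun s => ∫ ρ, p ρ * q (s - ρ) :=
  hp.integrable_convolution (ContinuousLinearMap.mul ℝ ℝ) hq

variable {k l : ℝ → ℝ}

namespace IsKernelPair

lemma shiftedDeriv_nonneg (H : IsKernelPair k l) {T ε : ℝ} (hε : 0 < ε) (s : ℝ) :
    0 ≤ shiftedDeriv k T ε s :=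
  indicator_nonneg (fun x hx => neg_nonneg.2
    (H.kdot_nonpos (t := x + ε) (by linarith [hx.1]))) s

lemma shiftedDeriv_le (H : IsKernelPair k l) {T ε : ℝ} (hε : 0 < ε) (s : ℝ) :
    shiftedDeriv k T ε s ≤ -kdot k ε := by
  by_cases hs : s ∈ Ioo 0 T
  · rw [shiftedDeriv, ext_of_mem hs]
    exact neg_le_neg (H.monotoneOn_kdot hε (by simp only [mem_Ioi]; linarith [hs.1])
      (by linarith [hs.1]))
  · rw [shiftedDeriv, ext_of_notMem hs]
    exact neg_nonneg.2 (H.kdot_nonpos hε)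

lemma measurable_shiftedDeriv (k : ℝ → ℝ) (T ε : ℝ) : Measurable (shiftedDeriv k T ε) := by
  refine Measurable.indicator ?_ measurableSet_Ioo
  exact ((measurable_deriv k).comp (measurable_id.add_const ε)).neg

lemma abs_shiftedDeriv_le (H : IsKernelPair k l) {T ε : ℝ} (hε : 0 < ε) (s : ℝ) :
    |shiftedDeriv k T ε s| ≤ -kdot k ε := by
  rw [abs_of_nonneg (H.shiftedDeriv_nonneg hε s)]
  exact H.shiftedDeriv_le hε s

lemma integrable_shiftedDeriv (H : IsKernelPair k l) {T ε : ℝ} (hε : 0 < ε) :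
    Integrable (shiftedDeriv k T ε) := by
  have h1 : IntegrableOn (fun _ : ℝ => -kdot k ε) (Ioo 0 T) := integrableOn_const (by simp)
  refine (integrable_indicator_iff measurableSet_Ioo).2 (h1.mono'
    ((measurable_deriv k).comp (measurable_id.add_const ε)).neg.aestronglyMeasurable ?_)
  filter_upwards [ae_restrict_mem measurableSet_Ioo] with s hs
  have := H.abs_shiftedDeriv_le hε (T := T) s
  rwa [shiftedDeriv, ext_of_mem hs] at this

lemma integral_shiftedDeriv_Iio (H : IsKernelPair k l) {T ε : ℝ} (hε : 0 < ε) {s : ℝ}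
    (hs : 0 ≤ s) (hsT : s ≤ T) :
    ∫ σ in Iio s, shiftedDeriv k T ε σ = k ε - k (s + ε) := by
  have h2 : ∫ σ in (0 : ℝ)..s, -kdot k (σ + ε) = k ε - k (s + ε) := by
    rw [intervalIntegral.integral_comp_add_right (fun x => -kdot k x), zero_add]
    exact H.integral_kdot hε (by linarith)
  rw [← h2, intervalIntegral.integral_of_le hs, integral_Ioc_eq_integral_Ioo,
    ← integral_indicator measurableSet_Iio, ← integral_indicator measurableSet_Ioo]
  congr 1; ext x
  by_cases h1 : x ∈ Ioo 0 s
  · rw [indicator_of_mem h1, indicator_of_mem (show x ∈ Iio s from h1.2), shiftedDeriv,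
      ext_of_mem ⟨h1.1, h1.2.trans_le hsT⟩]
  · rw [indicator_of_notMem h1]
    by_cases h3 : x ∈ Iio s
    · rw [indicator_of_mem h3, shiftedDeriv, ext_of_notMem]
      exact fun h => h1 ⟨h.1, h3⟩
    · rw [indicator_of_notMem h3]

lemma integrable_resolventKernel (H : IsKernelPair k l) {T ε : ℝ} (hε : 0 < ε) :
    Integrable (resolventKernel k l T ε) := by
  refine ((H.integrable_ext_l T).const_mul _).sub ?_
  exact integrable_conv (H.integrable_ext_l T) (H.integrable_shiftedDeriv (T := T) hε)

lemma resolventKernel_of_nonpos {T ε s : ℝ} (hs : s ≤ 0) : resolventKernel k l T ε s = 0 := by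
  have h1 : ∀ ρ, ext T l ρ * shiftedDeriv k T ε (s - ρ) = 0 := fun ρ => by
    by_cases h : 0 < ρ
    · rw [shiftedDeriv, ext_of_notMem (s := s - ρ), mul_zero]
      exact fun h' => by linarith [h'.1]
    · rw [ext_of_notMem (s := ρ), zero_mul]
      exact fun h' => h h'.1
  simp only [resolventKernel, h1, integral_zero, sub_zero]
  rw [ext_of_notMem, mul_zero]
  exact fun h => by linarith [h.1]

lemma integral_resolventKernel_mul (H : IsKernelPair k l) {T ε : ℝ} (hε : 0 < ε) {f : ℝ → ℝ}
    (hf : Measurable f) {C : ℝ} (hC : ∀ x, |f x| ≤ C) :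
    ∫ s, resolventKernel k l T ε s * f s
      = k ε * (∫ s, ext T l s * f s)
        - ∫ ρ, shiftedDeriv k T ε ρ * ∫ s, ext T l s * f (s + ρ) := by
  rw [← integral_convolution_mul (H.integrable_shiftedDeriv hε) (H.integrable_ext_l T) hf hC]
  simp only [resolventKernel, sub_mul, integral_convolution_comm (ext T l)]
  rw [integral_sub, ← integral_const_mul]
  · simp only [mul_assoc]
  · exact ((H.integrable_ext_l T).const_mul _).mul_bdd (c := C) hf.aestronglyMeasurable
      (ae_of_all _ hC)
  · exact (integrable_conv (H.integrable_shiftedDeriv hε) (H.integrable_ext_l T)).mul_bdd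
      (c := C) hf.aestronglyMeasurable (ae_of_all _ hC)

/-- The defect of the mass of `resolventKernel` on `(0,s)`. -/
lemma integral_resolventKernel (H : IsKernelPair k l) {T ε : ℝ} (hε : 0 < ε) {s : ℝ}
    (hs : 0 < s) (hsT : s ≤ T) :
    ∫ x in Iio s, resolventKernel k l T ε x = 1 - ∫ x in (0 : ℝ)..ε, k x * l (s + ε - x) := by
  set f : ℝ → ℝ := (Iio s).indicator 1 with hf
  have hfm : Measurable f := measurable_one.indicator measurableSet_Iio
  have hfb : ∀ x, |f x| ≤ 1 := fun x => by
    by_cases hx : x ∈ Iio s <;> simp [hf, hx]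
  have hint : IntervalIntegrable (fun τ => k (s + ε - τ) * l τ) volume 0 (s + ε) := by
    by_contra h
    have h1 := H.conv_eq_one (s + ε) (by linarith)
    rw [conv, intervalIntegral.integral_undef h] at h1
    exact zero_ne_one h1
  have h1 : ∫ x in Iio s, resolventKernel k l T ε x
      = ∫ x, resolventKernel k l T ε x * f x := by
    rw [← integral_indicator measurableSet_Iio]
    congr 1; ext x
    by_cases hx : x ∈ Iio s <;> simp [hf, hx]
  have h2 : ∫ x, (∫ ρ, ext T l ρ * shiftedDeriv k T ε (x - ρ)) * f x
      = ∫ ρ, ext s l ρ * (k ε - k (s + ε - ρ)) := by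
    rw [integral_convolution_mul (H.integrable_ext_l T) (H.integrable_shiftedDeriv hε) hfm hfb]
    congr 1; ext ρ
    by_cases hρ : ρ ∈ Ioo 0 s
    · rw [ext_of_mem hρ, ext_of_mem ⟨hρ.1, hρ.2.trans_le hsT⟩]
      congr 1
      have := H.integral_shiftedDeriv_Iio (T := T) hε (s := s - ρ) (by linarith [hρ.2])
        (by linarith [hρ.1])
      rw [show s + ε - ρ = s - ρ + ε by ring, ← this, ← integral_indicator measurableSet_Iio]
      congr 1; ext x
      by_cases hx : x ∈ Iio (s - ρ)
      · have : x + ρ ∈ Iio s := by simp only [mem_Iio] at hx ⊢; linarith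
        simp [hf, this, hx]
      · have : x + ρ ∉ Iio s := by simp only [mem_Iio] at hx ⊢; linarith
        simp [hf, this, hx]
    · rw [ext_of_notMem hρ, zero_mul]
      by_cases h0 : 0 < ρ
      · have : ∀ x, shiftedDeriv k T ε x * f (x + ρ) = 0 := fun x => by
          by_cases hx : 0 < x
          · have : x + ρ ∉ Iio s := fun h => hρ ⟨h0, by simp only [mem_Iio] at h; linarith⟩
            simp [hf, this]
          · rw [shiftedDeriv, ext_of_notMem, zero_mul]
            exact fun h => hx h.1
        simp [this]
      · rw [ext_of_notMem (s := ρ), zero_mul]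
        exact fun h => h0 h.1
  have hsub : IntervalIntegrable (fun τ => k (s + ε - τ) * l τ) volume 0 s :=
    hint.mono_set (by rw [uIcc_of_le hs.le, uIcc_of_le (by linarith)]
                      exact Icc_subset_Icc le_rfl (by linarith))
  have hsub2 : IntervalIntegrable (fun τ => k (s + ε - τ) * l τ) volume s (s + ε) :=
    hint.mono_set (by rw [uIcc_of_le (by linarith), uIcc_of_le (by linarith)]
                      exact Icc_subset_Icc hs.le le_rfl)
  have h3 : ∫ ρ, ext s l ρ * (k ε - k (s + ε - ρ))
      = k ε * (∫ ρ, ext s l ρ) - ∫ τ in (0 : ℝ)..s, k (s + ε - τ) * l τ := by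
    rw [intervalIntegral.integral_of_le hs.le, integral_Ioc_eq_integral_Ioo,
      ← integral_indicator measurableSet_Ioo, ← integral_const_mul, ← integral_sub]
    · congr 1; ext x
      by_cases hx : x ∈ Ioo 0 s
      · rw [ext_of_mem hx, indicator_of_mem hx]; ring
      · rw [ext_of_notMem hx, indicator_of_notMem hx]; ring
    · exact (H.integrable_ext_l s).const_mul _
    · exact (integrable_indicator_iff measurableSet_Ioo).2
        ((intervalIntegrable_iff_integrableOn_Ioo_of_le hs.le).1 hsub)
  have h4 : ∫ x, ext T l x * f x = ∫ ρ, ext s l ρ := by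
    congr 1; ext x
    by_cases hx : x ∈ Ioo 0 s
    · rw [ext_of_mem hx, ext_of_mem ⟨hx.1, hx.2.trans_le hsT⟩]
      simp [hf, hx.2]
    · rw [ext_of_notMem hx]
      by_cases h0 : 0 < x
      · have : x ∉ Iio s := fun h => hx ⟨h0, h⟩
        simp [hf, this]
      · rw [ext_of_notMem (s := x), zero_mul]
        exact fun h => h0 h.1
  have h5 : ∫ τ in s..(s + ε), k (s + ε - τ) * l τ = ∫ x in (0 : ℝ)..ε, k x * l (s + ε - x) := by
    have := intervalIntegral.integral_comp_sub_left (a := 0) (b := ε)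
      (fun τ => k (s + ε - τ) * l τ) (s + ε)
    simp only [sub_sub_cancel, sub_zero, add_sub_cancel_right] at this
    exact this.symm
  have h6 := H.conv_eq_one (s + ε) (by linarith)
  rw [conv, ← intervalIntegral.integral_add_adjacent_intervals hsub hsub2, h5] at h6
  rw [h1]
  simp only [resolventKernel, sub_mul, mul_assoc]
  rw [integral_sub, h2, h3, integral_const_mul, h4]
  · linarith
  · exact ((H.integrable_ext_l T).mul_bdd (c := 1) hfm.aestronglyMeasurable
      (ae_of_all _ hfb)).const_mul _
  · exact (integrable_conv (H.integrable_ext_l T) (H.integrable_shiftedDeriv hε)).mul_bdd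
      (c := 1) hfm.aestronglyMeasurable (ae_of_all _ hfb)

lemma intervalIntegrable_defect (H : IsKernelPair k l) {ε s : ℝ} (hε : 0 < ε) (hs : 0 < s) :
    IntervalIntegrable (fun x => k x * l (s + ε - x)) volume 0 ε := by
  have h : IntervalIntegrable (fun τ => k (s + ε - τ) * l τ) volume 0 (s + ε) := by
    by_contra h
    have h1 := H.conv_eq_one (s + ε) (by linarith)
    rw [conv, intervalIntegral.integral_undef h] at h1
    exact zero_ne_one h1
  have h2 := h.comp_sub_left (s + ε)
  simp only [sub_sub_cancel, sub_zero, sub_self] at h2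
  refine h2.symm.mono_set ?_
  rw [uIcc_of_le hε.le, uIcc_of_le (by linarith)]
  exact Icc_subset_Icc le_rfl (by linarith)

lemma defect_nonneg (H : IsKernelPair k l) {ε s : ℝ} (hε : 0 < ε) (hs : 0 < s) :
    0 ≤ ∫ x in (0 : ℝ)..ε, k x * l (s + ε - x) := by
  rw [intervalIntegral.integral_of_le hε.le]
  exact setIntegral_nonneg measurableSet_Ioc fun x hx =>
    mul_nonneg (H.nonneg_k _ hx.1) (H.nonneg_l _ (by linarith [hx.2]))

lemma defect_le (H : IsKernelPair k l) {ε s : ℝ} (hε : 0 < ε) (hs : 0 < s) :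
    ∫ x in (0 : ℝ)..ε, k x * l (s + ε - x) ≤ l s * ∫ x in (0 : ℝ)..ε, k x := by
  rw [← intervalIntegral.integral_const_mul]
  refine intervalIntegral.integral_mono_on_of_le_Ioo hε.le (H.intervalIntegrable_defect hε hs)
    ((H.intervalIntegrable_k le_rfl hε.le).const_mul _) fun x hx => ?_
  rw [mul_comm]
  exact mul_le_mul_of_nonneg_right (H.antitone_l hs (by simp only [mem_Ioi]; linarith [hx.2])
    (by linarith [hx.2])) (H.nonneg_k _ hx.1)

lemma defect_antitone (H : IsKernelPair k l) {ε s t : ℝ} (hε : 0 < ε) (hs : 0 < s)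
    (hst : s ≤ t) : ∫ x in (0 : ℝ)..ε, k x * l (t + ε - x)
      ≤ ∫ x in (0 : ℝ)..ε, k x * l (s + ε - x) := by
  refine intervalIntegral.integral_mono_on_of_le_Ioo hε.le
    (H.intervalIntegrable_defect hε (hs.trans_le hst))
    (H.intervalIntegrable_defect hε hs) fun x hx => ?_
  exact mul_le_mul_of_nonneg_left (H.antitone_l (by simp only [mem_Ioi]; linarith [hx.2])
    (by simp only [mem_Ioi]; linarith [hx.2]) (by linarith)) (H.nonneg_k _ hx.1)

/-- `resolventKernel` is nonnegative: its primitive is monotone since `l` is nonincreasing. -/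
lemma resolventKernel_nonneg (H : IsKernelPair k l) {T ε : ℝ} (hε : 0 < ε) :
    ∀ᵐ s, s ∈ Ioo 0 T → 0 ≤ resolventKernel k l T ε s := by
  have hi := H.integrable_resolventKernel (T := T) hε
  filter_upwards [LocallyIntegrable.ae_hasDerivAt_integral hi.locallyIntegrable] with s hs hsT
  have hd := hs 0
  have heq : ∀ t, ∫ x in (0 : ℝ)..t, resolventKernel k l T ε x
      = (∫ x in Iio t, resolventKernel k l T ε x) - ∫ x in Iio 0, resolventKernel k l T ε x := by
    intro t
    rw [← integral_Iic_eq_integral_Iio, ← integral_Iic_eq_integral_Iio,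
      intervalIntegral.integral_Iic_sub_Iic hi.integrableOn hi.integrableOn]
  have hm : MonotoneOn (fun t => ∫ x in (0 : ℝ)..t, resolventKernel k l T ε x) (Ioo 0 T) := by
    intro a ha b hb hab
    simp only [heq]
    rw [H.integral_resolventKernel hε ha.1 ha.2.le, H.integral_resolventKernel hε hb.1 hb.2.le]
    linarith [H.defect_antitone hε ha.1 hab]
  have h1 := hm.derivWithin_nonneg (x := s)
  rwa [derivWithin_of_isOpen isOpen_Ioo hsT, hd.deriv] at h1

lemma setIntegral_Iio_eq_Ioo (k l : ℝ → ℝ) (T ε s : ℝ) :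
    ∫ x in Iio s, resolventKernel k l T ε x = ∫ x in Ioo 0 s, resolventKernel k l T ε x := by
  rw [← integral_indicator measurableSet_Iio, ← integral_indicator measurableSet_Ioo]
  congr 1; ext x
  by_cases h0 : 0 < x
  · by_cases h1 : x < s <;> simp [h0, h1]
  · by_cases h1 : x < s <;> simp [h0, h1, resolventKernel_of_nonpos (not_lt.1 h0)]

/-- As `ε → 0` the kernels `resolventKernel k l T ε` concentrate at zero. -/
lemma tendsto_integral_resolventKernel (H : IsKernelPair k l) {T : ℝ} (hT : 0 < T) {b : ℝ → ℝ}
    (hb : Continuous b) {C : ℝ} (hC : ∀ x, |b x| ≤ C) :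
    Tendsto (fun ε => ∫ s in Ioo 0 T, resolventKernel k l T ε s * b s) (𝓝[>] 0) (𝓝 (b 0)) := by
  have hC0 : 0 ≤ C := (abs_nonneg _).trans (hC 0)
  rw [Metric.tendsto_nhds]
  intro θ hθ
  obtain ⟨d, hd, hdb⟩ := Metric.continuousAt_iff.1 (hb.continuousAt (x := 0)) (θ / 4) (by positivity)
  set s := min (d / 2) (T / 2) with hsdef
  have hs : 0 < s := lt_min (by positivity) (by positivity)
  have hsT : s < T := (min_le_right _ _).trans_lt (by linarith)
  have hlim : Tendsto (fun ε => l s * ∫ x in (0 : ℝ)..ε, k x) (𝓝[>] 0) (𝓝 0) := by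
    have h1 : ContinuousOn (fun ε => ∫ x in (0 : ℝ)..ε, k x) (Icc 0 1) := by
      have h0 : IntegrableOn k (uIcc 0 1) := by
        rw [uIcc_of_le zero_le_one]
        exact (intervalIntegrable_iff_integrableOn_Icc_of_le zero_le_one).1
          (H.intervalIntegrable_k le_rfl zero_le_one)
      simpa [uIcc_of_le zero_le_one] using intervalIntegral.continuousOn_primitive_interval h0
    have h2 := (h1 0 (by simp)).tendsto
    simp only [intervalIntegral.integral_same] at h2
    have h3 : 𝓝[>] (0 : ℝ) ≤ 𝓝[Icc 0 1] 0 := by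
      refine nhdsWithin_le_of_mem ?_
      exact mem_of_superset (Ioc_mem_nhdsGT zero_lt_one) Ioc_subset_Icc_self
    simpa using (h2.mono_left h3).const_mul (l s)
  have hsmall : ∀ᶠ ε in 𝓝[>] (0 : ℝ), l s * ∫ x in (0 : ℝ)..ε, k x < θ / (8 * (C + 1)) :=
    hlim.eventually_lt_const (by positivity)
  filter_upwards [hsmall, self_mem_nhdsWithin] with ε h1 hε
  have hε : 0 < ε := hε
  set r := resolventKernel k l T ε with hr
  have hi : Integrable r := H.integrable_resolventKernel hε
  have hnn : ∀ᵐ x ∂(volume.restrict (Ioo 0 T)), 0 ≤ r x := by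
    rw [ae_restrict_iff' measurableSet_Ioo]
    exact H.resolventKernel_nonneg hε
  have hmass : ∀ t, 0 < t → t ≤ T → ∫ x in Ioo 0 t, r x
      = 1 - ∫ x in (0 : ℝ)..ε, k x * l (t + ε - x) := fun t ht htT => by
    rw [← setIntegral_Iio_eq_Ioo k l T ε t, H.integral_resolventKernel hε ht htT]
  have hMT := hmass T hT le_rfl
  have hMs := hmass s hs hsT.le
  have hdT := H.defect_nonneg hε hT
  have hds := H.defect_le hε hs
  have hdTs := H.defect_antitone hε hs hsT.le
  -- pointwise: near zero `b` is close to `b 0`, further out the mass is small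
  have hpt : ∀ x ∈ Ioo 0 T,
      |b x - b 0| ≤ θ / 4 + (Ioo 0 T \ Ioo 0 s).indicator (fun _ => 2 * C) x := by
    intro x hx
    by_cases hxs : x ∈ Ioo 0 s
    · have h2 : x ∉ Ioo 0 T \ Ioo 0 s := fun h => h.2 hxs
      rw [indicator_of_notMem h2, add_zero]
      have : dist x 0 < d := by
        rw [Real.dist_eq, sub_zero, abs_of_pos hx.1]
        have := min_le_left (d / 2) (T / 2)
        linarith [hxs.2]
      have h3 := hdb this
      rw [Real.dist_eq] at h3
      exact h3.le
    · rw [indicator_of_mem (show x ∈ Ioo 0 T \ Ioo 0 s from ⟨hx, hxs⟩)]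
      have := abs_sub (b x) (b 0)
      linarith [hC x, hC 0]
  have hbi : IntegrableOn (fun x => r x * b x) (Ioo 0 T) :=
    (hi.mul_bdd (c := C) hb.aestronglyMeasurable (ae_of_all _ hC)).integrableOn
  have hrT : IntegrableOn r (Ioo 0 T) := hi.integrableOn
  have hrd : ∫ x in Ioo 0 T \ Ioo 0 s, r x ≤ l s * ∫ x in (0 : ℝ)..ε, k x := by
    rw [setIntegral_sdiff measurableSet_Ioo hrT (Ioo_subset_Ioo le_rfl hsT.le), hMT, hMs]
    linarith
  have hle : ∫ x in Ioo 0 T, r x * |b x - b 0| ≤ θ / 4 + 2 * C * (l s * ∫ x in (0 : ℝ)..ε, k x) := by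
    calc ∫ x in Ioo 0 T, r x * |b x - b 0|
        ≤ ∫ x in Ioo 0 T, (θ / 4 * r x
          + (Ioo 0 T \ Ioo 0 s).indicator (fun x => 2 * C * r x) x) := by
          refine integral_mono_of_nonneg ?_ ?_ ?_
          · filter_upwards [hnn] with x hx using mul_nonneg hx (abs_nonneg _)
          · exact (hrT.const_mul _).add ((hrT.const_mul _).indicator
              (measurableSet_Ioo.diff measurableSet_Ioo))
          · filter_upwards [hnn, ae_restrict_mem measurableSet_Ioo] with x hx hxT
            refine (mul_le_mul_of_nonneg_left (hpt x hxT) hx).trans (le_of_eq ?_)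
            by_cases h : x ∈ Ioo 0 T \ Ioo 0 s
            · rw [indicator_of_mem h, indicator_of_mem h]; ring
            · rw [indicator_of_notMem h, indicator_of_notMem h]; ring
      _ = θ / 4 * (∫ x in Ioo 0 T, r x) + 2 * C * ∫ x in Ioo 0 T \ Ioo 0 s, r x := by
          rw [integral_add (hrT.const_mul _) ((hrT.const_mul _).indicator
              (measurableSet_Ioo.diff measurableSet_Ioo)), integral_const_mul,
            setIntegral_indicator (measurableSet_Ioo.diff measurableSet_Ioo),
            inter_eq_right.2 sdiff_subset, integral_const_mul]
      _ ≤ _ := by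
          gcongr
          have : ∫ x in Ioo 0 T, r x ≤ 1 := by linarith
          nlinarith
  have hdiff : (∫ x in Ioo 0 T, r x * b x) - b 0
      = (∫ x in Ioo 0 T, r x * (b x - b 0)) - b 0 * (1 - ∫ x in Ioo 0 T, r x) := by
    simp only [mul_sub]
    rw [integral_sub hbi (hrT.mul_const _), integral_mul_const]
    ring
  have habs : |∫ x in Ioo 0 T, r x * (b x - b 0)| ≤ ∫ x in Ioo 0 T, r x * |b x - b 0| := by
    refine (abs_integral_le_integral_abs).trans (le_of_eq ?_)
    refine integral_congr_ae ?_
    filter_upwards [hnn] with x hx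
    rw [abs_mul, abs_of_nonneg hx]
  rw [Real.dist_eq, hdiff]
  have hb0 : |b 0 * (1 - ∫ x in Ioo 0 T, r x)| ≤ C * (l s * ∫ x in (0 : ℝ)..ε, k x) := by
    rw [abs_mul, hMT, abs_of_nonneg (a := 1 - _) (by linarith)]
    exact mul_le_mul (hC 0) (by linarith) (by linarith) hC0
  have h8 : C * (l s * ∫ x in (0 : ℝ)..ε, k x) ≤ C * (θ / (8 * (C + 1))) :=
    mul_le_mul_of_nonneg_left h1.le hC0
  have h9 : C * (θ / (8 * (C + 1))) ≤ θ / 8 := by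
    rw [← mul_div_assoc, div_le_div_iff₀ (by positivity) (by positivity)]
    nlinarith
  calc _ ≤ _ := abs_sub _ _
    _ < θ := by linarith
  

end IsKernelPair

lemma measurable_ext {f : ℝ → ℝ} (hf : ContinuousOn f (Ioi 0)) (T : ℝ) :
    Measurable (ext T f) := by
  classical
  rw [ext, ← piecewise_eq_indicator]
  exact (hf.mono fun x hx => hx.1).measurable_piecewise continuousOn_const measurableSet_Ioo

lemma measurable_integral_mul_add {p f : ℝ → ℝ} (hp : Measurable p) (hf : Measurable f) :
    Measurable fun s => ∫ σ, p σ * f (s + σ) := by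
  refine (StronglyMeasurable.integral_prod_right' (f := fun z : ℝ × ℝ =>
    p z.2 * f (z.1 + z.2)) ?_).measurable
  exact ((hp.comp measurable_snd).mul
    (hf.comp (measurable_fst.add measurable_snd))).stronglyMeasurable

lemma abs_integral_mul_add_le {p f : ℝ → ℝ} (hp : Integrable p) {C : ℝ} (hC : ∀ x, |f x| ≤ C)
    (s : ℝ) : |∫ σ, p σ * f (s + σ)| ≤ (∫ σ, |p σ|) * C := by
  rw [← integral_mul_const]
  rw [← Real.norm_eq_abs]
  refine norm_integral_le_of_norm_le (hp.abs.mul_const C) (ae_of_all _ fun σ => ?_)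
  rw [Real.norm_eq_abs, abs_mul]
  exact mul_le_mul_of_nonneg_left (hC _) (abs_nonneg _)

variable {k l : ℝ → ℝ}

namespace IsKernelPair

lemma measurable_ext_k (H : IsKernelPair k l) (T : ℝ) : Measurable (ext T k) :=
  measurable_ext H.contDiff_k.continuousOn T

lemma measurable_ext_l (H : IsKernelPair k l) (T : ℝ) : Measurable (ext T l) :=
  measurable_ext H.contDiff_l.continuousOn T

/-- The identity `k * l = 1` in adjoint form. -/
lemma integral_l_mul_integral_k_mul (H : IsKernelPair k l) {T : ℝ} {f : ℝ → ℝ}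
    (hf : Measurable f) {C : ℝ} (hC : ∀ x, |f x| ≤ C) (hf0 : ∀ x, T ≤ x → f x = 0) {ρ : ℝ}
    (hρ : 0 ≤ ρ) :
    ∫ s, ext T l s * ∫ σ, ext T k σ * f (s + ρ + σ) = ∫ τ in Ioo ρ T, f τ := by
  have h := integral_convolution_mul (H.integrable_ext_l T) (H.integrable_ext_k T)
    (hf.comp (measurable_id.add_const ρ)) (fun x => hC (x + ρ))
  have h1 : ∀ s, ∫ σ, ext T k σ * f (s + ρ + σ)
      = ∫ σ, ext T k σ * (f ∘ fun x => id x + ρ) (σ + s) := fun s => by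
    congr 1; ext σ; simp only [Function.comp, id]; congr 2; ring
  simp_rw [h1]
  rw [← h]
  have h2 : ∀ s, (∫ ρ, ext T l ρ * ext T k (s - ρ)) * (f ∘ fun x => id x + ρ) s
      = (Ioo ρ T).indicator f (s + ρ) := fun s => by
    simp only [Function.comp, id]
    by_cases hs : s + ρ < T
    · rw [H.conv_ext (by linarith)]
      by_cases h0 : 0 < s
      · rw [indicator_of_mem (show s + ρ ∈ Ioo ρ T from ⟨by linarith, hs⟩)]; simp [h0]
      · rw [indicator_of_notMem fun h : s + ρ ∈ Ioo ρ T => h0 (by linarith [h.1])]; simp [h0]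
    · rw [hf0 _ (not_lt.1 hs), mul_zero,
        indicator_of_notMem fun h : s + ρ ∈ Ioo ρ T => hs h.2]
  simp_rw [h2]
  rw [integral_add_right_eq_self (fun s => (Ioo ρ T).indicator f s),
    integral_indicator measurableSet_Ioo]

/-- The identity `k * h = k(· + ε)` in adjoint form, where `h` is the resolvent kernel. -/
lemma integral_resolventKernel_mul_integral_k_mul (H : IsKernelPair k l) {T ε : ℝ} (hε : 0 < ε)
    {f : ℝ → ℝ} (hf : Measurable f) {C : ℝ} (hC : ∀ x, |f x| ≤ C)
    (hf0 : ∀ x, T ≤ x → f x = 0) :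
    ∫ s, resolventKernel k l T ε s * ∫ σ, ext T k σ * f (s + σ)
      = ∫ τ in Ioo 0 T, k (τ + ε) * f τ := by
  rw [H.integral_resolventKernel_mul hε (measurable_integral_mul_add (H.measurable_ext_k T) hf)
    (abs_integral_mul_add_le (H.integrable_ext_k T) hC)]
  have h0 := H.integral_l_mul_integral_k_mul (T := T) hf hC hf0 le_rfl
  simp only [add_zero] at h0
  rw [h0]
  have h1 : ∀ ρ, shiftedDeriv k T ε ρ * ∫ s, ext T l s * ∫ σ, ext T k σ * f (s + ρ + σ)
      = ∫ τ, shiftedDeriv k T ε ρ * (Ioo ρ T).indicator f τ := fun ρ => by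
    by_cases hρ : ρ ∈ Ioo 0 T
    · rw [H.integral_l_mul_integral_k_mul hf hC hf0 hρ.1.le, integral_const_mul,
        integral_indicator measurableSet_Ioo]
    · simp [shiftedDeriv, ext_of_notMem hρ]
  simp_rw [h1]
  have hfi : IntegrableOn f (Ioo 0 T) := by
    have : IntegrableOn (fun _ : ℝ => C) (Ioo 0 T) := integrableOn_const (by simp)
    exact this.mono' hf.aestronglyMeasurable (ae_of_all _ hC)
  have hint : Integrable (fun z : ℝ × ℝ =>
      shiftedDeriv k T ε z.1 * (Ioo z.1 T).indicator f z.2) (volume.prod volume) := by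
    have e : (fun z : ℝ × ℝ => shiftedDeriv k T ε z.1 * (Ioo z.1 T).indicator f z.2)
        = fun z => shiftedDeriv k T ε z.1 * (Ioo 0 T).indicator f z.2
          * {z : ℝ × ℝ | z.1 < z.2}.indicator 1 z := by
      ext z
      by_cases hz : z.1 ∈ Ioo 0 T
      · by_cases h2 : z.1 < z.2 <;> by_cases h3 : z.2 < T <;>
          simp [indicator, h2, h3, hz.1.trans]
      · simp [shiftedDeriv, ext_of_notMem hz]
    rw [e]
    refine Integrable.mul_bdd (c := 1) ?_ ?_ (ae_of_all _ fun z => ?_)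
    · exact (H.integrable_shiftedDeriv hε).mul_prod (hfi.integrable_indicator measurableSet_Ioo)
    · exact (measurable_one.indicator
        (measurableSet_lt measurable_fst measurable_snd)).aestronglyMeasurable
    · by_cases hz : z ∈ {z : ℝ × ℝ | z.1 < z.2}
      · rw [indicator_of_mem hz]; simp
      · rw [indicator_of_notMem hz]; simp
  rw [integral_integral_swap hint, ← integral_const_mul]
  have h2 : ∀ τ, ∫ ρ, shiftedDeriv k T ε ρ * (Ioo ρ T).indicator f τ
      = (Ioo 0 T).indicator (fun τ => (k ε - k (τ + ε)) * f τ) τ := fun τ => by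
    by_cases hτ : τ ∈ Ioo 0 T
    · rw [indicator_of_mem hτ, ← H.integral_shiftedDeriv_Iio hε hτ.1.le hτ.2.le,
        ← integral_indicator measurableSet_Iio, ← integral_mul_const]
      congr 1; ext ρ
      by_cases h : ρ < τ <;> simp [indicator, h, hτ.2]
    · rw [indicator_of_notMem hτ]
      refine integral_eq_zero_of_ae (ae_of_all _ fun ρ => ?_)
      by_cases hρ : ρ ∈ Ioo 0 T
      · have : τ ∉ Ioo ρ T := fun h => hτ ⟨hρ.1.trans h.1, h.2⟩
        simp only [indicator_of_notMem this, mul_zero, Pi.zero_apply]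
      · simp [shiftedDeriv, ext_of_notMem hρ]
  simp_rw [h2]
  rw [integral_indicator measurableSet_Ioo, ← integral_sub]
  · congr 1; ext τ; ring
  · exact hfi.const_mul _
  · refine Integrable.bdd_mul (c := k ε) hfi ?_ ?_
    · refine ContinuousOn.aestronglyMeasurable ?_ measurableSet_Ioo
      refine continuousOn_const.sub (H.contDiff_k.continuousOn.comp (by fun_prop) fun x hx => ?_)
      simp only [mem_Ioi]; linarith [hx.1]
    · filter_upwards [ae_restrict_mem measurableSet_Ioo] with τ hτ
      have h3 := H.nonneg_k (τ + ε) (by linarith [hτ.1])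
      have h4 := H.antitone_k hε (show τ + ε ∈ Ioi 0 by simp only [mem_Ioi]; linarith [hτ.1])
        (by linarith [hτ.1])
      rw [Real.norm_of_nonneg (by linarith)]
      linarith

lemma abs_k_sub_le (H : IsKernelPair k l) {ε a δ : ℝ} (hε : 0 < ε) (ha : ε ≤ a) (hδ : 0 ≤ δ) :
    |k a - k (a + δ)| ≤ -kdot k ε * δ := by
  have h := H.integral_kdot (hε.trans_le ha) (show a ≤ a + δ by linarith)
  have h0 : k (a + δ) ≤ k a := H.antitone_k (hε.trans_le ha) (by
    simp only [mem_Ioi]; linarith) (by linarith)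
  rw [abs_of_nonneg (by linarith), ← h]
  have hle : ∫ t in a..(a + δ), -kdot k t ≤ ∫ t in a..(a + δ), -kdot k ε := by
    refine intervalIntegral.integral_mono_on (by linarith) ?_ (by simp) fun x hx => ?_
    · refine ContinuousOn.intervalIntegrable ?_
      refine (H.continuousOn_kdot.mono fun x hx => ?_).neg
      rw [uIcc_of_le (by linarith)] at hx
      exact hε.trans_le (ha.trans hx.1)
    · exact neg_le_neg (H.monotoneOn_kdot hε (hε.trans_le (ha.trans hx.1)) (ha.trans hx.1))
  refine hle.trans (le_of_eq ?_)
  simp; ring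

/-- A differentiated form of the inequality `K(s) + ∫ₛ^{s+δ} a ≤ K(s + δ)`, where
`K(s) = ∫ k(σ) m(s + σ) dσ`, obtained by integrating difference quotients against the resolvent
kernel `h`: since `k * h = k(· + ε)`, the singular kernel `k` is replaced by a smooth one, and the
difference quotients fall on that kernel instead of on `m`. -/
lemma resolvent_inequality (H : IsKernelPair k l) {T ε : ℝ} (hT : 0 < T) (hε : 0 < ε)
    {m a : ℝ → ℝ} (hm : Continuous m) {Cm : ℝ} (hCm : ∀ x, |m x| ≤ Cm)
    (hm0 : ∀ x, T ≤ x → m x = 0) (ha : Continuous a) {Ca : ℝ} (hCa : ∀ x, |a x| ≤ Ca)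
    (hK : ∀ s δ, 0 ≤ s → 0 ≤ δ → (∫ σ, ext T k σ * m (s + σ)) + ∫ x in s..(s + δ), a x
      ≤ ∫ σ, ext T k σ * m (s + δ + σ)) :
    k ε * m 0 - (∫ σ, shiftedDeriv k T ε σ * m σ)
      + ∫ s in Ioo 0 T, resolventKernel k l T ε s * a s ≤ 0 := by
  set r := resolventKernel k l T ε with hr
  have hCm0 : 0 ≤ Cm := (abs_nonneg _).trans (hCm 0)
  have hi : Integrable r := H.integrable_resolventKernel hε
  have hnn : ∀ᵐ x ∂(volume.restrict (Ioo 0 T)), 0 ≤ r x := by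
    rw [ae_restrict_iff' measurableSet_Ioo]
    exact H.resolventKernel_nonneg hε
  have hkc : ContinuousOn (fun τ => k (τ + ε)) (Ioi (-ε)) :=
    H.contDiff_k.continuousOn.comp (by fun_prop) fun x hx => by
      simp only [mem_Ioi] at hx ⊢; linarith
  have hkb : ∀ τ, 0 < τ → |k (τ + ε)| ≤ k ε := fun τ hτ => by
    rw [abs_of_nonneg (H.nonneg_k _ (by linarith))]
    exact H.antitone_k hε (by simp only [mem_Ioi]; linarith) (by linarith)
  have hkm : ∀ g : ℝ → ℝ, Continuous g → (∀ x, |g x| ≤ Cm) →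
      IntegrableOn (fun τ => k (τ + ε) * g τ) (Ioo 0 T) := fun g hg hgb => by
    have h1 : IntegrableOn (fun _ : ℝ => k ε * Cm) (Ioo 0 T) := integrableOn_const (by simp)
    refine h1.mono' ?_ ?_
    · exact ((hkc.mono fun x hx => by simp only [mem_Ioi]; linarith [hx.1]).mul
        hg.continuousOn).aestronglyMeasurable measurableSet_Ioo
    · filter_upwards [ae_restrict_mem measurableSet_Ioo] with τ hτ
      rw [norm_mul]
      exact mul_le_mul (hkb τ hτ.1) (hgb _) (abs_nonneg _) (H.nonneg_k _ hε)
  -- the function `s ↦ ∫ k(σ) m(s + δ + σ)` is bounded, so that it can be paired with `r`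
  have hKm : ∀ δ, Measurable fun s => ∫ σ, ext T k σ * m (s + δ + σ) := fun δ => by
    have := measurable_integral_mul_add (H.measurable_ext_k T) hm.measurable
    exact this.comp (measurable_id.add_const δ)
  have hKb : ∀ δ s, |∫ σ, ext T k σ * m (s + δ + σ)| ≤ (∫ σ, |ext T k σ|) * Cm := fun δ s =>
    abs_integral_mul_add_le (H.integrable_ext_k T) hCm (s + δ)
  have hpair : ∀ δ, 0 ≤ δ → ∫ s in Ioo 0 T, r s * ∫ σ, ext T k σ * m (s + δ + σ)
      = ∫ τ in Ioo 0 T, k (τ + ε) * m (τ + δ) := fun δ hδ => by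
    rw [← H.integral_resolventKernel_mul_integral_k_mul hε (f := fun x => m (x + δ))
      (hm.comp (continuous_id.add_const δ)).measurable (fun x => hCm _)
      (fun x hx => hm0 _ (by linarith)), ← integral_indicator measurableSet_Ioo]
    congr 1; ext s
    have e : ∀ s σ, m (s + δ + σ) = m (s + σ + δ) := fun s σ => by congr 1; ring
    simp only [e]
    by_cases hs : s ∈ Ioo 0 T
    · rw [indicator_of_mem hs]
    · rw [indicator_of_notMem hs]
      by_cases h0 : 0 < s
      · have hsT : T ≤ s := not_lt.1 fun h => hs ⟨h0, h⟩
        have : ∀ σ, ext T k σ * m (s + σ + δ) = 0 := fun σ => by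
          by_cases hσ : σ ∈ Ioo 0 T
          · rw [hm0 _ (by linarith [hσ.1]), mul_zero]
          · rw [ext_of_notMem hσ, zero_mul]
        simp [this]
      · simp [resolventKernel_of_nonpos (not_lt.1 h0)]
  have hIa : ∀ δ, Continuous fun s => ∫ x in s..(s + δ), a x := fun δ => by
    have h1 : ∀ s, ∫ x in s..(s + δ), a x
        = (∫ x in (0 : ℝ)..(s + δ), a x) - ∫ x in (0 : ℝ)..s, a x :=
      fun s => (intervalIntegral.integral_interval_sub_left (ha.intervalIntegrable _ _)
        (ha.intervalIntegrable _ _)).symm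
    have h2 : Continuous fun s => ∫ x in (0 : ℝ)..s, a x :=
      intervalIntegral.continuous_primitive (fun a b => ha.intervalIntegrable a b) 0
    rw [funext h1]
    exact (h2.comp (continuous_id.add_const δ)).sub h2
  have hIb : ∀ δ, 0 ≤ δ → ∀ s, |∫ x in s..(s + δ), a x| ≤ Ca * δ := fun δ hδ s => by
    have := intervalIntegral.norm_integral_le_of_norm_le_const (a := s) (b := s + δ) (f := a)
      (C := Ca) fun x _ => hCa x
    simpa [abs_of_nonneg hδ] using this
  have hmain : ∀ δ, 0 < δ → ∫ s in Ioo 0 T, r s * ∫ x in s..(s + δ), a x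
      ≤ (∫ τ in Ioo 0 T, k (τ + ε) * m (τ + δ)) - ∫ τ in Ioo 0 T, k (τ + ε) * m τ := by
    intro δ hδ
    have h0 := hpair 0 le_rfl
    simp only [add_zero] at h0
    rw [← hpair δ hδ.le, ← h0, ← integral_sub]
    · refine integral_mono_ae ?_ ?_ ?_
      · exact (hi.mul_bdd (c := Ca * δ) (hIa δ).aestronglyMeasurable
          (ae_of_all _ (hIb δ hδ.le))).integrableOn
      · have hK0 := hKm 0
        have hB0 := hKb 0
        simp only [add_zero] at hK0 hB0
        exact ((hi.mul_bdd (hKm δ).aestronglyMeasurable (ae_of_all _ (hKb δ))).sub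
          (hi.mul_bdd hK0.aestronglyMeasurable (ae_of_all _ hB0))).integrableOn
      · filter_upwards [hnn, ae_restrict_mem measurableSet_Ioo] with s hs hsT
        have := hK s δ hsT.1.le hδ.le
        rw [← mul_sub]
        exact mul_le_mul_of_nonneg_left (by linarith) hs
    · exact (hi.mul_bdd (hKm δ).aestronglyMeasurable (ae_of_all _ (hKb δ))).integrableOn
    · have hK0 := hKm 0
      have hB0 := hKb 0
      simp only [add_zero] at hK0 hB0
      exact (hi.mul_bdd hK0.aestronglyMeasurable (ae_of_all _ hB0)).integrableOn
  -- divide by `δ` and let `δ → 0`; on the right-hand side the shift is moved to the kernel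
  have hL : Tendsto (fun δ => ∫ s in Ioo 0 T, r s * (δ⁻¹ * ∫ x in s..(s + δ), a x)) (𝓝[>] 0)
      (𝓝 (∫ s in Ioo 0 T, r s * a s)) := by
    refine tendsto_integral_filter_of_dominated_convergence (fun s => |r s| * Ca) ?_ ?_ ?_ ?_
    · exact .of_forall fun δ =>
        (hi.1.mul ((hIa δ).const_mul δ⁻¹).aestronglyMeasurable).restrict
    · filter_upwards [self_mem_nhdsWithin] with δ hδ
      have hδ : 0 < δ := hδ
      refine ae_of_all _ fun s => ?_
      rw [norm_mul, Real.norm_eq_abs, Real.norm_eq_abs, abs_mul, abs_of_pos (inv_pos.2 hδ)]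
      refine mul_le_mul_of_nonneg_left ?_ (abs_nonneg _)
      rw [inv_mul_le_iff₀ hδ, mul_comm]
      exact hIb δ hδ.le s
    · exact (hi.abs.mul_const _).integrableOn
    · refine ae_of_all _ fun s => Tendsto.const_mul _ ?_
      have hd := intervalIntegral.integral_hasDerivAt_right (a := s) (b := s)
        (ha.intervalIntegrable _ _) (ha.stronglyMeasurableAtFilter _ _) ha.continuousAt
      have h1 := hd.tendsto_slope_zero_right
      simpa using h1
  have hR : Tendsto (fun δ => δ⁻¹ * ((∫ τ in Ioo 0 T, k (τ + ε) * m (τ + δ))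
      - ∫ τ in Ioo 0 T, k (τ + ε) * m τ)) (𝓝[>] 0)
      (𝓝 ((∫ σ, shiftedDeriv k T ε σ * m σ) - k ε * m 0)) := by
    have hA : Tendsto (fun δ => ∫ τ in Ioo 0 T,
        (Ioi δ).indicator (fun τ => δ⁻¹ * (k (τ + ε - δ) - k (τ + ε)) * m τ) τ) (𝓝[>] 0)
        (𝓝 (∫ τ in Ioo 0 T, -kdot k (τ + ε) * m τ)) := by
      refine tendsto_integral_filter_of_dominated_convergence (fun _ => -kdot k ε * Cm) ?_ ?_ ?_ ?_
      · filter_upwards [self_mem_nhdsWithin] with δ hδ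
        have hδ : 0 < δ := hδ
        have e : (Ioi δ).indicator (fun τ => δ⁻¹ * (k (τ + ε - δ) - k (τ + ε)) * m τ)
          = fun τ => δ⁻¹ * ((Ioi δ).indicator (fun τ => (k (τ + ε - δ) - k (τ + ε))) τ) * m τ := by
          ext τ; by_cases h : τ ∈ Ioi δ <;> simp [h]
        rw [e]
        refine AEStronglyMeasurable.mul (AEStronglyMeasurable.const_mul ?_ _)
          hm.aestronglyMeasurable
        refine AEStronglyMeasurable.restrict ?_
        rw [aestronglyMeasurable_indicator_iff measurableSet_Ioi]
        refine ContinuousOn.aestronglyMeasurable ?_ measurableSet_Ioi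
        refine ContinuousOn.sub ?_ ?_
        · refine H.contDiff_k.continuousOn.comp (by fun_prop) fun x hx => ?_
          simp only [mem_Ioi] at hx ⊢; linarith
        · refine H.contDiff_k.continuousOn.comp (by fun_prop) fun x hx => ?_
          simp only [mem_Ioi] at hx ⊢; linarith
      · filter_upwards [self_mem_nhdsWithin] with δ hδ
        have hδ : 0 < δ := hδ
        refine ae_of_all _ fun τ => ?_
        have hk0 : 0 ≤ -kdot k ε := neg_nonneg.2 (H.kdot_nonpos hε)
        by_cases h : τ ∈ Ioi δ
        · rw [indicator_of_mem h, norm_mul, norm_mul]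
          refine mul_le_mul ?_ (hCm _) (norm_nonneg _) hk0
          have h' : δ < τ := h
          have := H.abs_k_sub_le hε (a := τ + ε - δ) (δ := δ) (by linarith) hδ.le
          rw [sub_add_cancel] at this
          rw [Real.norm_eq_abs, Real.norm_eq_abs, abs_of_pos (inv_pos.2 hδ),
            inv_mul_le_iff₀ hδ, mul_comm]
          exact this
        · rw [indicator_of_notMem h, norm_zero]
          exact mul_nonneg hk0 hCm0
      · exact integrable_const _
      · filter_upwards [ae_restrict_mem measurableSet_Ioo] with τ hτ
        have hd := (H.hasDerivAt_k (t := τ + ε) (by linarith [hτ.1])).tendsto_slope_zero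
        have hneg : Tendsto (fun δ : ℝ => -δ) (𝓝[>] 0) (𝓝[≠] 0) := by
          refine tendsto_nhdsWithin_iff.2 ⟨?_, ?_⟩
          · have : Tendsto (fun δ : ℝ => -δ) (𝓝 0) (𝓝 (-0)) := tendsto_id.neg
            rw [neg_zero] at this
            exact this.mono_left nhdsWithin_le_nhds
          · filter_upwards [self_mem_nhdsWithin] with δ hδ
            simpa using (ne_of_gt hδ)
        have h2 := ((hd.comp hneg).neg).mul_const (m τ)
        refine h2.congr' ?_
        filter_upwards [Ioo_mem_nhdsGT hτ.1] with δ hδ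
        rw [indicator_of_mem (show τ ∈ Ioi δ from hδ.2)]
        simp only [Function.comp, smul_eq_mul]
        rw [inv_neg, ← sub_eq_add_neg]; ring
    have hB : Tendsto (fun δ => δ⁻¹ * ∫ τ in (0 : ℝ)..δ, k (τ + ε) * m τ) (𝓝[>] 0)
        (𝓝 (k ε * m 0)) := by
      have hc : ContinuousOn (fun τ => k (τ + ε) * m τ) (Ioi (-ε)) := hkc.mul hm.continuousOn
      have hd := intervalIntegral.integral_hasDerivAt_right (a := 0) (b := 0)
        (f := fun τ => k (τ + ε) * m τ) (by simp)
        (hc.stronglyMeasurableAtFilter isOpen_Ioi 0 (by simp [hε]))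
        (hc.continuousAt (Ioi_mem_nhds (by linarith)))
      have h1 := hd.tendsto_slope_zero_right
      simpa using h1
    have hAB := hA.sub hB
    have e1 : ∫ τ in Ioo 0 T, -kdot k (τ + ε) * m τ = ∫ σ, shiftedDeriv k T ε σ * m σ := by
      rw [← integral_indicator measurableSet_Ioo]
      congr 1; ext τ
      by_cases hτ : τ ∈ Ioo 0 T
      · rw [indicator_of_mem hτ, shiftedDeriv, ext_of_mem hτ]
      · rw [indicator_of_notMem hτ, shiftedDeriv, ext_of_notMem hτ, zero_mul]
    rw [e1] at hAB
    refine hAB.congr' ?_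
    filter_upwards [Ioo_mem_nhdsGT hT] with δ hδ
    have i1 := hkm m hm hCm
    have i2 : IntegrableOn (fun τ => k (τ + ε - δ) * m τ) (Ioo δ T) := by
      have h1 := hkm (fun τ => m (τ + δ)) (hm.comp (continuous_id.add_const δ)) (fun x => hCm _)
      have h2 := (integrable_indicator_iff measurableSet_Ioo).2 h1
      have h3 := h2.comp_sub_right δ
      refine ((integrable_indicator_iff (measurableSet_Ioo (a := δ) (b := T))).1 ?_)
      refine (h3.indicator (measurableSet_Ioo (a := δ) (b := T))).congr (ae_of_all _ fun x => ?_)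
      by_cases hx : x ∈ Ioo δ T
      · have : x - δ ∈ Ioo 0 T := ⟨by linarith [hx.1], by linarith [hx.2, hδ.1]⟩
        simp only [indicator_of_mem hx, indicator_of_mem this]
        congr 2 <;> ring
      · simp only [indicator_of_notMem hx]
    have e2 : ∫ τ in Ioo 0 T, k (τ + ε) * m (τ + δ) = ∫ τ in Ioo δ T, k (τ + ε - δ) * m τ := by
      rw [← integral_indicator measurableSet_Ioo, ← integral_indicator measurableSet_Ioo,
        ← integral_sub_right_eq_self _ δ]
      congr 1; ext x
      by_cases hx : x ∈ Ioo δ T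
      · have : x - δ ∈ Ioo 0 T := ⟨by linarith [hx.1], by linarith [hx.2, hδ.1]⟩
        simp only [indicator_of_mem hx, indicator_of_mem this]
        congr 2 <;> ring
      · rw [indicator_of_notMem hx]
        by_cases hx' : x - δ ∈ Ioo 0 T
        · rw [indicator_of_mem hx', sub_add_cancel, hm0 x, mul_zero]
          by_contra h
          exact hx ⟨by linarith [hx'.1], not_le.1 h⟩
        · rw [indicator_of_notMem hx']
    have e3 : ∫ τ in Ioo 0 T, k (τ + ε) * m τ
        = (∫ τ in (0 : ℝ)..δ, k (τ + ε) * m τ) + ∫ τ in Ioo δ T, k (τ + ε) * m τ := by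
      rw [← integral_Ioc_eq_integral_Ioo, ← integral_Ioc_eq_integral_Ioo,
        ← intervalIntegral.integral_of_le hT.le, ← intervalIntegral.integral_of_le hδ.2.le]
      refine (intervalIntegral.integral_add_adjacent_intervals ?_ ?_).symm
      · rw [intervalIntegrable_iff_integrableOn_Ioo_of_le hδ.1.le]
        exact i1.mono_set (Ioo_subset_Ioo le_rfl hδ.2.le)
      · rw [intervalIntegrable_iff_integrableOn_Ioo_of_le hδ.2.le]
        exact i1.mono_set (Ioo_subset_Ioo hδ.1.le le_rfl)
    have e4 : ∫ τ in Ioo 0 T,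
        (Ioi δ).indicator (fun τ => δ⁻¹ * (k (τ + ε - δ) - k (τ + ε)) * m τ) τ
        = δ⁻¹ * ((∫ τ in Ioo δ T, k (τ + ε - δ) * m τ) - ∫ τ in Ioo δ T, k (τ + ε) * m τ) := by
      rw [setIntegral_indicator measurableSet_Ioi, ← integral_sub i2
        (i1.mono_set (Ioo_subset_Ioo hδ.1.le le_rfl)), ← integral_const_mul]
      have : Ioo 0 T ∩ Ioi δ = Ioo δ T := by
        ext x; simp only [mem_inter_iff, mem_Ioo, mem_Ioi]
        constructor
        · rintro ⟨⟨_, h2⟩, h3⟩; exact ⟨h3, h2⟩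
        · rintro ⟨h1, h2⟩; exact ⟨⟨hδ.1.trans h1, h2⟩, h1⟩
      rw [this]
      congr 1; ext τ; ring
    rw [e4, e2, e3]; ring
  have hfin := le_of_tendsto_of_tendsto hL hR (by
    filter_upwards [self_mem_nhdsWithin] with δ hδ
    have hδ : 0 < δ := hδ
    have h1 : ∀ s, r s * (δ⁻¹ * ∫ x in s..(s + δ), a x) = δ⁻¹ * (r s * ∫ x in s..(s + δ), a x) :=
      fun s => by ring
    simp_rw [h1]
    rw [integral_const_mul]
    exact mul_le_mul_of_nonneg_left (hmain δ hδ) (inv_pos.2 hδ).le)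
  linarith

end IsKernelPair

/-! ### Sobolev functions of one variable -/

lemma exists_Icc_of_isCompact {K : Set ℝ} {a b : ℝ} (hab : a < b) (hK : IsCompact K)
    (hKs : K ⊆ Ioo a b) : ∃ c d, a < c ∧ c ≤ d ∧ d < b ∧ K ⊆ Icc c d := by
  have hK' : IsCompact (insert ((a + b) / 2) K) := hK.insert _
  have hsub : insert ((a + b) / 2) K ⊆ Ioo a b :=
    insert_subset ⟨by linarith, by linarith⟩ hKs
  obtain ⟨c, hc, hcl⟩ := hK'.exists_isLeast ⟨_, mem_insert _ _⟩
  obtain ⟨d, hd, hdl⟩ := hK'.exists_isGreatest ⟨_, mem_insert _ _⟩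
  exact ⟨c, d, (hsub hc).1, hcl hd, (hsub hd).2, fun x hx =>
    ⟨hcl (mem_insert_of_mem _ hx), hdl (mem_insert_of_mem _ hx)⟩⟩

lemma isTest_of_support {I : Set ℝ} {φ : ℝ → ℝ} {c d : ℝ}
    (hφ : ContDiff ℝ ((⊤ : ℕ∞) : WithTop ℕ∞) φ) (h0 : ∀ x, x ∉ Icc c d → φ x = 0)
    (hI : Icc c d ⊆ I) : IsTest I φ := by
  have hs : tsupport φ ⊆ Icc c d := closure_minimal
    (fun x hx => by by_contra h; exact hx (h0 x h)) isClosed_Icc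
  exact ⟨hφ, isCompact_Icc.of_isClosed_subset (isClosed_tsupport φ) hs, hs.trans hI⟩

lemma IsTest.exists_Icc {a b : ℝ} (hab : a < b) {φ : ℝ → ℝ} (hφ : IsTest (Ioo a b) φ) :
    ∃ c d, a < c ∧ c ≤ d ∧ d < b ∧ ∀ x, x ∉ Icc c d → φ x = 0 := by
  obtain ⟨c, d, h1, h2, h3, h4⟩ := exists_Icc_of_isCompact hab hφ.2.1 hφ.2.2
  exact ⟨c, d, h1, h2, h3, fun x hx => image_eq_zero_of_notMem_tsupport fun h => hx (h4 h)⟩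

/-- The primitive of a test function of mean zero is a test function. -/
lemma IsTest.primitive {a b : ℝ} (hab : a < b) {η : ℝ → ℝ} (hη : IsTest (Ioo a b) η)
    (h0 : ∫ x in a..b, η x = 0) :
    IsTest (Ioo a b) (fun x => ∫ y in a..x, η y) ∧
      ∀ x, deriv (fun x => ∫ y in a..x, η y) x = η x := by
  obtain ⟨c, d, hac, hcd, hdb, hz⟩ := hη.exists_Icc hab
  have hc : Continuous η := hη.1.continuous
  have hd : ∀ x, HasDerivAt (fun x => ∫ y in a..x, η y) (η x) x := fun x =>
    intervalIntegral.integral_hasDerivAt_right (hc.intervalIntegrable _ _)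
      (hc.stronglyMeasurableAtFilter _ _) hc.continuousAt
  refine ⟨isTest_of_support (c := c) (d := d) ?_ ?_ ?_, fun x => (hd x).deriv⟩
  · rw [contDiff_infty_iff_deriv]
    refine ⟨fun x => (hd x).differentiableAt, ?_⟩
    rw [funext fun x => (hd x).deriv]
    exact hη.1
  · intro x hx
    rcases lt_or_ge x c with h | h
    · refine intervalIntegral.integral_zero_ae (ae_of_all _ fun y hy => hz y fun hy' => ?_)
      have : y ≤ max a x := hy.2
      rcases max_le_iff.1 (le_of_eq (rfl : max a x = max a x)) with ⟨_, _⟩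
      have : max a x < c := max_lt hac h
      linarith [hy'.1]
    · have hxd : d < x := not_le.1 fun h' => hx ⟨h, h'⟩
      rw [← intervalIntegral.integral_add_adjacent_intervals (hc.intervalIntegrable a b)
        (hc.intervalIntegrable b x), h0, zero_add]
      refine intervalIntegral.integral_zero_ae (ae_of_all _ fun y hy => hz y fun hy' => ?_)
      have h1 : min b x < y := hy.1
      have : d < min b x := lt_min hdb hxd
      linarith [hy'.2]
  · exact fun x hx => ⟨hac.trans_le hx.1, hx.2.trans_lt hdb⟩

/-- On every interval `(a,b)` there are smooth cutoff functions that are one at a distance `d` from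
the end points and have slope at most `C / d`. -/
def HasCutoffs (C : ℝ) : Prop :=
  ∀ a b d : ℝ, 0 < d → ∃ ζ : ℝ → ℝ,
    ContDiff ℝ ((⊤ : ℕ∞) : WithTop ℕ∞) ζ ∧ (∀ x, 0 ≤ ζ x) ∧ (∀ x, ζ x ≤ 1) ∧
    (∀ x ∈ Icc (a + d) (b - d), ζ x = 1) ∧ (∀ x, x ∉ Ioo a b → ζ x = 0) ∧
    ∀ x, |deriv ζ x| ≤ C / d

lemma exists_cutoff : ∃ C : ℝ, 0 < C ∧ HasCutoffs C := by
  have hS : ContDiff ℝ ((⊤ : ℕ∞) : WithTop ℕ∞) Real.smoothTransition :=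
    Real.smoothTransition.contDiff
  have hS1 : Continuous (deriv Real.smoothTransition) := hS.continuous_deriv (by simp)
  obtain ⟨C, hC⟩ := (isCompact_Icc (a := (0 : ℝ)) (b := 1)).exists_bound_of_continuousOn
    hS1.continuousOn
  have hC0 : 0 ≤ C := (norm_nonneg _).trans (hC 0 (by simp))
  have hCall : ∀ x, |deriv Real.smoothTransition x| ≤ C := fun x => by
    by_cases hx : x ∈ Icc (0 : ℝ) 1
    · exact hC x hx
    · have : deriv Real.smoothTransition x = 0 := by
        rcases lt_or_ge x 0 with h | h
        · have : Real.smoothTransition =ᶠ[𝓝 x] fun _ => 0 := by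
            filter_upwards [Iio_mem_nhds h] with y hy
            exact Real.smoothTransition.zero_of_nonpos (le_of_lt hy)
          rw [this.deriv_eq, deriv_const]
        · have h1 : 1 < x := not_le.1 fun h' => hx ⟨h, h'⟩
          have : Real.smoothTransition =ᶠ[𝓝 x] fun _ => 1 := by
            filter_upwards [Ioi_mem_nhds h1] with y hy
            exact Real.smoothTransition.one_of_one_le (le_of_lt hy)
          rw [this.deriv_eq, deriv_const]
      rw [this, abs_zero]; exact hC0
  refine ⟨2 * C + 1, by positivity, fun a b d hd => ?_⟩
  have hl : ContDiff ℝ ((⊤ : ℕ∞) : WithTop ℕ∞) fun x : ℝ => (x - a) / d := by fun_prop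
  have hr : ContDiff ℝ ((⊤ : ℕ∞) : WithTop ℕ∞) fun x : ℝ => (b - x) / d := by fun_prop
  refine ⟨fun x => Real.smoothTransition ((x - a) / d) * Real.smoothTransition ((b - x) / d),
    (hS.comp hl).mul (hS.comp hr), fun x => mul_nonneg (Real.smoothTransition.nonneg _)
    (Real.smoothTransition.nonneg _), fun x => mul_le_one₀ (Real.smoothTransition.le_one _)
    (Real.smoothTransition.nonneg _) (Real.smoothTransition.le_one _), fun x hx => ?_,
    fun x hx => ?_, fun x => ?_⟩
  · simp only
    rw [Real.smoothTransition.one_of_one_le, Real.smoothTransition.one_of_one_le, one_mul]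
    · rw [le_div_iff₀ hd]; linarith [hx.2]
    · rw [le_div_iff₀ hd]; linarith [hx.1]
  · simp only
    rcases le_or_gt x a with h | h
    · rw [Real.smoothTransition.zero_of_nonpos (div_nonpos_of_nonpos_of_nonneg (by linarith) hd.le),
        zero_mul]
    · have : b ≤ x := not_lt.1 fun h' => hx ⟨h, h'⟩
      rw [Real.smoothTransition.zero_of_nonpos (x := (b - x) / d)
        (div_nonpos_of_nonpos_of_nonneg (by linarith) hd.le), mul_zero]
  · have hSd : ∀ y, HasDerivAt Real.smoothTransition (deriv Real.smoothTransition y) y := fun y =>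
      (hS.differentiable (by simp) y).hasDerivAt
    have d1 : HasDerivAt (fun x => Real.smoothTransition ((x - a) / d))
        (deriv Real.smoothTransition ((x - a) / d) * (1 / d)) x :=
      (hSd _).comp x (((hasDerivAt_id x).sub_const a).div_const d)
    have d2 : HasDerivAt (fun x => Real.smoothTransition ((b - x) / d))
        (deriv Real.smoothTransition ((b - x) / d) * (-1 / d)) x :=
      (hSd _).comp x (((hasDerivAt_id x).const_sub b).div_const d)
    rw [(d1.fun_mul d2).deriv]
    have b1 := Real.smoothTransition.nonneg ((x - a) / d)
    have b2 := Real.smoothTransition.le_one ((x - a) / d)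
    have b3 := Real.smoothTransition.nonneg ((b - x) / d)
    have b4 := Real.smoothTransition.le_one ((b - x) / d)
    have c1 := hCall ((x - a) / d)
    have c2 := hCall ((b - x) / d)
    have hd' : 0 < 1 / d := by positivity
    calc _ ≤ _ := abs_add_le _ _
      _ ≤ C / d + C / d := by
        refine add_le_add ?_ ?_
        · rw [abs_mul, abs_mul, abs_of_pos hd', abs_of_nonneg b3, div_eq_mul_one_div C d]
          exact (mul_le_of_le_one_right (by positivity) b4).trans
            (mul_le_mul_of_nonneg_right c1 hd'.le)
        · rw [abs_mul, abs_mul, abs_of_nonneg b1, neg_div, abs_neg, abs_of_pos hd',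
            div_eq_mul_one_div C d]
          exact (mul_le_of_le_one_left (by positivity) b2).trans
            (mul_le_mul_of_nonneg_right c2 hd'.le)
      _ ≤ (2 * C + 1) / d := by
        rw [← add_div]
        exact div_le_div_of_nonneg_right (by linarith) hd.le

/-- A nonnegative test function of integral one. -/
lemma exists_isTest_integral_one {a b : ℝ} (hab : a < b) :
    ∃ θ, IsTest (Ioo a b) θ ∧ ∫ x in a..b, θ x = 1 := by
  obtain ⟨C, -, hC⟩ := exists_cutoff
  set d := (b - a) / 6 with hd
  have hd0 : 0 < d := by rw [hd]; linarith
  obtain ⟨ζ, h1, h2, -, h4, h5, -⟩ := hC (a + d) (b - d) d hd0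
  have ht : IsTest (Ioo a b) ζ := isTest_of_support (c := a + d) (d := b - d) h1
    (fun x hx => h5 x fun h => hx ⟨h.1.le, h.2.le⟩)
    fun x hx => ⟨by linarith [hx.1], by linarith [hx.2]⟩
  have hpos : 0 < ∫ x in a..b, ζ x := by
    refine intervalIntegral.integral_pos hab h1.continuous.continuousOn (fun x _ => h2 x)
      ⟨(a + b) / 2, ⟨by linarith, by linarith⟩, ?_⟩
    rw [h4 _ ⟨by linarith, by linarith⟩]; exact one_pos
  refine ⟨fun x => (∫ x in a..b, ζ x)⁻¹ * ζ x, isTest_of_support (c := a + d) (d := b - d)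
    (contDiff_const.mul h1) (fun x hx => ?_) (fun x hx => ⟨by linarith [hx.1], by linarith [hx.2]⟩),
    ?_⟩
  · rw [h5 x fun h => hx ⟨h.1.le, h.2.le⟩, mul_zero]
  · rw [intervalIntegral.integral_const_mul, inv_mul_cancel₀ hpos.ne']

lemma IsTest.add_const_mul {a b : ℝ} (hab : a < b) {φ θ : ℝ → ℝ} (hφ : IsTest (Ioo a b) φ)
    (hθ : IsTest (Ioo a b) θ) (c : ℝ) : IsTest (Ioo a b) (fun x => φ x - c * θ x) := by
  obtain ⟨c₁, d₁, h1, h2, h3, h4⟩ := hφ.exists_Icc hab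
  obtain ⟨c₂, d₂, k1, k2, k3, k4⟩ := hθ.exists_Icc hab
  refine isTest_of_support (c := min c₁ c₂) (d := max d₁ d₂)
    (hφ.1.sub (contDiff_const.mul hθ.1)) (fun x hx => ?_) fun x hx =>
    ⟨(lt_min h1 k1).trans_le hx.1, hx.2.trans_lt (max_lt h3 k3)⟩
  rw [h4 x fun h => hx ⟨(min_le_left _ _).trans h.1, h.2.trans (le_max_left _ _)⟩,
    k4 x fun h => hx ⟨(min_le_right _ _).trans h.1, h.2.trans (le_max_right _ _)⟩]
  ring

lemma intervalIntegral_eq_setIntegral {a b : ℝ} (hab : a ≤ b) (f : ℝ → ℝ) :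
    ∫ x in a..b, f x = ∫ x in Ioo a b, f x := by
  rw [intervalIntegral.integral_of_le hab, integral_Ioc_eq_integral_Ioo]

lemma MemLp.intervalIntegrable_Ioo {a b : ℝ} {f : ℝ → ℝ} (hab : a ≤ b)
    (hf : MemLp f 2 (volume.restrict (Ioo a b))) : IntervalIntegrable f volume a b := by
  rw [intervalIntegrable_iff_integrableOn_Ioo_of_le hab]
  exact hf.integrable (by norm_num)

/-- Integration by parts of a primitive against a test function. -/
lemma integral_primitive_mul_deriv {a b : ℝ} (hab : a < b) {g φ : ℝ → ℝ}
    (hg : IntervalIntegrable g volume a b) (hφ : IsTest (Ioo a b) φ) :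
    ∫ x in Ioo a b, (∫ y in a..x, g y) * deriv φ x = -∫ x in Ioo a b, g x * φ x := by
  obtain ⟨c, d, hac, hcd, hdb, hz⟩ := hφ.exists_Icc hab
  have hga : AbsolutelyContinuousOnInterval (fun x => ∫ y in a..x, g y) a b :=
    hg.absolutelyContinuousOnInterval_intervalIntegral (by simp)
  have hφa : AbsolutelyContinuousOnInterval φ a b :=
    (hφ.1.of_le (by norm_cast)).contDiffOn.absolutelyContinuousOnInterval
  have h := hga.integral_mul_deriv_eq_deriv_mul hφa
  rw [hz b fun h => by linarith [h.2], hz a fun h => by linarith [h.1]] at h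
  rw [← intervalIntegral_eq_setIntegral hab.le, ← intervalIntegral_eq_setIntegral hab.le, h]
  simp only [mul_zero, sub_zero, zero_sub, neg_inj]
  refine intervalIntegral.integral_congr_ae ?_
  filter_upwards [hg.ae_hasDerivAt_integral] with x hx hxm
  rw [(hx (uIoc_subset_uIcc hxm) a (by simp)).deriv]

/-- A function with weak derivative in `L_2` is the primitive of that derivative. -/
lemma IsH1.exists_primitive {a b : ℝ} (hab : a < b) {f f' : ℝ → ℝ} (h : IsH1 (Ioo a b) f f') :
    ∃ c, ∀ᵐ x ∂(volume.restrict (Ioo a b)), f x = c + ∫ y in a..x, f' y := by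
  have hf' := MemLp.intervalIntegrable_Ioo hab.le h.memLp_deriv
  have hfi : IntegrableOn f (Ioo a b) := h.memLp.integrable (by norm_num)
  have hga : AbsolutelyContinuousOnInterval (fun x => ∫ y in a..x, f' y) a b :=
    hf'.absolutelyContinuousOnInterval_intervalIntegral (by simp)
  have hgc : ContinuousOn (fun x => ∫ y in a..x, f' y) (Icc a b) := by
    simpa [uIcc_of_le hab.le] using hga.continuousOn
  have hgi : IntegrableOn (fun x => ∫ y in a..x, f' y) (Ioo a b) :=
    (hgc.integrableOn_Icc).mono_set Ioo_subset_Icc_self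
  obtain ⟨θ, hθ, hθ1⟩ := exists_isTest_integral_one hab
  set w : ℝ → ℝ := fun x => f x - ∫ y in a..x, f' y with hw
  have hwi : IntegrableOn w (Ioo a b) := hfi.sub hgi
  have hmul : ∀ v : ℝ → ℝ, IntegrableOn v (Ioo a b) → ∀ φ : ℝ → ℝ, Continuous φ →
      HasCompactSupport φ → IntegrableOn (fun x => v x * φ x) (Ioo a b) := fun v hv φ hφ hc => by
    obtain ⟨C, hC⟩ := hφ.bounded_above_of_compact_support hc
    exact hv.mul_bdd hφ.aestronglyMeasurable (ae_of_all _ hC)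
  have hweak : ∀ φ, IsTest (Ioo a b) φ → ∫ x in Ioo a b, w x * deriv φ x = 0 := fun φ hφ => by
    have hc : Continuous (deriv φ) := hφ.1.continuous_deriv (by simp)
    simp only [hw, sub_mul]
    rw [integral_sub (hmul f hfi _ hc hφ.2.1.deriv) (hmul _ hgi _ hc hφ.2.1.deriv), h.weak φ hφ,
      integral_primitive_mul_deriv hab hf' hφ, sub_self]
  set c := ∫ x in Ioo a b, w x * θ x with hcdef
  have hconst : ∀ η, IsTest (Ioo a b) η →
      ∫ x in Ioo a b, (w x - c) * η x = 0 := fun η hη => by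
    have hηc : IntervalIntegrable η volume a b := hη.1.continuous.intervalIntegrable _ _
    have hθc : IntervalIntegrable θ volume a b := hθ.1.continuous.intervalIntegrable _ _
    set m := ∫ x in a..b, η x with hm
    have ht := hη.add_const_mul hab hθ m
    have hz : ∫ x in a..b, (η x - m * θ x) = 0 := by
      rw [intervalIntegral.integral_sub hηc (hθc.const_mul m),
        intervalIntegral.integral_const_mul, hθ1]; simp [hm]
    obtain ⟨ht1, ht2⟩ := ht.primitive hab hz
    have h1 := hweak _ ht1
    simp only [ht2] at h1
    have e1 : ∫ x in Ioo a b, w x * (η x - m * θ x)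
        = (∫ x in Ioo a b, w x * η x) - m * c := by
      rw [hcdef, ← integral_const_mul, ← integral_sub (hmul w hwi _ hη.1.continuous hη.2.1)]
      · congr 1; ext x; ring
      · exact (hmul w hwi _ hθ.1.continuous hθ.2.1).const_mul m
    have e2 : ∫ x in Ioo a b, (w x - c) * η x = (∫ x in Ioo a b, w x * η x) - c * m := by
      rw [hm, intervalIntegral_eq_setIntegral hab.le, ← integral_const_mul,
        ← integral_sub (hmul w hwi _ hη.1.continuous hη.2.1)]
      · congr 1; ext x; ring
      · exact ((intervalIntegrable_iff_integrableOn_Ioo_of_le hab.le).1 hηc).const_mul c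
    rw [e2]; rw [e1] at h1; linarith
  refine ⟨c, ?_⟩
  have hloc : LocallyIntegrableOn (fun x => w x - c) (Ioo a b) :=
    (hwi.sub (integrableOn_const (by simp))).locallyIntegrableOn
  have := isOpen_Ioo.ae_eq_zero_of_integral_contDiff_smul_eq_zero hloc fun g hg hgc hgs => by
    have := hconst g ⟨hg, hgc, hgs⟩
    rw [← integral_indicator measurableSet_Ioo] at this
    rw [← this]
    congr 1; ext x
    by_cases hx : x ∈ Ioo a b
    · rw [indicator_of_mem hx, smul_eq_mul, mul_comm]
    · rw [indicator_of_notMem hx, image_eq_zero_of_notMem_tsupport fun h => hx (hgs h), zero_smul]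
  rw [ae_restrict_iff' measurableSet_Ioo]
  filter_upwards [this] with x hx hxm
  have := hx hxm
  simp only [hw] at this
  linarith

lemma AbsolutelyContinuousOnInterval.posPart {a b : ℝ} {F : ℝ → ℝ}
    (hF : AbsolutelyContinuousOnInterval F a b) (c : ℝ) :
    AbsolutelyContinuousOnInterval (fun x => max (F x - c) 0) a b := by
  refine squeeze_zero (fun t => Finset.sum_nonneg fun i _ => dist_nonneg) (fun t => ?_) hF
  refine Finset.sum_le_sum fun i _ => ?_
  rw [Real.dist_eq, Real.dist_eq]
  refine (abs_max_sub_max_le_abs _ _ 0).trans (le_of_eq ?_)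
  congr 1; ring

/-- Chain rule for the truncation of a primitive, localized by a factor vanishing at the left
end point. -/
lemma mul_posPart_eq_integral {a b : ℝ} (hab : a < b) {f' ζ : ℝ → ℝ} {c lam : ℝ}
    (hf' : IntervalIntegrable f' volume a b) (hζ : ContDiff ℝ 1 ζ) (hζa : ζ a = 0) {x : ℝ}
    (hx : x ∈ Icc a b) :
    ζ x * max (c + (∫ y in a..x, f' y) - lam) 0
      = ∫ y in a..x, (deriv ζ y * max (c + (∫ z in a..y, f' z) - lam) 0
          + ζ y * if lam < c + ∫ z in a..y, f' z then f' y else 0) := by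
  set F : ℝ → ℝ := fun x => c + ∫ y in a..x, f' y with hFdef
  have hconst : AbsolutelyContinuousOnInterval (fun _ : ℝ => c) a b :=
    contDiffOn_const.absolutelyContinuousOnInterval
  have hFac : AbsolutelyContinuousOnInterval F a b :=
    hconst.fun_add (hf'.absolutelyContinuousOnInterval_intervalIntegral (by simp))
  have hM := AbsolutelyContinuousOnInterval.posPart hFac lam
  have hζac : AbsolutelyContinuousOnInterval ζ a b := hζ.contDiffOn.absolutelyContinuousOnInterval
  have hP := (hζac.fun_mul hM)
  have hsub : uIcc a x ⊆ uIcc a b := by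
    rw [uIcc_of_le hx.1, uIcc_of_le hab.le]; exact Icc_subset_Icc le_rfl hx.2
  have h := (hP.mono hsub).integral_deriv_eq_sub
  simp only [hζa, zero_mul, sub_zero] at h
  rw [← h]
  refine intervalIntegral.integral_congr_ae ?_
  have hne : ∀ᵐ y : ℝ, y ≠ b := by simp [ae_iff, measure_singleton]
  filter_upwards [hf'.ae_hasDerivAt_integral, hM.ae_differentiableAt, hne] with y hy hMy hyb hyx
  have hyu : y ∈ uIcc a b := hsub (uIoc_subset_uIcc hyx)
  have hdF : HasDerivAt F (f' y) y := (hy hyu a (by simp)).const_add c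
  have hdM : HasDerivAt (fun x => max (F x - lam) 0) (if lam < F y then f' y else 0) y := by
    rcases lt_trichotomy (F y) lam with hlt | heq | hgt
    · rw [if_neg (not_lt.2 hlt.le)]
      have : (fun x => max (F x - lam) 0) =ᶠ[𝓝 y] fun _ => 0 := by
        filter_upwards [hdF.continuousAt.eventually_lt_const hlt] with z hz
        exact max_eq_right (by linarith)
      exact (hasDerivAt_const y (0 : ℝ)).congr_of_eventuallyEq this
    · rw [if_neg (by linarith)]
      have hd := (hMy hyu).hasDerivAt
      have hmin : IsLocalMin (fun x => max (F x - lam) 0) y := by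
        refine Eventually.of_forall fun z => ?_
        simp only [heq, sub_self, max_self]
        exact le_max_right _ _
      rwa [hmin.deriv_eq_zero] at hd
    · rw [if_pos hgt]
      have : (fun x => max (F x - lam) 0) =ᶠ[𝓝 y] fun x => F x - lam := by
        filter_upwards [hdF.continuousAt.eventually_const_lt hgt] with z hz
        exact max_eq_left (by linarith)
      exact (hdF.sub_const lam).congr_of_eventuallyEq this
  have hdζ : HasDerivAt ζ (deriv ζ y) y := (hζ.differentiable one_ne_zero y).hasDerivAt
  exact (hdζ.fun_mul hdM).deriv

/-- Chain rule for truncations of functions in `H_2^1`. -/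
lemma IsH1.mul_posPart {a b : ℝ} (hab : a < b) {f f' ζ : ℝ → ℝ} (h : IsH1 (Ioo a b) f f')
    (lam : ℝ) (hζ : ContDiff ℝ 1 ζ) (hζa : ζ a = 0) :
    ∀ᵐ x ∂(volume.restrict (Ioo a b)), ζ x * max (f x - lam) 0
      = ∫ y in a..x, (deriv ζ y * max (f y - lam) 0 + ζ y * if lam < f y then f' y else 0) := by
  obtain ⟨c, hc⟩ := h.exists_primitive hab
  have hf' := MemLp.intervalIntegrable_Ioo hab.le h.memLp_deriv
  filter_upwards [hc, ae_restrict_mem measurableSet_Ioo] with x hx hxm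
  rw [hx, mul_posPart_eq_integral hab hf' hζ hζa (Ioo_subset_Icc_self hxm)]
  rw [intervalIntegral_eq_setIntegral hxm.1.le, intervalIntegral_eq_setIntegral hxm.1.le]
  refine integral_congr_ae ?_
  filter_upwards [ae_restrict_of_ae_restrict_of_subset (Ioo_subset_Ioo le_rfl hxm.2.le) hc]
    with y hy
  rw [hy]

/-- The Cauchy-Schwarz inequality on a set outside of which the function vanishes. -/
lemma sq_integral_le {q : ℝ → ℝ} {s E : Set ℝ} (hE : MeasurableSet E)
    (hsE : volume (s ∩ E) ≠ ∞) (hq : MemLp q 2 (volume.restrict s)) (hq0 : ∀ y, y ∉ E → q y = 0) :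
    (∫ y in s, |q y|) ^ 2 ≤ (volume (s ∩ E)).toReal * ∫ y in s, q y ^ 2 := by
  have h1 : MemLp (E.indicator fun _ => (1 : ℝ)) 2 (volume.restrict s) :=
    memLp_indicator_const 2 hE 1 (Or.inr (by rwa [Measure.restrict_apply hE, inter_comm]))
  have h := integral_mul_le_Lp_mul_Lq_of_nonneg (μ := volume.restrict s) Real.HolderConjugate.two_two
    (f := E.indicator fun _ => (1 : ℝ)) (g := fun y => |q y|)
    (ae_of_all _ fun y => indicator_nonneg (fun _ _ => zero_le_one) y)
    (ae_of_all _ fun y => abs_nonneg _) (by simpa using h1)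
    (by rw [ENNReal.ofReal_ofNat]; exact hq.abs)
  have e1 : ∀ y, E.indicator (fun _ => (1 : ℝ)) y * |q y| = |q y| := fun y => by
    by_cases hy : y ∈ E
    · simp [hy]
    · simp [hy, hq0 y hy]
  have e2 : ∀ y, E.indicator (fun _ => (1 : ℝ)) y ^ (2 : ℝ) = E.indicator (fun _ => (1 : ℝ)) y :=
    fun y => by by_cases hy : y ∈ E <;> simp [hy]
  have e3 : ∫ y in s, E.indicator (fun _ => (1 : ℝ)) y = (volume (s ∩ E)).toReal := by
    rw [setIntegral_indicator hE]; simp [measureReal_def]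
  have e4 : ∀ y, |q y| ^ (2 : ℝ) = q y ^ 2 := fun y => by
    rw [Real.rpow_two, sq_abs]
  simp only [e1, e2, e3, e4] at h
  have hA : 0 ≤ (volume (s ∩ E)).toReal := ENNReal.toReal_nonneg
  have hB : 0 ≤ ∫ y in s, q y ^ 2 := integral_nonneg fun y => sq_nonneg _
  have h0 : 0 ≤ ∫ y in s, |q y| := integral_nonneg fun y => abs_nonneg _
  calc (∫ y in s, |q y|) ^ 2 ≤ _ := pow_le_pow_left₀ h0 h 2
    _ = _ := by
      rw [mul_pow, ← Real.rpow_natCast, ← Real.rpow_natCast, ← Real.rpow_mul hA,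
        ← Real.rpow_mul hB]
      norm_num

/-- Smooth functions supported in `(a,b)` and of integral zero approximate in `L_2` each function
of integral zero that is supported in a compact subinterval. -/
lemma exists_approx_integral_zero {a b a' b' : ℝ} (h1 : a < a') (h2 : a' ≤ b') (h3 : b' < b)
    {g : ℝ → ℝ} (hg : MemLp g 2 volume) (hg0 : ∀ y, y ∉ Icc a' b' → g y = 0)
    (hgi : ∫ y in a..b, g y = 0) :
    ∃ G : ℕ → ℝ → ℝ, (∀ n, IsTest (Ioo a b) (G n)) ∧ (∀ n, ∫ y in a..b, G n y = 0) ∧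
      Tendsto (fun n => eLpNorm (fun y => G n y - g y) 2 (volume.restrict (Ioo a b)))
        atTop (𝓝 0) := by
  have hab : a < b := by linarith
  obtain ⟨C, -, hC⟩ := exists_cutoff
  set d := min (a' - a) (b - b') / 2 with hd
  have hd0 : 0 < d := by rw [hd]; have := lt_min (sub_pos.2 h1) (sub_pos.2 h3); positivity
  have hda : d ≤ (a' - a) / 2 := by rw [hd]; gcongr; exact min_le_left _ _
  have hdb : d ≤ (b - b') / 2 := by rw [hd]; gcongr; exact min_le_right _ _
  obtain ⟨ζ, z1, z2, z3, z4, z5, -⟩ := hC (a' - d) (b' + d) d hd0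
  have hz1 : ∀ x ∈ Icc a' b', ζ x = 1 := fun x hx => z4 x ⟨by linarith [hx.1], by linarith [hx.2]⟩
  obtain ⟨θ, hθ, hθ1⟩ := exists_isTest_integral_one hab
  have hap : ∀ n : ℕ, ∃ p : ℝ → ℝ, HasCompactSupport p ∧
      ContDiff ℝ ((⊤ : ℕ∞) : WithTop ℕ∞) p ∧
      eLpNorm (g - p) 2 volume ≤ ENNReal.ofReal (1 / (n + 1)) := fun n =>
    hg.exist_eLpNorm_sub_le (by norm_num) (by norm_num) (by positivity)
  choose p hpc hp hpe using hap
  have ht : ∀ n, IsTest (Ioo a b) fun x => ζ x * p n x := fun n =>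
    isTest_of_support (c := a' - d) (d := b' + d) (z1.mul (hp n))
      (fun x hx => by rw [z5 x fun h => hx ⟨h.1.le, h.2.le⟩, zero_mul])
      fun x hx => ⟨by linarith [hx.1], by linarith [hx.2]⟩
  have hpm : ∀ n, MemLp (p n) 2 volume := fun n =>
    (hp n).continuous.memLp_of_hasCompactSupport (hpc n)
  have hζp : ∀ n, MemLp (fun x => ζ x * p n x) 2 volume := fun n =>
    (ht n).1.continuous.memLp_of_hasCompactSupport (ht n).2.1
  have hdiff : ∀ n, eLpNorm (fun x => ζ x * p n x - g x) 2 volume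
      ≤ ENNReal.ofReal (1 / (n + 1)) := fun n => by
    refine (eLpNorm_mono fun x => ?_).trans (hpe n)
    simp only [Pi.sub_apply, Real.norm_eq_abs]
    by_cases hx : x ∈ Icc a' b'
    · rw [hz1 x hx, one_mul, abs_sub_comm]
    · rw [hg0 x hx, sub_zero, zero_sub, abs_neg, abs_mul, abs_of_nonneg (z2 x)]
      exact mul_le_of_le_one_left (abs_nonneg _) (z3 x)
  -- the mean of the approximants tends to zero
  set m : ℕ → ℝ := fun n => ∫ x in a..b, ζ x * p n x with hm
  have hmn : ∀ n, |m n| ≤ √(b - a) * (1 / (n + 1)) := fun n => by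
    have hgI := MemLp.intervalIntegrable_Ioo hab.le (hg.restrict (Ioo a b))
    have hζI := MemLp.intervalIntegrable_Ioo hab.le ((hζp n).restrict (Ioo a b))
    have e : m n = ∫ x in Ioo a b, (ζ x * p n x - g x) := by
      rw [← intervalIntegral_eq_setIntegral hab.le, intervalIntegral.integral_sub hζI hgI, hgi,
        sub_zero]
    have hq : MemLp (fun x => ζ x * p n x - g x) 2 (volume.restrict (Ioo a b)) :=
      ((hζp n).sub hg).restrict _
    have hcs := sq_integral_le (s := Ioo a b) MeasurableSet.univ
      (by simp) hq (fun y hy => absurd (mem_univ y) hy)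
    have hsq : ∫ y in Ioo a b, (ζ y * p n y - g y) ^ 2 ≤ (1 / (n + 1)) ^ 2 := by
      have h5 : ∫ y in Ioo a b, (ζ y * p n y - g y) ^ 2 ≤ ∫ y, (ζ y * p n y - g y) ^ 2 :=
        setIntegral_le_integral ((hζp n).sub hg).integrable_sq (ae_of_all _ fun y => sq_nonneg _)
      refine h5.trans ?_
      have h6 := ((hζp n).sub hg).eLpNorm_eq_integral_rpow_norm (by norm_num) (by norm_num)
      have h7 := hdiff n
      rw [show (fun x => ζ x * p n x - g x) = (fun x => ζ x * p n x) - g from rfl, h6,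
        ENNReal.ofReal_le_ofReal_iff (by positivity)] at h7
      simp only [ENNReal.toReal_ofNat, Pi.sub_apply, Real.rpow_two, Real.norm_eq_abs, sq_abs] at h7
      have hI : 0 ≤ ∫ y, (ζ y * p n y - g y) ^ 2 := integral_nonneg fun y => sq_nonneg _
      calc ∫ y, (ζ y * p n y - g y) ^ 2
          = ((∫ y, (ζ y * p n y - g y) ^ 2) ^ (2⁻¹ : ℝ)) ^ 2 := by
            rw [← Real.rpow_natCast, ← Real.rpow_mul hI]; norm_num
        _ ≤ _ := pow_le_pow_left₀ (by positivity) h7 2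
    rw [e]
    refine (abs_integral_le_integral_abs).trans ?_
    refine abs_le_of_sq_le_sq' ?_ (by positivity) |>.2
    rw [mul_pow, Real.sq_sqrt (by linarith)]
    refine hcs.trans ?_
    simp only [inter_univ, Real.volume_Ioo]
    rw [ENNReal.toReal_ofReal (by linarith)]
    exact mul_le_mul_of_nonneg_left hsq (by linarith)
  refine ⟨fun n x => ζ x * p n x - m n * θ x, fun n => (ht n).add_const_mul hab hθ (m n),
    fun n => ?_, ?_⟩
  · rw [intervalIntegral.integral_sub ((ht n).1.continuous.intervalIntegrable _ _)
      ((hθ.1.continuous.intervalIntegrable _ _).const_mul _),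
      intervalIntegral.integral_const_mul, hθ1, mul_one, hm, sub_self]
  · have hθm : MemLp θ 2 volume := hθ.1.continuous.memLp_of_hasCompactSupport hθ.2.1
    have hb : ∀ n, eLpNorm (fun y => ζ y * p n y - m n * θ y - g y) 2 (volume.restrict (Ioo a b))
        ≤ ENNReal.ofReal (1 / (n + 1))
          + ENNReal.ofReal (√(b - a) * (1 / (n + 1))) * eLpNorm θ 2 volume := fun n => by
      have e : (fun y => ζ y * p n y - m n * θ y - g y)
          = (fun y => ζ y * p n y - g y) - (m n) • θ := by
        ext y; simp only [Pi.sub_apply, Pi.smul_apply, smul_eq_mul]; ring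
      refine (eLpNorm_mono_measure _ Measure.restrict_le_self).trans ?_
      rw [e]
      refine (eLpNorm_sub_le ((hζp n).sub hg).1 (hθm.const_smul _).1 (by norm_num)).trans ?_
      refine add_le_add (hdiff n) ?_
      rw [eLpNorm_const_smul]
      gcongr
      rw [← ofReal_norm]
      exact ENNReal.ofReal_le_ofReal (hmn n)
    refine tendsto_of_tendsto_of_tendsto_of_le_of_le tendsto_const_nhds ?_
      (fun n => zero_le) hb
    have l1 : Tendsto (fun n : ℕ => 1 / ((n : ℝ) + 1)) atTop (𝓝 0) :=
      tendsto_one_div_add_atTop_nhds_zero_nat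
    have l2 := ENNReal.tendsto_ofReal l1
    have l3 := ENNReal.tendsto_ofReal (l1.const_mul √(b - a))
    rw [mul_zero] at l3
    rw [ENNReal.ofReal_zero] at l2 l3
    have l4 := ENNReal.Tendsto.mul_const (b := eLpNorm θ 2 volume) l3 (Or.inr hθm.2.ne)
    simpa using l2.add l4

/-- A primitive with compact support in `(a,b)` of an `L_2` function belongs to the closure of the
test functions in `H_2^1`. -/
lemma isH10_of_primitive {a b a' b' : ℝ} (h1 : a < a') (h2 : a' ≤ b') (h3 : b' < b)
    {f g : ℝ → ℝ} (hg : MemLp g 2 volume) (hg0 : ∀ y, y ∉ Icc a' b' → g y = 0)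
    (hf : ∀ᵐ x ∂(volume.restrict (Ioo a b)), f x = ∫ y in a..x, g y)
    (hf0 : ∀ x, x ∉ Icc a' b' → f x = 0) : IsH10 (Ioo a b) f g := by
  have hab : a < b := by linarith
  have hgI := MemLp.intervalIntegrable_Ioo hab.le (hg.restrict (Ioo a b))
  have hac : AbsolutelyContinuousOnInterval (fun x => ∫ y in a..x, g y) a b :=
    hgI.absolutelyContinuousOnInterval_intervalIntegral (by simp)
  have hcont : ContinuousOn (fun x => ∫ y in a..x, g y) (Icc a b) := by
    simpa [uIcc_of_le hab.le] using hac.continuousOn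
  have hgi : ∫ y in a..b, g y = 0 := by
    -- the primitive vanishes at some point of `(b', b)` and is constant there
    have h4 : ∃ᵐ x ∂(volume.restrict (Ioo b' b)), x ∈ Ioo b' b := by
      have : NeBot (ae (volume.restrict (Ioo b' b))) := by
        rw [ae_neBot, Ne, Measure.restrict_eq_zero]
        simp [h3]
      exact (ae_restrict_mem measurableSet_Ioo).frequently
    obtain ⟨x, hx, hfx⟩ := (h4.and_eventually
      (ae_restrict_of_ae_restrict_of_subset (Ioo_subset_Ioo (h1.le.trans h2) le_rfl) hf)).exists
    rw [hf0 x fun h => by linarith [h.2, hx.1]] at hfx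
    have hxa : a ≤ x := by linarith [hx.1]
    rw [← intervalIntegral.integral_add_adjacent_intervals (b := x)
      (hgI.mono_set ?_) (hgI.mono_set ?_), ← hfx, zero_add]
    · refine intervalIntegral.integral_zero_ae (ae_of_all _ fun y hy => hg0 y fun hy' => ?_)
      rw [uIoc_of_le hx.2.le] at hy
      linarith [hy'.2, hy.1, hx.1]
    · rw [uIcc_of_le hxa, uIcc_of_le hab.le]; exact Icc_subset_Icc le_rfl hx.2.le
    · rw [uIcc_of_le hx.2.le, uIcc_of_le hab.le]; exact Icc_subset_Icc hxa le_rfl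
  have hfm : MemLp f 2 (volume.restrict (Ioo a b)) := by
    obtain ⟨C, hC⟩ := isCompact_Icc.exists_bound_of_continuousOn hcont
    refine MemLp.ae_eq (f := fun x => ∫ y in a..x, g y) ?_ ?_
    · filter_upwards [hf] with x hx using hx.symm
    · refine MemLp.of_bound ((hcont.mono Ioo_subset_Icc_self).aestronglyMeasurable
        measurableSet_Ioo) C ?_
      filter_upwards [ae_restrict_mem measurableSet_Ioo] with x hx
        using hC x (Ioo_subset_Icc_self hx)
  refine ⟨⟨hfm, hg.restrict _, fun φ hφ => ?_⟩, ?_⟩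
  · rw [← integral_primitive_mul_deriv hab hgI hφ]
    refine integral_congr_ae ?_
    filter_upwards [hf] with x hx
    rw [hx]
  · obtain ⟨G, hG, hG0, hGt⟩ := exists_approx_integral_zero h1 h2 h3 hg hg0 hgi
    refine ⟨fun n x => ∫ y in a..x, G n y, fun n => ((hG n).primitive hab (hG0 n)).1, ?_, ?_⟩
    · have hGm : ∀ n, MemLp (G n) 2 volume := fun n =>
        (hG n).1.continuous.memLp_of_hasCompactSupport (hG n).2.1
      set N : ℕ → ℝ≥0∞ := fun n => eLpNorm (fun y => G n y - g y) 2 (volume.restrict (Ioo a b))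
      have hNt : ∀ n, N n ≠ ∞ := fun n => (((hGm n).sub hg).restrict _).2.ne
      have hpt : ∀ n, ∀ᵐ x ∂(volume.restrict (Ioo a b)),
          ‖(∫ y in a..x, G n y) - f x‖ ≤ √(b - a) * (N n).toReal := fun n => by
        filter_upwards [hf, ae_restrict_mem measurableSet_Ioo] with x hx hxm
        have hq : MemLp (fun y => G n y - g y) 2 (volume.restrict (Ioo a b)) :=
          ((hGm n).sub hg).restrict _
        have hcs := sq_integral_le (s := Ioo a b) MeasurableSet.univ
          (by simp) hq (fun y hy => absurd (mem_univ y) hy)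
        have hGI := MemLp.intervalIntegrable_Ioo hab.le ((hGm n).restrict (Ioo a b))
        have hs : uIcc a x ⊆ uIcc a b := by
          rw [uIcc_of_le hab.le, uIcc_of_le hxm.1.le]; exact Icc_subset_Icc le_rfl hxm.2.le
        rw [hx, ← intervalIntegral.integral_sub (hGI.mono_set hs) (hgI.mono_set hs),
          intervalIntegral_eq_setIntegral hxm.1.le]
        have e1 : ‖∫ y in Ioo a x, (G n y - g y)‖ ≤ ∫ y in Ioo a b, |G n y - g y| := by
          refine (norm_integral_le_integral_norm _).trans ?_
          exact setIntegral_mono_set (hq.integrable (by norm_num)).abs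
            (ae_of_all _ fun y => abs_nonneg _)
            (LE.le.eventuallyLE (Ioo_subset_Ioo le_rfl hxm.2.le))
        refine e1.trans ?_
        refine abs_le_of_sq_le_sq' ?_ (by positivity) |>.2
        rw [mul_pow, Real.sq_sqrt (by linarith)]
        refine hcs.trans (le_of_eq ?_)
        simp only [inter_univ, Real.volume_Ioo]
        rw [ENNReal.toReal_ofReal (by linarith)]
        congr 1
        have hI : 0 ≤ ∫ y in Ioo a b, (G n y - g y) ^ 2 := integral_nonneg fun y => sq_nonneg _
        simp only [N]
        rw [hq.eLpNorm_eq_integral_rpow_norm (by norm_num) (by norm_num),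
          ENNReal.toReal_ofReal (by positivity)]
        simp only [ENNReal.toReal_ofNat, Real.rpow_two, Real.norm_eq_abs, sq_abs]
        rw [← Real.rpow_natCast _ 2, ← Real.rpow_mul hI]; norm_num
      have hle : ∀ n, eLpNorm (fun x => (∫ y in a..x, G n y) - f x) 2 (volume.restrict (Ioo a b))
          ≤ volume.restrict (Ioo a b) univ ^ (2 : ℝ≥0∞).toReal⁻¹
            * ENNReal.ofReal (√(b - a) * (N n).toReal) := fun n =>
        eLpNorm_le_of_ae_bound (hpt n)
      refine tendsto_of_tendsto_of_tendsto_of_le_of_le tendsto_const_nhds ?_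
        (fun n => zero_le) hle
      have t1 : Tendsto (fun n => (N n).toReal) atTop (𝓝 0) := by
        have := (ENNReal.tendsto_toReal ENNReal.zero_ne_top).comp hGt
        rwa [ENNReal.toReal_zero] at this
      have t2 := ENNReal.tendsto_ofReal (t1.const_mul √(b - a))
      rw [mul_zero, ENNReal.ofReal_zero] at t2
      have t3 := ENNReal.Tendsto.const_mul
        (a := volume.restrict (Ioo a b) univ ^ (2 : ℝ≥0∞).toReal⁻¹) t2
        (Or.inr (by simp))
      simpa using t3
    · refine hGt.congr fun n => ?_
      congr 1; ext x
      rw [((hG n).primitive hab (hG0 n)).2 x]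

/-! ### Translations in time -/

/-- The correlation `s ↦ ∫ f(t + s, x) g(t, x) d(t, x)` of two functions of time and space. -/
def lag (f g : ℝ × ℝ → ℝ) (s : ℝ) : ℝ := ∫ z, f (z.1 + s, z.2) * g z

lemma measurePreserving_timeShift (s : ℝ) :
    MeasurePreserving (fun z : ℝ × ℝ => (z.1 + s, z.2)) volume volume := by
  have := measurePreserving_add_right (volume : Measure (ℝ × ℝ)) ((s, 0) : ℝ × ℝ)
  convert this using 2 with z
  ext <;> simp

lemma MemLp.timeShift {f : ℝ × ℝ → ℝ} {p : ℝ≥0∞} (hf : MemLp f p volume) (s : ℝ) :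
    MemLp (fun z : ℝ × ℝ => f (z.1 + s, z.2)) p volume :=
  hf.comp_measurePreserving (measurePreserving_timeShift s)

lemma continuous_timeShift_toLp {p : ℝ≥0∞} [Fact (1 ≤ p)] (hp : p ≠ ∞) {f : ℝ × ℝ → ℝ}
    (hf : MemLp f p volume) : Continuous fun s => (MemLp.timeShift hf s).toLp _ := by
  let g : C(ℝ × (ℝ × ℝ), ℝ × ℝ) := ⟨fun q => (q.2.1 + q.1, q.2.2), by fun_prop⟩
  have h := Continuous.compMeasurePreservingLp (E := ℝ) (p := p) (μ := (volume : Measure (ℝ × ℝ)))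
    (ν := (volume : Measure (ℝ × ℝ))) (f := fun _ : ℝ => hf.toLp f) (g := fun s => g.curry s)
    continuous_const g.curry.continuous (fun s => measurePreserving_timeShift s) hp
  refine h.congr fun s => ?_
  exact Lp.toLp_compMeasurePreserving hf (measurePreserving_timeShift s)

lemma lag_eq_inner {f g : ℝ × ℝ → ℝ} (hf : MemLp f 2 volume) (hg : MemLp g 2 volume) (s : ℝ) :
    lag f g s = inner ℝ (hg.toLp g) ((MemLp.timeShift hf s).toLp _) := by
  rw [L2.inner_def]
  refine integral_congr_ae ?_
  filter_upwards [hg.coeFn_toLp, (MemLp.timeShift hf s).coeFn_toLp] with z h1 h2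
  rw [h1, h2]
  simp

lemma continuous_lag {f g : ℝ × ℝ → ℝ} (hf : MemLp f 2 volume) (hg : MemLp g 2 volume) :
    Continuous (lag f g) := by
  rw [funext (lag_eq_inner hf hg)]
  exact continuous_const.inner (continuous_timeShift_toLp (by norm_num) hf)

lemma abs_lag_le {f g : ℝ × ℝ → ℝ} (hf : MemLp f 2 volume) (hg : MemLp g 2 volume) (s : ℝ) :
    |lag f g s| ≤ ‖hg.toLp g‖ * ‖hf.toLp f‖ := by
  rw [lag_eq_inner hf hg]
  refine (abs_real_inner_le_norm _ _).trans (le_of_eq ?_)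
  congr 1
  rw [Lp.norm_toLp, Lp.norm_toLp]
  congr 1
  exact eLpNorm_comp_measurePreserving hf.1 (measurePreserving_timeShift s)

lemma continuous_lag_of_bounded {f g : ℝ × ℝ → ℝ} (hf : Integrable f) (hg : Measurable g) {C : ℝ}
    (hC : ∀ z, |g z| ≤ C) : Continuous (lag f g) := by
  have hf1 : MemLp f 1 volume := memLp_one_iff_integrable.2 hf
  have hcont := continuous_timeShift_toLp (p := 1) (by norm_num) hf1
  have hC0 : 0 ≤ C := (abs_nonneg _).trans (hC 0)
  refine continuous_iff_continuousAt.2 fun s₀ => ?_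
  rw [ContinuousAt, tendsto_iff_dist_tendsto_zero]
  have h1 := (tendsto_iff_dist_tendsto_zero.1 (hcont.tendsto s₀)).const_mul C
  rw [mul_zero] at h1
  refine squeeze_zero (fun _ => dist_nonneg) (fun s => ?_) h1
  have hi : ∀ s, Integrable fun z : ℝ × ℝ => f (z.1 + s, z.2) := fun s =>
    memLp_one_iff_integrable.1 (MemLp.timeShift hf1 s)
  have e : dist ((MemLp.timeShift hf1 s).toLp _) ((MemLp.timeShift hf1 s₀).toLp _)
      = ∫ z : ℝ × ℝ, |f (z.1 + s, z.2) - f (z.1 + s₀, z.2)| := by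
    rw [dist_eq_norm, ← MemLp.toLp_sub, Lp.norm_toLp, eLpNorm_one_eq_lintegral_enorm,
      ← integral_norm_eq_lintegral_enorm ((hi s).sub (hi s₀)).1]
    rfl
  rw [e, Real.dist_eq, lag, lag, ← integral_sub, ← integral_const_mul]
  · rw [← Real.norm_eq_abs]
    refine norm_integral_le_of_norm_le (((hi s).sub (hi s₀)).abs.const_mul C)
      (ae_of_all _ fun z => ?_)
    rw [← sub_mul, norm_mul, mul_comm]
    exact mul_le_mul_of_nonneg_right (hC z) (abs_nonneg _)
  · exact (hi s).mul_bdd hg.aestronglyMeasurable (ae_of_all _ hC)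
  · exact (hi s₀).mul_bdd hg.aestronglyMeasurable (ae_of_all _ hC)

lemma lag_timeShift (f g : ℝ × ℝ → ℝ) (s σ : ℝ) :
    lag (fun z => f (z.1 + s, z.2)) g σ = lag f g (s + σ) := by
  simp only [lag]
  congr 1; ext z; congr 3; ring

/-- `∫ f(t + s, x) g(t - σ, x)` depends on `s + σ` only. -/
lemma integral_shift_mul_shift (f g : ℝ × ℝ → ℝ) (s σ : ℝ) :
    ∫ z : ℝ × ℝ, f (z.1 + s, z.2) * g (z.1 - σ, z.2) = lag f g (s + σ) := by
  have e : MeasurableEmbedding (fun z : ℝ × ℝ => (z.1 + σ, z.2)) := by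
    have := measurableEmbedding_addRight ((σ, 0) : ℝ × ℝ)
    convert this using 2 with z
    ext <;> simp
  rw [lag, ← (measurePreserving_timeShift σ).integral_comp e]
  congr 1; ext z
  simp only [add_sub_cancel_right]
  congr 3; ring

/-- Joint integrability of a family of translated products weighted by an integrable function. -/
lemma integrable_weighted_shift {f g : ℝ × ℝ → ℝ} (hfm : Measurable f) (hgm : Measurable g)
    (hf : MemLp f 2 volume) (hg : MemLp g 2 volume) {c e : ℝ → ℝ} (hc : Integrable c)
    (he : Measurable e) :
    Integrable (fun q : ℝ × (ℝ × ℝ) => c q.1 * (f (q.2.1 + e q.1, q.2.2) * g q.2))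
      (volume.prod volume) := by
  have hm : Measurable fun q : ℝ × (ℝ × ℝ) => f (q.2.1 + e q.1, q.2.2) * g q.2 := by
    refine (hfm.comp ?_).mul (hgm.comp measurable_snd)
    exact ((measurable_fst.comp measurable_snd).add (he.comp measurable_fst)).prodMk
      (measurable_snd.comp measurable_snd)
  have hmeas : AEStronglyMeasurable (fun q : ℝ × (ℝ × ℝ) =>
      c q.1 * (f (q.2.1 + e q.1, q.2.2) * g q.2)) (volume.prod volume) :=
    hc.1.comp_fst.mul hm.aestronglyMeasurable
  rw [integrable_prod_iff hmeas]
  have hslice : ∀ s, Integrable fun z : ℝ × ℝ => f (z.1 + e s, z.2) * g z := fun s =>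
    (MemLp.timeShift hf (e s)).integrable_mul hg
  refine ⟨ae_of_all _ fun s => (hslice s).const_mul (c s), ?_⟩
  set B : ℝ := ‖hg.abs.toLp _‖ * ‖hf.abs.toLp _‖ with hB
  refine (hc.abs.mul_const B).mono' hmeas.norm.integral_prod_right' (ae_of_all _ fun s => ?_)
  simp only
  rw [Real.norm_of_nonneg (integral_nonneg fun z => norm_nonneg _)]
  have : ∀ z : ℝ × ℝ, ‖c s * (f (z.1 + e s, z.2) * g z)‖
      = |c s| * (|f| (z.1 + e s, z.2) * |g| z) := fun z => by
    rw [norm_mul, norm_mul]; rfl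
  simp_rw [this]
  rw [integral_const_mul]
  refine mul_le_mul_of_nonneg_left ?_ (abs_nonneg _)
  exact (le_abs_self _).trans (abs_lag_le hf.abs hg.abs (e s))

/-! ### Averages in time -/

/-- Cauchy-Schwarz for an average in time. -/
lemma eLpNorm_integral_time_le {F : ℝ × ℝ → ℝ} (hFm : Measurable F) {c d : ℝ} (hcd : c ≤ d) :
    eLpNorm (fun x => ∫ τ in c..d, F (τ, x)) 2 volume
      ≤ ENNReal.ofReal (d - c) ^ (1 / 2 : ℝ) * eLpNorm F 2 volume := by
  rw [eLpNorm_eq_lintegral_rpow_enorm_toReal (by norm_num) (by norm_num),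
    eLpNorm_eq_lintegral_rpow_enorm_toReal (by norm_num) (by norm_num)]
  simp only [ENNReal.toReal_ofNat]
  rw [← ENNReal.mul_rpow_of_nonneg _ _ (by norm_num)]
  refine ENNReal.rpow_le_rpow ?_ (by norm_num)
  have hpt : ∀ x, ‖∫ τ in c..d, F (τ, x)‖ₑ ^ (2 : ℝ)
      ≤ ENNReal.ofReal (d - c) * ∫⁻ τ, ‖F (τ, x)‖ₑ ^ (2 : ℝ) := fun x => by
    have hm : Measurable fun τ => ‖F (τ, x)‖ₑ :=
      (hFm.comp (measurable_id.prodMk measurable_const)).enorm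
    have h1 : ‖∫ τ in c..d, F (τ, x)‖ₑ ≤ ∫⁻ τ in Ioc c d, ‖F (τ, x)‖ₑ := by
      rw [intervalIntegral.integral_of_le hcd]
      exact enorm_integral_le_lintegral_enorm _
    have h2 := ENNReal.lintegral_mul_le_Lp_mul_Lq (volume.restrict (Ioc c d))
      Real.HolderConjugate.two_two (f := fun _ => 1) (g := fun τ => ‖F (τ, x)‖ₑ)
      aemeasurable_const hm.aemeasurable
    simp only [Pi.mul_apply, one_mul, ENNReal.one_rpow, lintegral_const, Measure.restrict_apply,
      MeasurableSet.univ, univ_inter, Real.volume_Ioc] at h2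
    calc _ ≤ (ENNReal.ofReal (d - c) ^ (1 / 2 : ℝ)
          * (∫⁻ τ in Ioc c d, ‖F (τ, x)‖ₑ ^ (2 : ℝ)) ^ (1 / 2 : ℝ)) ^ (2 : ℝ) :=
          ENNReal.rpow_le_rpow (h1.trans h2) (by norm_num)
      _ = ENNReal.ofReal (d - c) * ∫⁻ τ in Ioc c d, ‖F (τ, x)‖ₑ ^ (2 : ℝ) := by
          rw [ENNReal.mul_rpow_of_nonneg _ _ (by norm_num), ← ENNReal.rpow_mul,
            ← ENNReal.rpow_mul]
          norm_num
      _ ≤ _ := by gcongr; exact Measure.restrict_le_self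
  calc _ ≤ ∫⁻ x, ENNReal.ofReal (d - c) * ∫⁻ τ, ‖F (τ, x)‖ₑ ^ (2 : ℝ) := lintegral_mono hpt
    _ = ENNReal.ofReal (d - c) * ∫⁻ x, ∫⁻ τ, ‖F (τ, x)‖ₑ ^ (2 : ℝ) := by
        rw [lintegral_const_mul' _ _ ENNReal.ofReal_ne_top]
    _ = _ := by
        congr 1
        rw [Measure.volume_eq_prod, lintegral_prod_symm' _ (hFm.enorm.pow_const _)]

lemma measurable_integral_time {F : ℝ × ℝ → ℝ} (hFm : Measurable F) (c d : ℝ) :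
    Measurable fun x => ∫ τ in c..d, F (τ, x) := by
  simp only [intervalIntegral]
  refine Measurable.sub ?_ ?_
  all_goals
    refine (StronglyMeasurable.integral_prod_right' (f := fun z : ℝ × ℝ => F (z.2, z.1))
      (hFm.comp measurable_swap).stronglyMeasurable).measurable

lemma MemLp.integral_time {F : ℝ × ℝ → ℝ} (hFm : Measurable F) (hF : MemLp F 2 volume) {c d : ℝ}
    (hcd : c ≤ d) : MemLp (fun x => ∫ τ in c..d, F (τ, x)) 2 volume :=
  ⟨(measurable_integral_time hFm c d).aestronglyMeasurable,
    (eLpNorm_integral_time_le hFm hcd).trans_lt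
      (ENNReal.mul_lt_top (ENNReal.rpow_lt_top_of_nonneg (by norm_num) ENNReal.ofReal_ne_top) hF.2)⟩

lemma integral_time_eq {F : ℝ × ℝ → ℝ} {δ : ℝ} (hδ : 0 ≤ δ) (z : ℝ × ℝ) :
    ∫ τ in z.1..(z.1 + δ), F (τ, z.2)
      = ∫ s, (Ioc 0 δ).indicator 1 s * F (z.1 + s, z.2) := by
  have h1 : ∀ s, (Ioc 0 δ).indicator 1 s * F (z.1 + s, z.2)
      = (Ioc 0 δ).indicator (fun s => F (z.1 + s, z.2)) s := fun s => by
    by_cases hs : s ∈ Ioc 0 δ <;> simp [hs]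
  simp_rw [h1]
  rw [integral_indicator measurableSet_Ioc, ← intervalIntegral.integral_of_le hδ,
    intervalIntegral.integral_comp_add_left (fun τ => F (τ, z.2))]
  simp

lemma measurable_time_average {F : ℝ × ℝ → ℝ} (hFm : Measurable F) {δ : ℝ} (hδ : 0 ≤ δ) :
    Measurable fun z : ℝ × ℝ => ∫ τ in z.1..(z.1 + δ), F (τ, z.2) := by
  simp_rw [integral_time_eq hδ]
  refine (StronglyMeasurable.integral_prod_right' (f := fun q : (ℝ × ℝ) × ℝ =>
    (Ioc 0 δ).indicator 1 q.2 * F (q.1.1 + q.2, q.1.2)) ?_).measurable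
  refine (Measurable.mul ?_ (hFm.comp ?_)).stronglyMeasurable
  · exact (measurable_one.indicator measurableSet_Ioc).comp measurable_snd
  · exact ((measurable_fst.comp measurable_fst).add measurable_snd).prodMk
      (measurable_snd.comp measurable_fst)

lemma MemLp.time_average {F : ℝ × ℝ → ℝ} (hFm : Measurable F) (hF : MemLp F 2 volume) {δ : ℝ}
    (hδ : 0 ≤ δ) (T : ℝ) (I : Set ℝ) :
    MemLp (fun z : ℝ × ℝ => ∫ τ in z.1..(z.1 + δ), F (τ, z.2)) 2 (cyl T I) := by
  have hm := measurable_time_average hFm hδ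
  have h0 : MemLp (fun z : ℝ × ℝ => ∫ τ in z.1..(z.1 + δ), F (τ, z.2)) 2
      ((volume.restrict (Ioo 0 T)).prod volume) := by
    refine ⟨hm.aestronglyMeasurable, ?_⟩
    rw [eLpNorm_lt_top_iff_lintegral_rpow_enorm_lt_top (by norm_num) (by norm_num)]
    simp only [ENNReal.toReal_ofNat]
    rw [lintegral_prod _ (hm.enorm.pow_const _).aemeasurable]
    set B := (ENNReal.ofReal δ ^ (1 / 2 : ℝ) * eLpNorm F 2 volume) ^ (2 : ℝ) with hB
    have hle : ∀ t : ℝ, ∫⁻ x, ‖∫ τ in t..(t + δ), F (τ, x)‖ₑ ^ (2 : ℝ) ≤ B := fun t => by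
      have h1 := eLpNorm_integral_time_le hFm (show t ≤ t + δ by linarith)
      rw [eLpNorm_eq_lintegral_rpow_enorm_toReal (by norm_num) (by norm_num),
        add_sub_cancel_left] at h1
      simp only [ENNReal.toReal_ofNat] at h1
      have h2 := ENNReal.rpow_le_rpow h1 (show (0 : ℝ) ≤ 2 by norm_num)
      rw [← ENNReal.rpow_mul] at h2
      norm_num at h2
      rw [hB]
      norm_num
      exact h2
    calc _ ≤ ∫⁻ t in Ioo 0 T, B := lintegral_mono fun t => hle t
      _ < ∞ := by
        rw [lintegral_const, Measure.restrict_apply MeasurableSet.univ, univ_inter,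
          Real.volume_Ioo]
        refine ENNReal.mul_lt_top (ENNReal.rpow_lt_top_of_nonneg (by norm_num) ?_)
          ENNReal.ofReal_lt_top
        exact (ENNReal.mul_lt_top (ENNReal.rpow_lt_top_of_nonneg (by norm_num)
          ENNReal.ofReal_ne_top) hF.2).ne
  refine h0.mono_measure ?_
  rw [cyl, Measure.volume_eq_prod, ← Measure.prod_restrict]
  exact Measure.prod_mono le_rfl Measure.restrict_le_self

/-! ### Time averages as test functions -/

/-- A nonnegative function `Ψ` of time and space, with spatial derivative `G`, that vanishes for
times after `T` and outside of `[a', b']` in space. No regularity in time is required. -/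
structure SpaceTest (T a b a' b' : ℝ) (Ψ G : ℝ × ℝ → ℝ) : Prop where
  meas : Measurable Ψ
  meas_deriv : Measurable G
  memLp : MemLp Ψ 2 volume
  memLp_deriv : MemLp G 2 volume
  zero : ∀ z : ℝ × ℝ, (T ≤ z.1 ∨ z.2 ∉ Icc a' b') → Ψ z = 0
  zero_deriv : ∀ z : ℝ × ℝ, (T ≤ z.1 ∨ z.2 ∉ Icc a' b') → G z = 0
  nonneg : ∀ z, 0 ≤ Ψ z
  prim : ∀ᵐ z : ℝ × ℝ, z.2 ∈ Ioo a b → Ψ z = ∫ y in a..z.2, G (z.1, y)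

lemma isH1_of_primitive {a b : ℝ} (hab : a < b) {f g : ℝ → ℝ} {c : ℝ}
    (hg : MemLp g 2 (volume.restrict (Ioo a b)))
    (hf : ∀ x ∈ Ioo a b, f x = c + ∫ y in a..x, g y) : IsH1 (Ioo a b) f g := by
  have hgI := MemLp.intervalIntegrable_Ioo hab.le hg
  have hac : AbsolutelyContinuousOnInterval (fun x => ∫ y in a..x, g y) a b :=
    hgI.absolutelyContinuousOnInterval_intervalIntegral (by simp)
  have hcont : ContinuousOn (fun x => ∫ y in a..x, g y) (Icc a b) := by
    simpa [uIcc_of_le hab.le] using hac.continuousOn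
  have hcf : ContinuousOn (fun x => c + ∫ y in a..x, g y) (Icc a b) := continuousOn_const.add hcont
  obtain ⟨C, hC⟩ := isCompact_Icc.exists_bound_of_continuousOn hcf
  refine ⟨?_, hg, fun φ hφ => ?_⟩
  · refine MemLp.ae_eq (f := fun x => c + ∫ y in a..x, g y) ?_ ?_
    · filter_upwards [ae_restrict_mem measurableSet_Ioo] with x hx using (hf x hx).symm
    · refine MemLp.of_bound ((hcf.mono Ioo_subset_Icc_self).aestronglyMeasurable
        measurableSet_Ioo) C ?_
      filter_upwards [ae_restrict_mem measurableSet_Ioo] with x hx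
        using hC x (Ioo_subset_Icc_self hx)
  · have hφc : Continuous (deriv φ) := hφ.1.continuous_deriv (by simp)
    have h0 : ∫ x in Ioo a b, deriv φ x = 0 := by
      obtain ⟨c', d', h1, h2, h3, h4⟩ := hφ.exists_Icc hab
      rw [← intervalIntegral_eq_setIntegral hab.le,
        intervalIntegral.integral_deriv_eq_sub
          (fun x _ => hφ.1.differentiable (by simp) x) (hφc.intervalIntegrable _ _),
        h4 b fun h => by linarith [h.2], h4 a fun h => by linarith [h.1], sub_zero]
    have hi1 : IntegrableOn (fun x => c * deriv φ x) (Ioo a b) :=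
      ((hφc.const_mul c).continuousOn.integrableOn_Icc (a := a) (b := b)).mono_set
        Ioo_subset_Icc_self
    have hi2 : IntegrableOn (fun x => (∫ y in a..x, g y) * deriv φ x) (Ioo a b) :=
      ((hcont.mul hφc.continuousOn).integrableOn_Icc).mono_set Ioo_subset_Icc_self
    rw [← integral_primitive_mul_deriv hab hgI hφ]
    calc ∫ x in Ioo a b, f x * deriv φ x
        = ∫ x in Ioo a b, (c * deriv φ x + (∫ y in a..x, g y) * deriv φ x) := by
          refine setIntegral_congr_fun measurableSet_Ioo fun x hx => ?_
          simp only [hf x hx]; ring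
      _ = _ := by rw [integral_add hi1 hi2, integral_const_mul, h0, mul_zero, zero_add]

lemma MemLp.slice_time {F : ℝ × ℝ → ℝ} (hFm : Measurable F) (hF : MemLp F 2 volume) :
    ∀ᵐ x, MemLp (fun t => F (t, x)) 2 volume := by
  have h := hF.integrable_sq
  rw [Measure.volume_eq_prod] at h
  filter_upwards [h.prod_left_ae] with x hx
  exact (memLp_two_iff_integrable_sq
    (hFm.comp (measurable_id.prodMk measurable_const)).aestronglyMeasurable).2 hx

lemma MemLp.slice_space {F : ℝ × ℝ → ℝ} (hFm : Measurable F) (hF : MemLp F 2 volume) :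
    ∀ᵐ t, MemLp (fun x => F (t, x)) 2 volume := by
  have h := hF.integrable_sq
  rw [Measure.volume_eq_prod] at h
  filter_upwards [h.prod_right_ae] with t ht
  exact (memLp_two_iff_integrable_sq
    (hFm.comp (measurable_const.prodMk measurable_id)).aestronglyMeasurable).2 ht

lemma MemLp.intervalIntegrable_all {f : ℝ → ℝ} (hf : MemLp f 2 volume) (a b : ℝ) :
    IntervalIntegrable f volume a b :=
  ((hf.locallyIntegrable (by norm_num)).integrableOn_isCompact isCompact_uIcc).intervalIntegrable

lemma ae_ae_swap {p : ℝ × ℝ → Prop} (h : ∀ᵐ z : ℝ × ℝ, p z) : ∀ᵐ x : ℝ, ∀ᵐ t : ℝ, p (t, x) := by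
  have h1 : ∀ᵐ z : ℝ × ℝ, p z.swap :=
    (Measure.measurePreserving_swap (μ := (volume : Measure ℝ))
      (ν := (volume : Measure ℝ))).quasiMeasurePreserving.ae h
  exact Measure.ae_ae_of_ae_prod h1

namespace SpaceTest

variable {T a b a' b' : ℝ} {Ψ G : ℝ × ℝ → ℝ}

lemma timeShift (h : SpaceTest T a b a' b' Ψ G) {s : ℝ} (hs : 0 ≤ s) :
    SpaceTest T a b a' b' (fun z => Ψ (z.1 + s, z.2)) (fun z => G (z.1 + s, z.2)) where
  meas := h.meas.comp ((measurable_fst.add_const s).prodMk measurable_snd)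
  meas_deriv := h.meas_deriv.comp ((measurable_fst.add_const s).prodMk measurable_snd)
  memLp := MemLp.timeShift h.memLp s
  memLp_deriv := MemLp.timeShift h.memLp_deriv s
  zero z hz := h.zero _ (hz.imp (fun h => by simp only; linarith) id)
  zero_deriv z hz := h.zero_deriv _ (hz.imp (fun h => by simp only; linarith) id)
  nonneg z := h.nonneg _
  prim := (measurePreserving_timeShift s).quasiMeasurePreserving.ae h.prim

/-- The increment of a time average. -/
lemma average_sub {p : ℝ → ℝ} (hp : MemLp p 2 volume) (δ s t : ℝ) :
    (∫ τ in t..(t + δ), p τ) - ∫ τ in s..(s + δ), p τ = ∫ τ in s..t, (p (τ + δ) - p τ) := by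
  have hi := MemLp.intervalIntegrable_all hp
  have hi' : IntervalIntegrable (fun τ => p (τ + δ)) volume s t := by
    simpa using (hi (s + δ) (t + δ)).comp_add_right δ
  rw [intervalIntegral.integral_sub hi' (hi _ _),
    intervalIntegral.integral_comp_add_right (fun τ => p τ)]
  have e1 := intervalIntegral.integral_add_adjacent_intervals (hi s t) (hi t (t + δ))
  have e2 := intervalIntegral.integral_add_adjacent_intervals (hi s (s + δ)) (hi (s + δ) (t + δ))
  linarith

lemma isTestFunction_average (h : SpaceTest T a b a' b' Ψ G) (hT : 0 < T) (h1 : a < a')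
    (h2 : a' ≤ b') (h3 : b' < b) {δ : ℝ} (hδ : 0 ≤ δ) :
    IsTestFunction T (Ioo a b) (fun z => ∫ τ in z.1..(z.1 + δ), Ψ (τ, z.2))
      (fun z => Ψ (z.1 + δ, z.2) - Ψ z) (fun z => ∫ τ in z.1..(z.1 + δ), G (τ, z.2)) := by
  have hsl : ∀ t, MemLp (fun x => ∫ τ in t..(t + δ), Ψ (τ, x)) 2 volume := fun t =>
    MemLp.integral_time h.meas h.memLp (by linarith)
  have hψtm : Measurable fun z : ℝ × ℝ => Ψ (z.1 + δ, z.2) - Ψ z :=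
    (h.timeShift hδ).meas.sub h.meas
  have hψt : MemLp (fun z : ℝ × ℝ => Ψ (z.1 + δ, z.2) - Ψ z) 2 volume :=
    (MemLp.timeShift h.memLp δ).sub h.memLp
  refine ⟨MemLp.time_average h.meas h.memLp hδ T _, hψt.restrict _,
    MemLp.time_average h.meas_deriv h.memLp_deriv hδ T _, ?_, ?_, ?_, ?_⟩
  · refine ae_restrict_of_ae ?_
    filter_upwards [MemLp.slice_time h.meas h.memLp] with x hx
    refine isH1_of_primitive hT (c := ∫ τ in (0 : ℝ)..(0 + δ), Ψ (τ, x)) ?_ fun t _ => ?_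
    · have : MemLp (fun t => Ψ (t + δ, x)) 2 volume :=
        hx.comp_measurePreserving (measurePreserving_add_right volume δ)
      exact (this.sub hx).restrict _
    · have := average_sub hx δ 0 t
      linarith
  · refine ae_of_all _ fun t => ?_
    refine isH10_of_primitive h1 h2 h3 (MemLp.integral_time (c := t) (d := t + δ) h.meas_deriv
      h.memLp_deriv (by linarith)) (fun y hy => ?_) ?_ fun x hx => ?_
    · simp only
      rw [show (fun τ => G (τ, y)) = fun _ => 0 from funext fun τ => h.zero_deriv _ (Or.inr hy)]
      simp
    · filter_upwards [ae_restrict_of_ae (ae_ae_swap h.prim), ae_restrict_mem measurableSet_Ioo]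
        with x hx hxm
      have e1 : ∫ τ in t..(t + δ), Ψ (τ, x) = ∫ τ in t..(t + δ), ∫ y in a..x, G (τ, y) := by
        refine intervalIntegral.integral_congr_ae ?_
        filter_upwards [hx] with τ hτ _
        exact hτ hxm
      rw [e1, intervalIntegral.integral_of_le (by linarith),
        intervalIntegral.integral_of_le hxm.1.le]
      simp only [intervalIntegral.integral_of_le hxm.1.le,
        intervalIntegral.integral_of_le (show t ≤ t + δ by linarith)]
      refine integral_integral_swap (f := fun τ y => G (τ, y)) ?_
      rw [Measure.prod_restrict, ← Measure.volume_eq_prod]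
      have : IsFiniteMeasure ((volume : Measure (ℝ × ℝ)).restrict (Ioc t (t + δ) ×ˢ Ioc a x)) := by
        refine ⟨?_⟩
        rw [Measure.restrict_apply_univ, Measure.volume_eq_prod, Measure.prod_prod,
          Real.volume_Ioc, Real.volume_Ioc]
        exact ENNReal.mul_lt_top ENNReal.ofReal_lt_top ENNReal.ofReal_lt_top
      exact (h.memLp_deriv.restrict _).integrable (by norm_num)
    · simp only
      rw [show (fun τ => Ψ (τ, x)) = fun _ => 0 from funext fun τ => h.zero _ (Or.inr hx)]
      simp
  · refine ⟨fun t => ((hsl t).restrict (Ioo a b)).toLp _, ?_, ?_, ?_⟩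
    · set F : ℝ × ℝ → ℝ := fun z => Ψ (z.1 + δ, z.2) - Ψ z with hF
      have hdist : ∀ s t, s ≤ t → dist (((hsl t).restrict (Ioo a b)).toLp _)
          (((hsl s).restrict (Ioo a b)).toLp _)
          ≤ (ENNReal.ofReal (t - s) ^ (1 / 2 : ℝ) * eLpNorm F 2 volume).toReal := by
        intro s t hst
        rw [dist_eq_norm, ← MemLp.toLp_sub, Lp.norm_toLp]
        refine ENNReal.toReal_mono ?_ ?_
        · exact (ENNReal.mul_lt_top (ENNReal.rpow_lt_top_of_nonneg (by norm_num)
            ENNReal.ofReal_ne_top) hψt.2).ne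
        · refine (eLpNorm_mono_measure _ Measure.restrict_le_self).trans ?_
          refine le_trans (le_of_eq (eLpNorm_congr_ae ?_)) (eLpNorm_integral_time_le hψtm hst)
          filter_upwards [MemLp.slice_time h.meas h.memLp] with x hx
          exact average_sub hx δ s t
      have hdist' : ∀ s t, dist (((hsl t).restrict (Ioo a b)).toLp _)
          (((hsl s).restrict (Ioo a b)).toLp _)
          ≤ (ENNReal.ofReal |t - s| ^ (1 / 2 : ℝ) * eLpNorm F 2 volume).toReal := by
        intro s t
        rcases le_total s t with hst | hst
        · rw [abs_of_nonneg (sub_nonneg.2 hst)]; exact hdist s t hst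
        · rw [abs_sub_comm, abs_of_nonneg (sub_nonneg.2 hst), dist_comm]; exact hdist t s hst
      refine Continuous.continuousOn (continuous_iff_continuousAt.2 fun s => ?_)
      rw [ContinuousAt, tendsto_iff_dist_tendsto_zero]
      refine squeeze_zero (fun _ => dist_nonneg) (fun t => hdist' s t) ?_
      have t1 : Tendsto (fun t => |t - s|) (𝓝 s) (𝓝 0) := by
        have : Continuous fun t : ℝ => |t - s| := by fun_prop
        simpa using this.tendsto s
      have t2 := ENNReal.tendsto_ofReal t1
      rw [ENNReal.ofReal_zero] at t2
      have t3 := t2.ennrpow_const (1 / 2 : ℝ)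
      rw [ENNReal.zero_rpow_of_pos (by norm_num)] at t3
      have t4 := ENNReal.Tendsto.mul_const (b := eLpNorm F 2 volume) t3 (Or.inr hψt.2.ne)
      rw [zero_mul] at t4
      have t5 := (ENNReal.tendsto_toReal ENNReal.zero_ne_top).comp t4
      rwa [ENNReal.toReal_zero] at t5
    · refine (Lp.eq_zero_iff_ae_eq_zero).2 (((hsl T).restrict (Ioo a b)).coeFn_toLp.trans
        (ae_of_all _ fun x => ?_))
      refine intervalIntegral.integral_zero_ae (ae_of_all _ fun τ hτ => h.zero _ (Or.inl ?_))
      rw [uIoc_of_le (by linarith)] at hτ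
      exact hτ.1.le
    · exact ae_of_all _ fun t => ((hsl t).restrict (Ioo a b)).coeFn_toLp.symm
  · exact ae_of_all _ fun z => intervalIntegral.integral_nonneg (by linarith) fun τ _ =>
      h.nonneg _

end SpaceTest

/-! ### The weak inequality for correlations -/

/-- A nonnegative weak subsolution in `(0,T) × (a,b)` with spatial derivative `Du` and flux `Q`,
extended by zero to the plane and given by measurable functions. -/
structure ExtendedSubsolution (k : ℝ → ℝ) (T a b : ℝ) (u Du Q : ℝ × ℝ → ℝ) (u₀ : ℝ → ℝ) :
    Prop where
  meas : Measurable u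
  meas_deriv : Measurable Du
  meas_flux : Measurable Q
  meas_init : Measurable u₀
  memLp : MemLp u 2 volume
  memLp_deriv : MemLp Du 2 volume
  memLp_flux : MemLp Q 2 volume
  memLp_init : MemLp u₀ 2 volume
  zero : ∀ z, z ∉ Ioo 0 T ×ˢ Ioo a b → u z = 0
  zero_flux : ∀ z, z ∉ Ioo 0 T ×ˢ Ioo a b → Q z = 0
  zero_init : ∀ x, x ∉ Ioo a b → u₀ x = 0
  nonneg : ∀ z, 0 ≤ u z
  nonneg_init : ∀ x, 0 ≤ u₀ x
  slice : ∀ᵐ t, t ∈ Ioo 0 T → IsH1 (Ioo a b) (fun x => u (t, x)) (fun x => Du (t, x))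
  weak : ∀ ψ ψt Dψ : ℝ × ℝ → ℝ, IsTestFunction T (Ioo a b) ψ ψt Dψ →
    ∫ z, (-ψt z * timeConv k (fun y => u y - u₀ y.2) z + Q z * Dψ z) ∂(cyl T (Ioo a b)) ≤ 0

/-- The difference `u - u₀` on the cylinder, extended by zero. -/
def excess (T : ℝ) (u : ℝ × ℝ → ℝ) (u₀ : ℝ → ℝ) (z : ℝ × ℝ) : ℝ :=
  u z - (Ioo 0 T).indicator 1 z.1 * u₀ z.2

namespace ExtendedSubsolution

variable {k l : ℝ → ℝ} {T a b a' b' : ℝ} {u Du Q : ℝ × ℝ → ℝ} {u₀ : ℝ → ℝ} {Ψ G : ℝ × ℝ → ℝ}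

lemma measurable_excess (D : ExtendedSubsolution k T a b u Du Q u₀) :
    Measurable (excess T u u₀) :=
  D.meas.sub (((measurable_one.indicator measurableSet_Ioo).comp measurable_fst).mul
    (D.meas_init.comp measurable_snd))

lemma memLp_init_ext (D : ExtendedSubsolution k T a b u Du Q u₀) :
    MemLp (fun z : ℝ × ℝ => (Ioo 0 T).indicator 1 z.1 * u₀ z.2) 2 volume := by
  have hm : Measurable fun z : ℝ × ℝ => (Ioo 0 T).indicator (1 : ℝ → ℝ) z.1 * u₀ z.2 :=
    ((measurable_one.indicator measurableSet_Ioo).comp measurable_fst).mul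
      (D.meas_init.comp measurable_snd)
  rw [memLp_two_iff_integrable_sq hm.aestronglyMeasurable]
  have h1 : Integrable ((Ioo 0 T).indicator (1 : ℝ → ℝ)) :=
    (integrable_indicator_iff measurableSet_Ioo).2 (integrableOn_const (by simp))
  have h2 := h1.mul_prod D.memLp_init.integrable_sq
  refine h2.congr (ae_of_all _ fun z => ?_)
  by_cases hz : z.1 ∈ Ioo 0 T <;> simp [hz]

lemma memLp_excess (D : ExtendedSubsolution k T a b u Du Q u₀) :
    MemLp (excess T u u₀) 2 volume :=
  D.memLp.sub D.memLp_init_ext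

lemma excess_eq_zero (D : ExtendedSubsolution k T a b u Du Q u₀) {z : ℝ × ℝ}
    (hz : z ∉ Ioo 0 T ×ˢ Ioo a b) : excess T u u₀ z = 0 := by
  rw [excess, D.zero z hz]
  by_cases h1 : z.1 ∈ Ioo 0 T
  · rw [D.zero_init z.2 fun h => hz ⟨h1, h⟩]; simp
  · simp [h1]

lemma timeConv_eq (D : ExtendedSubsolution k T a b u Du Q u₀) {z : ℝ × ℝ}
    (hz : z ∈ Ioo 0 T ×ˢ Ioo a b) :
    timeConv k (fun y => u y - u₀ y.2) z = ∫ σ, ext T k σ * excess T u u₀ (z.1 - σ, z.2) := by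
  obtain ⟨⟨h0, hT⟩, hx⟩ := hz
  rw [timeConv, conv, intervalIntegral_eq_setIntegral h0.le, ← integral_indicator measurableSet_Ioo,
    ← integral_sub_left_eq_self _ volume z.1]
  congr 1; ext σ
  by_cases hσ : σ ∈ Ioo 0 z.1
  · have h1 : z.1 - σ ∈ Ioo 0 z.1 := ⟨by linarith [hσ.2], by linarith [hσ.1]⟩
    have h2 : z.1 - σ ∈ Ioo 0 T := ⟨h1.1, h1.2.trans hT⟩
    rw [indicator_of_mem h1, ext_of_mem ⟨hσ.1, hσ.2.trans hT⟩, excess, indicator_of_mem h2]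
    simp
  · have h1 : z.1 - σ ∉ Ioo 0 z.1 := fun h => hσ ⟨by linarith [h.2], by linarith [h.1]⟩
    rw [indicator_of_notMem h1]
    by_cases h3 : 0 < σ
    · rw [D.excess_eq_zero, mul_zero]
      rintro ⟨h4, -⟩
      exact hσ ⟨h3, by linarith [h4.1]⟩
    · rw [ext_of_notMem fun h => h3 h.1, zero_mul]

/-- Fubini's theorem for the pairing of a test function with the convolution `k * (u - u₀)`. -/
lemma pairing_timeConv (D : ExtendedSubsolution k T a b u Du Q u₀) (H : IsKernelPair k l)
    (h : SpaceTest T a b a' b' Ψ G) :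
    IntegrableOn (fun z => Ψ z * timeConv k (fun y => u y - u₀ y.2) z) (Ioo 0 T ×ˢ Ioo a b) ∧
    ∫ z in Ioo 0 T ×ˢ Ioo a b, Ψ z * timeConv k (fun y => u y - u₀ y.2) z
      = ∫ σ, ext T k σ * lag Ψ (excess T u u₀) σ := by
  have hint := integrable_weighted_shift D.measurable_excess h.meas D.memLp_excess h.memLp
    (H.integrable_ext_k T) measurable_neg
  have hmeas : MeasurableSet (Ioo 0 T ×ˢ Ioo a b : Set (ℝ × ℝ)) :=
    measurableSet_Ioo.prod measurableSet_Ioo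
  have e : ∀ z, (Ioo 0 T ×ˢ Ioo a b).indicator
      (fun z => Ψ z * timeConv k (fun y => u y - u₀ y.2) z) z
      = ∫ σ, ext T k σ * (excess T u u₀ (z.1 + -σ, z.2) * Ψ z) := fun z => by
    simp only [← mul_assoc, integral_mul_const]
    simp only [← sub_eq_add_neg]
    by_cases hz : z ∈ Ioo 0 T ×ˢ Ioo a b
    · rw [indicator_of_mem hz, D.timeConv_eq hz, mul_comm]
    · rw [indicator_of_notMem hz]
      by_cases hT : T ≤ z.1
      · rw [h.zero z (Or.inl hT), mul_zero]
      · rw [integral_eq_zero_of_ae, zero_mul]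
        refine ae_of_all _ fun σ => ?_
        show ext T k σ * excess T u u₀ (z.1 - σ, z.2) = 0
        by_cases hσ : 0 < σ
        · rw [D.excess_eq_zero, mul_zero]
          rintro ⟨h4, h5⟩
          exact hz ⟨⟨by have := h4.1; simp only at this; linarith, not_le.1 hT⟩, h5⟩
        · rw [ext_of_notMem fun h => hσ h.1, zero_mul]
  constructor
  · rw [← integrable_indicator_iff hmeas, funext e]
    exact hint.integral_prod_right
  · rw [← integral_indicator hmeas, funext e,
      ← integral_integral_swap (f := fun σ z => ext T k σ * (excess T u u₀ (z.1 + -σ, z.2) * Ψ z))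
        hint]
    congr 1; ext σ
    rw [integral_const_mul]
    congr 1
    have := integral_shift_mul_shift Ψ (excess T u u₀) 0 σ
    rw [zero_add] at this
    rw [← this]
    congr 1; ext z
    rw [add_zero, ← sub_eq_add_neg, mul_comm]

/-- The weak inequality, tested with the time average `t ↦ ∫_s^{s+δ} Ψ(t + σ, x) dσ`, whose time
derivative is the difference `Ψ(t + s + δ, x) - Ψ(t + s, x)`. -/
lemma lag_le (D : ExtendedSubsolution k T a b u Du Q u₀) (H : IsKernelPair k l) (hT : 0 < T)
    (h1 : a < a') (h2 : a' ≤ b') (h3 : b' < b) (h : SpaceTest T a b a' b' Ψ G) {s δ : ℝ}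
    (hs : 0 ≤ s) (hδ : 0 ≤ δ) :
    (∫ σ, ext T k σ * lag Ψ (excess T u u₀) (s + σ)) + ∫ x in s..(s + δ), lag G Q x
      ≤ ∫ σ, ext T k σ * lag Ψ (excess T u u₀) (s + δ + σ) := by
  have hs' := h.timeShift hs
  obtain ⟨i1, p1⟩ := D.pairing_timeConv H hs'
  obtain ⟨i2, p2⟩ := D.pairing_timeConv H (hs'.timeShift hδ)
  have hw := D.weak _ _ _ (hs'.isTestFunction_average hT h1 h2 h3 hδ)
  have l1 : ∀ σ, lag (fun z => Ψ (z.1 + s, z.2)) (excess T u u₀) σ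
      = lag Ψ (excess T u u₀) (s + σ) := lag_timeShift Ψ _ s
  have l2 : ∀ σ, lag (fun z => Ψ (z.1 + δ + s, z.2)) (excess T u u₀) σ
      = lag Ψ (excess T u u₀) (s + δ + σ) := fun σ => by
    rw [lag_timeShift (fun z => Ψ (z.1 + s, z.2)) _ δ, l1, add_assoc]
  simp only [l1] at p1
  simp only [l2] at p2
  have hint := integrable_weighted_shift hs'.meas_deriv D.meas_flux hs'.memLp_deriv D.memLp_flux
    (c := (Ioc 0 δ).indicator 1) ((integrable_indicator_iff measurableSet_Ioc).2
      (integrableOn_const (by simp))) measurable_id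
  have hmeas : MeasurableSet (Ioo 0 T ×ˢ Ioo a b : Set (ℝ × ℝ)) :=
    measurableSet_Ioo.prod measurableSet_Ioo
  have eQ : ∀ z : ℝ × ℝ, Q z * ∫ τ in z.1..(z.1 + δ), G (τ + s, z.2)
      = ∫ x, (Ioc 0 δ).indicator 1 x * (G (z.1 + id x + s, z.2) * Q z) := fun z => by
    rw [integral_time_eq (F := fun y => G (y.1 + s, y.2)) hδ z]
    simp only [← mul_assoc, integral_mul_const, id]
    rw [mul_comm]
  have i3 : Integrable fun z : ℝ × ℝ => Q z * ∫ τ in z.1..(z.1 + δ), G (τ + s, z.2) := by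
    rw [funext eQ]
    exact hint.integral_prod_right
  have p3 : ∫ z in Ioo 0 T ×ˢ Ioo a b, Q z * ∫ τ in z.1..(z.1 + δ), G (τ + s, z.2)
      = ∫ x in s..(s + δ), lag G Q x := by
    rw [setIntegral_eq_integral_of_forall_compl_eq_zero fun z hz => by
      rw [D.zero_flux z hz, zero_mul], funext eQ,
      ← integral_integral_swap (f := fun x z =>
        (Ioc 0 δ).indicator 1 x * (G (z.1 + id x + s, z.2) * Q z)) hint]
    simp only [integral_const_mul]
    have e1 : ∀ x, ∫ z : ℝ × ℝ, G (z.1 + id x + s, z.2) * Q z = lag G Q (s + x) := fun x => by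
      rw [lag]; congr 1; ext z; congr 3; simp only [id]; ring
    simp only [e1]
    have e2 := intervalIntegral.integral_comp_add_left (a := 0) (b := δ) (fun x => lag G Q x) s
    rw [add_zero] at e2
    rw [← e2, intervalIntegral.integral_of_le hδ, ← integral_indicator measurableSet_Ioc]
    congr 1; ext x
    by_cases hx : x ∈ Ioc 0 δ <;> simp [hx]
  rw [cyl] at hw
  have esplit : ∀ z : ℝ × ℝ, -(Ψ (z.1 + δ + s, z.2) - Ψ (z.1 + s, z.2))
        * timeConv k (fun y => u y - u₀ y.2) z + Q z * ∫ τ in z.1..(z.1 + δ), G (τ + s, z.2)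
      = Ψ (z.1 + s, z.2) * timeConv k (fun y => u y - u₀ y.2) z
        - Ψ (z.1 + δ + s, z.2) * timeConv k (fun y => u y - u₀ y.2) z
        + Q z * ∫ τ in z.1..(z.1 + δ), G (τ + s, z.2) := fun z => by ring
  simp only [esplit] at hw
  have i12 : IntegrableOn (fun z : ℝ × ℝ =>
      Ψ (z.1 + s, z.2) * timeConv k (fun y => u y - u₀ y.2) z
        - Ψ (z.1 + δ + s, z.2) * timeConv k (fun y => u y - u₀ y.2) z) (Ioo 0 T ×ˢ Ioo a b) :=
    i1.sub i2
  rw [integral_add i12 i3.integrableOn, integral_sub i1 i2, p1, p2, p3] at hw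
  linarith

/-- The weak inequality for the regularized kernel `k(· + ε)`. In terms of `Ψ` it reads
`∫ Ψ ∂ₜ(k(· + ε) * (u - u₀)) + ∫ G (h * Q) ≤ 0`, with the time derivative carried out. -/
lemma resolvent_inequality (D : ExtendedSubsolution k T a b u Du Q u₀) (H : IsKernelPair k l)
    (hT : 0 < T) (h1 : a < a') (h2 : a' ≤ b') (h3 : b' < b) (h : SpaceTest T a b a' b' Ψ G)
    {ε : ℝ} (hε : 0 < ε) :
    k ε * lag Ψ (excess T u u₀) 0 - (∫ σ, shiftedDeriv k T ε σ * lag Ψ (excess T u u₀) σ)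
      + ∫ s in Ioo 0 T, resolventKernel k l T ε s * lag G Q s ≤ 0 := by
  refine H.resolvent_inequality hT hε (continuous_lag h.memLp D.memLp_excess)
    (abs_lag_le h.memLp D.memLp_excess) (fun s hs => ?_)
    (continuous_lag h.memLp_deriv D.memLp_flux) (abs_lag_le h.memLp_deriv D.memLp_flux)
    fun s δ hs hδ => D.lag_le H hT h1 h2 h3 h hs hδ
  rw [lag, integral_eq_zero_of_ae]
  refine ae_of_all _ fun z => ?_
  show Ψ (z.1 + s, z.2) * excess T u u₀ z = 0
  by_cases hz : 0 < z.1
  · rw [h.zero _ (Or.inl (by show T ≤ z.1 + s; linarith)), zero_mul]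
  · rw [D.excess_eq_zero fun h => hz h.1.1, mul_zero]

end ExtendedSubsolution

/-! ### Truncations, cutoffs and the memory of the past -/

/-- A cutoff function in space, supported in `(a', b')`, with slope at most `K`. -/
structure IsCutoff (a' b' K : ℝ) (ζ : ℝ → ℝ) : Prop where
  contDiff : ContDiff ℝ 1 ζ
  nonneg : ∀ x, 0 ≤ ζ x
  le_one : ∀ x, ζ x ≤ 1
  zero : ∀ x, x ∉ Ioo a' b' → ζ x = 0
  abs_deriv_le : ∀ x, |deriv ζ x| ≤ K

/-- The truncation `(u - lam)₊`. -/
def truncation (lam : ℝ) (u : ℝ × ℝ → ℝ) (z : ℝ × ℝ) : ℝ := max (u z - lam) 0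

/-- The spatial derivative of the truncation `(u - lam)₊`. -/
def truncationDeriv (lam : ℝ) (u Du : ℝ × ℝ → ℝ) (z : ℝ × ℝ) : ℝ :=
  if lam < u z then Du z else 0

/-- The contribution of the times before `t₁` and of the initial value to the equation at the
point `z`. It has values in `[0,∞]`, so that no integrability has to be checked. -/
def memory (k : ℝ → ℝ) (t₁ : ℝ) (u : ℝ × ℝ → ℝ) (u₀ : ℝ → ℝ) (z : ℝ × ℝ) : ℝ≥0∞ :=
  (∫⁻ τ in Ioo 0 t₁, ENNReal.ofReal (-kdot k (z.1 - τ)) * ENNReal.ofReal (u (τ, z.2)))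
    + ENNReal.ofReal (k z.1) * ENNReal.ofReal (u₀ z.2)

lemma truncation_nonneg (lam : ℝ) (u : ℝ × ℝ → ℝ) (z : ℝ × ℝ) : 0 ≤ truncation lam u z :=
  le_max_right _ _

lemma truncation_le {lam : ℝ} (hlam : 0 ≤ lam) {u : ℝ × ℝ → ℝ} {z : ℝ × ℝ} (hu : 0 ≤ u z) :
    truncation lam u z ≤ u z := max_le (by linarith) hu

/-- Convexity of the square of the truncation, in the form needed for the memory term. -/
lemma truncation_mul_le (lam p q : ℝ) :
    max (p - lam) 0 * q
      ≤ max (p - lam) 0 * p - max (p - lam) 0 ^ 2 / 2 + max (q - lam) 0 ^ 2 / 2 := by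
  rcases le_total p lam with h | h
  · rw [max_eq_right (by linarith : p - lam ≤ 0)]
    have := sq_nonneg (max (q - lam) 0)
    linarith
  · have h2 : max (p - lam) 0 = p - lam := max_eq_left (by linarith)
    have h1 : q ≤ lam + max (q - lam) 0 := by linarith [le_max_left (q - lam) 0]
    rw [h2]
    nlinarith [sq_nonneg (p - lam - max (q - lam) 0),
      mul_le_mul_of_nonneg_left h1 (by linarith : 0 ≤ p - lam)]

lemma measurable_lag {f g : ℝ × ℝ → ℝ} (hf : Measurable f) (hg : Measurable g) :
    Measurable (lag f g) := by
  have : Measurable fun q : ℝ × (ℝ × ℝ) => f (q.2.1 + q.1, q.2.2) * g q.2 :=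
    (hf.comp (by fun_prop)).mul (hg.comp measurable_snd)
  exact this.stronglyMeasurable.integral_prod_right'.measurable

/-- Fubini's theorem for a weighted integral of correlations. -/
lemma integral_mul_lag {f g : ℝ × ℝ → ℝ} (hfm : Measurable f) (hgm : Measurable g)
    (hf : MemLp f 2 volume) (hg : MemLp g 2 volume) {c : ℝ → ℝ} (hc : Integrable c) :
    Integrable (fun z : ℝ × ℝ => f z * ∫ s, c s * g (z.1 - s, z.2)) ∧
    ∫ s, c s * lag f g s = ∫ z : ℝ × ℝ, f z * ∫ s, c s * g (z.1 - s, z.2) := by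
  have hint := integrable_weighted_shift hgm hfm hg hf hc measurable_neg
  have e : ∀ z : ℝ × ℝ, f z * ∫ s, c s * g (z.1 - s, z.2)
      = ∫ σ, c σ * (g (z.1 + -σ, z.2) * f z) := fun z => by
    simp only [← mul_assoc, integral_mul_const]
    simp only [← sub_eq_add_neg]
    rw [mul_comm]
  constructor
  · rw [funext e]
    exact hint.integral_prod_right
  · rw [funext e, ← integral_integral_swap
      (f := fun σ (z : ℝ × ℝ) => c σ * (g (z.1 + -σ, z.2) * f z)) hint]
    congr 1; ext σ
    rw [integral_const_mul]
    congr 1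
    have := integral_shift_mul_shift f g 0 σ
    rw [zero_add] at this
    rw [← this]
    congr 1; ext z
    rw [add_zero, ← sub_eq_add_neg, mul_comm]

lemma integral_add_add_sub {α : Type*} [MeasurableSpace α] {μ : Measure α} {f₁ f₂ f₃ f₄ : α → ℝ}
    (h₁ : Integrable f₁ μ) (h₂ : Integrable f₂ μ) (h₃ : Integrable f₃ μ) (h₄ : Integrable f₄ μ) :
    Integrable (fun x => f₁ x + f₂ x + f₃ x - f₄ x) μ ∧
    ∫ x, (f₁ x + f₂ x + f₃ x - f₄ x) ∂μ
      = (∫ x, f₁ x ∂μ) + (∫ x, f₂ x ∂μ) + (∫ x, f₃ x ∂μ) - ∫ x, f₄ x ∂μ := by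
  have h12 : Integrable (fun x => f₁ x + f₂ x) μ := h₁.add h₂
  have h123 : Integrable (fun x => f₁ x + f₂ x + f₃ x) μ := h12.add h₃
  exact ⟨h123.sub h₄, by rw [integral_sub h123 h₄, integral_add h12 h₃, integral_add h₁ h₂]⟩

lemma IsKernelPair.integral_shiftedDeriv_le {k l : ℝ → ℝ} (H : IsKernelPair k l) {T ε : ℝ}
    (hT : 0 < T) (hε : 0 < ε) : ∫ σ, shiftedDeriv k T ε σ ≤ k ε := by
  have h1 := H.integral_shiftedDeriv_Iio hε hT.le le_rfl
  have h2 : ∀ x, x ∉ Iio T → shiftedDeriv k T ε x = 0 := fun x hx =>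
    ext_of_notMem fun h => hx h.2
  rw [setIntegral_eq_integral_of_forall_compl_eq_zero h2] at h1
  rw [h1]
  linarith [H.nonneg_k (T + ε) (by linarith)]

namespace ExtendedSubsolution

variable {k l : ℝ → ℝ} {T a b a' b' K lam : ℝ} {u Du Q : ℝ × ℝ → ℝ} {u₀ ζ φ : ℝ → ℝ}

lemma measurable_truncation (D : ExtendedSubsolution k T a b u Du Q u₀) (lam : ℝ) :
    Measurable (truncation lam u) := (D.meas.sub_const lam).max measurable_const

lemma measurable_truncationDeriv (D : ExtendedSubsolution k T a b u Du Q u₀) (lam : ℝ) :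
    Measurable (truncationDeriv lam u Du) :=
  Measurable.ite (measurableSet_lt measurable_const D.meas) D.meas_deriv measurable_const

lemma memLp_truncation (D : ExtendedSubsolution k T a b u Du Q u₀) (hlam : 0 ≤ lam) :
    MemLp (truncation lam u) 2 volume :=
  D.memLp.mono (D.measurable_truncation lam).aestronglyMeasurable (ae_of_all _ fun z => by
    rw [Real.norm_of_nonneg (truncation_nonneg _ _ _), Real.norm_of_nonneg (D.nonneg z)]
    exact truncation_le hlam (D.nonneg z))

lemma memLp_truncationDeriv (D : ExtendedSubsolution k T a b u Du Q u₀) (lam : ℝ) :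
    MemLp (truncationDeriv lam u Du) 2 volume :=
  D.memLp_deriv.mono (D.measurable_truncationDeriv lam).aestronglyMeasurable
    (ae_of_all _ fun z => by
      rw [truncationDeriv]; split_ifs
      · exact le_rfl
      · simp)

lemma truncation_eq_zero (D : ExtendedSubsolution k T a b u Du Q u₀) (hlam : 0 ≤ lam) {z : ℝ × ℝ}
    (hz : z ∉ Ioo 0 T ×ˢ Ioo a b) : truncation lam u z = 0 := by
  rw [truncation, D.zero z hz, max_eq_right (by linarith)]

/-- The weighted truncation as a test function. -/
lemma spaceTest (D : ExtendedSubsolution k T a b u Du Q u₀) (hζ : IsCutoff a' b' K ζ)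
    (h1 : a < a') (h2 : a' ≤ b') (h3 : b' < b) (hlam : 0 ≤ lam) (hφm : Measurable φ)
    (hφ0 : ∀ t, 0 ≤ φ t) {C : ℝ} (hφC : ∀ t, φ t ≤ C) (hφ : ∀ t, t ≤ 0 → φ t = 0)
    (hφT : ∀ t, T ≤ t → φ t = 0) :
    SpaceTest T a b a' b' (fun z => φ z.1 * (ζ z.2 ^ 2 * truncation lam u z))
      (fun z => φ z.1 * (2 * ζ z.2 * deriv ζ z.2 * truncation lam u z
        + ζ z.2 ^ 2 * truncationDeriv lam u Du z)) := by
  have hab : a < b := h1.trans_le (h2.trans h3.le)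
  have hζm : Measurable ζ := hζ.contDiff.continuous.measurable
  have hw := D.measurable_truncation lam
  have hp := D.measurable_truncationDeriv lam
  have hζd : Measurable (deriv ζ) := measurable_deriv ζ
  have hG : Measurable fun z : ℝ × ℝ => φ z.1 * (2 * ζ z.2 * deriv ζ z.2 * truncation lam u z
        + ζ z.2 ^ 2 * truncationDeriv lam u Du z) :=
    (hφm.comp measurable_fst).mul ((((hζm.comp measurable_snd).const_mul 2 |>.mul
      (hζd.comp measurable_snd)).mul hw).add (((hζm.comp measurable_snd).pow_const 2).mul hp))
  have hΨ : Measurable fun z : ℝ × ℝ => φ z.1 * (ζ z.2 ^ 2 * truncation lam u z) :=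
    (hφm.comp measurable_fst).mul (((hζm.comp measurable_snd).pow_const 2).mul hw)
  have hK : 0 ≤ K := (abs_nonneg _).trans (hζ.abs_deriv_le 0)
  have hz1 : ∀ x, ζ x ^ 2 ≤ 1 := fun x => pow_le_one₀ (hζ.nonneg x) (hζ.le_one x)
  have hbd : ∀ (c : ℝ) (f : ℝ → ℝ), Measurable f → (∀ x, |f x| ≤ c) → ∀ v : ℝ × ℝ → ℝ,
      MemLp v 2 volume → MemLp (fun z : ℝ × ℝ => φ z.1 * (f z.2 * v z)) 2 volume := by
    intro c f hf hfc v hv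
    refine (hv.const_mul (C * c)).mono ?_ (ae_of_all _ fun z => ?_)
    · exact (hφm.comp measurable_fst).aestronglyMeasurable.mul
        ((hf.comp measurable_snd).aestronglyMeasurable.mul hv.1)
    · have hC : 0 ≤ C := (hφ0 0).trans (hφC 0)
      have hc : 0 ≤ c := (abs_nonneg _).trans (hfc 0)
      rw [norm_mul, norm_mul, norm_mul, Real.norm_of_nonneg (mul_nonneg hC hc),
        Real.norm_of_nonneg (hφ0 _), mul_assoc]
      exact mul_le_mul (hφC _) (mul_le_mul_of_nonneg_right (hfc _) (norm_nonneg _))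
        (by positivity) hC
  refine ⟨hΨ, hG, ?_, ?_, fun z hz => ?_, fun z hz => ?_, fun z => ?_, ?_⟩
  · refine hbd 1 (fun x => ζ x ^ 2) (hζm.pow_const 2) (fun x => ?_) _ (D.memLp_truncation hlam)
    rw [abs_of_nonneg (sq_nonneg _)]
    exact hz1 x
  · have e1 := hbd (2 * K) (fun x => 2 * ζ x * deriv ζ x) ((hζm.const_mul 2).mul hζd) (fun x => by
      rw [abs_mul, abs_mul, abs_of_nonneg (hζ.nonneg x), abs_two]
      exact mul_le_mul (by linarith [hζ.le_one x]) (hζ.abs_deriv_le x) (abs_nonneg _)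
        (by norm_num)) _ (D.memLp_truncation hlam)
    have e2 := hbd 1 (fun x => ζ x ^ 2) (hζm.pow_const 2) (fun x => by
      rw [abs_of_nonneg (sq_nonneg _)]; exact hz1 x) _ (D.memLp_truncationDeriv lam)
    refine (e1.add e2).ae_eq (ae_of_all _ fun z => ?_)
    simp only [Pi.add_apply]; ring
  · rcases hz with hz | hz
    · rw [hφT _ hz, zero_mul]
    · rw [hζ.zero _ fun h => hz (Ioo_subset_Icc_self h)]; ring
  · rcases hz with hz | hz
    · rw [hφT _ hz, zero_mul]
    · rw [hζ.zero _ fun h => hz (Ioo_subset_Icc_self h)]; ring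
  · exact mul_nonneg (hφ0 _) (mul_nonneg (sq_nonneg _) (truncation_nonneg _ _ _))
  · have hI : Measurable fun z : ℝ × ℝ => ∫ y in a..z.2, φ z.1 *
        (2 * ζ y * deriv ζ y * truncation lam u (z.1, y)
          + ζ y ^ 2 * truncationDeriv lam u Du (z.1, y)) := by
      have key : ∀ S : Set (ℝ × ℝ), MeasurableSet S → Measurable fun z : ℝ × ℝ =>
          ∫ y, S.indicator (fun _ => φ z.1 * (2 * ζ y * deriv ζ y * truncation lam u (z.1, y)
          + ζ y ^ 2 * truncationDeriv lam u Du (z.1, y))) (z.2, y) := by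
        intro S hS
        have : Measurable fun q : (ℝ × ℝ) × ℝ => S.indicator (fun _ => (1 : ℝ)) (q.1.2, q.2) *
            (φ q.1.1 * (2 * ζ q.2 * deriv ζ q.2 * truncation lam u (q.1.1, q.2)
          + ζ q.2 ^ 2 * truncationDeriv lam u Du (q.1.1, q.2))) :=
          ((measurable_const.indicator hS).comp (by fun_prop)).mul
            (hG.comp (g := fun z : ℝ × ℝ => φ z.1 * (2 * ζ z.2 * deriv ζ z.2 * truncation lam u z
        + ζ z.2 ^ 2 * truncationDeriv lam u Du z)) (f := fun q : (ℝ × ℝ) × ℝ => (q.1.1, q.2))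
              (by fun_prop))
        have e := (this.stronglyMeasurable.integral_prod_right' (ν := volume)).measurable
        convert e using 3 with z
        funext y
        by_cases h : ((z.2, y) : ℝ × ℝ) ∈ S <;> simp [h]
      have e : ∀ z : ℝ × ℝ, ∫ y in a..z.2, φ z.1 *
          (2 * ζ y * deriv ζ y * truncation lam u (z.1, y)
          + ζ y ^ 2 * truncationDeriv lam u Du (z.1, y))
          = (∫ y, {q : ℝ × ℝ | a < q.2 ∧ q.2 ≤ q.1}.indicator (fun _ => φ z.1 *
            (2 * ζ y * deriv ζ y * truncation lam u (z.1, y)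
          + ζ y ^ 2 * truncationDeriv lam u Du (z.1, y))) (z.2, y))
            - ∫ y, {q : ℝ × ℝ | q.1 < q.2 ∧ q.2 ≤ a}.indicator (fun _ => φ z.1 *
            (2 * ζ y * deriv ζ y * truncation lam u (z.1, y)
          + ζ y ^ 2 * truncationDeriv lam u Du (z.1, y))) (z.2, y) := fun z => by
        rw [intervalIntegral, ← integral_indicator measurableSet_Ioc,
          ← integral_indicator measurableSet_Ioc]
        rfl
      rw [funext e]
      exact (key _ ((measurableSet_lt measurable_const measurable_snd).inter
        (measurableSet_le measurable_snd measurable_fst))).sub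
        (key _ ((measurableSet_lt measurable_fst measurable_snd).inter
        (measurableSet_le measurable_snd measurable_const)))
    rw [Measure.volume_eq_prod]
    refine (Measure.ae_prod_iff_ae_ae ?_).2 ?_
    · have hS : MeasurableSet {z : ℝ × ℝ | z.2 ∈ Ioo a b} := measurable_snd measurableSet_Ioo
      exact hS.imp (measurableSet_eq_fun hΨ hI)
    · filter_upwards [D.slice] with t ht
      by_cases hT : t ∈ Ioo 0 T
      · have hs := (ht hT).mul_posPart hab lam (hζ.contDiff.pow 2)
          (by rw [hζ.zero a fun h => by linarith [h.1]]; norm_num)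
        rw [ae_restrict_iff' measurableSet_Ioo] at hs
        filter_upwards [hs] with x hx hxm
        simp only [truncation, truncationDeriv]
        rw [hx hxm, ← intervalIntegral.integral_const_mul]
        refine intervalIntegral.integral_congr fun y _ => ?_
        have hd : deriv (fun x => ζ x ^ 2) y = 2 * ζ y * deriv ζ y := by
          rw [deriv_fun_pow ((hζ.contDiff.differentiable (by norm_num)) y)]
          norm_num
        simp only [hd]
      · have : φ t = 0 := by
          by_cases h : t ≤ 0
          · exact hφ t h
          · exact hφT t (not_lt.1 fun h' => hT ⟨not_le.1 h, h'⟩)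
        refine ae_of_all _ fun x _ => ?_
        simp only [this, zero_mul, intervalIntegral.integral_zero]

/-- The terms that involve the past, uniformly in the regularization parameter `ε`: they are
bounded by the memory, since `k(· + ε) ≤ k` and `-k̇(· + ε) ≤ -k̇`. -/
lemma past_le (D : ExtendedSubsolution k T a b u Du Q u₀) (H : IsKernelPair k l) {ε t₁ : ℝ}
    (hε : 0 < ε) {Ψ : ℝ × ℝ → ℝ} (hΨm : Measurable Ψ)
    (hΨ : MemLp Ψ 2 volume) (hΨ0 : ∀ z, 0 ≤ Ψ z) (hΨs : ∀ z : ℝ × ℝ, z.1 ∉ Ioo 0 T → Ψ z = 0)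
    {X : ℝ} (hX : 0 ≤ X)
    (hXM : ∫⁻ z, ENNReal.ofReal (Ψ z) * memory k t₁ u u₀ z ≤ ENNReal.ofReal X) :
    k ε * lag Ψ (fun z => (Ioo 0 T).indicator 1 z.1 * u₀ z.2) 0
      - (∫ s, shiftedDeriv k T ε s * lag Ψ (fun z => (Ioo 0 T).indicator 1 z.1 * u₀ z.2) s)
      + (∫ s, shiftedDeriv k T ε s * lag Ψ (fun z => if z.1 < t₁ then u z else 0) s) ≤ X := by
  have him : Measurable fun z : ℝ × ℝ => (Ioo 0 T).indicator (1 : ℝ → ℝ) z.1 * u₀ z.2 :=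
    ((measurable_one.indicator measurableSet_Ioo).comp measurable_fst).mul
      (D.meas_init.comp measurable_snd)
  have hvm : Measurable fun z : ℝ × ℝ => if z.1 < t₁ then u z else 0 :=
    Measurable.ite (measurableSet_lt measurable_fst measurable_const) D.meas measurable_const
  have hv : MemLp (fun z : ℝ × ℝ => if z.1 < t₁ then u z else 0) 2 volume :=
    D.memLp.mono hvm.aestronglyMeasurable (ae_of_all _ fun z => by
      split_ifs
      · exact le_rfl
      · simp)
  have hc := H.integrable_shiftedDeriv (T := T) hε
  obtain ⟨i1, e1⟩ := integral_mul_lag hΨm him hΨ D.memLp_init_ext hc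
  obtain ⟨i2, e2⟩ := integral_mul_lag hΨm hvm hΨ hv hc
  have i0 : Integrable fun z : ℝ × ℝ => Ψ z * ((Ioo 0 T).indicator 1 z.1 * u₀ z.2) :=
    hΨ.integrable_mul D.memLp_init_ext
  have i3 : Integrable fun z : ℝ × ℝ => k ε * (Ψ z * ((Ioo 0 T).indicator 1 z.1 * u₀ z.2))
      - Ψ z * ∫ s, shiftedDeriv k T ε s * ((Ioo 0 T).indicator 1 (z.1 - s) * u₀ z.2) :=
    (i0.const_mul _).sub i1
  rw [e1, e2, show lag Ψ (fun z => (Ioo 0 T).indicator 1 z.1 * u₀ z.2) 0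
    = ∫ z : ℝ × ℝ, Ψ z * ((Ioo 0 T).indicator 1 z.1 * u₀ z.2) from by simp [lag],
    ← integral_const_mul, ← integral_sub (i0.const_mul _) i1,
    ← integral_add i3 i2]
  have hpt : ∀ z : ℝ × ℝ, k ε * (Ψ z * ((Ioo 0 T).indicator 1 z.1 * u₀ z.2))
      - Ψ z * (∫ s, shiftedDeriv k T ε s * ((Ioo 0 T).indicator 1 (z.1 - s) * u₀ z.2))
      = Ψ z * (k (z.1 + ε) * u₀ z.2) := by
    intro z
    by_cases hz : z.1 ∈ Ioo 0 T
    · have e3 : ∫ s, shiftedDeriv k T ε s * ((Ioo 0 T).indicator 1 (z.1 - s) * u₀ z.2)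
          = (k ε - k (z.1 + ε)) * u₀ z.2 := by
        simp only [← mul_assoc, integral_mul_const]
        rw [← H.integral_shiftedDeriv_Iio hε hz.1.le hz.2.le, ← integral_indicator measurableSet_Iio]
        congr 2; ext s
        by_cases hs : s ∈ Ioo 0 T
        · by_cases hsz : s < z.1
          · rw [indicator_of_mem (show s ∈ Iio z.1 from hsz),
              indicator_of_mem (show z.1 - s ∈ Ioo 0 T from
                ⟨by linarith, by linarith [hs.1, hz.2]⟩)]
            simp
          · rw [indicator_of_notMem (show s ∉ Iio z.1 from hsz),
              indicator_of_notMem (fun h : z.1 - s ∈ Ioo 0 T => hsz (by linarith [h.1])), mul_zero]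
        · simp [shiftedDeriv, ext_of_notMem hs, indicator]
      rw [e3, indicator_of_mem hz, Pi.one_apply]; ring
    · rw [hΨs z hz]; ring
  simp only [hpt, ← mul_add]
  have hkd : ∀ z : ℝ × ℝ, z.1 ∈ Ioo 0 T → 0 ≤ k (z.1 + ε) * u₀ z.2 := fun z hz =>
    mul_nonneg (H.nonneg_k _ (by linarith [hz.1])) (D.nonneg_init _)
  have hvn : ∀ z : ℝ × ℝ, 0 ≤ if z.1 < t₁ then u z else 0 := fun z => by
    split_ifs
    · exact D.nonneg z
    · exact le_rfl
  have hin : ∀ z : ℝ × ℝ, 0 ≤ ∫ s, shiftedDeriv k T ε s *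
      (if z.1 - s < t₁ then u (z.1 - s, z.2) else 0) := fun z =>
    integral_nonneg fun s => mul_nonneg (H.shiftedDeriv_nonneg hε s) (hvn (z.1 - s, z.2))
  have hnn : ∀ z : ℝ × ℝ, 0 ≤ Ψ z * (k (z.1 + ε) * u₀ z.2 + ∫ s, shiftedDeriv k T ε s *
      (if z.1 - s < t₁ then u (z.1 - s, z.2) else 0)) := fun z => by
    by_cases hz : z.1 ∈ Ioo 0 T
    · exact mul_nonneg (hΨ0 z) (add_nonneg (hkd z hz) (hin z))
    · rw [hΨs z hz, zero_mul]
  have hmeas : AEStronglyMeasurable (fun z : ℝ × ℝ => Ψ z * (k (z.1 + ε) * u₀ z.2 +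
      ∫ s, shiftedDeriv k T ε s * (if z.1 - s < t₁ then u (z.1 - s, z.2) else 0))) volume := by
    refine (i3.add i2).aestronglyMeasurable.congr
      (ae_of_all _ fun z => ?_)
    simp only [Pi.add_apply, hpt z, mul_add]
  rw [integral_eq_lintegral_of_nonneg_ae (ae_of_all _ hnn) hmeas]
  refine ENNReal.toReal_le_of_le_ofReal hX (le_trans (lintegral_mono fun z => ?_) hXM)
  rw [ENNReal.ofReal_mul (hΨ0 z)]
  by_cases hz : z.1 ∈ Ioo 0 T
  swap; · rw [hΨs z hz]; simp
  gcongr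
  rw [ENNReal.ofReal_add (hkd z hz) (hin z), memory, add_comm]
  refine add_le_add ?_ ?_
  · have hsm : Measurable fun s => shiftedDeriv k T ε s *
        (if z.1 - s < t₁ then u (z.1 - s, z.2) else 0) :=
      (IsKernelPair.measurable_shiftedDeriv k T ε).mul
        (hvm.comp (g := fun z : ℝ × ℝ => if z.1 < t₁ then u z else 0)
          (f := fun s => (z.1 - s, z.2)) (by fun_prop))
    rw [integral_eq_lintegral_of_nonneg_ae (ae_of_all _ fun s =>
      mul_nonneg (H.shiftedDeriv_nonneg hε s) (hvn (z.1 - s, z.2))) hsm.aestronglyMeasurable]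
    refine ENNReal.ofReal_toReal_le.trans ?_
    rw [← lintegral_sub_left_eq_self _ z.1, ← lintegral_indicator measurableSet_Ioo]
    refine lintegral_mono fun τ => ?_
    simp only [sub_sub_cancel]
    by_cases hτ : τ ∈ Ioo 0 t₁
    · rw [indicator_of_mem hτ, if_pos hτ.2, ENNReal.ofReal_mul (H.shiftedDeriv_nonneg hε _)]
      refine mul_le_mul' ?_ le_rfl
      by_cases hs : z.1 - τ ∈ Ioo 0 T
      · rw [shiftedDeriv, ext_of_mem hs]
        exact ENNReal.ofReal_le_ofReal (neg_le_neg (H.monotoneOn_kdot hs.1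
          (show (0 : ℝ) < z.1 - τ + ε by linarith [hs.1]) (by linarith)))
      · rw [shiftedDeriv, ext_of_notMem hs, ENNReal.ofReal_zero]
        exact zero_le
    · rw [indicator_of_notMem hτ]
      split_ifs with h
      · rw [D.zero _ fun h' => hτ ⟨h'.1.1, h⟩]; simp
      · simp
  · rw [← ENNReal.ofReal_mul (H.nonneg_k _ hz.1)]
    refine ENNReal.ofReal_le_ofReal (mul_le_mul_of_nonneg_right ?_ (D.nonneg_init _))
    exact H.antitone_k hz.1 (show (0:ℝ) < _ by linarith [hz.1]) (by linarith)

/-- The energy inequality for the regularized kernel and a general weight `φ` in time, tested with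
`φ ζ² (u - lam)₊`. Before the base time `t₁` the function `u` enters only through the memory. -/
lemma regularized_energy (D : ExtendedSubsolution k T a b u Du Q u₀) (H : IsKernelPair k l)
    (hT : 0 < T) (hζ : IsCutoff a' b' K ζ) (h1 : a < a') (h2 : a' ≤ b') (h3 : b' < b)
    (hlam : 0 ≤ lam) (hφm : Measurable φ) (hφ0 : ∀ t, 0 ≤ φ t) {C : ℝ} (hφC : ∀ t, φ t ≤ C)
    {t₁ : ℝ} (ht₁ : 0 ≤ t₁) (hφ : ∀ t, t ≤ t₁ → φ t = 0) (hφT : ∀ t, T ≤ t → φ t = 0) {ε : ℝ}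
    (hε : 0 < ε) {X : ℝ} (hX : 0 ≤ X)
    (hXM : ∫⁻ z : ℝ × ℝ, ENNReal.ofReal (φ z.1 * (ζ z.2 ^ 2 * truncation lam u z))
      * memory k t₁ u u₀ z ≤ ENNReal.ofReal X) :
    k ε * lag (fun z => φ z.1)
        (fun z => if t₁ ≤ z.1 then ζ z.2 ^ 2 * truncation lam u z ^ 2 / 2 else 0) 0
      - (∫ s, shiftedDeriv k T ε s * lag (fun z => φ z.1)
        (fun z => if t₁ ≤ z.1 then ζ z.2 ^ 2 * truncation lam u z ^ 2 / 2 else 0) s)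
      + (∫ s in Ioo 0 T, resolventKernel k l T ε s *
        lag (fun z => φ z.1 * (2 * ζ z.2 * deriv ζ z.2 * truncation lam u z
          + ζ z.2 ^ 2 * truncationDeriv lam u Du z)) Q s) ≤ X := by
  have hst := D.spaceTest hζ h1 h2 h3 hlam hφm hφ0 hφC (fun t ht => hφ t (ht.trans ht₁)) hφT
  have hres := D.resolvent_inequality H hT h1 h2 h3 hst hε
  set Ψ : ℝ × ℝ → ℝ := fun z => φ z.1 * (ζ z.2 ^ 2 * truncation lam u z) with hΨdef
  set hh : ℝ × ℝ → ℝ :=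
    fun z => if t₁ ≤ z.1 then ζ z.2 ^ 2 * truncation lam u z ^ 2 / 2 else 0 with hhdef
  set init : ℝ × ℝ → ℝ := fun z => (Ioo 0 T).indicator 1 z.1 * u₀ z.2 with hinit
  set v : ℝ × ℝ → ℝ := fun z => if z.1 < t₁ then u z else 0 with hvdef
  have hpast := D.past_le (T := T) (t₁ := t₁) H hε hst.meas hst.memLp hst.nonneg
    (fun z hz => by
      rcases not_and_or.1 hz with hz | hz
      · show φ z.1 * _ = 0
        rw [hφ _ ((not_lt.1 hz).trans ht₁), zero_mul]
      · exact hst.zero z (Or.inl (not_lt.1 hz))) hX hXM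
  have hζm : Measurable ζ := hζ.contDiff.continuous.measurable
  have hwm := D.measurable_truncation lam
  have hw := D.memLp_truncation hlam
  have hwi : Integrable fun z : ℝ × ℝ => ζ z.2 ^ 2 * truncation lam u z ^ 2 / 2 := by
    refine (hw.integrable_sq.bdd_mul (c := 1)
      ((hζm.comp measurable_snd).pow_const 2).aestronglyMeasurable
      (ae_of_all _ fun z => ?_)).div_const 2
    rw [Real.norm_of_nonneg (sq_nonneg _)]
    exact pow_le_one₀ (hζ.nonneg _) (hζ.le_one _)
  have hhm : Measurable hh := Measurable.ite (measurableSet_le measurable_const measurable_fst)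
    ((((hζm.comp measurable_snd).pow_const 2).mul (hwm.pow_const 2)).div_const 2) measurable_const
  have hw0 : ∀ z : ℝ × ℝ, 0 ≤ ζ z.2 ^ 2 * truncation lam u z ^ 2 / 2 := fun z => by positivity
  have hh0 : ∀ z, 0 ≤ hh z := fun z => by
    simp only [hhdef]; split_ifs
    · exact hw0 z
    · exact le_rfl
  have hhi : Integrable hh := hwi.mono hhm.aestronglyMeasurable (ae_of_all _ fun z => by
    rw [Real.norm_of_nonneg (hh0 z), Real.norm_of_nonneg (hw0 z)]
    simp only [hhdef]; split_ifs
    · exact le_rfl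
    · exact hw0 z)
  have hvm : Measurable v :=
    Measurable.ite (measurableSet_lt measurable_fst measurable_const) D.meas measurable_const
  have hv : MemLp v 2 volume :=
    D.memLp.mono hvm.aestronglyMeasurable (ae_of_all _ fun z => by
      simp only [hvdef]; split_ifs
      · exact le_rfl
      · simp)
  have him : Measurable init :=
    ((measurable_one.indicator measurableSet_Ioo).comp measurable_fst).mul
      (D.meas_init.comp measurable_snd)
  have hi : MemLp init 2 volume := D.memLp_init_ext
  have hφb : ∀ t, ‖φ t‖ ≤ C := fun t => by rw [Real.norm_of_nonneg (hφ0 t)]; exact hφC t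
  have iu : Integrable fun z => Ψ z * u z := hst.memLp.integrable_mul D.memLp
  have iB : Integrable fun z : ℝ × ℝ => φ z.1 * (ζ z.2 ^ 2 * truncation lam u z ^ 2 / 2) :=
    hwi.bdd_mul (hφm.comp measurable_fst).aestronglyMeasurable (ae_of_all _ fun z => hφb _)
  set B : ℝ := ∫ z : ℝ × ℝ, (Ψ z * u z - φ z.1 * (ζ z.2 ^ 2 * truncation lam u z ^ 2 / 2)) with hB
  have iuB : Integrable fun z : ℝ × ℝ =>
      Ψ z * u z - φ z.1 * (ζ z.2 ^ 2 * truncation lam u z ^ 2 / 2) := iu.sub iB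
  have hB0 : 0 ≤ B := integral_nonneg fun z => by
    have e1 := truncation_nonneg lam u z
    have e2 := truncation_le hlam (D.nonneg z)
    have e3 := mul_nonneg (hφ0 z.1) (sq_nonneg (ζ z.2))
    show 0 ≤ φ z.1 * (ζ z.2 ^ 2 * truncation lam u z) * u z
      - φ z.1 * (ζ z.2 ^ 2 * truncation lam u z ^ 2 / 2)
    have : 0 ≤ φ z.1 * ζ z.2 ^ 2 * (truncation lam u z * (u z - truncation lam u z / 2)) :=
      mul_nonneg e3 (mul_nonneg e1 (by linarith))
    linarith
  have mp : ∀ s : ℝ, MeasurePreserving (fun z : ℝ × ℝ => (z.1 + -s, z.2)) volume volume :=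
    fun s => measurePreserving_timeShift (-s)
  have ish : ∀ {g : ℝ × ℝ → ℝ}, MemLp g 2 volume → ∀ s,
      Integrable (fun z : ℝ × ℝ => Ψ z * g (z.1 - s, z.2)) ∧
      ∫ z : ℝ × ℝ, Ψ z * g (z.1 - s, z.2) = lag Ψ g s := fun {g} hg s => by
    refine ⟨?_, ?_⟩
    · have : Integrable fun z : ℝ × ℝ => Ψ z * g (z.1 + -s, z.2) :=
        hst.memLp.integrable_mul (MemLp.timeShift hg (-s))
      simpa only [← sub_eq_add_neg] using this
    · simpa using integral_shift_mul_shift Ψ g 0 s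
  have isφ : ∀ s, Integrable (fun z : ℝ × ℝ => φ z.1 * hh (z.1 - s, z.2)) ∧
      ∫ z : ℝ × ℝ, φ z.1 * hh (z.1 - s, z.2) = lag (fun z => φ z.1) hh s := fun s => by
    refine ⟨?_, ?_⟩
    · have : Integrable fun z : ℝ × ℝ => hh (z.1 + -s, z.2) :=
        ((mp s).integrable_comp hhm.aestronglyMeasurable).2 hhi
      simp only [← sub_eq_add_neg] at this
      exact this.bdd_mul (hφm.comp measurable_fst).aestronglyMeasurable
        (ae_of_all _ fun z => hφb _)
    · simpa using integral_shift_mul_shift (fun z => φ z.1) hh 0 s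
  have hle : ∀ s, lag Ψ (excess T u u₀) s
      ≤ B + lag (fun z => φ z.1) hh s + lag Ψ v s - lag Ψ init s := fun s => by
    obtain ⟨ci, ce⟩ := integral_add_add_sub iuB (isφ s).1 (ish hv s).1 (ish hi s).1
    rw [← (ish D.memLp_excess s).2, ← (isφ s).2, ← (ish hv s).2, ← (ish hi s).2, hB, ← ce]
    refine integral_mono (ish D.memLp_excess s).1 ci fun z => ?_
    show Ψ z * (u (z.1 - s, z.2) - init (z.1 - s, z.2)) ≤ Ψ z * u z
      - φ z.1 * (ζ z.2 ^ 2 * truncation lam u z ^ 2 / 2) + φ z.1 * hh (z.1 - s, z.2)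
      + Ψ z * v (z.1 - s, z.2) - Ψ z * init (z.1 - s, z.2)
    have e1 := truncation_nonneg lam u z
    have e2 := truncation_le hlam (D.nonneg z)
    have e3 := mul_nonneg (hφ0 z.1) (sq_nonneg (ζ z.2))
    by_cases hs : z.1 - s < t₁
    · have : 0 ≤ φ z.1 * ζ z.2 ^ 2 * (truncation lam u z * (u z - truncation lam u z / 2)) :=
        mul_nonneg e3 (mul_nonneg e1 (by linarith))
      have e4 : v (z.1 - s, z.2) = u (z.1 - s, z.2) := if_pos hs
      have e5 : hh (z.1 - s, z.2) = 0 := if_neg (not_le.2 hs)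
      rw [e4, e5]
      simp only [hΨdef]
      linarith
    · have e4 : v (z.1 - s, z.2) = 0 := if_neg hs
      have e5 : hh (z.1 - s, z.2) = ζ z.2 ^ 2 * truncation lam u (z.1 - s, z.2) ^ 2 / 2 :=
        if_pos (not_lt.1 hs)
      rw [e4, e5]
      have := mul_le_mul_of_nonneg_left (truncation_mul_le lam (u z) (u (z.1 - s, z.2))) e3
      simp only [hΨdef, truncation] at this ⊢
      linarith
  have h00 : lag Ψ (excess T u u₀) 0 = B + lag (fun z => φ z.1) hh 0 - lag Ψ init 0 := by
    have i2 : Integrable fun z : ℝ × ℝ => Ψ z * u z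
        - φ z.1 * (ζ z.2 ^ 2 * truncation lam u z ^ 2 / 2) + φ z.1 * hh (z.1 - 0, z.2) :=
      iuB.add (isφ 0).1
    rw [← (ish D.memLp_excess 0).2, ← (isφ 0).2, ← (ish hi 0).2, hB,
      ← integral_add iuB (isφ 0).1, ← integral_sub i2 (ish hi 0).1]
    congr 1; ext z
    show Ψ z * (u (z.1 - 0, z.2) - init (z.1 - 0, z.2)) = Ψ z * u z
      - φ z.1 * (ζ z.2 ^ 2 * truncation lam u z ^ 2 / 2) + φ z.1 * hh (z.1 - 0, z.2)
      - Ψ z * init (z.1 - 0, z.2)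
    simp only [sub_zero]
    by_cases hs : z.1 < t₁
    · simp only [hΨdef, hφ _ hs.le]; ring
    · rw [show hh (z.1, z.2) = ζ z.2 ^ 2 * truncation lam u z ^ 2 / 2 from if_pos (not_lt.1 hs)]
      ring
  have hmass := H.integral_shiftedDeriv_le hT hε
  have hc := H.integrable_shiftedDeriv (T := T) hε
  have ilag : ∀ {g : ℝ × ℝ → ℝ}, MemLp g 2 volume →
      Integrable fun s => shiftedDeriv k T ε s * lag Ψ g s := fun {g} hg =>
    hc.mul_bdd (continuous_lag hst.memLp hg).measurable.aestronglyMeasurable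
      (ae_of_all _ fun s => abs_lag_le hst.memLp hg s)
  have ilagφ : Integrable fun s => shiftedDeriv k T ε s * lag (fun z => φ z.1) hh s := by
    refine hc.mul_bdd (c := C * ∫ z, hh z)
      (measurable_lag (hφm.comp measurable_fst) hhm).aestronglyMeasurable
      (ae_of_all _ fun s => ?_)
    rw [← integral_const_mul, lag]
    refine norm_integral_le_of_norm_le (hhi.const_mul C) (ae_of_all _ fun z => ?_)
    rw [norm_mul, Real.norm_of_nonneg (hh0 z)]
    exact mul_le_mul_of_nonneg_right (hφb _) (hh0 z)
  have hint : ∫ s, shiftedDeriv k T ε s * lag Ψ (excess T u u₀) s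
      ≤ (∫ s, shiftedDeriv k T ε s) * B + (∫ s, shiftedDeriv k T ε s * lag (fun z => φ z.1) hh s)
        + (∫ s, shiftedDeriv k T ε s * lag Ψ v s)
        - ∫ s, shiftedDeriv k T ε s * lag Ψ init s := by
    obtain ⟨ci, ce⟩ := integral_add_add_sub (hc.mul_const B) ilagφ (ilag hv) (ilag hi)
    rw [← integral_mul_const, ← ce]
    refine integral_mono (ilag D.memLp_excess) ci fun s => ?_
    have := mul_le_mul_of_nonneg_left (hle s) (H.shiftedDeriv_nonneg (T := T) hε s)
    show _ ≤ shiftedDeriv k T ε s * B + shiftedDeriv k T ε s * lag (fun z => φ z.1) hh s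
      + shiftedDeriv k T ε s * lag Ψ v s - shiftedDeriv k T ε s * lag Ψ init s
    linarith
  rw [h00] at hres
  have := mul_le_mul_of_nonneg_right hmass hB0
  linarith

end ExtendedSubsolution

/-! ### Weights in time that gain a reverse fractional derivative -/

lemma integral_add_add {α : Type*} [MeasurableSpace α] {μ : Measure α} {f₁ f₂ f₃ : α → ℝ}
    (h₁ : Integrable f₁ μ) (h₂ : Integrable f₂ μ) (h₃ : Integrable f₃ μ) :
    Integrable (fun x => f₁ x + f₂ x + f₃ x) μ ∧
    ∫ x, (f₁ x + f₂ x + f₃ x) ∂μ = (∫ x, f₁ x ∂μ) + (∫ x, f₂ x ∂μ) + ∫ x, f₃ x ∂μ := by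
  have h12 : Integrable (fun x => f₁ x + f₂ x) μ := h₁.add h₂
  exact ⟨h12.add h₃, by rw [integral_add h12 h₃, integral_add h₁ h₂]⟩

/-- The weight `χ(t) (c₁ + ∫ l(ρ) g(t + ρ) dρ)` on times before `T`. The second summand solves
the backward equation with right-hand side `g`, because `k * l = 1`; the constant `c₁` keeps the
weight comparable with `χ`, see `weight_le` and `le_weight`. -/
def weight (l : ℝ → ℝ) (T c₁ : ℝ) (χ g : ℝ → ℝ) (t : ℝ) : ℝ :=
  if t < T then χ t * (c₁ + ∫ ρ, ext T l ρ * g (t + ρ)) else 0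

section

variable {k l : ℝ → ℝ} {T t₁ c₁ Lχ : ℝ} {χ g : ℝ → ℝ} {h : ℝ × ℝ → ℝ}

lemma measurable_weight (H : IsKernelPair k l) (hχ : Measurable χ) (hg : Measurable g) :
    Measurable (weight l T c₁ χ g) :=
  Measurable.ite measurableSet_Iio (hχ.mul (measurable_const.add <| by
    simpa only [add_comm] using
      measurable_integral_mul_add (H.measurable_ext_l T) hg)) measurable_const

lemma integral_ext_l_nonneg (H : IsKernelPair k l) (hg0 : ∀ t, 0 ≤ g t) (t : ℝ) :
    0 ≤ ∫ ρ, ext T l ρ * g (t + ρ) :=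
  integral_nonneg fun ρ => mul_nonneg (H.ext_l_nonneg T ρ) (hg0 _)

lemma weight_nonneg (H : IsKernelPair k l) (hc₁ : 0 ≤ c₁) (hχ0 : ∀ t, 0 ≤ χ t)
    (hg0 : ∀ t, 0 ≤ g t) (t : ℝ) : 0 ≤ weight l T c₁ χ g t := by
  rw [weight]; split_ifs
  · exact mul_nonneg (hχ0 t) (add_nonneg hc₁ (integral_ext_l_nonneg H hg0 t))
  · exact le_rfl

lemma weight_le (hχ0 : ∀ t, 0 ≤ χ t) (hc₁ : 0 ≤ c₁)
    (hc : ∀ t, ∫ ρ, ext T l ρ * g (t + ρ) ≤ c₁) (t : ℝ) :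
    weight l T c₁ χ g t ≤ 2 * c₁ * χ t := by
  rw [weight]; split_ifs
  · linarith [mul_le_mul_of_nonneg_left (hc t) (hχ0 t)]
  · have := mul_nonneg hc₁ (hχ0 t); linarith

lemma le_weight (H : IsKernelPair k l) (hχ0 : ∀ t, 0 ≤ χ t) (hg0 : ∀ t, 0 ≤ g t) {t : ℝ}
    (ht : t < T) : c₁ * χ t ≤ weight l T c₁ χ g t := by
  rw [weight, if_pos ht]
  linarith [mul_nonneg (hχ0 t) (integral_ext_l_nonneg (T := T) H hg0 t)]

/-- Fubini's theorem for the part of the weight that contains `l`. -/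
lemma integral_weight_swap (H : IsKernelPair k l) (hi : Integrable h)
    (hχ : Measurable χ) (hχ0 : ∀ t, 0 ≤ χ t) (hχ1 : ∀ t, χ t ≤ 1) (hg : Measurable g)
    (hg0 : ∀ t, 0 ≤ g t) (hg1 : ∀ t, g t ≤ 1) (s : ℝ) :
    Integrable (fun z : ℝ × ℝ => χ z.1 * (∫ ρ, ext T l ρ * g (z.1 + s + ρ)) * h z) ∧
    ∫ z : ℝ × ℝ, χ z.1 * (∫ ρ, ext T l ρ * g (z.1 + s + ρ)) * h z
      = ∫ ρ, ext T l ρ * ∫ z : ℝ × ℝ, χ z.1 * g (z.1 + (s + ρ)) * h z := by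
  have hint : Integrable (fun q : ℝ × (ℝ × ℝ) =>
      ext T l q.1 * (χ q.2.1 * g (q.2.1 + (s + q.1)) * h q.2)) (volume.prod volume) := by
    have h1 := (H.integrable_ext_l T).mul_prod hi
    have h2 : Measurable fun q : ℝ × (ℝ × ℝ) => χ q.2.1 * g (q.2.1 + (s + q.1)) :=
      (hχ.comp (by fun_prop)).mul (hg.comp (by fun_prop))
    refine (h1.bdd_mul (c := 1) h2.aestronglyMeasurable (ae_of_all _ fun q => ?_)).congr
      (ae_of_all _ fun q => ?_)
    · rw [Real.norm_of_nonneg (mul_nonneg (hχ0 _) (hg0 _))]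
      exact mul_le_one₀ (hχ1 _) (hg0 _) (hg1 _)
    · show χ q.2.1 * g (q.2.1 + (s + q.1)) * (ext T l q.1 * h q.2) = _
      ring
  have e : ∀ z : ℝ × ℝ, χ z.1 * (∫ ρ, ext T l ρ * g (z.1 + s + ρ)) * h z
      = ∫ ρ, ext T l ρ * (χ z.1 * g (z.1 + (s + ρ)) * h z) := fun z => by
    rw [← integral_const_mul, ← integral_mul_const]
    congr 1; ext ρ; rw [add_assoc]; ring
  constructor
  · rw [funext e]; exact hint.integral_prod_right
  · rw [funext e, ← integral_integral_swap
      (f := fun ρ (z : ℝ × ℝ) => ext T l ρ * (χ z.1 * g (z.1 + (s + ρ)) * h z)) hint]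
    simp only [integral_const_mul]

/-- The regularized backward derivative of the weight dominates the resolvent average of `g`, up
to an error caused by the slope of `χ`. -/
lemma integral_resolventKernel_le_weight (H : IsKernelPair k l) (hT : 0 < T) (ht₁ : 0 ≤ t₁)
    (hm : Measurable h) (hi : Integrable h) (h0 : ∀ z, 0 ≤ h z)
    (hlo : ∀ z : ℝ × ℝ, z.1 < t₁ → h z = 0) (hhi : ∀ z : ℝ × ℝ, T ≤ z.1 → h z = 0)
    (ht₁T : t₁ ≤ T)
    (hχ : Measurable χ) (hχ0 : ∀ t, 0 ≤ χ t) (hχ1 : ∀ t, χ t ≤ 1) (hL : 0 ≤ Lχ)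
    (hχL : ∀ s t, s ≤ t → χ t ≤ χ s + Lχ * (t - s)) (hg : Measurable g)
    (hg0 : ∀ t, 0 ≤ g t) (hg1 : ∀ t, g t ≤ 1) (hgT : ∀ t, T ≤ t → g t = 0) (hc₁ : 0 ≤ c₁)
    (hc : ∀ t, ∫ ρ, ext T l ρ * g (t + ρ) ≤ c₁) {ε : ℝ} (hε : 0 < ε) :
    ∫ s in Ioo 0 T, resolventKernel k l T ε s * ∫ z : ℝ × ℝ, χ z.1 * g (z.1 + s) * h z
      ≤ k ε * lag (fun z => weight l T c₁ χ g z.1) h 0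
        - (∫ s, shiftedDeriv k T ε s * lag (fun z => weight l T c₁ χ g z.1) h s)
        + 2 * c₁ * Lχ * (∫ s in (0 : ℝ)..(T - t₁), k s) * ∫ z, h z := by
  set φ := weight l T c₁ χ g with hφdef
  set b : ℝ → ℝ := fun s => ∫ z : ℝ × ℝ, χ z.1 * g (z.1 + s) * h z with hbdef
  set N := ∫ z, h z with hN
  have hN0 : 0 ≤ N := integral_nonneg h0
  have hφm : Measurable φ := measurable_weight H hχ hg
  have hφ0 := weight_nonneg (T := T) H hc₁ hχ0 hg0
  have hφ2 : ∀ t, φ t ≤ 2 * c₁ := fun t => (weight_le hχ0 hc₁ hc t).trans (by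
    have := mul_le_mul_of_nonneg_left (hχ1 t) hc₁; linarith)
  have hbm : Measurable b := by
    have : Measurable fun q : ℝ × (ℝ × ℝ) => χ q.2.1 * g (q.2.1 + q.1) * h q.2 :=
      ((hχ.comp (by fun_prop)).mul (hg.comp (by fun_prop))).mul (hm.comp measurable_snd)
    exact this.stronglyMeasurable.integral_prod_right'.measurable
  have hbN : ∀ s, |b s| ≤ N := fun s => by
    rw [← Real.norm_eq_abs]
    refine norm_integral_le_of_norm_le hi (ae_of_all _ fun z => ?_)
    rw [Real.norm_of_nonneg (mul_nonneg (mul_nonneg (hχ0 _) (hg0 _)) (h0 z))]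
    exact mul_le_of_le_one_left (h0 z) (mul_le_one₀ (hχ1 _) (hg0 _) (hg1 _))
  have hb0 : ∀ s, T ≤ s → b s = 0 := fun s hs => by
    refine integral_eq_zero_of_ae (ae_of_all _ fun z => ?_)
    show χ z.1 * g (z.1 + s) * h z = 0
    by_cases hz : z.1 < t₁
    · rw [hlo z hz, mul_zero]
    · rw [hgT _ (by linarith), mul_zero, zero_mul]
  -- the integral over `(0, T)` is an integral over the line
  have e1 : ∫ s in Ioo 0 T, resolventKernel k l T ε s * b s
      = ∫ s, resolventKernel k l T ε s * b s := by
    refine setIntegral_eq_integral_of_forall_compl_eq_zero fun s hs => ?_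
    by_cases h' : s ≤ 0
    · rw [IsKernelPair.resolventKernel_of_nonpos h', zero_mul]
    · rw [hb0 s (not_lt.1 fun h'' => hs ⟨not_le.1 h', h''⟩), mul_zero]
  rw [e1, H.integral_resolventKernel_mul hε hbm hbN]
  have iχ : Integrable fun z : ℝ × ℝ => χ z.1 * h z :=
    hi.bdd_mul (c := 1) (hχ.comp measurable_fst).aestronglyMeasurable (ae_of_all _ fun z => by
      rw [Real.norm_of_nonneg (hχ0 _)]; exact hχ1 _)
  have hM0 : 0 ≤ ∫ z : ℝ × ℝ, χ z.1 * h z :=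
    integral_nonneg fun z => mul_nonneg (hχ0 _) (h0 z)
  have iφ : ∀ s, Integrable fun z : ℝ × ℝ => φ (z.1 + s) * h z := fun s =>
    hi.bdd_mul (c := 2 * c₁) (hφm.comp (measurable_fst.add_const s)).aestronglyMeasurable
      (ae_of_all _ fun z => by rw [Real.norm_of_nonneg (hφ0 _)]; exact hφ2 _)
  have hlag0 : lag (fun z => φ z.1) h 0
      = c₁ * (∫ z : ℝ × ℝ, χ z.1 * h z) + ∫ ρ, ext T l ρ * b ρ := by
    obtain ⟨i1, e2⟩ := integral_weight_swap (T := T) H hi hχ hχ0 hχ1 hg hg0 hg1 0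
    simp only [add_zero, zero_add] at e2 i1
    rw [← e2, ← integral_const_mul, ← integral_add (iχ.const_mul c₁) i1, lag]
    congr 1; ext z
    simp only [add_zero]
    by_cases hz : z.1 < T
    · simp only [hφdef, weight, if_pos hz]; ring
    · rw [hhi z (not_lt.1 hz)]; ring
  have hlag : ∀ s, 0 ≤ s → lag (fun z => φ z.1) h s ≤ c₁ * (∫ z : ℝ × ℝ, χ z.1 * h z)
      + (∫ ρ, ext T l ρ * b (s + ρ))
      + 2 * c₁ * Lχ * ((Ioo 0 (T - t₁)).indicator 1 s * s) * N := fun s hs => by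
    obtain ⟨i1, e2⟩ := integral_weight_swap (T := T) H hi hχ hχ0 hχ1 hg hg0 hg1 s
    obtain ⟨ci, ce⟩ := integral_add_add (iχ.const_mul c₁) i1
      (hi.const_mul (2 * c₁ * Lχ * ((Ioo 0 (T - t₁)).indicator 1 s * s)))
    rw [← e2, ← integral_const_mul, hN, ← integral_const_mul, ← ce, lag]
    refine integral_mono (iφ s) ci fun z => ?_
    show φ (z.1 + s) * h z ≤ c₁ * (χ z.1 * h z)
      + χ z.1 * (∫ ρ, ext T l ρ * g (z.1 + s + ρ)) * h z
      + 2 * c₁ * Lχ * ((Ioo 0 (T - t₁)).indicator 1 s * s) * h z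
    have hJ := integral_ext_l_nonneg (T := T) H hg0 (z.1 + s)
    have hind : 0 ≤ (Ioo 0 (T - t₁)).indicator (1 : ℝ → ℝ) s * s :=
      mul_nonneg (indicator_nonneg (fun _ _ => zero_le_one) _) hs
    have hA : 0 ≤ 2 * c₁ * Lχ * ((Ioo 0 (T - t₁)).indicator 1 s * s) := by positivity
    rw [show ∀ A B C D : ℝ, A * (B * D) + B * C * D = (B * (A + C)) * D from
      fun A B C D => by ring, ← add_mul]
    by_cases hz : z.1 < t₁
    · rw [hlo z hz]; simp
    refine mul_le_mul_of_nonneg_right ?_ (h0 z)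
    simp only [hφdef, weight]
    split_ifs with hzT
    · have h3 := mul_le_mul_of_nonneg_right (hχL z.1 (z.1 + s) (by linarith))
        (add_nonneg hc₁ hJ)
      rw [add_sub_cancel_left] at h3
      have h4 : Lχ * s * (c₁ + ∫ ρ, ext T l ρ * g (z.1 + s + ρ)) ≤ Lχ * s * (2 * c₁) :=
        mul_le_mul_of_nonneg_left (by linarith [hc (z.1 + s)]) (mul_nonneg hL hs)
      rcases hs.eq_or_lt with rfl | hs0
      · simp only [mul_zero, add_zero] at h3 ⊢; exact h3
      · rw [indicator_of_mem (show s ∈ Ioo 0 (T - t₁) from ⟨hs0, by linarith⟩), Pi.one_apply]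
        linarith
    · have := mul_nonneg (hχ0 z.1) (add_nonneg hc₁ hJ)
      linarith
  have hcκ := H.integrable_shiftedDeriv (T := T) hε
  have i1 : Integrable fun s => shiftedDeriv k T ε s * lag (fun z => φ z.1) h s := by
    refine hcκ.mul_bdd (c := 2 * c₁ * N)
      (measurable_lag (hφm.comp measurable_fst) hm).aestronglyMeasurable
      (ae_of_all _ fun s => ?_)
    rw [hN, ← integral_const_mul, lag]
    refine norm_integral_le_of_norm_le (hi.const_mul _) (ae_of_all _ fun z => ?_)
    rw [norm_mul, Real.norm_of_nonneg (h0 z), Real.norm_of_nonneg (hφ0 _)]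
    exact mul_le_mul_of_nonneg_right (hφ2 _) (h0 z)
  have i2 : Integrable fun s => shiftedDeriv k T ε s * ∫ ρ, ext T l ρ * b (s + ρ) :=
    hcκ.mul_bdd (measurable_integral_mul_add (H.measurable_ext_l T) hbm).aestronglyMeasurable
      (ae_of_all _ fun s => abs_integral_mul_add_le (H.integrable_ext_l T) hbN s)
  have i3 : Integrable fun s => shiftedDeriv k T ε s *
      ((Ioo 0 (T - t₁)).indicator 1 s * s) := by
    refine hcκ.mul_bdd (c := T - t₁) ((measurable_one.indicator
      measurableSet_Ioo).mul measurable_id).aestronglyMeasurable (ae_of_all _ fun s => ?_)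
    by_cases hs : s ∈ Ioo 0 (T - t₁)
    · rw [indicator_of_mem hs, Pi.one_apply, one_mul, Real.norm_of_nonneg hs.1.le]
      exact hs.2.le
    · rw [indicator_of_notMem hs]; simpa using ht₁T
  have hmass := H.integral_shiftedDeriv_le hT hε
  have hmom : ∫ s, shiftedDeriv k T ε s * ((Ioo 0 (T - t₁)).indicator 1 s * s)
      ≤ ∫ s in (0 : ℝ)..(T - t₁), k s := by
    refine le_trans (le_of_eq ?_) (H.integral_mul_kdot_le hε (sub_nonneg.2 ht₁T))
    rw [intervalIntegral_eq_setIntegral (sub_nonneg.2 ht₁T), ← integral_indicator measurableSet_Ioo]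
    congr 1; ext s
    by_cases hs : s ∈ Ioo 0 (T - t₁)
    · rw [indicator_of_mem hs, indicator_of_mem hs, shiftedDeriv,
        ext_of_mem ⟨hs.1, by linarith [hs.2]⟩, Pi.one_apply]; ring
    · rw [indicator_of_notMem hs, indicator_of_notMem hs]; ring
  have hle : ∫ s, shiftedDeriv k T ε s * lag (fun z => φ z.1) h s
      ≤ (∫ s, shiftedDeriv k T ε s) * (c₁ * ∫ z : ℝ × ℝ, χ z.1 * h z)
        + (∫ s, shiftedDeriv k T ε s * ∫ ρ, ext T l ρ * b (s + ρ))
        + (∫ s, shiftedDeriv k T ε s * ((Ioo 0 (T - t₁)).indicator 1 s * s))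
          * (2 * c₁ * Lχ * N) := by
    obtain ⟨ci, ce⟩ := integral_add_add (hcκ.mul_const (c₁ * ∫ z : ℝ × ℝ, χ z.1 * h z)) i2
      (i3.mul_const (2 * c₁ * Lχ * N))
    rw [← integral_mul_const, ← integral_mul_const, ← ce]
    refine integral_mono i1 ci fun s => ?_
    show shiftedDeriv k T ε s * lag (fun z => φ z.1) h s
      ≤ shiftedDeriv k T ε s * (c₁ * ∫ z : ℝ × ℝ, χ z.1 * h z)
        + shiftedDeriv k T ε s * (∫ ρ, ext T l ρ * b (s + ρ))
        + shiftedDeriv k T ε s * ((Ioo 0 (T - t₁)).indicator 1 s * s) * (2 * c₁ * Lχ * N)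
    by_cases hs : 0 ≤ s
    · have := mul_le_mul_of_nonneg_left (hlag s hs) (H.shiftedDeriv_nonneg (T := T) hε s)
      linarith
    · rw [shiftedDeriv, ext_of_notMem fun h => hs h.1.le]; simp
  have h5 := mul_le_mul_of_nonneg_right hmass (mul_nonneg hc₁ hM0)
  have h6 := mul_le_mul_of_nonneg_right hmom
    (mul_nonneg (mul_nonneg (mul_nonneg zero_le_two hc₁) hL) hN0)
  have e3 : ∫ ρ, shiftedDeriv k T ε ρ * ∫ s, ext T l s * b (s + ρ)
      = ∫ s, shiftedDeriv k T ε s * ∫ ρ, ext T l ρ * b (s + ρ) := by simp only [add_comm]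
  rw [hlag0, e3]
  linarith

end

namespace ExtendedSubsolution

variable {k l : ℝ → ℝ} {T a b a' b' K lam : ℝ} {u Du Q : ℝ × ℝ → ℝ} {u₀ ζ φ : ℝ → ℝ}
  {t₁ c₁ Lχ : ℝ} {χ g : ℝ → ℝ}

/-- The energy inequality for the weight `weight l T c₁ χ g`, in the limit of vanishing
regularization. The first term on the left is the gain from the backward equation. -/
lemma weighted_energy (D : ExtendedSubsolution k T a b u Du Q u₀) (H : IsKernelPair k l)
    (hT : 0 < T) (hζ : IsCutoff a' b' K ζ) (h1 : a < a') (h2 : a' ≤ b') (h3 : b' < b)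
    (hlam : 0 ≤ lam) (ht₁ : 0 ≤ t₁) (ht₁T : t₁ ≤ T)
    (hχ : Measurable χ) (hχ0 : ∀ t, 0 ≤ χ t) (hχ1 : ∀ t, χ t ≤ 1) (hL : 0 ≤ Lχ)
    (hχL : ∀ s t, s ≤ t → χ t ≤ χ s + Lχ * (t - s)) (hχt : ∀ t, t ≤ t₁ → χ t = 0)
    (hg : Measurable g)
    (hg0 : ∀ t, 0 ≤ g t) (hg1 : ∀ t, g t ≤ 1) (hgT : ∀ t, T ≤ t → g t = 0) (hc₁ : 0 ≤ c₁)
    (hc : ∀ t, ∫ ρ, ext T l ρ * g (t + ρ) ≤ c₁) {X : ℝ} (hX : 0 ≤ X)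
    (hXM : ∫⁻ z : ℝ × ℝ, ENNReal.ofReal (weight l T c₁ χ g z.1
      * (ζ z.2 ^ 2 * truncation lam u z)) * memory k t₁ u u₀ z ≤ ENNReal.ofReal X) :
    (∫ z : ℝ × ℝ, χ z.1 * g z.1 * (ζ z.2 ^ 2 * truncation lam u z ^ 2 / 2))
      + (∫ z : ℝ × ℝ, weight l T c₁ χ g z.1 * (2 * ζ z.2 * deriv ζ z.2 * truncation lam u z
          + ζ z.2 ^ 2 * truncationDeriv lam u Du z) * Q z)
      ≤ X + 2 * c₁ * Lχ * (∫ s in (0 : ℝ)..(T - t₁), k s)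
        * ∫ z : ℝ × ℝ, if t₁ ≤ z.1 then ζ z.2 ^ 2 * truncation lam u z ^ 2 / 2 else 0 := by
  have hφm := measurable_weight (T := T) (c₁ := c₁) H hχ hg
  have hφ0 := weight_nonneg (T := T) H hc₁ hχ0 hg0
  have hφC : ∀ t, weight l T c₁ χ g t ≤ 2 * c₁ := fun t =>
    (weight_le hχ0 hc₁ hc t).trans (by
      have := mul_le_mul_of_nonneg_left (hχ1 t) hc₁; linarith)
  have hφt : ∀ t, t ≤ t₁ → weight l T c₁ χ g t = 0 := fun t ht => by
    rw [weight, hχt t ht, zero_mul, ite_self]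
  have hφT : ∀ t, T ≤ t → weight l T c₁ χ g t = 0 := fun t ht => if_neg (not_lt.2 ht)
  set φ := weight l T c₁ χ g with hφdef
  set h : ℝ × ℝ → ℝ :=
    fun z => if t₁ ≤ z.1 then ζ z.2 ^ 2 * truncation lam u z ^ 2 / 2 else 0 with hdef
  have hζm : Measurable ζ := hζ.contDiff.continuous.measurable
  have hw0 : ∀ z : ℝ × ℝ, 0 ≤ ζ z.2 ^ 2 * truncation lam u z ^ 2 / 2 := fun z => by positivity
  have hm : Measurable h := Measurable.ite (measurableSet_le measurable_const measurable_fst)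
    ((((hζm.comp measurable_snd).pow_const 2).mul
      ((D.measurable_truncation lam).pow_const 2)).div_const 2) measurable_const
  have h0 : ∀ z, 0 ≤ h z := fun z => by
    simp only [hdef]; split_ifs
    · exact hw0 z
    · exact le_rfl
  have hi : Integrable h := by
    refine (D.memLp_truncation hlam).integrable_sq.mono hm.aestronglyMeasurable
      (ae_of_all _ fun z => ?_)
    rw [Real.norm_of_nonneg (h0 z), Real.norm_of_nonneg (sq_nonneg _)]
    simp only [hdef]; split_ifs
    · have := mul_le_mul_of_nonneg_right (pow_le_one₀ (n := 2) (hζ.nonneg z.2) (hζ.le_one z.2))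
        (sq_nonneg (truncation lam u z))
      nlinarith [sq_nonneg (truncation lam u z)]
    · positivity
  have hst := D.spaceTest hζ h1 h2 h3 hlam hφm hφ0 hφC (fun t ht => hφt t (ht.trans ht₁)) hφT
  set G : ℝ × ℝ → ℝ := fun z => φ z.1 * (2 * ζ z.2 * deriv ζ z.2 * truncation lam u z
          + ζ z.2 ^ 2 * truncationDeriv lam u Du z) with hG
  set bb : ℝ → ℝ := fun s => ∫ z : ℝ × ℝ, χ z.1 * g (z.1 + s) * h z with hbb
  have ibb : Integrable fun z : ℝ × ℝ => χ z.1 * h z :=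
    hi.bdd_mul (c := 1) (hχ.comp measurable_fst).aestronglyMeasurable (ae_of_all _ fun z => by
      rw [Real.norm_of_nonneg (hχ0 _)]; exact hχ1 _)
  have hbbc : Continuous bb := by
    have e : bb = fun s => lag (fun z => χ z.1 * h z) (fun z => g z.1) (-s) := by
      ext s
      have := integral_shift_mul_shift (fun z => χ z.1 * h z) (fun z => g z.1) 0 (-s)
      rw [zero_add] at this
      rw [← this]
      simp only [hbb, add_zero, sub_neg_eq_add]
      congr 1; ext z; ring
    rw [e]
    exact (continuous_lag_of_bounded (C := 1) ibb (hg.comp measurable_fst) fun z => by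
      show |g z.1| ≤ 1
      rw [abs_of_nonneg (hg0 _)]; exact hg1 _).comp continuous_neg
  have hbbC : ∀ s, |bb s| ≤ ∫ z, h z := fun s => by
    rw [← Real.norm_eq_abs]
    refine norm_integral_le_of_norm_le hi (ae_of_all _ fun z => ?_)
    rw [Real.norm_of_nonneg (mul_nonneg (mul_nonneg (hχ0 _) (hg0 _)) (h0 z))]
    exact mul_le_of_le_one_left (h0 z) (mul_le_one₀ (hχ1 _) (hg0 _) (hg1 _))
  have t1 := H.tendsto_integral_resolventKernel hT hbbc hbbC
  have t2 := H.tendsto_integral_resolventKernel hT (continuous_lag hst.memLp_deriv D.memLp_flux)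
    (abs_lag_le hst.memLp_deriv D.memLp_flux)
  have hlim := le_of_tendsto (t1.add t2)
    (b := X + 2 * c₁ * Lχ * (∫ s in (0 : ℝ)..(T - t₁), k s) * ∫ z, h z) (by
      filter_upwards [self_mem_nhdsWithin] with ε hε
      have e1 := D.regularized_energy H hT hζ h1 h2 h3 hlam hφm hφ0 hφC ht₁ hφt hφT hε hX hXM
      have e2 := integral_resolventKernel_le_weight (c₁ := c₁) H hT ht₁ hm hi h0
        (fun z hz => if_neg (not_le.2 hz)) (fun z hz => by
          simp only [hdef, D.truncation_eq_zero hlam fun h => not_lt.2 hz h.1.2]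
          simp) ht₁T hχ hχ0 hχ1 hL hχL hg hg0 hg1 hgT hc₁ hc hε
      linarith)
  have e0 : bb 0 = ∫ z : ℝ × ℝ, χ z.1 * g z.1 * (ζ z.2 ^ 2 * truncation lam u z ^ 2 / 2) := by
    simp only [hbb, add_zero]
    congr 1; ext z
    by_cases hz : t₁ ≤ z.1
    · simp only [hdef, if_pos hz]
    · rw [hχt _ (not_le.1 hz).le]; ring
  have e1 : lag G Q 0 = ∫ z : ℝ × ℝ, φ z.1 * (2 * ζ z.2 * deriv ζ z.2 * truncation lam u z
          + ζ z.2 ^ 2 * truncationDeriv lam u Du z) * Q z := by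
    simp only [lag, add_zero, hG]
  rw [← e0, ← e1]
  exact hlim

end ExtendedSubsolution

/-! ### The local energy estimate -/

/-- The length of the set of points of `(a', b')` where `u(t, ·)` exceeds the level `lam`. -/
def levelMeasure (a' b' lam : ℝ) (u : ℝ × ℝ → ℝ) (t : ℝ) : ℝ :=
  (volume {x | x ∈ Ioo a' b' ∧ lam < u (t, x)}).toReal

/-- The spatial derivative of the localized truncation `ζ (u - lam)₊`. -/
def localDeriv (ζ : ℝ → ℝ) (lam : ℝ) (u Du : ℝ × ℝ → ℝ) (z : ℝ × ℝ) : ℝ :=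
  deriv ζ z.2 * truncation lam u z + ζ z.2 * truncationDeriv lam u Du z

lemma IsCutoff.deriv_eq_zero_of_notMem {a' b' K : ℝ} {ζ : ℝ → ℝ} (h : IsCutoff a' b' K ζ) {x : ℝ}
    (hx : x ∉ Ioo a' b') : deriv ζ x = 0 := by
  -- a zero of a nonnegative function is a minimum
  have : IsLocalMin ζ x := Eventually.of_forall fun y => by rw [h.zero x hx]; exact h.nonneg y
  exact this.deriv_eq_zero

lemma levelMeasure_nonneg (a' b' lam : ℝ) (u : ℝ × ℝ → ℝ) (t : ℝ) :
    0 ≤ levelMeasure a' b' lam u t := ENNReal.toReal_nonneg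

lemma levelMeasure_le {a' b' : ℝ} (hab : a' ≤ b') (lam : ℝ) (u : ℝ × ℝ → ℝ) (t : ℝ) :
    levelMeasure a' b' lam u t ≤ b' - a' := by
  rw [levelMeasure]
  refine ENNReal.toReal_le_of_le_ofReal (sub_nonneg.2 hab) ?_
  rw [← Real.volume_Ioo]
  exact measure_mono fun x hx => hx.1

lemma measurable_levelMeasure {u : ℝ × ℝ → ℝ} (hu : Measurable u) (a' b' lam : ℝ) :
    Measurable (levelMeasure a' b' lam u) := by
  have hS : MeasurableSet {z : ℝ × ℝ | z.2 ∈ Ioo a' b' ∧ lam < u z} :=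
    (measurable_snd measurableSet_Ioo).inter (measurableSet_lt measurable_const hu)
  exact (measurable_measure_prodMk_left (ν := (volume : Measure ℝ)) hS).ennreal_toReal

namespace ExtendedSubsolution

variable {k l : ℝ → ℝ} {T a b a' b' K lam : ℝ} {u Du Q : ℝ × ℝ → ℝ} {u₀ ζ φ : ℝ → ℝ}
  {t₁ c₁ Lχ ν Λ F : ℝ} {χ g : ℝ → ℝ}

lemma measurable_localDeriv (D : ExtendedSubsolution k T a b u Du Q u₀)
    (hζ : IsCutoff a' b' K ζ) : Measurable (localDeriv ζ lam u Du) :=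
  (((measurable_deriv ζ).comp measurable_snd).mul (D.measurable_truncation lam)).add
    ((hζ.contDiff.continuous.measurable.comp measurable_snd).mul (D.measurable_truncationDeriv lam))

lemma memLp_deriv_mul (D : ExtendedSubsolution k T a b u Du Q u₀)
    (hζ : IsCutoff a' b' K ζ) (hlam : 0 ≤ lam) :
    MemLp (fun z : ℝ × ℝ => deriv ζ z.2 * truncation lam u z) 2 volume :=
  ((D.memLp_truncation hlam).const_mul K).mono
    (((measurable_deriv ζ).comp measurable_snd).mul
      (D.measurable_truncation lam)).aestronglyMeasurable (ae_of_all _ fun z => by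
    rw [norm_mul, norm_mul]
    exact mul_le_mul_of_nonneg_right ((hζ.abs_deriv_le _).trans (le_abs_self K)) (norm_nonneg _))

lemma memLp_mul_truncationDeriv (D : ExtendedSubsolution k T a b u Du Q u₀)
    (hζ : IsCutoff a' b' K ζ) :
    MemLp (fun z : ℝ × ℝ => ζ z.2 * truncationDeriv lam u Du z) 2 volume :=
  (D.memLp_truncationDeriv lam).mono
    ((hζ.contDiff.continuous.measurable.comp measurable_snd).mul
      (D.measurable_truncationDeriv lam)).aestronglyMeasurable (ae_of_all _ fun z => by
    rw [norm_mul, Real.norm_of_nonneg (hζ.nonneg _)]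
    exact mul_le_of_le_one_left (norm_nonneg _) (hζ.le_one _))

lemma memLp_localDeriv (D : ExtendedSubsolution k T a b u Du Q u₀)
    (hζ : IsCutoff a' b' K ζ) (hlam : 0 ≤ lam) : MemLp (localDeriv ζ lam u Du) 2 volume :=
  (D.memLp_deriv_mul hζ hlam).add (D.memLp_mul_truncationDeriv hζ)

/-- In one dimension the localized truncation is bounded by its derivative; the factor is the
length of the set where the truncation does not vanish. -/
lemma sq_le_levelMeasure_mul (D : ExtendedSubsolution k T a b u Du Q u₀)
    (hζ : IsCutoff a' b' K ζ) (h1 : a < a') (h2 : a' ≤ b') (h3 : b' < b) (hlam : 0 ≤ lam) :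
    ∀ᵐ t, ∀ᵐ x, (ζ x * truncation lam u (t, x)) ^ 2
      ≤ levelMeasure a' b' lam u t * ∫ y, localDeriv ζ lam u Du (t, y) ^ 2 := by
  have hab : a < b := h1.trans_le (h2.trans h3.le)
  filter_upwards [D.slice, MemLp.slice_space (D.measurable_localDeriv hζ)
    (D.memLp_localDeriv hζ hlam)] with t ht hq
  have hnn : 0 ≤ levelMeasure a' b' lam u t * ∫ y, localDeriv ζ lam u Du (t, y) ^ 2 :=
    mul_nonneg (levelMeasure_nonneg _ _ _ _ _) (integral_nonneg fun y => sq_nonneg _)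
  by_cases hT : t ∈ Ioo 0 T
  · have hs := (ht hT).mul_posPart hab lam hζ.contDiff (hζ.zero a fun h => by linarith [h.1])
    rw [ae_restrict_iff' measurableSet_Ioo] at hs
    filter_upwards [hs] with x hx
    by_cases hxm : x ∈ Ioo a b
    · have hE : MeasurableSet {x | x ∈ Ioo a' b' ∧ lam < u (t, x)} :=
        measurableSet_Ioo.inter (measurableSet_lt measurable_const
          (D.meas.comp (measurable_const.prodMk measurable_id)))
      have hEf : volume (univ ∩ {x | x ∈ Ioo a' b' ∧ lam < u (t, x)}) ≠ ∞ := by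
        refine (lt_of_le_of_lt (measure_mono (t := Ioo a' b') fun x hx => hx.2.1) ?_).ne
        rw [Real.volume_Ioo]; exact ENNReal.ofReal_lt_top
      have h0 : ∀ y, y ∉ {x | x ∈ Ioo a' b' ∧ lam < u (t, x)} →
          localDeriv ζ lam u Du (t, y) = 0 := fun y hy => by
        rw [localDeriv]
        by_cases hy' : y ∈ Ioo a' b'
        · have : ¬ lam < u (t, y) := fun h => hy ⟨hy', h⟩
          rw [truncationDeriv, if_neg this, truncation, max_eq_right (by linarith)]
          ring
        · rw [hζ.deriv_eq_zero_of_notMem hy', hζ.zero y hy']; ring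
      have hcs := sq_integral_le hE hEf (hq.restrict univ) h0
      rw [Measure.restrict_univ, univ_inter] at hcs
      refine le_trans ?_ hcs
      rw [← sq_abs]
      refine pow_le_pow_left₀ (abs_nonneg _) ?_ 2
      have e : ζ x * truncation lam u (t, x) = ∫ y in a..x, localDeriv ζ lam u Du (t, y) :=
        hx hxm
      rw [e, intervalIntegral.integral_of_le hxm.1.le]
      refine (abs_integral_le_integral_abs).trans ?_
      refine setIntegral_le_integral (Integrable.abs ?_) (ae_of_all _ fun y => abs_nonneg _)
      have : IntegrableOn (fun y => localDeriv ζ lam u Du (t, y)) (Icc a' b') :=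
        (MemLp.intervalIntegrable_all hq a' b').1.congr_set_ae Ioc_ae_eq_Icc.symm |>.mono_set
          (by rfl)
      exact this.integrable_of_forall_notMem_eq_zero fun y hy =>
        h0 y fun h => hy (Ioo_subset_Icc_self h.1)
    · rw [hζ.zero x fun h => hxm ⟨h1.trans h.1, h.2.trans h3⟩]
      simpa using hnn
  · refine ae_of_all _ fun x => ?_
    rw [D.truncation_eq_zero hlam fun h => hT h.1]
    simpa using hnn

/-- The coercivity of the flux, with the cutoff function absorbed by Young's inequality. -/
lemma le_flux_mul (hν : 0 < ν) {z : ℝ × ℝ} (hζ : IsCutoff a' b' K ζ)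
    (hQ1 : ν * Du z ^ 2 ≤ Q z * Du z) (hQ2 : |Q z| ≤ Λ * |Du z|) :
    ν / 2 * (ζ z.2 * truncationDeriv lam u Du z) ^ 2
        - 2 * Λ ^ 2 / ν * (deriv ζ z.2 * truncation lam u z) ^ 2
      ≤ (2 * ζ z.2 * deriv ζ z.2 * truncation lam u z
        + ζ z.2 ^ 2 * truncationDeriv lam u Du z) * Q z := by
  by_cases h : lam < u z
  · simp only [truncationDeriv, if_pos h]
    set w := truncation lam u z
    have hw : 0 ≤ w := truncation_nonneg _ _ _
    have e1 : -(ζ z.2 * |deriv ζ z.2| * w * (Λ * |Du z|)) ≤ ζ z.2 * deriv ζ z.2 * w * Q z := by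
      have h1 : |ζ z.2 * deriv ζ z.2 * w * Q z| ≤ ζ z.2 * |deriv ζ z.2| * w * (Λ * |Du z|) := by
        rw [abs_mul, abs_mul, abs_mul, abs_of_nonneg (hζ.nonneg _), abs_of_nonneg hw]
        exact mul_le_mul_of_nonneg_left hQ2
          (mul_nonneg (mul_nonneg (hζ.nonneg _) (abs_nonneg _)) hw)
      linarith [neg_abs_le (ζ z.2 * deriv ζ z.2 * w * Q z)]
    have e2 : 2 * (ζ z.2 * |deriv ζ z.2| * w * (Λ * |Du z|))
        ≤ ν / 2 * (ζ z.2 * Du z) ^ 2 + 2 * Λ ^ 2 / ν * (deriv ζ z.2 * w) ^ 2 := by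
      have h3 : 0 ≤ ν / 2 * (ζ z.2 * |Du z| - 2 * Λ / ν * (|deriv ζ z.2| * w)) ^ 2 := by positivity
      have h4 : ν / 2 * (ζ z.2 * |Du z| - 2 * Λ / ν * (|deriv ζ z.2| * w)) ^ 2
          = ν / 2 * (ζ z.2 ^ 2 * |Du z| ^ 2) + 2 * Λ ^ 2 / ν * (|deriv ζ z.2| ^ 2 * w ^ 2)
            - 2 * (ζ z.2 * |deriv ζ z.2| * w * (Λ * |Du z|)) := by
        field_simp; ring
      rw [h4, sq_abs, sq_abs] at h3
      rw [mul_pow, mul_pow]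
      linarith
    have e3 := mul_le_mul_of_nonneg_left hQ1 (sq_nonneg (ζ z.2))
    rw [mul_pow] at e2 ⊢
    linarith
  · have : truncation lam u z = 0 := by rw [truncation, max_eq_right (by linarith)]
    simp [truncationDeriv, h, this]

/-- Control of the memory term by the energy: the memory is integrable in space, the localized
truncation is bounded in space by `sq_le_levelMeasure_mul`, and Young's inequality separates the two
factors. -/
lemma lintegral_memory_le (D : ExtendedSubsolution k T a b u Du Q u₀)
    (hζ : IsCutoff a' b' K ζ) (h1 : a < a') (h2 : a' ≤ b') (h3 : b' < b) (hlam : 0 ≤ lam)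
    (hν : 0 < ν) (hφm : Measurable φ) (hφ0 : ∀ t, 0 ≤ φ t) {C : ℝ}
    (hφC : ∀ t, φ t ≤ C) (hφ : ∀ t, t ≤ 0 → φ t = 0) (hφT : ∀ t, T ≤ t → φ t = 0)
    (hFM : ∀ᵐ t, φ t ≠ 0 →
      ∫⁻ x in Ioo a' b', memory k t₁ u u₀ (t, x) ≤ ENNReal.ofReal F) :
    Integrable (fun t => φ t * levelMeasure a' b' lam u t) ∧
    Integrable (fun z : ℝ × ℝ => φ z.1 * localDeriv ζ lam u Du z ^ 2) ∧
    ∫⁻ z : ℝ × ℝ, ENNReal.ofReal (φ z.1 * (ζ z.2 ^ 2 * truncation lam u z))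
      * memory k t₁ u u₀ z
      ≤ ENNReal.ofReal (ν / 8 * (∫ z : ℝ × ℝ, φ z.1 * localDeriv ζ lam u Du z ^ 2)
        + 2 * F ^ 2 / ν * ∫ t, φ t * levelMeasure a' b' lam u t) := by
  have hC : 0 ≤ C := (hφ0 0).trans (hφC 0)
  have iμ : Integrable (fun t => φ t * levelMeasure a' b' lam u t) := by
    have : Integrable ((Icc 0 T).indicator fun _ => C * (b' - a')) :=
      (integrable_indicator_iff measurableSet_Icc).2 (integrableOn_const (by simp))
    refine this.mono (hφm.mul (measurable_levelMeasure D.meas _ _ _)).aestronglyMeasurable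
      (ae_of_all _ fun t => ?_)
    have hnn : 0 ≤ C * (b' - a') := mul_nonneg hC (by linarith)
    by_cases ht : t ∈ Icc 0 T
    · rw [indicator_of_mem ht, Real.norm_of_nonneg (mul_nonneg (hφ0 _)
        (levelMeasure_nonneg _ _ _ _ _)), Real.norm_of_nonneg hnn]
      exact mul_le_mul (hφC t) (levelMeasure_le h2 _ _ _) (levelMeasure_nonneg _ _ _ _ _) hC
    · have : φ t = 0 := by
        by_cases h : t ≤ 0
        · exact hφ t h
        · exact hφT t (not_lt.1 fun h' => ht ⟨(not_le.1 h).le, h'.le⟩)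
      rw [this, zero_mul, norm_zero]; exact norm_nonneg _
  have hqm := D.measurable_localDeriv (lam := lam) hζ
  have iq : Integrable (fun z : ℝ × ℝ => φ z.1 * localDeriv ζ lam u Du z ^ 2) :=
    (D.memLp_localDeriv hζ hlam).integrable_sq.bdd_mul (c := C)
      (hφm.comp measurable_fst).aestronglyMeasurable (ae_of_all _ fun z => by
        rw [Real.norm_of_nonneg (hφ0 _)]; exact hφC _)
  refine ⟨iμ, iq, ?_⟩
  have iq' := iq
  rw [Measure.volume_eq_prod] at iq'
  have iS : Integrable fun t => φ t * ∫ x, localDeriv ζ lam u Du (t, x) ^ 2 := by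
    have := iq'.integral_prod_left
    simpa only [integral_const_mul] using this
  have eS : ∫ z : ℝ × ℝ, φ z.1 * localDeriv ζ lam u Du z ^ 2
      = ∫ t, φ t * ∫ x, localDeriv ζ lam u Du (t, x) ^ 2 := by
    rw [Measure.volume_eq_prod, integral_prod _ iq']
    simp only [integral_const_mul]
  rw [eS, ← integral_const_mul, ← integral_const_mul,
    ← integral_add (iS.const_mul _) (iμ.const_mul _)]
  have hnn : ∀ t, 0 ≤ ν / 8 * (φ t * ∫ x, localDeriv ζ lam u Du (t, x) ^ 2)
      + 2 * F ^ 2 / ν * (φ t * levelMeasure a' b' lam u t) := fun t => by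
    have e1 := levelMeasure_nonneg a' b' lam u t
    have e2 : 0 ≤ ∫ x, localDeriv ζ lam u Du (t, x) ^ 2 := integral_nonneg fun x => sq_nonneg _
    have := hφ0 t
    positivity
  have iSμ : Integrable fun t => ν / 8 * (φ t * ∫ x, localDeriv ζ lam u Du (t, x) ^ 2)
      + 2 * F ^ 2 / ν * (φ t * levelMeasure a' b' lam u t) :=
    (iS.const_mul _).add (iμ.const_mul _)
  rw [ofReal_integral_eq_lintegral_ofReal iSμ (ae_of_all _ hnn), Measure.volume_eq_prod]
  refine (lintegral_prod_le _).trans (lintegral_mono_ae ?_)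
  filter_upwards [D.sq_le_levelMeasure_mul hζ h1 h2 h3 hlam, hFM] with t ht hFt
  by_cases hφt : φ t = 0
  · simp [hφt]
  set μ := levelMeasure a' b' lam u t with hμ
  set S := ∫ y, localDeriv ζ lam u Du (t, y) ^ 2 with hS
  have hμ0 : 0 ≤ μ := levelMeasure_nonneg _ _ _ _ _
  have hS0 : 0 ≤ S := integral_nonneg fun x => sq_nonneg _
  have hb : ∀ᵐ x, ENNReal.ofReal (φ t * (ζ x ^ 2 * truncation lam u (t, x)))
      * memory k t₁ u u₀ (t, x) ≤ (Ioo a' b').indicator (fun x =>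
        ENNReal.ofReal (φ t * √(μ * S)) * memory k t₁ u u₀ (t, x)) x := by
    filter_upwards [ht] with x hx
    by_cases hxm : x ∈ Ioo a' b'
    · rw [indicator_of_mem hxm]
      refine mul_le_mul' (ENNReal.ofReal_le_ofReal
        (mul_le_mul_of_nonneg_left ?_ (hφ0 t))) le_rfl
      have hw := truncation_nonneg lam u (t, x)
      refine le_trans ?_ (Real.le_sqrt_of_sq_le hx)
      have := mul_le_mul_of_nonneg_right (hζ.le_one x) (mul_nonneg (hζ.nonneg x) hw)
      linarith
    · rw [hζ.zero x hxm]; simp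
  refine (lintegral_mono_ae hb).trans ?_
  rw [lintegral_indicator measurableSet_Ioo, lintegral_const_mul' _ _ ENNReal.ofReal_ne_top]
  refine (mul_le_mul' le_rfl (hFt hφt)).trans ?_
  rw [← ENNReal.ofReal_mul (mul_nonneg (hφ0 t) (Real.sqrt_nonneg _))]
  refine ENNReal.ofReal_le_ofReal ?_
  have key : √(μ * S) * F ≤ ν / 8 * S + 2 * F ^ 2 / ν * μ := by
    rw [Real.sqrt_mul hμ0]
    have h4 : 0 ≤ ν / 8 * (√S - 4 * F / ν * √μ) ^ 2 := by positivity
    have h5 : ν / 8 * (√S - 4 * F / ν * √μ) ^ 2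
        = ν / 8 * √S ^ 2 + 2 * F ^ 2 / ν * √μ ^ 2 - √μ * √S * F := by
      field_simp; ring
    rw [h5, Real.sq_sqrt hS0, Real.sq_sqrt hμ0] at h4
    linarith
  have := mul_le_mul_of_nonneg_left key (hφ0 t)
  show φ t * √(μ * S) * F ≤ ν / 8 * (φ t * S) + 2 * F ^ 2 / ν * (φ t * μ)
  linarith

/-- The local energy estimate. The function `g` selects the times at which the square of the
truncation is estimated without its derivative. The right-hand side carries the factor `c₁`, and
the first term on the left does not: it is small if `c₁` is. -/
lemma local_energy (D : ExtendedSubsolution k T a b u Du Q u₀) (H : IsKernelPair k l)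
    (hT : 0 < T) (hζ : IsCutoff a' b' K ζ) (h1 : a < a') (h2 : a' ≤ b') (h3 : b' < b)
    (hlam : 0 ≤ lam) (ht₁ : 0 ≤ t₁) (ht₁T : t₁ ≤ T) (hν : 0 < ν)
    (hQ1 : ∀ᵐ z, ν * Du z ^ 2 ≤ Q z * Du z) (hQ2 : ∀ᵐ z, |Q z| ≤ Λ * |Du z|)
    (hχ : Measurable χ) (hχ0 : ∀ t, 0 ≤ χ t) (hχ1 : ∀ t, χ t ≤ 1) (hL : 0 ≤ Lχ)
    (hχL : ∀ s t, s ≤ t → χ t ≤ χ s + Lχ * (t - s)) (hχt : ∀ t, t ≤ t₁ → χ t = 0)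
    (hg : Measurable g)
    (hg0 : ∀ t, 0 ≤ g t) (hg1 : ∀ t, g t ≤ 1) (hgT : ∀ t, T ≤ t → g t = 0) (hc₁ : 0 ≤ c₁)
    (hc : ∀ t, ∫ ρ, ext T l ρ * g (t + ρ) ≤ c₁)
    (hFM : ∀ t, t < T → χ t ≠ 0 →
      ∫⁻ x in Ioo a' b', memory k t₁ u u₀ (t, x) ≤ ENNReal.ofReal F) :
    (∫ z : ℝ × ℝ, χ z.1 * g z.1 * (ζ z.2 ^ 2 * truncation lam u z ^ 2 / 2))
      + ν / 4 * c₁ * (∫ z : ℝ × ℝ, χ z.1 * (ζ z.2 * truncationDeriv lam u Du z) ^ 2)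
      ≤ 2 * c₁ * (Lχ * (∫ s in (0 : ℝ)..(T - t₁), k s)
          * (∫ z : ℝ × ℝ, if t₁ ≤ z.1 then ζ z.2 ^ 2 * truncation lam u z ^ 2 / 2 else 0)
        + (2 * Λ ^ 2 / ν + ν / 4)
          * (∫ z : ℝ × ℝ, χ z.1 * (deriv ζ z.2 * truncation lam u z) ^ 2)
        + 2 * F ^ 2 / ν * ∫ t, χ t * (if t < T then levelMeasure a' b' lam u t else 0)) := by
  have hφm := measurable_weight (T := T) (c₁ := c₁) H hχ hg
  have hφ0 := weight_nonneg (T := T) H hc₁ hχ0 hg0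
  have hφ2 : ∀ t, weight l T c₁ χ g t ≤ 2 * c₁ * χ t := weight_le hχ0 hc₁ hc
  have hφC : ∀ t, weight l T c₁ χ g t ≤ 2 * c₁ := fun t =>
    (hφ2 t).trans (by
      have := mul_le_mul_of_nonneg_left (hχ1 t) hc₁; linarith)
  have hφt : ∀ t, t ≤ t₁ → weight l T c₁ χ g t = 0 := fun t ht => by
    rw [weight, hχt t ht, zero_mul, ite_self]
  have hφT : ∀ t, T ≤ t → weight l T c₁ χ g t = 0 := fun t ht => if_neg (not_lt.2 ht)
  have hφl : ∀ t, t < T → c₁ * χ t ≤ weight l T c₁ χ g t := fun t ht => le_weight H hχ0 hg0 ht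
  obtain ⟨iμ, iq, hX⟩ := D.lintegral_memory_le (k := k) (F := F) (t₁ := t₁) hζ h1 h2 h3 hlam hν
    hφm hφ0 hφC
    (fun t ht => hφt t (ht.trans ht₁)) hφT (ae_of_all _ fun t ht =>
      hFM t (not_le.1 fun h => ht (hφT t h)) fun h => ht (by
        rw [weight, h, zero_mul, ite_self]))
  have hX0 : 0 ≤ ν / 8 * (∫ z : ℝ × ℝ, weight l T c₁ χ g z.1 * localDeriv ζ lam u Du z ^ 2)
        + 2 * F ^ 2 / ν * ∫ t, weight l T c₁ χ g t * levelMeasure a' b' lam u t := by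
    have e1 : 0 ≤ ∫ z : ℝ × ℝ, weight l T c₁ χ g z.1 * localDeriv ζ lam u Du z ^ 2 :=
      integral_nonneg fun z => mul_nonneg (hφ0 _) (sq_nonneg _)
    have e2 : 0 ≤ ∫ t, weight l T c₁ χ g t * levelMeasure a' b' lam u t :=
      integral_nonneg fun z => mul_nonneg (hφ0 _) (levelMeasure_nonneg _ _ _ _ _)
    positivity
  have hmain := D.weighted_energy H hT hζ h1 h2 h3 hlam ht₁ ht₁T hχ hχ0 hχ1 hL hχL hχt hg hg0 hg1
    hgT hc₁ hc hX0 hX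
  have hst := D.spaceTest hζ h1 h2 h3 hlam hφm hφ0 hφC (fun t ht => hφt t (ht.trans ht₁)) hφT
  set φ := weight l T c₁ χ g with hφdef
  have ip := (D.memLp_mul_truncationDeriv (lam := lam) hζ).integrable_sq
  have iw := (D.memLp_deriv_mul hζ hlam).integrable_sq
  have ibd : ∀ {θ : ℝ → ℝ} {C : ℝ}, Measurable θ → (∀ t, 0 ≤ θ t) → (∀ t, θ t ≤ C) →
      ∀ {f : ℝ × ℝ → ℝ}, Integrable f → Integrable fun z : ℝ × ℝ => θ z.1 * f z :=
    fun hθ h0 hC f hf => hf.bdd_mul (hθ.comp measurable_fst).aestronglyMeasurable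
      (ae_of_all _ fun z => by rw [Real.norm_of_nonneg (h0 _)]; exact hC _)
  have ipφ := ibd hφm hφ0 hφC ip
  have iwφ := ibd hφm hφ0 hφC iw
  have ipχ := ibd hχ hχ0 hχ1 ip
  have iwχ := ibd hχ hχ0 hχ1 iw
  have iGQ : Integrable fun z : ℝ × ℝ => φ z.1 * (2 * ζ z.2 * deriv ζ z.2 * truncation lam u z
          + ζ z.2 ^ 2 * truncationDeriv lam u Du z) * Q z :=
    hst.memLp_deriv.integrable_mul D.memLp_flux
  have s1 : ν / 2 * (∫ z : ℝ × ℝ, φ z.1 * (ζ z.2 * truncationDeriv lam u Du z) ^ 2)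
      - 2 * Λ ^ 2 / ν * (∫ z : ℝ × ℝ, φ z.1 * (deriv ζ z.2 * truncation lam u z) ^ 2)
      ≤ ∫ z : ℝ × ℝ, φ z.1 * (2 * ζ z.2 * deriv ζ z.2 * truncation lam u z
          + ζ z.2 ^ 2 * truncationDeriv lam u Du z) * Q z := by
    rw [← integral_const_mul, ← integral_const_mul,
      ← integral_sub (ipφ.const_mul _) (iwφ.const_mul _)]
    refine integral_mono_ae ((ipφ.const_mul _).sub (iwφ.const_mul _)) iGQ ?_
    filter_upwards [hQ1, hQ2] with z hz1 hz2
    have := mul_le_mul_of_nonneg_left (le_flux_mul (lam := lam) (u := u) hν hζ hz1 hz2) (hφ0 z.1)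
    show ν / 2 * (φ z.1 * (ζ z.2 * truncationDeriv lam u Du z) ^ 2)
      - 2 * Λ ^ 2 / ν * (φ z.1 * (deriv ζ z.2 * truncation lam u z) ^ 2) ≤ _
    linarith
  have s2 : ∫ z : ℝ × ℝ, φ z.1 * localDeriv ζ lam u Du z ^ 2
      ≤ 2 * (∫ z : ℝ × ℝ, φ z.1 * (deriv ζ z.2 * truncation lam u z) ^ 2)
        + 2 * ∫ z : ℝ × ℝ, φ z.1 * (ζ z.2 * truncationDeriv lam u Du z) ^ 2 := by
    rw [← integral_const_mul, ← integral_const_mul,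
      ← integral_add (iwφ.const_mul _) (ipφ.const_mul _)]
    refine integral_mono iq ((iwφ.const_mul _).add (ipφ.const_mul _)) fun z => ?_
    show φ z.1 * (deriv ζ z.2 * truncation lam u z + ζ z.2 * truncationDeriv lam u Du z) ^ 2
      ≤ 2 * (φ z.1 * (deriv ζ z.2 * truncation lam u z) ^ 2)
        + 2 * (φ z.1 * (ζ z.2 * truncationDeriv lam u Du z) ^ 2)
    have := mul_nonneg (hφ0 z.1)
      (sq_nonneg (deriv ζ z.2 * truncation lam u z - ζ z.2 * truncationDeriv lam u Du z))
    linarith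
  have s3 : c₁ * (∫ z : ℝ × ℝ, χ z.1 * (ζ z.2 * truncationDeriv lam u Du z) ^ 2)
      ≤ ∫ z : ℝ × ℝ, φ z.1 * (ζ z.2 * truncationDeriv lam u Du z) ^ 2 := by
    rw [← integral_const_mul]
    refine integral_mono (ipχ.const_mul _) ipφ fun z => ?_
    show c₁ * (χ z.1 * (ζ z.2 * truncationDeriv lam u Du z) ^ 2)
      ≤ φ z.1 * (ζ z.2 * truncationDeriv lam u Du z) ^ 2
    rw [← mul_assoc]
    by_cases hz : z.1 < T
    · exact mul_le_mul_of_nonneg_right (hφl _ hz) (sq_nonneg _)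
    · have : ¬ lam < u z := by
        rw [D.zero z fun h => hz h.1.2]; exact not_lt.2 hlam
      simp [truncationDeriv, this]
  have s4 : ∫ z : ℝ × ℝ, φ z.1 * (deriv ζ z.2 * truncation lam u z) ^ 2
      ≤ 2 * c₁ * ∫ z : ℝ × ℝ, χ z.1 * (deriv ζ z.2 * truncation lam u z) ^ 2 := by
    rw [← integral_const_mul]
    refine integral_mono iwφ (iwχ.const_mul _) fun z => ?_
    show φ z.1 * _ ≤ 2 * c₁ * (χ z.1 * _)
    rw [← mul_assoc]
    exact mul_le_mul_of_nonneg_right (hφ2 _) (sq_nonneg _)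
  have iχμ : Integrable fun t => χ t * (if t < T then levelMeasure a' b' lam u t else 0) := by
    have : Integrable ((Icc 0 T).indicator fun _ => b' - a') :=
      (integrable_indicator_iff measurableSet_Icc).2 (integrableOn_const (by simp))
    refine this.mono (hχ.mul (Measurable.ite measurableSet_Iio
      (measurable_levelMeasure D.meas _ _ _) measurable_const)).aestronglyMeasurable
      (ae_of_all _ fun t => ?_)
    by_cases ht : t < T
    · by_cases ht' : t ≤ t₁
      · rw [hχt t ht', zero_mul, norm_zero]; exact norm_nonneg _
      · rw [indicator_of_mem (show t ∈ Icc 0 T from ⟨by linarith, ht.le⟩), if_pos ht,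
          Real.norm_of_nonneg (mul_nonneg (hχ0 _) (levelMeasure_nonneg _ _ _ _ _)),
          Real.norm_of_nonneg (sub_nonneg.2 h2)]
        exact (mul_le_of_le_one_left (levelMeasure_nonneg _ _ _ _ _) (hχ1 t)).trans
          (levelMeasure_le h2 _ _ _)
    · rw [if_neg ht, mul_zero, norm_zero]; exact norm_nonneg _
  have s5 : ∫ t, φ t * levelMeasure a' b' lam u t
      ≤ 2 * c₁ * ∫ t, χ t * (if t < T then levelMeasure a' b' lam u t else 0) := by
    rw [← integral_const_mul]
    refine integral_mono iμ (iχμ.const_mul _) fun t => ?_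
    show φ t * _ ≤ 2 * c₁ * (χ t * _)
    rw [← mul_assoc]
    split_ifs with ht
    · exact mul_le_mul_of_nonneg_right (hφ2 _) (levelMeasure_nonneg _ _ _ _ _)
    · rw [hφT t (not_lt.1 ht)]; simp
  have f1 := mul_le_mul_of_nonneg_left s2 (show 0 ≤ ν / 8 by positivity)
  have f3 := mul_le_mul_of_nonneg_left s3 (show 0 ≤ ν / 4 by positivity)
  have f4 := mul_le_mul_of_nonneg_left s4 (show 0 ≤ 2 * Λ ^ 2 / ν + ν / 4 by positivity)
  have f5 := mul_le_mul_of_nonneg_left s5 (show 0 ≤ 2 * F ^ 2 / ν by positivity)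
  linarith

end ExtendedSubsolution

/-! ### One step of De Giorgi's iteration -/

/-- The square integral of `(u - lam)₊` over `(s,T) × (x₀ - R, x₀ + R)`. -/
def levelEnergy (u : ℝ × ℝ → ℝ) (T x₀ lam s R : ℝ) : ℝ :=
  ∫ z in Ioo s T ×ˢ Ioo (x₀ - R) (x₀ + R), truncation lam u z ^ 2

/-- Among sets of given measure, an initial interval maximizes the integral of the nonincreasing
function `l`. -/
lemma IsKernelPair.integral_ext_l_indicator_le {k l : ℝ → ℝ} (H : IsKernelPair k l) {T : ℝ}
    {S : Set ℝ} (hS : MeasurableSet S) (hSf : volume S ≠ ∞) (t : ℝ) :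
    ∫ ρ, ext T l ρ * S.indicator 1 (t + ρ) ≤ conv (fun _ => 1) l (volume S).toReal := by
  set τ := (volume S).toReal with hτ
  have hτ0 : 0 ≤ τ := ENNReal.toReal_nonneg
  rw [IsKernelPair.conv_one]
  set S' : Set ℝ := (fun ρ => t + ρ) ⁻¹' S ∩ Ioo 0 T with hS'
  have hS'm : MeasurableSet S' := (measurable_const_add t hS).inter measurableSet_Ioo
  have hvol : volume S' ≤ volume S := by
    refine (measure_mono inter_subset_left).trans (le_of_eq ?_)
    exact measure_preimage_add volume t S
  have e1 : ∫ ρ, ext T l ρ * S.indicator 1 (t + ρ) = ∫ ρ in S', l ρ := by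
    rw [← integral_indicator hS'm]
    congr 1; ext ρ
    by_cases h1 : ρ ∈ Ioo 0 T
    · by_cases h2 : t + ρ ∈ S
      · rw [ext_of_mem h1, indicator_of_mem h2, indicator_of_mem (show ρ ∈ S' from ⟨h2, h1⟩)]
        simp
      · rw [indicator_of_notMem h2, indicator_of_notMem (fun h : ρ ∈ S' => h2 h.1), mul_zero]
    · rw [ext_of_notMem h1, indicator_of_notMem (fun h : ρ ∈ S' => h1 h.2), zero_mul]
  rw [e1, intervalIntegral_eq_setIntegral hτ0]
  rcases hτ0.eq_or_lt with h0 | h0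
  · have : volume S' = 0 := by
      have : volume S = 0 := by
        rcases (ENNReal.toReal_eq_zero_iff _).1 (hτ ▸ h0.symm) with h | h
        · exact h
        · exact absurd h hSf
      exact le_antisymm (this ▸ hvol) zero_le
    rw [setIntegral_measure_zero _ this, ← h0]; simp
  have hST : S' ⊆ Ioo 0 (max T 1) := fun x hx => ⟨hx.2.1, hx.2.2.trans_le (le_max_left _ _)⟩
  have iS : IntegrableOn l S' := (H.integrable_l (max T 1) (by positivity)).mono_set hST
  have iB : IntegrableOn l (Ioo 0 τ) := H.integrable_l τ h0
  have hfS : volume S' ≠ ∞ := (lt_of_le_of_lt hvol hSf.lt_top).ne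
  have d1 : ∫ x in S', l x = (∫ x in S' ∩ Ioo 0 τ, l x) + ∫ x in S' \ Ioo 0 τ, l x :=
    (integral_inter_add_sdiff measurableSet_Ioo iS).symm
  have d2 : ∫ x in Ioo 0 τ, l x = (∫ x in S' ∩ Ioo 0 τ, l x) + ∫ x in Ioo 0 τ \ S', l x := by
    rw [inter_comm]; exact (integral_inter_add_sdiff hS'm iB).symm
  have b1 : ∫ x in S' \ Ioo 0 τ, l x ≤ l τ * (volume (S' \ Ioo 0 τ)).toReal := by
    have hf : volume (S' \ Ioo 0 τ) ≠ ∞ :=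
      (lt_of_le_of_lt (measure_mono sdiff_subset) hfS.lt_top).ne
    refine (setIntegral_mono_on (g := fun _ => l τ) (iS.mono_set sdiff_subset)
      (integrableOn_const hf) (hS'm.diff measurableSet_Ioo) fun x hx => ?_).trans
      (le_of_eq ?_)
    · have : τ ≤ x := not_lt.1 fun h => hx.2 ⟨hx.1.2.1, h⟩
      exact H.antitone_l h0 (show 0 < x from hx.1.2.1) this
    · rw [setIntegral_const, smul_eq_mul, mul_comm]; rfl
  have b2 : l τ * (volume (Ioo 0 τ \ S')).toReal ≤ ∫ x in Ioo 0 τ \ S', l x := by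
    have hf : volume (Ioo 0 τ \ S') ≠ ∞ :=
      (lt_of_le_of_lt (measure_mono sdiff_subset)
        (by rw [Real.volume_Ioo]; exact ENNReal.ofReal_lt_top)).ne
    refine le_trans (le_of_eq ?_) (setIntegral_mono_on (f := fun _ => l τ)
      (integrableOn_const hf) (iB.mono_set sdiff_subset) (measurableSet_Ioo.diff hS'm)
      fun x hx => ?_)
    · rw [setIntegral_const, smul_eq_mul, mul_comm]; rfl
    · exact H.antitone_l (show 0 < x from hx.1.1) h0 hx.1.2.le
  have hm : (volume (S' \ Ioo 0 τ)).toReal ≤ (volume (Ioo 0 τ \ S')).toReal := by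
    refine ENNReal.toReal_mono (lt_of_le_of_lt (measure_mono sdiff_subset)
        (by rw [Real.volume_Ioo]; exact ENNReal.ofReal_lt_top)).ne ?_
    have hle : volume S' ≤ volume (Ioo 0 τ) := by
      refine hvol.trans ?_
      rw [Real.volume_Ioo, sub_zero, hτ, ENNReal.ofReal_toReal hSf]
    have m1 := measure_inter_add_sdiff (μ := volume) S' (measurableSet_Ioo (a := (0 : ℝ)) (b := τ))
    have m2 := measure_inter_add_sdiff (μ := volume) (Ioo (0 : ℝ) τ) hS'm
    rw [← m1, ← m2, inter_comm (Ioo 0 τ)] at hle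
    exact (ENNReal.add_le_add_iff_left
      (lt_of_le_of_lt (measure_mono inter_subset_left) hfS.lt_top).ne).1 hle
  have := mul_le_mul_of_nonneg_left hm (H.nonneg_l τ h0)
  linarith

/-- A piecewise linear cutoff in time. -/
def timeCutoff (s s' t : ℝ) : ℝ := max 0 (min 1 ((t - s) / (s' - s)))

section

variable {s s' : ℝ}

lemma continuous_timeCutoff (s s' : ℝ) : Continuous (timeCutoff s s') := by
  unfold timeCutoff; fun_prop

lemma timeCutoff_nonneg (s s' t : ℝ) : 0 ≤ timeCutoff s s' t := le_max_left _ _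

lemma timeCutoff_le_one (s s' t : ℝ) : timeCutoff s s' t ≤ 1 :=
  max_le zero_le_one (min_le_left _ _)

lemma timeCutoff_eq_zero (h : s < s') {t : ℝ} (ht : t ≤ s) : timeCutoff s s' t = 0 :=
  max_eq_left ((min_le_right _ _).trans
    (div_nonpos_of_nonpos_of_nonneg (by linarith) (by linarith)))

lemma timeCutoff_eq_one (h : s < s') {t : ℝ} (ht : s' ≤ t) : timeCutoff s s' t = 1 := by
  have : 1 ≤ (t - s) / (s' - s) := (one_le_div (sub_pos.2 h)).2 (by linarith)
  rw [timeCutoff, min_eq_left this, max_eq_right zero_le_one]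

lemma timeCutoff_le_add (h : s < s') {τ t : ℝ} (ht : τ ≤ t) :
    timeCutoff s s' t ≤ timeCutoff s s' τ + (s' - s)⁻¹ * (t - τ) := by
  have h0 : 0 < (s' - s)⁻¹ := inv_pos.2 (sub_pos.2 h)
  have h1 := timeCutoff_nonneg s s' τ
  have h2 : 0 ≤ (s' - s)⁻¹ * (t - τ) := mul_nonneg h0.le (by linarith)
  have e : (t - s) / (s' - s) = (τ - s) / (s' - s) + (s' - s)⁻¹ * (t - τ) := by
    rw [div_eq_mul_inv, div_eq_mul_inv]; ring
  refine max_le (by linarith) ?_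
  rcases le_total 1 ((τ - s) / (s' - s)) with h3 | h3
  · have : 1 ≤ timeCutoff s s' τ := by
      rw [timeCutoff, min_eq_left h3]; exact le_max_right _ _
    exact (min_le_left _ _).trans (by linarith)
  · have : (τ - s) / (s' - s) ≤ timeCutoff s s' τ := by
      rw [timeCutoff, min_eq_right h3]; exact le_max_right _ _
    exact (min_le_right _ _).trans (by rw [e]; linarith)

end

namespace ExtendedSubsolution

variable {k l : ℝ → ℝ} {T a b x₀ lam lam' s s' R R' ρ c₁ ν Λ F : ℝ} {u Du Q : ℝ × ℝ → ℝ}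
  {u₀ : ℝ → ℝ}

lemma integrableOn_truncation_sq (D : ExtendedSubsolution k T a b u Du Q u₀) (hlam : 0 ≤ lam)
    (S : Set (ℝ × ℝ)) : IntegrableOn (fun z => truncation lam u z ^ 2) S :=
  (D.memLp_truncation hlam).integrable_sq.integrableOn

lemma levelEnergy_nonneg (u : ℝ × ℝ → ℝ) (T x₀ lam s R : ℝ) : 0 ≤ levelEnergy u T x₀ lam s R :=
  integral_nonneg fun _ => sq_nonneg _

/-- Chebyshev's inequality for two levels. -/
lemma integral_levelMeasure_le (D : ExtendedSubsolution k T a b u Du Q u₀) (hlam : 0 ≤ lam)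
    (hlam' : lam < lam') (hR : 0 ≤ R) :
    IntegrableOn (levelMeasure (x₀ - R) (x₀ + R) lam' u) (Ioo s T) ∧
    (lam' - lam) ^ 2 * (∫ t in Ioo s T, levelMeasure (x₀ - R) (x₀ + R) lam' u t)
      ≤ levelEnergy u T x₀ lam s R := by
  have i1 : IntegrableOn (levelMeasure (x₀ - R) (x₀ + R) lam' u) (Ioo s T) := by
    refine Measure.integrableOn_of_bounded (M := x₀ + R - (x₀ - R)) (by simp)
      (measurable_levelMeasure D.meas _ _ _).aestronglyMeasurable (ae_of_all _ fun t => ?_)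
    rw [Real.norm_of_nonneg (levelMeasure_nonneg _ _ _ _ _)]
    exact levelMeasure_le (by linarith) _ _ _
  refine ⟨i1, ?_⟩
  have iw := D.integrableOn_truncation_sq hlam (Ioo s T ×ˢ Ioo (x₀ - R) (x₀ + R))
  rw [levelEnergy, Measure.volume_eq_prod, setIntegral_prod _ (by
    rwa [← Measure.volume_eq_prod]), ← integral_const_mul]
  have iw' := iw
  rw [IntegrableOn, Measure.volume_eq_prod, ← Measure.prod_restrict] at iw'
  refine integral_mono_ae (i1.const_mul _) iw'.integral_prod_left ?_
  filter_upwards [iw'.prod_right_ae] with t ht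
  set E : Set ℝ := {x | x ∈ Ioo (x₀ - R) (x₀ + R) ∧ lam' < u (t, x)} with hE
  have hEm : MeasurableSet E := measurableSet_Ioo.inter (measurableSet_lt measurable_const
    (D.meas.comp (measurable_const.prodMk measurable_id)))
  have hEf : volume E ≠ ∞ := by
    refine (lt_of_le_of_lt (measure_mono (t := Ioo (x₀ - R) (x₀ + R)) fun x hx => hx.1) ?_).ne
    rw [Real.volume_Ioo]; exact ENNReal.ofReal_lt_top
  have hsub : E ⊆ Ioo (x₀ - R) (x₀ + R) := fun x hx => hx.1
  calc (lam' - lam) ^ 2 * levelMeasure (x₀ - R) (x₀ + R) lam' u t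
      = ∫ x in E, (lam' - lam) ^ 2 := by
        rw [setIntegral_const, smul_eq_mul, mul_comm]; rfl
    _ ≤ ∫ x in E, truncation lam u (t, x) ^ 2 := by
        refine setIntegral_mono_on (integrableOn_const hEf) (IntegrableOn.mono_set ht hsub) hEm
          fun x hx => ?_
        refine pow_le_pow_left₀ (by linarith) ?_ 2
        rw [truncation]
        exact le_trans (by linarith [hx.2]) (le_max_left _ _)
    _ ≤ ∫ x in Ioo (x₀ - R) (x₀ + R), truncation lam u (t, x) ^ 2 :=
        setIntegral_mono_set ht (ae_of_all _ fun x => sq_nonneg _) hsub.eventuallyLE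

/-- Times at which the superlevel set is small: the truncation is controlled by its derivative. -/
lemma integral_sq_le_of_levelMeasure_le (D : ExtendedSubsolution k T a b u Du Q u₀) {a' b' K : ℝ}
    {ζ : ℝ → ℝ} (hζ : IsCutoff a' b' K ζ) (h1 : a < a') (h2 : a' ≤ b') (h3 : b' < b)
    (hlam : 0 ≤ lam) :
    ∀ᵐ t, levelMeasure a' b' lam u t ≤ ρ → ∫ x, (ζ x * truncation lam u (t, x)) ^ 2
      ≤ ρ ^ 2 * ∫ y, localDeriv ζ lam u Du (t, y) ^ 2 := by
  filter_upwards [D.sq_le_levelMeasure_mul hζ h1 h2 h3 hlam] with t ht hρ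
  set μ := levelMeasure a' b' lam u t with hμ
  set S := ∫ y, localDeriv ζ lam u Du (t, y) ^ 2 with hS
  have hμ0 : 0 ≤ μ := levelMeasure_nonneg _ _ _ _ _
  have hS0 : 0 ≤ S := integral_nonneg fun x => sq_nonneg _
  set E : Set ℝ := {x | x ∈ Ioo a' b' ∧ lam < u (t, x)} with hE
  have hEm : MeasurableSet E := measurableSet_Ioo.inter (measurableSet_lt measurable_const
    (D.meas.comp (measurable_const.prodMk measurable_id)))
  have hEf : volume E ≠ ∞ := by
    refine (lt_of_le_of_lt (measure_mono (t := Ioo a' b') fun x hx => hx.1) ?_).ne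
    rw [Real.volume_Ioo]; exact ENNReal.ofReal_lt_top
  calc ∫ x, (ζ x * truncation lam u (t, x)) ^ 2 ≤ ∫ x, E.indicator (fun _ => μ * S) x := by
        refine integral_mono_of_nonneg (ae_of_all _ fun x => sq_nonneg _)
          ((integrable_indicator_iff hEm).2 (integrableOn_const hEf)) ?_
        filter_upwards [ht] with x hx
        by_cases hxE : x ∈ E
        · rw [indicator_of_mem hxE]; exact hx
        · rw [indicator_of_notMem hxE]
          by_cases hxm : x ∈ Ioo a' b'
          · have : ¬ lam < u (t, x) := fun h => hxE ⟨hxm, h⟩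
            rw [truncation, max_eq_right (by linarith)]; simp
          · rw [hζ.zero x hxm]; simp
    _ = μ * (μ * S) := by
        rw [integral_indicator hEm, setIntegral_const, smul_eq_mul]; rfl
    _ ≤ ρ ^ 2 * S := by
        rw [← mul_assoc, ← sq]
        exact mul_le_mul_of_nonneg_right (pow_le_pow_left₀ hμ0 hρ 2) hS0

/-- One step of the iteration. The number `ρ` separates the times at which the superlevel set is
long from those at which it is short. If the former have total length `τ`, then
`ρ τ (lam' - lam)²` is at most the energy at the lower level, so that `c₁` has to bound `L(τ)` for
such `τ` only. -/
lemma levelEnergy_step {C₀ : ℝ} (hC₀ : HasCutoffs C₀)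
    (D : ExtendedSubsolution k T a b u Du Q u₀) (H : IsKernelPair k l)
    (hν : 0 < ν) (hQ1 : ∀ᵐ z, ν * Du z ^ 2 ≤ Q z * Du z) (hQ2 : ∀ᵐ z, |Q z| ≤ Λ * |Du z|)
    (hs : 0 ≤ s) (hss' : s < s') (hs'T : s' < T) (hlam : 0 ≤ lam) (hlam' : lam < lam')
    (hR' : 0 < R') (hRR' : R' < R) (haR : a < x₀ - R) (hbR : x₀ + R < b) (hρ : 0 < ρ)
    (hc₁ : 0 < c₁)
    (hc : ∀ τ, 0 ≤ τ → τ ≤ T - s → ρ * τ * (lam' - lam) ^ 2 ≤ levelEnergy u T x₀ lam s R →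
      conv (fun _ => 1) l τ ≤ c₁)
    (hFM : ∀ t, t < T → (s + s') / 2 < t →
      ∫⁻ x in Ioo (x₀ - R) (x₀ + R), memory k s u u₀ (t, x) ≤ ENNReal.ofReal F) :
    levelEnergy u T x₀ lam' s' R' ≤ (4 * c₁ + 24 * ρ ^ 2 / ν) *
      ((∫ σ in (0 : ℝ)..(T - s), k σ) / (s' - s)
        + (2 * Λ ^ 2 / ν + ν / 4) * (C₀ / (R - R')) ^ 2
        + 2 * F ^ 2 / ν / (lam' - lam) ^ 2) * levelEnergy u T x₀ lam s R := by
  obtain ⟨ζ, hζc, hζ0, hζ1, hζone, hζz, hζd⟩ := hC₀ (x₀ - R) (x₀ + R) (R - R') (by linarith)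
  have hζ : IsCutoff (x₀ - R) (x₀ + R) (C₀ / (R - R')) ζ :=
    ⟨hζc.of_le (by simp), hζ0, hζ1, hζz, hζd⟩
  have hT : 0 < T := by linarith
  have hlam0 : 0 ≤ lam' := by linarith
  have hR : x₀ - R ≤ x₀ + R := by linarith
  have hhalf : (s + s') / 2 < s' := by linarith
  set Y := levelEnergy u T x₀ lam s R with hY
  have hY0 : 0 ≤ Y := levelEnergy_nonneg _ _ _ _ _ _
  set χ := timeCutoff ((s + s') / 2) s' with hχdef
  have hχm : Measurable χ := (continuous_timeCutoff _ _).measurable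
  have hχ0 : ∀ t, 0 ≤ χ t := timeCutoff_nonneg _ _
  have hχ1 : ∀ t, χ t ≤ 1 := timeCutoff_le_one _ _
  have hχs : ∀ t, t ≤ (s + s') / 2 → χ t = 0 := fun t ht => timeCutoff_eq_zero hhalf ht
  set Lχ := (s' - (s + s') / 2)⁻¹ with hLχ
  have hL0 : 0 ≤ Lχ := inv_nonneg.2 (by linarith)
  set μ := levelMeasure (x₀ - R) (x₀ + R) lam' u with hμ
  have hμm : Measurable μ := measurable_levelMeasure D.meas _ _ _
  have hμ0 : ∀ t, 0 ≤ μ t := levelMeasure_nonneg _ _ _ _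
  obtain ⟨iμ, hμY⟩ := D.integral_levelMeasure_le (x₀ := x₀) (s := s) hlam hlam'
    (by linarith : 0 ≤ R)
  have hΔ : 0 < (lam' - lam) ^ 2 := by have := sub_pos.2 hlam'; positivity
  -- at the times in `𝒯` the gain from the weight is used, at the others the derivative
  set 𝒯 : Set ℝ := Ioo s T ∩ {t | ρ < μ t} with h𝒯
  have h𝒯m : MeasurableSet 𝒯 := measurableSet_Ioo.inter (measurableSet_lt measurable_const hμm)
  have h𝒯le : volume 𝒯 ≤ ENNReal.ofReal (T - s) := by
    rw [← Real.volume_Ioo]; exact measure_mono inter_subset_left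
  have h𝒯f : volume 𝒯 ≠ ∞ := (lt_of_le_of_lt h𝒯le ENNReal.ofReal_lt_top).ne
  have h𝒯ρ : ρ * (volume 𝒯).toReal ≤ ∫ t in Ioo s T, μ t := by
    calc ρ * (volume 𝒯).toReal = ∫ t in 𝒯, ρ := by
          rw [setIntegral_const, smul_eq_mul, mul_comm]; rfl
      _ ≤ ∫ t in 𝒯, μ t := setIntegral_mono_on (integrableOn_const h𝒯f)
          (iμ.mono_set inter_subset_left) h𝒯m fun t ht => ht.2.le
      _ ≤ ∫ t in Ioo s T, μ t := setIntegral_mono_set iμ (ae_of_all _ hμ0)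
          inter_subset_left.eventuallyLE
  have hc' : ∀ t, ∫ r, ext T l r * 𝒯.indicator 1 (t + r) ≤ c₁ := fun t => by
    refine (H.integral_ext_l_indicator_le h𝒯m h𝒯f t).trans (hc _ ENNReal.toReal_nonneg
      (ENNReal.toReal_le_of_le_ofReal (by linarith) h𝒯le) ?_)
    calc ρ * (volume 𝒯).toReal * (lam' - lam) ^ 2 ≤ (∫ t in Ioo s T, μ t) * (lam' - lam) ^ 2 :=
          mul_le_mul_of_nonneg_right h𝒯ρ hΔ.le
      _ ≤ Y := by rw [mul_comm]; exact hμY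
  have hg1 : ∀ t, 𝒯.indicator (1 : ℝ → ℝ) t ≤ 1 := fun t =>
    indicator_le_self' (fun _ _ => zero_le_one) t
  have hg0 : ∀ t, 0 ≤ 𝒯.indicator (1 : ℝ → ℝ) t := indicator_nonneg fun _ _ => zero_le_one
  have hen := D.local_energy (χ := χ) (F := F) H hT hζ haR hR hbR hlam0 hs
    (by linarith : s ≤ T) hν hQ1 hQ2 hχm hχ0 hχ1 hL0 (fun τ t h => timeCutoff_le_add hhalf h)
    (fun t ht => hχs t (by linarith)) (measurable_one.indicator h𝒯m) hg0 hg1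
    (fun t ht => indicator_of_notMem (fun h => not_lt.2 ht h.1.2) _) hc₁.le hc'
    fun t ht hχt => hFM t ht (not_le.1 fun h => hχt (hχs t h))
  set IG := ∫ z : ℝ × ℝ, χ z.1 * 𝒯.indicator 1 z.1 * (ζ z.2 ^ 2 * truncation lam' u z ^ 2 / 2)
    with hIG
  set P := ∫ z : ℝ × ℝ, χ z.1 * (ζ z.2 * truncationDeriv lam' u Du z) ^ 2 with hP
  set W := ∫ z : ℝ × ℝ, χ z.1 * (deriv ζ z.2 * truncation lam' u z) ^ 2 with hW
  set N := ∫ z : ℝ × ℝ, (if s ≤ z.1 then ζ z.2 ^ 2 * truncation lam' u z ^ 2 / 2 else 0) with hN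
  set V := ∫ t, χ t * (if t < T then μ t else 0) with hV
  set k₀ := ∫ σ in (0 : ℝ)..(T - s), k σ with hk₀
  have hk₀0 : 0 ≤ k₀ := by
    rw [hk₀, intervalIntegral_eq_setIntegral (by linarith)]
    exact setIntegral_nonneg measurableSet_Ioo fun x hx => H.nonneg_k x hx.1
  have hmono : ∀ z, truncation lam' u z ≤ truncation lam u z := fun z =>
    max_le_max (by linarith) le_rfl
  have hw0 : ∀ z, 0 ≤ truncation lam' u z := truncation_nonneg _ _
  have hsq : ∀ z, truncation lam' u z ^ 2 ≤ truncation lam u z ^ 2 := fun z =>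
    pow_le_pow_left₀ (hw0 z) (hmono z) 2
  set S : Set (ℝ × ℝ) := Ioo s T ×ˢ Ioo (x₀ - R) (x₀ + R) with hS
  have hSm : MeasurableSet S := measurableSet_Ioo.prod measurableSet_Ioo
  have hYind : Y = ∫ z, S.indicator (fun z => truncation lam u z ^ 2) z := by
    rw [integral_indicator hSm]; rfl
  have iY : Integrable (S.indicator fun z => truncation lam u z ^ 2) :=
    (integrable_indicator_iff hSm).2 (D.integrableOn_truncation_sq hlam S)
  have hz0 : ∀ z : ℝ × ℝ, T ≤ z.1 → truncation lam' u z = 0 := fun z hz =>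
    D.truncation_eq_zero hlam0 fun h => not_lt.2 hz h.1.2
  -- every term on the right-hand side of `hen` is a multiple of the energy at the lower level
  have hNY : N ≤ Y / 2 := by
    rw [hYind, ← integral_div]
    refine integral_mono_of_nonneg (ae_of_all _ fun z => ?_) (iY.div_const 2) ?_
    · show 0 ≤ if s ≤ z.1 then _ else _
      split_ifs
      · positivity
      · exact le_rfl
    · have hne : ∀ᵐ z : ℝ × ℝ, z.1 ≠ s := by
        have : ∀ᵐ t : ℝ, t ≠ s := by simp [ae_iff]
        rw [Measure.volume_eq_prod]
        exact Measure.quasiMeasurePreserving_fst.ae this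
      filter_upwards [hne] with z hz
      have hnn : 0 ≤ S.indicator (fun z => truncation lam u z ^ 2) z :=
        indicator_nonneg (fun _ _ => sq_nonneg _) _
      split_ifs with h
      · by_cases hzS : z ∈ S
        · rw [indicator_of_mem hzS]
          have := mul_le_mul (pow_le_one₀ (n := 2) (hζ0 z.2) (hζ1 z.2)) (hsq z) (sq_nonneg _)
            zero_le_one
          linarith
        · have : ζ z.2 ^ 2 * truncation lam' u z ^ 2 = 0 := by
            by_cases h1 : z.1 < T
            · rw [hζz z.2 fun h' => hzS ⟨⟨lt_of_le_of_ne h hz.symm, h1⟩, h'⟩]; ring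
            · rw [hz0 z (not_lt.1 h1)]; ring
          rw [this]; linarith
      · linarith
  have hWY : W ≤ (C₀ / (R - R')) ^ 2 * Y := by
    rw [hYind, ← integral_const_mul]
    refine integral_mono_of_nonneg (ae_of_all _ fun z => mul_nonneg (hχ0 _) (sq_nonneg _))
      (iY.const_mul _) (ae_of_all _ fun z => ?_)
    show χ z.1 * (deriv ζ z.2 * truncation lam' u z) ^ 2
      ≤ (C₀ / (R - R')) ^ 2 * S.indicator (fun z => truncation lam u z ^ 2) z
    by_cases hzS : z ∈ S
    · rw [indicator_of_mem hzS, mul_pow, ← sq_abs (deriv ζ z.2)]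
      refine (mul_le_of_le_one_left (by positivity) (hχ1 _)).trans ?_
      exact mul_le_mul (pow_le_pow_left₀ (abs_nonneg _) (hζd _) 2) (hsq z) (sq_nonneg _)
        (sq_nonneg _)
    · rw [indicator_of_notMem hzS, mul_zero]
      refine le_of_eq ?_
      by_cases h1 : T ≤ z.1
      · rw [hz0 z h1]; ring
      · by_cases h2 : z.1 ≤ s
        · rw [hχs _ (by linarith), zero_mul]
        · rw [hζ.deriv_eq_zero_of_notMem fun h' => hzS ⟨⟨not_le.1 h2, not_le.1 h1⟩, h'⟩]; ring
  have hVY : V ≤ Y / (lam' - lam) ^ 2 := by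
    rw [le_div_iff₀ hΔ, mul_comm]
    refine le_trans (mul_le_mul_of_nonneg_left ?_ hΔ.le) hμY
    rw [← integral_indicator measurableSet_Ioo]
    refine integral_mono_of_nonneg (ae_of_all _ fun t => ?_)
      ((integrable_indicator_iff measurableSet_Ioo).2 iμ) (ae_of_all _ fun t => ?_)
    · show 0 ≤ χ t * _
      refine mul_nonneg (hχ0 t) ?_
      split_ifs
      · exact hμ0 t
      · exact le_rfl
    · show χ t * _ ≤ _
      split_ifs with h1
      · by_cases h2 : t ≤ s
        · rw [hχs t (by linarith), zero_mul]
          exact indicator_nonneg (fun _ _ => hμ0 _) _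
        · rw [indicator_of_mem (show t ∈ Ioo s T from ⟨not_le.1 h2, h1⟩)]
          exact mul_le_of_le_one_left (hμ0 t) (hχ1 t)
      · rw [mul_zero]
        exact indicator_nonneg (fun _ _ => hμ0 _) _
  set Z := Lχ * k₀ * N + (2 * Λ ^ 2 / ν + ν / 4) * W + 2 * F ^ 2 / ν * V with hZ
  have hLχ2 : Lχ = 2 / (s' - s) := by
    rw [hLχ]; field_simp; ring
  have hZY : Z ≤ (k₀ / (s' - s) + (2 * Λ ^ 2 / ν + ν / 4) * (C₀ / (R - R')) ^ 2
        + 2 * F ^ 2 / ν / (lam' - lam) ^ 2) * Y := by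
    have e1 := mul_le_mul_of_nonneg_left hNY (mul_nonneg hL0 hk₀0)
    have e2 := mul_le_mul_of_nonneg_left hWY (show 0 ≤ 2 * Λ ^ 2 / ν + ν / 4 by positivity)
    have e3 := mul_le_mul_of_nonneg_left hVY (show 0 ≤ 2 * F ^ 2 / ν by positivity)
    have e4 : Lχ * k₀ * (Y / 2) = k₀ / (s' - s) * Y := by
      rw [hLχ2]; have := (sub_pos.2 hss').ne'; field_simp
    have e5 : 2 * F ^ 2 / ν * (Y / (lam' - lam) ^ 2) = 2 * F ^ 2 / ν / (lam' - lam) ^ 2 * Y := by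
      ring
    rw [hZ, add_mul, add_mul]
    linarith
  have hN0 : 0 ≤ N := integral_nonneg fun z => by
    show 0 ≤ if s ≤ z.1 then _ else _
    split_ifs
    · positivity
    · exact le_rfl
  have hW0 : 0 ≤ W := integral_nonneg fun z => mul_nonneg (hχ0 _) (sq_nonneg _)
  have hP0 : 0 ≤ P := integral_nonneg fun z => mul_nonneg (hχ0 _) (sq_nonneg _)
  have hIG0 : 0 ≤ IG := integral_nonneg fun z =>
    mul_nonneg (mul_nonneg (hχ0 _) (hg0 _)) (by positivity)
  have hV0 : 0 ≤ V := integral_nonneg fun t => by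
    show 0 ≤ χ t * _
    refine mul_nonneg (hχ0 t) ?_
    split_ifs
    · exact hμ0 t
    · exact le_rfl
  have hWZ : W ≤ 4 / ν * Z := by
    have e1 : 0 ≤ Lχ * k₀ * N + 2 * Λ ^ 2 / ν * W + 2 * F ^ 2 / ν * V := by positivity
    have e2 : ν / 4 * W ≤ Z := by rw [hZ]; linarith
    calc W = 4 / ν * (ν / 4 * W) := by field_simp
      _ ≤ _ := mul_le_mul_of_nonneg_left e2 (by positivity)
  have hPZ : P ≤ 8 / ν * Z := by
    have e1 : c₁ * (ν / 4 * P) ≤ c₁ * (2 * Z) := by linarith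
    have e2 := le_of_mul_le_mul_left e1 hc₁
    calc P = 4 / ν * (ν / 4 * P) := by field_simp
      _ ≤ 4 / ν * (2 * Z) := mul_le_mul_of_nonneg_left e2 (by positivity)
      _ = _ := by ring
  have hIGZ : IG ≤ 2 * c₁ * Z := by
    have : 0 ≤ ν / 4 * c₁ * P := by positivity
    linarith
  -- split the energy at the upper level by `𝒯`, with `hIGZ` on `𝒯` and `hPZ` outside of it
  have hζm : Measurable ζ := hζ.contDiff.continuous.measurable
  have ibd : ∀ {θ : ℝ → ℝ}, Measurable θ → (∀ t, 0 ≤ θ t) → (∀ t, θ t ≤ 1) →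
      ∀ {f : ℝ × ℝ → ℝ}, Integrable f → Integrable fun z : ℝ × ℝ => θ z.1 * f z :=
    fun hθ h0 hC f hf => hf.bdd_mul (c := 1) (hθ.comp measurable_fst).aestronglyMeasurable
      (ae_of_all _ fun z => by rw [Real.norm_of_nonneg (h0 _)]; exact hC _)
  have iζw : Integrable fun z : ℝ × ℝ => (ζ z.2 * truncation lam' u z) ^ 2 := by
    refine (D.memLp_truncation hlam0).integrable_sq.mono
      (((hζm.comp measurable_snd).mul
        (D.measurable_truncation lam')).pow_const 2).aestronglyMeasurable
      (ae_of_all _ fun z => ?_)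
    rw [Real.norm_of_nonneg (sq_nonneg _), Real.norm_of_nonneg (sq_nonneg _), mul_pow]
    exact mul_le_of_le_one_left (sq_nonneg _) (pow_le_one₀ (hζ0 _) (hζ1 _))
  have iq := (D.memLp_localDeriv (lam := lam') hζ hlam0).integrable_sq
  set θ : ℝ → ℝ := fun t => χ t * (1 - 𝒯.indicator 1 t) with hθ
  have hθm : Measurable θ := hχm.mul (measurable_const.sub (measurable_one.indicator h𝒯m))
  have hθ0 : ∀ t, 0 ≤ θ t := fun t => mul_nonneg (hχ0 t) (sub_nonneg.2 (hg1 t))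
  have hθχ : ∀ t, θ t ≤ χ t := fun t => mul_le_of_le_one_right (hχ0 t) (by linarith [hg0 t])
  have iθ := ibd hθm hθ0 (fun t => (hθχ t).trans (hχ1 t)) iζw
  have ig : Integrable fun z : ℝ × ℝ => χ z.1 * 𝒯.indicator 1 z.1
      * (ζ z.2 ^ 2 * truncation lam' u z ^ 2 / 2) := by
    refine (ibd (hχm.mul (measurable_one.indicator h𝒯m)) (fun t => mul_nonneg (hχ0 t) (hg0 t))
      (fun t => mul_le_one₀ (hχ1 t) (hg0 t) (hg1 t)) (iζw.div_const 2)).congr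
      (ae_of_all _ fun z => ?_)
    simp only [mul_pow, Pi.mul_apply]
  have iχq := ibd hχm hχ0 hχ1 iq
  have hshort : ∫ z : ℝ × ℝ, θ z.1 * (ζ z.2 * truncation lam' u z) ^ 2
      ≤ ρ ^ 2 * ∫ z : ℝ × ℝ, χ z.1 * localDeriv ζ lam' u Du z ^ 2 := by
    have iθ' := iθ
    have iχq' := iχq
    rw [Measure.volume_eq_prod] at iθ' iχq'
    rw [Measure.volume_eq_prod, integral_prod _ iθ', integral_prod _ iχq', ← integral_const_mul]
    refine integral_mono_ae iθ'.integral_prod_left (iχq'.integral_prod_left.const_mul _) ?_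
    filter_upwards [D.integral_sq_le_of_levelMeasure_le (ρ := ρ) hζ haR hR hbR hlam0] with t ht
    show ∫ x, θ t * (ζ x * truncation lam' u (t, x)) ^ 2
      ≤ ρ ^ 2 * ∫ x, χ t * localDeriv ζ lam' u Du (t, x) ^ 2
    rw [integral_const_mul, integral_const_mul]
    have hS0 : 0 ≤ ∫ x, localDeriv ζ lam' u Du (t, x) ^ 2 := integral_nonneg fun x => sq_nonneg _
    by_cases h1 : T ≤ t
    · have : ∀ x, truncation lam' u (t, x) = 0 := fun x => hz0 (t, x) h1
      simp only [this, mul_zero]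
      have := mul_nonneg (hχ0 t) hS0
      simp only [ne_eq, OfNat.ofNat_ne_zero, not_false_eq_true, zero_pow, integral_zero, mul_zero]
      positivity
    by_cases h2 : t ≤ s
    · simp only [hθ, hχs t (by linarith), zero_mul, mul_zero, le_refl]
    by_cases h3 : ρ < μ t
    · have : t ∈ 𝒯 := ⟨⟨not_le.1 h2, not_le.1 h1⟩, h3⟩
      simp only [hθ, indicator_of_mem this, Pi.one_apply, sub_self, mul_zero, zero_mul]
      have := mul_nonneg (hχ0 t) hS0
      positivity
    · calc θ t * ∫ x, (ζ x * truncation lam' u (t, x)) ^ 2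
          ≤ χ t * (ρ ^ 2 * ∫ x, localDeriv ζ lam' u Du (t, x) ^ 2) :=
            mul_le_mul (hθχ t) (ht (not_lt.1 h3)) (integral_nonneg fun x => sq_nonneg _) (hχ0 t)
        _ = _ := by ring
  have hqPW : ∫ z : ℝ × ℝ, χ z.1 * localDeriv ζ lam' u Du z ^ 2 ≤ 2 * W + 2 * P := by
    have ip := ibd hχm hχ0 hχ1 (D.memLp_mul_truncationDeriv (lam := lam') hζ).integrable_sq
    have iw := ibd hχm hχ0 hχ1 (D.memLp_deriv_mul hζ hlam0).integrable_sq
    rw [hW, hP, ← integral_const_mul, ← integral_const_mul,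
      ← integral_add (iw.const_mul _) (ip.const_mul _)]
    refine integral_mono iχq ((iw.const_mul _).add (ip.const_mul _)) fun z => ?_
    show χ z.1 * (deriv ζ z.2 * truncation lam' u z + ζ z.2 * truncationDeriv lam' u Du z) ^ 2
      ≤ 2 * (χ z.1 * (deriv ζ z.2 * truncation lam' u z) ^ 2)
        + 2 * (χ z.1 * (ζ z.2 * truncationDeriv lam' u Du z) ^ 2)
    have := mul_nonneg (hχ0 z.1)
      (sq_nonneg (deriv ζ z.2 * truncation lam' u z - ζ z.2 * truncationDeriv lam' u Du z))
    linarith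
  have hnext : levelEnergy u T x₀ lam' s' R' ≤ 2 * IG
      + ∫ z : ℝ × ℝ, θ z.1 * (ζ z.2 * truncation lam' u z) ^ 2 := by
    rw [levelEnergy, ← integral_indicator (measurableSet_Ioo.prod measurableSet_Ioo), hIG,
      ← integral_const_mul, ← integral_add (ig.const_mul _) iθ]
    refine integral_mono_of_nonneg (ae_of_all _ fun z =>
      indicator_nonneg (fun _ _ => sq_nonneg _) _) ((ig.const_mul _).add iθ)
      (ae_of_all _ fun z => ?_)
    show indicator _ _ z ≤ 2 * (χ z.1 * 𝒯.indicator 1 z.1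
      * (ζ z.2 ^ 2 * truncation lam' u z ^ 2 / 2))
      + χ z.1 * (1 - 𝒯.indicator 1 z.1) * (ζ z.2 * truncation lam' u z) ^ 2
    rw [show ∀ A B C D : ℝ, 2 * (A * B * (C ^ 2 * D ^ 2 / 2)) + A * (1 - B) * (C * D) ^ 2
      = A * (C * D) ^ 2 from fun A B C D => by ring]
    by_cases hz : z ∈ Ioo s' T ×ˢ Ioo (x₀ - R') (x₀ + R')
    · have e1 : ζ z.2 = 1 := hζone _ ⟨by linarith [hz.2.1], by linarith [hz.2.2]⟩
      have e2 : χ z.1 = 1 := timeCutoff_eq_one hhalf hz.1.1.le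
      rw [indicator_of_mem hz, e1, e2, one_mul, one_mul]
    · rw [indicator_of_notMem hz]
      exact mul_nonneg (hχ0 _) (sq_nonneg _)
  have hρ2 : 0 ≤ ρ ^ 2 := sq_nonneg ρ
  calc levelEnergy u T x₀ lam' s' R'
      ≤ 2 * (2 * c₁ * Z) + ρ ^ 2 * (2 * (4 / ν * Z) + 2 * (8 / ν * Z)) := by
        have := mul_le_mul_of_nonneg_left hqPW hρ2
        have h5 : ρ ^ 2 * (2 * W + 2 * P) ≤ ρ ^ 2 * (2 * (4 / ν * Z) + 2 * (8 / ν * Z)) :=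
          mul_le_mul_of_nonneg_left (by linarith) hρ2
        linarith
    _ = (4 * c₁ + 24 * ρ ^ 2 / ν) * Z := by ring
    _ ≤ (4 * c₁ + 24 * ρ ^ 2 / ν) * ((k₀ / (s' - s)
        + (2 * Λ ^ 2 / ν + ν / 4) * (C₀ / (R - R')) ^ 2
        + 2 * F ^ 2 / ν / (lam' - lam) ^ 2) * Y) :=
        mul_le_mul_of_nonneg_left hZY (by positivity)
    _ = _ := by ring

end ExtendedSubsolution

/-! ### Growth of the kernels at the intrinsic scale -/

namespace IsKernelPair

variable {k l : ℝ → ℝ}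

lemma mul_l_le_conv_one (H : IsKernelPair k l) {t : ℝ} (ht : 0 < t) :
    t * l t ≤ conv (fun _ => 1) l t := by
  rw [IsKernelPair.conv_one, intervalIntegral_eq_setIntegral ht.le]
  calc t * l t = ∫ _ in Ioo 0 t, l t := by
        rw [setIntegral_const, smul_eq_mul, Measure.real, Real.volume_Ioo, sub_zero,
          ENNReal.toReal_ofReal ht.le]
    _ ≤ _ := setIntegral_mono_on (integrableOn_const (by simp)) (H.integrable_l t ht)
        measurableSet_Ioo fun s hs => H.antitone_l hs.1 ht hs.2.le

/-- The higher integrability of `l` turns into a power bound for its primitive, by Hölder's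
inequality; beyond `Φ` the primitive grows at most linearly. -/
lemma conv_one_le_rpow (H : IsKernelPair k l) {p₀ cbar s₀ Φ η τ : ℝ} (hp : 1 < p₀)
    (hcb : 1 < cbar) (hmem : MemLp l (ENNReal.ofReal p₀) (volume.restrict (Ioo 0 s₀)))
    (hav : ∀ t : ℝ, 0 < t → t ≤ s₀ → 1 / t * ∫ s in (0 : ℝ)..t, (l s) ^ p₀ ≤ cbar * (l t) ^ p₀)
    (hΦ : 0 < Φ) (hΦs : Φ ≤ s₀) (hτ : 0 ≤ τ) (hτη : τ ≤ η * Φ) :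
    conv (fun _ => 1) l τ
      ≤ cbar * max 1 η * (τ / Φ) ^ (1 - 1 / p₀) * conv (fun _ => 1) l Φ := by
  have hp0 : 0 < p₀ := by linarith
  have hβ : 0 < 1 - 1 / p₀ := sub_pos.2 ((div_lt_one hp0).2 hp)
  have hL0 : 0 ≤ conv (fun _ => 1) l Φ := H.conv_one_nonneg hΦ.le
  have hM1 : 1 ≤ max 1 η := le_max_left _ _
  rcases hτ.eq_or_lt with h0 | h0
  · rw [← h0, zero_div, Real.zero_rpow hβ.ne', mul_zero, zero_mul, IsKernelPair.conv_one]
    simp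
  rcases le_total τ Φ with h | h
  · have hq : p₀.HolderConjugate (p₀ / (p₀ - 1)) := Real.HolderConjugate.conjExponent hp
    have hlm : MemLp l (ENNReal.ofReal p₀) (volume.restrict (Ioo 0 τ)) :=
      hmem.mono_measure (Measure.restrict_mono (Ioo_subset_Ioo_right (h.trans hΦs)) le_rfl)
    have hfin : IsFiniteMeasure (volume.restrict (Ioo (0 : ℝ) τ)) := ⟨by simp⟩
    have hold := integral_mul_le_Lp_mul_Lq_of_nonneg (μ := volume.restrict (Ioo 0 τ)) hq (f := l)
      (g := fun _ => 1)
      ((ae_restrict_mem measurableSet_Ioo).mono fun x hx => H.nonneg_l x hx.1)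
      (ae_of_all _ fun _ => zero_le_one) hlm (memLp_const 1)
    have hLp : ∀ t, 0 < t → ∫ s in (0 : ℝ)..t, (l s) ^ p₀ = ∫ s in Ioo 0 t, (l s) ^ p₀ :=
      fun t ht => intervalIntegral_eq_setIntegral ht.le _
    have hmemΦ : MemLp l (ENNReal.ofReal p₀) (volume.restrict (Ioo 0 Φ)) :=
      hmem.mono_measure (Measure.restrict_mono (Ioo_subset_Ioo_right hΦs) le_rfl)
    have hintΦ : IntegrableOn (fun s => (l s) ^ p₀) (Ioo 0 Φ) := by
      refine ((hmemΦ.integrable_norm_rpow (by simpa using hp0) (by simp)).congr ?_)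
      filter_upwards [ae_restrict_mem measurableSet_Ioo] with s hs
      rw [Real.norm_of_nonneg (H.nonneg_l s hs.1), ENNReal.toReal_ofReal hp0.le]
    have hI : ∫ s in Ioo 0 τ, (l s) ^ p₀ ≤ Φ * (cbar * l Φ ^ p₀) := by
      have e1 := hav Φ hΦ hΦs
      rw [hLp Φ hΦ] at e1
      have e2 : ∫ s in Ioo 0 Φ, (l s) ^ p₀ ≤ Φ * (cbar * l Φ ^ p₀) := by
        have := mul_le_mul_of_nonneg_left e1 hΦ.le
        rwa [← mul_assoc, mul_one_div_cancel hΦ.ne', one_mul] at this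
      refine le_trans (setIntegral_mono_set hintΦ ?_ (Ioo_subset_Ioo_right h).eventuallyLE) e2
      filter_upwards [ae_restrict_mem measurableSet_Ioo] with s hs
        using Real.rpow_nonneg (H.nonneg_l s hs.1) _
    have hlΦ : 0 ≤ l Φ := H.nonneg_l Φ hΦ
    have hroot : (∫ s in Ioo 0 τ, (l s) ^ p₀) ^ (1 / p₀) ≤ Φ ^ (1 / p₀) * cbar * l Φ := by
      have hi0 : 0 ≤ ∫ s in Ioo 0 τ, (l s) ^ p₀ :=
        setIntegral_nonneg measurableSet_Ioo fun s hs => Real.rpow_nonneg (H.nonneg_l s hs.1) _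
      refine (Real.rpow_le_rpow hi0 hI (by positivity)).trans ?_
      rw [Real.mul_rpow hΦ.le (by positivity), Real.mul_rpow (by linarith) (by positivity),
        ← Real.rpow_mul hlΦ, mul_one_div_cancel hp0.ne', Real.rpow_one, mul_assoc]
      refine mul_le_mul_of_nonneg_left (mul_le_mul_of_nonneg_right ?_ hlΦ) (by positivity)
      calc cbar ^ (1 / p₀) ≤ cbar ^ (1 : ℝ) :=
            Real.rpow_le_rpow_of_exponent_le hcb.le ((div_le_one hp0).2 hp.le)
        _ = cbar := Real.rpow_one _
    have hone : (∫ _ in Ioo (0 : ℝ) τ, (1 : ℝ) ^ (p₀ / (p₀ - 1))) ^ (1 / (p₀ / (p₀ - 1)))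
        = τ ^ (1 - 1 / p₀) := by
      rw [Real.one_rpow, setIntegral_const, smul_eq_mul, mul_one, Measure.real, Real.volume_Ioo,
        sub_zero, ENNReal.toReal_ofReal hτ]
      congr 1
      have : p₀ - 1 ≠ 0 := (sub_pos.2 hp).ne'
      field_simp
    rw [hone] at hold
    simp only [mul_one] at hold
    rw [IsKernelPair.conv_one l τ, intervalIntegral_eq_setIntegral hτ]
    refine hold.trans ((mul_le_mul_of_nonneg_right hroot (Real.rpow_nonneg hτ _)).trans ?_)
    have hΦl := H.mul_l_le_conv_one hΦ
    have e1 : Φ ^ (1 / p₀) * cbar * l Φ * τ ^ (1 - 1 / p₀)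
        = cbar * (τ / Φ) ^ (1 - 1 / p₀) * (Φ * l Φ) := by
      rw [Real.div_rpow hτ hΦ.le, Real.rpow_sub hΦ, Real.rpow_one]
      have : Φ ^ (1 / p₀) ≠ 0 := (Real.rpow_pos_of_pos hΦ _).ne'
      field_simp
    rw [e1]
    have hnn : 0 ≤ (τ / Φ) ^ (1 - 1 / p₀) := Real.rpow_nonneg (by positivity) _
    refine mul_le_mul (mul_le_mul_of_nonneg_right ?_ hnn) hΦl (by positivity) (by positivity)
    nlinarith
  · have hx : 1 ≤ τ / Φ := (one_le_div hΦ).2 h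
    have hxη : τ / Φ ≤ η := (div_le_iff₀ hΦ).2 hτη
    have e1 := H.mul_conv_one_le hΦ h
    have e2 : conv (fun _ => 1) l τ ≤ τ / Φ * conv (fun _ => 1) l Φ := by
      rw [div_mul_eq_mul_div, le_div_iff₀ hΦ]; linarith
    refine e2.trans (mul_le_mul_of_nonneg_right ?_ hL0)
    calc τ / Φ = (τ / Φ) ^ (1 / p₀) * (τ / Φ) ^ (1 - 1 / p₀) := by
          rw [← Real.rpow_add (by linarith), add_sub_cancel, Real.rpow_one]
      _ ≤ cbar * max 1 η * (τ / Φ) ^ (1 - 1 / p₀) := by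
          refine mul_le_mul_of_nonneg_right ?_ (Real.rpow_nonneg (by linarith) _)
          calc (τ / Φ) ^ (1 / p₀) ≤ (τ / Φ) ^ (1 : ℝ) :=
                Real.rpow_le_rpow_of_exponent_le hx ((div_le_one hp0).2 hp.le)
            _ = τ / Φ := Real.rpow_one _
            _ ≤ 1 * max 1 η := by rw [one_mul]; exact hxη.trans (le_max_right _ _)
            _ ≤ _ := mul_le_mul_of_nonneg_right hcb.le (by positivity)

end IsKernelPair

/-! ### The tail -/

/-- The tail of a solution: the contribution of the initial value and of the times before `t₁`, as
seen at the time `T`. -/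
def pastTail (k : ℝ → ℝ) (u : ℝ × ℝ → ℝ) (u₀ : ℝ → ℝ) (T x₀ t₁ R : ℝ) : ℝ≥0∞ :=
  kRight k t₁ * (∫⁻ x in Ioo (x₀ - R) (x₀ + R), ENNReal.ofReal (u₀ x))
    + ∫⁻ τ in Ioo 0 t₁, ENNReal.ofReal (-kdot k (T - τ))
      * ∫⁻ x in Ioo (x₀ - R) (x₀ + R), ENNReal.ofReal (u (τ, x))

/-- The integral of a nonnegative function over `(t₁,T) × (x₀ - R, x₀ + R)`. -/
def mass (u : ℝ × ℝ → ℝ) (T x₀ t₁ R : ℝ) : ℝ≥0∞ :=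
  ∫⁻ t in Ioo t₁ T, ∫⁻ x in Ioo (x₀ - R) (x₀ + R), ENNReal.ofReal (u (t, x))

lemma ofReal_le_kRight {k : ℝ → ℝ} {s t : ℝ} (h : s < t) : ENNReal.ofReal (k t) ≤ kRight k s :=
  le_iSup₂_of_le t h le_rfl

lemma kRight_anti (k : ℝ → ℝ) {s t : ℝ} (h : s ≤ t) : kRight k t ≤ kRight k s :=
  iSup₂_le fun _ hr => ofReal_le_kRight (lt_of_le_of_lt h hr)

lemma measurable_kdot (k : ℝ → ℝ) : Measurable (kdot k) := measurable_deriv k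

/-- The memory with respect to the time `s`, split at an earlier time `t₁`: before `t₁` it is
comparable with the tail, and between `t₁` and `s` the kernel is bounded. -/
lemma lintegral_memory_le_pastTail {k : ℝ → ℝ} {u : ℝ × ℝ → ℝ} {u₀ : ℝ → ℝ} (hu : Measurable u)
    (hu₀ : Measurable u₀) {T x₀ t₁ s t R R' p q : ℝ} (hsT : s ≤ T) (hst : t₁ < t) (hp1 : 1 ≤ p)
    (hp : ∀ τ ∈ Ioo 0 t₁, -kdot k (t - τ) ≤ p * -kdot k (T - τ))
    (hq : ∀ τ ∈ Ico t₁ s, -kdot k (t - τ) ≤ q) (hR : R ≤ R') :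
    ∫⁻ x in Ioo (x₀ - R) (x₀ + R), memory k s u u₀ (t, x)
      ≤ ENNReal.ofReal p * pastTail k u u₀ T x₀ t₁ R'
        + ENNReal.ofReal q * mass u T x₀ t₁ R' := by
  have hp0 : 0 ≤ p := by linarith
  have hsub : Ioo (x₀ - R) (x₀ + R) ⊆ Ioo (x₀ - R') (x₀ + R') :=
    Ioo_subset_Ioo (by linarith) (by linarith)
  refine (lintegral_mono_set hsub).trans ?_
  set B := Ioo (x₀ - R') (x₀ + R') with hB
  have hum : ∀ τ, Measurable fun x => ENNReal.ofReal (u (τ, x)) := fun τ =>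
    (hu.comp (measurable_const.prodMk measurable_id)).ennreal_ofReal
  simp only [memory]
  rw [lintegral_add_right _ (hu₀.ennreal_ofReal.const_mul _),
    lintegral_const_mul _ hu₀.ennreal_ofReal, lintegral_lintegral_swap (by
      refine Measurable.aemeasurable ?_
      exact (((measurable_kdot k).comp (by fun_prop)).neg.ennreal_ofReal).mul
        (hu.comp (measurable_snd.prodMk measurable_fst)).ennreal_ofReal)]
  simp only [lintegral_const_mul _ (hum _)]
  have e1 : ∫⁻ τ in Ioo 0 s, ENNReal.ofReal (-kdot k (t - τ))
        * ∫⁻ x in B, ENNReal.ofReal (u (τ, x))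
      ≤ ENNReal.ofReal p * (∫⁻ τ in Ioo 0 t₁, ENNReal.ofReal (-kdot k (T - τ))
        * ∫⁻ x in B, ENNReal.ofReal (u (τ, x))) + ENNReal.ofReal q * mass u T x₀ t₁ R' := by
    have hss : Ioo 0 s ⊆ Ioo 0 t₁ ∪ Ico t₁ s := fun τ hτ => by
      rcases lt_or_ge τ t₁ with h | h
      · exact Or.inl ⟨hτ.1, h⟩
      · exact Or.inr ⟨h, hτ.2⟩
    refine (lintegral_mono_set hss).trans ((lintegral_union_le _ _ _).trans (add_le_add ?_ ?_))
    · rw [← lintegral_const_mul' _ _ ENNReal.ofReal_ne_top]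
      refine setLIntegral_mono' measurableSet_Ioo fun τ hτ => ?_
      rw [← mul_assoc, ← ENNReal.ofReal_mul hp0]
      exact mul_le_mul' (ENNReal.ofReal_le_ofReal (hp τ hτ)) le_rfl
    · rw [mass, ← lintegral_const_mul' _ _ ENNReal.ofReal_ne_top]
      refine (setLIntegral_mono' measurableSet_Ico fun τ hτ =>
        mul_le_mul' (ENNReal.ofReal_le_ofReal (hq τ hτ)) le_rfl).trans ?_
      rw [← restrict_Ioo_eq_restrict_Ico]
      exact lintegral_mono_set (Ioo_subset_Ioo_right hsT)
  have e2 : ENNReal.ofReal (k t) * ∫⁻ x in B, ENNReal.ofReal (u₀ x)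
      ≤ ENNReal.ofReal p * (kRight k t₁ * ∫⁻ x in B, ENNReal.ofReal (u₀ x)) := by
    refine (mul_le_mul' (ofReal_le_kRight hst) le_rfl).trans ?_
    exact le_mul_of_one_le_left' (by simpa using hp1)
  rw [pastTail, mul_add]
  calc _ ≤ _ := add_le_add e1 e2
    _ = _ := by ring

/-- The standing assumptions at an intrinsic scale: `u` is a subsolution in `(0,T) × B_r(x₀)`, and
`Φ` is the time belonging to the radius `r`. The assumptions on the kernels enter through `power`,
`deriv_bound` and `scaling`; the value of the function `c` at `η` is `cη`. -/
structure LocalSetting (k l : ℝ → ℝ) (ν Λ η cbar c₀ cη ω p₀ r Φ T x₀ : ℝ) (u Du Q : ℝ × ℝ → ℝ)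
    (u₀ : ℝ → ℝ) : Prop where
  subsolution : ExtendedSubsolution k T (x₀ - r) (x₀ + r) u Du Q u₀
  kernel : IsKernelPair k l
  ν_pos : 0 < ν
  coercive : ∀ᵐ z, ν * Du z ^ 2 ≤ Q z * Du z
  bounded : ∀ᵐ z, |Q z| ≤ Λ * |Du z|
  η_pos : 0 < η
  one_lt_cbar : 1 < cbar
  one_lt_p₀ : 1 < p₀
  c₀_pos : 0 < c₀
  cη_pos : 0 < cη
  ω_pos : 0 < ω
  r_pos : 0 < r
  Φ_pos : 0 < Φ
  Φ_le_one : Φ ≤ 1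
  mul_Φ_le_one : η * Φ ≤ 1
  mul_Φ_le : η * Φ ≤ T
  conv_one_Φ : conv (fun _ => 1) l Φ = r ^ 2
  power : ∀ τ, 0 ≤ τ → τ ≤ η * Φ →
    conv (fun _ => 1) l τ ≤ cbar * max 1 η * (τ / Φ) ^ (1 - 1 / p₀) * r ^ 2
  deriv_bound : ∀ y : ℝ, 0 < y → y ≤ 1 → -kdot k y ≤ c₀ / (y * conv (fun _ => 1) l y)
  scaling : ∀ x y : ℝ, 0 < y → y ≤ 1 → 0 < x * (1 - y) → x * (1 - y) ≤ η →
    -kdot k (x * y) ≤ cη * y ^ (-ω) * (-kdot k x)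

namespace LocalSetting

variable {k l : ℝ → ℝ} {ν Λ η cbar c₀ cη ω p₀ r Φ T x₀ : ℝ} {u Du Q : ℝ × ℝ → ℝ} {u₀ : ℝ → ℝ}

lemma h_pos (L : LocalSetting k l ν Λ η cbar c₀ cη ω p₀ r Φ T x₀ u Du Q u₀) : 0 < η * Φ :=
  mul_pos L.η_pos L.Φ_pos

lemma min_pos (L : LocalSetting k l ν Λ η cbar c₀ cη ω p₀ r Φ T x₀ u Du Q u₀) : 0 < min 1 η :=
  lt_min one_pos L.η_pos

/-- A lower bound for `L` at fractions of the intrinsic time, since `L(t) / t` is nonincreasing. -/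
lemma le_conv_one (L : LocalSetting k l ν Λ η cbar c₀ cη ω p₀ r Φ T x₀ u Du Q u₀) {θ : ℝ}
    (hθ : 0 < θ) (hθ1 : θ ≤ 1) :
    θ * (min 1 η * r ^ 2) ≤ conv (fun _ => 1) l (θ * (η * Φ)) := by
  have hh := L.h_pos
  have e1 : min 1 η * r ^ 2 ≤ conv (fun _ => 1) l (η * Φ) := by
    rw [← L.conv_one_Φ]
    have hL0 : 0 ≤ conv (fun _ => 1) l Φ := L.kernel.conv_one_nonneg L.Φ_pos.le
    rcases le_total η 1 with h | h
    · rw [min_eq_right h]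
      have := L.kernel.mul_conv_one_le hh (by nlinarith [L.Φ_pos] : η * Φ ≤ Φ)
      have h2 : Φ * (η * conv (fun _ => 1) l Φ) ≤ Φ * conv (fun _ => 1) l (η * Φ) := by linarith
      exact le_of_mul_le_mul_left h2 L.Φ_pos
    · rw [min_eq_left h, one_mul]
      exact L.kernel.conv_one_mono L.Φ_pos.le (by nlinarith [L.Φ_pos])
  have e2 := L.kernel.mul_conv_one_le (mul_pos hθ hh) (mul_le_of_le_one_left hh.le hθ1)
  have e3 : (η * Φ) * (θ * conv (fun _ => 1) l (η * Φ))
      ≤ (η * Φ) * conv (fun _ => 1) l (θ * (η * Φ)) := by linarith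
  exact (mul_le_mul_of_nonneg_left e1 hθ.le).trans (le_of_mul_le_mul_left e3 hh)

/-- The derivative of `k` at times comparable with the intrinsic time. -/
lemma kdot_le (L : LocalSetting k l ν Λ η cbar c₀ cη ω p₀ r Φ T x₀ u Du Q u₀) {θ y : ℝ}
    (hθ : 0 < θ) (hθ1 : θ ≤ 1) (hy : θ * (η * Φ) ≤ y) :
    -kdot k y ≤ c₀ / (θ ^ 2 * η * min 1 η) / (Φ * r ^ 2) := by
  have hh := L.h_pos
  have hm := L.min_pos
  have hr := L.r_pos
  have hΦ := L.Φ_pos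
  have hη := L.η_pos
  have hy0 : 0 < θ * (η * Φ) := mul_pos hθ hh
  have e1 : -kdot k y ≤ -kdot k (θ * (η * Φ)) :=
    neg_le_neg (L.kernel.monotoneOn_kdot hy0 (hy0.trans_le hy) hy)
  have e2 := L.deriv_bound _ hy0
    ((mul_le_of_le_one_left hh.le hθ1).trans L.mul_Φ_le_one)
  refine e1.trans (e2.trans ?_)
  have e3 := L.le_conv_one hθ hθ1
  rw [div_div]
  refine div_le_div_of_nonneg_left L.c₀_pos.le (by positivity) ?_
  have := mul_le_mul_of_nonneg_left e3 hy0.le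
  refine le_trans (le_of_eq ?_) this
  ring

end LocalSetting

/-! ### De Giorgi's iteration -/

/-- Fast geometric convergence, for a recursion that is superlinear relative to a unit `N`. -/
lemma tendsto_zero_of_superlinear {Y : ℕ → ℝ} {N B a : ℝ} (ha : 0 < a) (hB : 0 < B)
    (hY : ∀ j, 0 ≤ Y j)
    (hstep : ∀ (j : ℕ) (y : ℝ), 0 < y → Y j ≤ y * N →
      Y (j + 1) ≤ B * (256 : ℝ) ^ j * y ^ a * Y j)
    (h0 : Y 0 ≤ ((256 : ℝ) ^ (-(1 / a)) / B) ^ (1 / a) * N) :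
    Tendsto Y atTop (𝓝 0) := by
  set q : ℝ := (256 : ℝ) ^ (-(1 / a)) with hq
  have hq0 : 0 < q := Real.rpow_pos_of_pos (by norm_num) _
  have hq1 : q < 1 := Real.rpow_lt_one_of_one_lt_of_neg (by norm_num) (by
    have := one_div_pos.2 ha; linarith)
  have hqa : q ^ a = 1 / 256 := by
    rw [hq, ← Real.rpow_mul (by norm_num), neg_mul, one_div_mul_cancel ha.ne', Real.rpow_neg_one]
    norm_num
  set y₀ : ℝ := (q / B) ^ (1 / a) with hy₀
  have hy0 : 0 < y₀ := Real.rpow_pos_of_pos (by positivity) _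
  have hya : y₀ ^ a = q / B := by
    rw [hy₀, ← Real.rpow_mul (by positivity), one_div_mul_cancel ha.ne', Real.rpow_one]
  have key : ∀ j : ℕ, Y j ≤ y₀ * q ^ j * N := by
    intro j
    induction j with
    | zero => simpa using h0
    | succ j ih =>
      have hpos : 0 < y₀ * q ^ j := by positivity
      have h1 := hstep j _ hpos ih
      have h2 : (y₀ * q ^ j) ^ a = q / B * (1 / 256) ^ j := by
        rw [Real.mul_rpow hy0.le (by positivity), hya, ← hqa, ← Real.rpow_natCast,
          ← Real.rpow_natCast, ← Real.rpow_mul hq0.le, ← Real.rpow_mul hq0.le, mul_comm a]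
      have h3 : B * (256 : ℝ) ^ j * (y₀ * q ^ j) ^ a = q := by
        rw [h2, one_div, inv_pow]
        have : (256 : ℝ) ^ j ≠ 0 := by positivity
        field_simp
      rw [h3] at h1
      calc Y (j + 1) ≤ q * Y j := h1
        _ ≤ q * (y₀ * q ^ j * N) := mul_le_mul_of_nonneg_left ih hq0.le
        _ = _ := by ring
  refine squeeze_zero hY key ?_
  have := ((tendsto_pow_atTop_nhds_zero_of_lt_one hq0.le hq1).const_mul y₀).mul_const N
  simpa using this

lemma levelEnergy_mono {k : ℝ → ℝ} {T a b : ℝ} {u Du Q : ℝ × ℝ → ℝ} {u₀ : ℝ → ℝ}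
    (D : ExtendedSubsolution k T a b u Du Q u₀) {x₀ lam lam' s s' R R' : ℝ} (hlam : 0 ≤ lam)
    (hl : lam ≤ lam') (hs : s ≤ s') (hR : R' ≤ R) :
    levelEnergy u T x₀ lam' s' R' ≤ levelEnergy u T x₀ lam s R := by
  have hsub : Ioo s' T ×ˢ Ioo (x₀ - R') (x₀ + R') ⊆ Ioo s T ×ˢ Ioo (x₀ - R) (x₀ + R) :=
    prod_mono (Ioo_subset_Ioo_left hs) (Ioo_subset_Ioo (by linarith) (by linarith))
  calc levelEnergy u T x₀ lam' s' R'
      ≤ ∫ z in Ioo s' T ×ˢ Ioo (x₀ - R') (x₀ + R'), truncation lam u z ^ 2 := by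
        refine integral_mono (D.integrableOn_truncation_sq (hlam.trans hl) _)
          (D.integrableOn_truncation_sq hlam _) fun z => ?_
        exact pow_le_pow_left₀ (truncation_nonneg _ _ _)
          (max_le_max (by linarith) le_rfl) 2
    _ ≤ _ := setIntegral_mono_set (D.integrableOn_truncation_sq hlam _)
        (ae_of_all _ fun z => sq_nonneg _) hsub.eventuallyLE

namespace LocalSetting

variable {k l : ℝ → ℝ} {ν Λ η cbar c₀ cη ω p₀ r Φ T x₀ : ℝ} {u Du Q : ℝ × ℝ → ℝ} {u₀ : ℝ → ℝ}
  {σ σ' X G lam : ℝ}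

/-- The memory at a time `t` that is separated by `θ η Φ` from the base time `s`. -/
lemma lintegral_memory_le (L : LocalSetting k l ν Λ η cbar c₀ cη ω p₀ r Φ T x₀ u Du Q u₀)
    (hσ' : 0 < σ') (hσσ' : σ' < σ) (hσ : σ ≤ 1) {s t θ R : ℝ} (hθ : 0 < θ) (hθ1 : θ ≤ 1)
    (hs : T - σ * (η * Φ) + (σ - σ') * (η * Φ) / 2 ≤ s) (hst : θ * (η * Φ) ≤ t - s)
    (htT : t < T) (hR : R ≤ r * σ) (hX0 : 0 ≤ X) (hG0 : 0 ≤ G)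
    (hX : mass u T x₀ (T - σ * (η * Φ)) (r * σ) ≤ ENNReal.ofReal (r * Φ * X))
    (hG : pastTail k u u₀ T x₀ (T - σ * (η * Φ)) (r * σ) ≤ ENNReal.ofReal (G / r)) :
    ∫⁻ x in Ioo (x₀ - R) (x₀ + R), memory k s u u₀ (t, x)
      ≤ ENNReal.ofReal (((1 + cη) * (2 / (σ - σ')) ^ ω * G
        + c₀ / (θ ^ 2 * η * min 1 η) * X) / r) := by
  have hh := L.h_pos
  have hr := L.r_pos
  have hΦ := L.Φ_pos
  have hη := L.η_pos
  have hm := L.min_pos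
  have hc₀ := L.c₀_pos
  have hcη := L.cη_pos
  set h := η * Φ with hhdef
  set ε := σ - σ' with hε
  have hε0 : 0 < ε := sub_pos.2 hσσ'
  have hε1 : ε < 1 := by linarith
  have hθh : 0 < θ * h := mul_pos hθ hh
  have hεh : 0 < ε * h := mul_pos hε0 hh
  have hσh : σ * h ≤ h := mul_le_of_le_one_left hh.le hσ
  set p := (1 + cη) * (2 / ε) ^ ω with hp
  have h2ε : 1 ≤ (2 / ε) ^ ω :=
    Real.one_le_rpow ((one_le_div hε0).2 (by linarith)) L.ω_pos.le
  have hp1 : 1 ≤ p := by rw [hp]; nlinarith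
  set q := c₀ / (θ ^ 2 * η * min 1 η) / (Φ * r ^ 2) with hq
  have hq0 : 0 ≤ q := by positivity
  have hmem := lintegral_memory_le_pastTail (k := k) (u₀ := u₀) (x₀ := x₀) (t₁ := T - σ * h)
    (s := s) (t := t) (T := T) (p := p) (q := q) L.subsolution.meas L.subsolution.meas_init
    (by linarith) (by linarith) hp1 (fun τ hτ => ?_) (fun τ hτ => ?_) hR
  · refine hmem.trans ((add_le_add (mul_le_mul' le_rfl hG) (mul_le_mul' le_rfl hX)).trans ?_)
    rw [← ENNReal.ofReal_mul (by linarith), ← ENNReal.ofReal_mul hq0,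
      ← ENNReal.ofReal_add (by positivity) (by positivity)]
    refine ENNReal.ofReal_le_ofReal (le_of_eq ?_)
    rw [hq]; field_simp
  · -- the scaling property, with the smaller time as a fraction of the larger one
    have hTτ : 0 < T - τ := by linarith [hτ.2, mul_pos (hσ'.trans hσσ') hh]
    have htτ : 0 < t - τ := by linarith [hτ.2]
    set y := (t - τ) / (T - τ) with hy
    have hxy : (T - τ) * y = t - τ := by rw [hy]; field_simp
    have hx1 : (T - τ) * (1 - y) = T - t := by rw [mul_sub, hxy]; ring
    have hyε : ε / 2 ≤ y := by
      rw [hy, le_div_iff₀ hTτ]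
      have h1 : T - τ = (T - σ * h - τ) + σ * h := by ring
      have h2 : 0 ≤ T - σ * h - τ := by linarith [hτ.2]
      have h3 : ε / 2 * (T - σ * h - τ) ≤ T - σ * h - τ :=
        mul_le_of_le_one_left h2 (by linarith)
      have h4 : ε / 2 * (σ * h) ≤ ε / 2 * h := mul_le_mul_of_nonneg_left hσh (by linarith)
      rw [h1, mul_add]
      linarith
    have hTt : T - t ≤ η := by
      have : h ≤ η := mul_le_of_le_one_right hη.le L.Φ_le_one
      linarith
    have hsc := L.scaling (T - τ) y (by positivity) ((div_le_one hTτ).2 (by linarith))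
      (by rw [hx1]; linarith) (by rw [hx1]; exact hTt)
    rw [hxy] at hsc
    have hκ : 0 ≤ -kdot k (T - τ) := by linarith [L.kernel.kdot_nonpos hTτ]
    refine hsc.trans (mul_le_mul_of_nonneg_right ?_ hκ)
    have hyω : y ^ (-ω) ≤ (2 / ε) ^ ω := by
      calc y ^ (-ω) ≤ (ε / 2) ^ (-ω) :=
            Real.rpow_le_rpow_of_nonpos (by linarith) hyε (by linarith [L.ω_pos])
        _ = (2 / ε) ^ ω := by
            rw [Real.rpow_neg (by linarith), ← Real.inv_rpow (by linarith), inv_div]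
    refine (mul_le_mul_of_nonneg_left hyω hcη.le).trans ?_
    exact mul_le_mul_of_nonneg_right (by linarith) (by linarith)
  · exact L.kdot_le hθ hθ1 (by linarith [hτ.2])

/-- The constant in the iteration inequality; `C₀` is the constant of the cutoff functions. It
contains neither `ω` nor `p₀`. -/
def iterationConst (ν Λ η cbar c₀ cη C₀ : ℝ) : ℝ :=
  (4 * (cbar * max 1 η) + 24 / ν) * 4 *
    (8 / min 1 η + 16 * (2 * Λ ^ 2 / ν + ν / 4) * C₀ ^ 2
      + 8 / ν * (1 + cη + 64 * c₀ / (η * min 1 η)) ^ 2)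

/-- The time integral of the kernel, relative to the length of a time step. -/
lemma integral_k_div_le (L : LocalSetting k l ν Λ η cbar c₀ cη ω p₀ r Φ T x₀ u Du Q u₀)
    {ε P t : ℝ} (hε : 0 < ε) (hP : 0 < P) (ht0 : 0 ≤ t) (ht : t ≤ η * Φ) :
    (∫ σ in (0 : ℝ)..t, k σ) / (ε * (η * Φ) / (4 * P)) ≤ 8 / min 1 η * P / (ε * r ^ 2) := by
  have hh := L.h_pos
  have hr := L.r_pos
  have hm := L.min_pos
  set h := η * Φ with hhdef
  have e1 : ∫ σ in (0 : ℝ)..t, k σ ≤ ∫ σ in (0 : ℝ)..h, k σ := by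
    rw [intervalIntegral_eq_setIntegral ht0, intervalIntegral_eq_setIntegral hh.le]
    exact setIntegral_mono_set (L.kernel.integrable_k h hh)
      ((ae_restrict_mem measurableSet_Ioo).mono fun x hx => L.kernel.nonneg_k x hx.1)
      (Ioo_subset_Ioo_right ht).eventuallyLE
  have e2 := L.kernel.integral_k_mul_conv_one_le hh
  have e3 := L.le_conv_one one_pos le_rfl
  rw [one_mul, one_mul, ← hhdef] at e3
  have e4 : ∫ σ in (0 : ℝ)..h, k σ ≤ 2 * h / (min 1 η * r ^ 2) := by
    rw [le_div_iff₀ (by positivity)]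
    refine le_trans (mul_le_mul_of_nonneg_left e3 ?_) e2
    rw [intervalIntegral_eq_setIntegral hh.le]
    exact setIntegral_nonneg measurableSet_Ioo fun x hx => L.kernel.nonneg_k x hx.1
  calc _ ≤ 2 * h / (min 1 η * r ^ 2) / (ε * h / (4 * P)) :=
        div_le_div_of_nonneg_right (e1.trans e4) (by positivity)
    _ = _ := by
      clear_value h
      generalize min 1 η = m at *
      field_simp
      ring

/-- The product of the factors in the estimate of one step of the iteration, for the scale `P`. -/
lemma scale_factor_le {C₀ ε P A Y J : ℝ} (hν : 0 < ν) (hc₀ : 0 < c₀) (hcη : 0 < cη)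
    (hm : 0 < min 1 η) (hη : 0 < η) (hcbar : 0 < cbar) (hr : 0 < r) (hε : 0 < ε) (hε1 : ε ≤ 1)
    (hP : 1 ≤ P) (hlam : 0 < lam) (hA : 0 ≤ A) (hAY : A ≤ 4 * P ^ 2 * Y) (hJ0 : 0 ≤ J)
    (hJ : J ≤ 8 / min 1 η * P / (ε * r ^ 2)) :
    (4 * (cbar * max 1 η * A * r ^ 2) + 24 * (r ^ 2 * A) / ν) *
      (J + (2 * Λ ^ 2 / ν + ν / 4) * (C₀ / (r * ε / (4 * P))) ^ 2
        + 2 * (P ^ 2 * (1 + cη + 64 * c₀ / (η * min 1 η)) * lam / r) ^ 2 / ν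
          / (lam / (2 * P)) ^ 2)
      ≤ iterationConst ν Λ η cbar c₀ cη C₀ / ε ^ 2 * P ^ 8 * Y := by
  have hM : 0 < max 1 η := lt_of_lt_of_le one_pos (le_max_left _ _)
  rw [iterationConst]
  set B := 1 + cη + 64 * c₀ / (η * min 1 η) with hB
  have hB0 : 0 < B := by positivity
  clear_value B
  generalize min 1 η = m at *
  generalize max 1 η = M at *
  have hP0 : 0 < P := by linarith
  have hpow : ∀ n ≤ 6, P ^ n ≤ P ^ 6 := fun n hn => pow_le_pow_right₀ hP hn
  have hεsq : ε ^ 2 ≤ ε := by nlinarith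
  have hε2 : ε ^ 2 ≤ 1 := by nlinarith
  set Z := P ^ 6 / (ε ^ 2 * r ^ 2) with hZ
  have hZ0 : 0 < Z := by positivity
  have b1 : J ≤ 8 / m * Z := by
    refine hJ.trans ?_
    rw [mul_div_assoc]
    refine mul_le_mul_of_nonneg_left ?_ (by positivity)
    exact div_le_div₀ (by positivity) (by simpa using hpow 1 (by norm_num)) (by positivity)
      (mul_le_mul_of_nonneg_right hεsq (by positivity))
  have b2 : (2 * Λ ^ 2 / ν + ν / 4) * (C₀ / (r * ε / (4 * P))) ^ 2
      ≤ 16 * (2 * Λ ^ 2 / ν + ν / 4) * C₀ ^ 2 * Z := by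
    have e1 : (C₀ / (r * ε / (4 * P))) ^ 2 = 16 * C₀ ^ 2 * (P ^ 2 / (ε ^ 2 * r ^ 2)) := by
      field_simp; ring
    have e2 : P ^ 2 / (ε ^ 2 * r ^ 2) ≤ Z :=
      div_le_div_of_nonneg_right (hpow 2 (by norm_num)) (by positivity)
    have := mul_le_mul_of_nonneg_left e2
      (show 0 ≤ 16 * (2 * Λ ^ 2 / ν + ν / 4) * C₀ ^ 2 by positivity)
    rw [e1]; linarith
  have b3 : 2 * (P ^ 2 * B * lam / r) ^ 2 / ν / (lam / (2 * P)) ^ 2 ≤ 8 / ν * B ^ 2 * Z := by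
    have e1 : 2 * (P ^ 2 * B * lam / r) ^ 2 / ν / (lam / (2 * P)) ^ 2
        = 8 / ν * B ^ 2 * (P ^ 6 / (1 * r ^ 2)) := by
      field_simp; ring
    rw [e1]
    refine mul_le_mul_of_nonneg_left (div_le_div_of_nonneg_left (by positivity) (by positivity)
      (mul_le_mul_of_nonneg_right hε2 (by positivity))) (by positivity)
  have hZr : r ^ 2 * (4 * P ^ 2 * Y) * Z = 4 / ε ^ 2 * P ^ 8 * Y := by
    rw [hZ]; field_simp
  have e0 : 4 * (cbar * M * A * r ^ 2) + 24 * (r ^ 2 * A) / ν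
      = (4 * (cbar * M) + 24 / ν) * (r ^ 2 * A) := by ring
  rw [e0]
  calc _ ≤ (4 * (cbar * M) + 24 / ν) * (r ^ 2 * (4 * P ^ 2 * Y))
        * (8 / m * Z + 16 * (2 * Λ ^ 2 / ν + ν / 4) * C₀ ^ 2 * Z + 8 / ν * B ^ 2 * Z) := by
        refine mul_le_mul ?_ (add_le_add (add_le_add b1 b2) b3) (by positivity) ?_
        · exact mul_le_mul_of_nonneg_left (mul_le_mul_of_nonneg_left hAY (by positivity))
            (by positivity)
        · exact mul_nonneg (by positivity) (mul_nonneg (by positivity) (hA.trans hAY))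
    _ = (4 * (cbar * M) + 24 / ν)
        * (8 / m + 16 * (2 * Λ ^ 2 / ν + ν / 4) * C₀ ^ 2 + 8 / ν * B ^ 2)
        * (r ^ 2 * (4 * P ^ 2 * Y) * Z) := by ring
    _ = _ := by rw [hZr]; ring

/-- The bound for the memory in terms of the level. -/
lemma memory_const_le {ε P : ℝ} (hc₀ : 0 < c₀) (hcη : 0 < cη) (hm : 0 < min 1 η) (hη : 0 < η)
    (hε : 0 < ε) (hP : 1 ≤ P) (hlam : 0 < lam) (hlG : (2 / ε) ^ ω * G ≤ lam)
    (hlX : X / ε ^ 2 ≤ lam) :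
    (1 + cη) * (2 / ε) ^ ω * G + c₀ / ((ε / (8 * P)) ^ 2 * η * min 1 η) * X
      ≤ P ^ 2 * (1 + cη + 64 * c₀ / (η * min 1 η)) * lam := by
  have hP0 : 0 < P := by linarith
  generalize min 1 η = m at *
  have e1 : c₀ / ((ε / (8 * P)) ^ 2 * η * m) * X
      = 64 * c₀ / (η * m) * P ^ 2 * (X / ε ^ 2) := by field_simp; ring
  have e2 : (1 + cη) * (2 / ε) ^ ω * G = (1 + cη) * ((2 / ε) ^ ω * G) := by ring
  rw [e1, e2]
  have e3 := mul_le_mul_of_nonneg_left hlG (show 0 ≤ 1 + cη by positivity)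
  have e4 := mul_le_mul_of_nonneg_left hlX
    (show 0 ≤ 64 * c₀ / (η * m) * P ^ 2 by positivity)
  have e5 : (1 + cη) * lam ≤ (1 + cη) * lam * P ^ 2 :=
    le_mul_of_one_le_right (by positivity) (by nlinarith)
  calc _ ≤ (1 + cη) * lam * P ^ 2 + 64 * c₀ / (η * m) * P ^ 2 * lam := by linarith
    _ = _ := by ring

/-- The iteration inequality between the scales `P` and `2 P`. In the iteration `P = 2 ^ j`; the
levels `lam (1 - 1 / P)` increase to `lam`, and the cylinders shrink to the one with parameter
`σ'`. -/
lemma levelEnergy_scale_step {C₀ : ℝ} (hC₀ : HasCutoffs C₀)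
    (L : LocalSetting k l ν Λ η cbar c₀ cη ω p₀ r Φ T x₀ u Du Q u₀)
    (hσ' : 0 < σ') (hσσ' : σ' < σ) (hσ : σ ≤ 1) (hX0 : 0 ≤ X) (hG0 : 0 ≤ G)
    (hX : mass u T x₀ (T - σ * (η * Φ)) (r * σ) ≤ ENNReal.ofReal (r * Φ * X))
    (hG : pastTail k u u₀ T x₀ (T - σ * (η * Φ)) (r * σ) ≤ ENNReal.ofReal (G / r))
    (hlam : 0 < lam) (hlG : (2 / (σ - σ')) ^ ω * G ≤ lam) (hlX : X / (σ - σ') ^ 2 ≤ lam)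
    {P y : ℝ} (hP : 1 ≤ P) (hy : 0 < y)
    (hY : levelEnergy u T x₀ (lam * (1 - 1 / P))
      (T - σ * (η * Φ) + (σ - σ') * (η * Φ) * (1 - 1 / (2 * P))) (r * (σ' + (σ - σ') / (2 * P)))
      ≤ y * (r * Φ * lam ^ 2)) :
    levelEnergy u T x₀ (lam * (1 - 1 / (2 * P)))
      (T - σ * (η * Φ) + (σ - σ') * (η * Φ) * (1 - 1 / (4 * P))) (r * (σ' + (σ - σ') / (4 * P)))
      ≤ iterationConst ν Λ η cbar c₀ cη C₀ / (σ - σ') ^ 2 * P ^ 8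
        * y ^ (2 * (1 - 1 / p₀) / (2 + (1 - 1 / p₀)))
        * levelEnergy u T x₀ (lam * (1 - 1 / P))
      (T - σ * (η * Φ) + (σ - σ') * (η * Φ) * (1 - 1 / (2 * P)))
      (r * (σ' + (σ - σ') / (2 * P))) := by
  have hP2 : 1 ≤ 4 * P ^ 2 := by linarith [one_le_pow₀ hP (n := 2)]
  have hh := L.h_pos
  have hr := L.r_pos
  have hΦ := L.Φ_pos
  have hη := L.η_pos
  have hm := L.min_pos
  have hc₀ := L.c₀_pos
  have hcη := L.cη_pos
  have hν := L.ν_pos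
  have hP0 : 0 < P := by linarith
  set h := η * Φ with hhdef
  set ε := σ - σ' with hε
  have hε0 : 0 < ε := sub_pos.2 hσσ'
  have hε1 : ε < 1 := by linarith
  have hεh : 0 < ε * h := mul_pos hε0 hh
  have hσh : σ * h ≤ h := mul_le_of_le_one_left hh.le hσ
  have hσ'h : 0 < σ' * h := mul_pos hσ' hh
  have hεσ : ε * h = σ * h - σ' * h := by rw [hε]; ring
  have hp0 : 0 < p₀ := by linarith [L.one_lt_p₀]
  set β := 1 - 1 / p₀ with hβ
  have hβ0 : 0 < β := sub_pos.2 ((div_lt_one hp0).2 L.one_lt_p₀)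
  have hβ1 : β < 1 := by have := one_div_pos.2 hp0; linarith
  set a := 2 * β / (2 + β) with ha
  set γ := β / (2 + β) with hγ
  have ha0 : 0 < a := by positivity
  have ha1 : a ≤ 1 := (div_le_one (by linarith)).2 (by linarith)
  have hγa : 2 * γ = a := by rw [hγ, ha]; ring
  have hβγ : (1 - γ) * β = a := by rw [hγ, ha]; field_simp; ring
  set M₁ := max 1 η with hM₁
  have hM₁1 : 1 ≤ M₁ := le_max_left _ _
  have hcbar := L.one_lt_cbar
  have i2 : 1 / (2 * P) ≤ 1 / 2 := one_div_le_one_div_of_le (by norm_num) (by linarith)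
  have i4 : 1 / (4 * P) < 1 / (2 * P) := one_div_lt_one_div_of_lt (by linarith) (by linarith)
  have i1 : 1 / P ≤ 1 := (div_le_one hP0).2 hP
  have i21 : 1 / (2 * P) < 1 / P := one_div_lt_one_div_of_lt hP0 (by linarith)
  have i4p : 0 < 1 / (4 * P) := by positivity
  set s := T - σ * h + ε * h * (1 - 1 / (2 * P)) with hs
  set s' := T - σ * h + ε * h * (1 - 1 / (4 * P)) with hs'
  set R := r * (σ' + ε / (2 * P)) with hR
  set R' := r * (σ' + ε / (4 * P)) with hR'
  set lam₁ := lam * (1 - 1 / P) with hlam₁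
  set lam₂ := lam * (1 - 1 / (2 * P)) with hlam₂
  have hds : s' - s = ε * h / (4 * P) := by rw [hs, hs']; field_simp; ring
  have hdR : R - R' = r * ε / (4 * P) := by rw [hR, hR']; field_simp; ring
  have hdl : lam₂ - lam₁ = lam / (2 * P) := by rw [hlam₁, hlam₂]; field_simp; ring
  have hT0 : T - σ * h ≥ 0 := by linarith [L.mul_Φ_le]
  have hs1 : T - σ * h + ε * h / 2 ≤ s := by
    have := mul_le_mul_of_nonneg_left i2 hεh.le
    rw [hs]; linarith
  have hsT : T - s ≤ h := by linarith
  have hs'T : s' < T := by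
    have := mul_pos hεh i4p
    rw [hs']; linarith
  have hss' : 0 < s' - s := by rw [hds]; positivity
  have hsT0 : 0 ≤ T - s := by linarith
  have hRσ : R < r * σ := by
    have h1 : ε / (2 * P) ≤ ε / 2 := div_le_div_of_nonneg_left hε0.le (by norm_num) (by linarith)
    exact mul_lt_mul_of_pos_left (by linarith) hr
  have hRr : R < r := hRσ.trans_le (mul_le_of_le_one_right hr.le hσ)
  have hs0 : 0 ≤ s := by linarith
  have hl1 : 0 ≤ lam₁ := mul_nonneg hlam.le (by linarith)
  have hR0 : 0 < R' := by positivity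
  have hdR0 : 0 < R - R' := by rw [hdR]; positivity
  have hdl0 : 0 < lam₂ - lam₁ := by rw [hdl]; positivity
  clear_value s s' R R' lam₁ lam₂ β a γ
  set α := 4 * P ^ 2 * y with hα
  have hα0 : 0 < α := by positivity
  set c₁ := cbar * M₁ * α ^ a * r ^ 2 with hc₁
  -- this `ρ` balances the two contributions: `ρ ^ 2` and `L(τ)` are both of order `r ^ 2 * α ^ a`
  set ρ := r * α ^ γ with hρ
  have hρ0 : 0 < ρ := mul_pos hr (Real.rpow_pos_of_pos hα0 _)
  have hρ2 : ρ ^ 2 = r ^ 2 * α ^ a := by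
    rw [hρ, mul_pow, ← Real.rpow_natCast (α ^ γ), ← Real.rpow_mul hα0.le]
    congr 2
    rw [← hγa]; push_cast; ring
  have hαa : 0 < α ^ a := Real.rpow_pos_of_pos hα0 _
  have hc₁0 : 0 < c₁ := by positivity
  set BF := 1 + cη + 64 * c₀ / (η * min 1 η) with hBF
  have hstep := L.subsolution.levelEnergy_step (F := P ^ 2 * BF * lam / r) (ρ := ρ) (c₁ := c₁)
    (x₀ := x₀) (lam := lam₁) (lam' := lam₂) (s := s) (s' := s') (R := R) (R' := R') hC₀ L.kernel hν
    L.coercive L.bounded hs0 (by linarith) hs'T hl1 (by linarith) hR0 (by linarith)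
    (by linarith) (by linarith) hρ0 hc₁0 ?_ ?_
  · refine hstep.trans (mul_le_mul_of_nonneg_right ?_
      (ExtendedSubsolution.levelEnergy_nonneg _ _ _ _ _ _))
    have hy2 : α ^ a ≤ 4 * P ^ 2 * y ^ a := by
      rw [hα, Real.mul_rpow (by positivity) hy.le]
      refine mul_le_mul_of_nonneg_right ?_ (Real.rpow_nonneg hy.le _)
      calc (4 * P ^ 2) ^ a ≤ (4 * P ^ 2) ^ (1 : ℝ) :=
            Real.rpow_le_rpow_of_exponent_le hP2 ha1
        _ = _ := Real.rpow_one _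
    have hk₀ := L.integral_k_div_le hε0 hP0 hsT0 hsT
    rw [← hds] at hk₀
    have hk₁ : 0 ≤ (∫ σ in (0 : ℝ)..(T - s), k σ) / (s' - s) := by
      rw [intervalIntegral_eq_setIntegral hsT0]
      exact div_nonneg (setIntegral_nonneg measurableSet_Ioo fun x hx =>
        L.kernel.nonneg_k x hx.1) hss'.le
    rw [hρ2, hdR, hdl]
    exact scale_factor_le hν hc₀ hcη hm hη (by linarith) hr hε0 hε1.le hP hlam hαa.le hy2 hk₁ hk₀
  · -- the total length `τ` of the times with a long superlevel set is at most `α ^ (1 - γ) * Φ`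
    intro τ hτ0 hτT hτY
    refine (L.power τ hτ0 (hτT.trans hsT)).trans ?_
    rw [hc₁]
    refine mul_le_mul_of_nonneg_right (mul_le_mul_of_nonneg_left ?_ (by positivity))
      (by positivity)
    have e1 : ρ * τ * (lam₂ - lam₁) ^ 2 ≤ y * (r * Φ * lam ^ 2) := hτY.trans hY
    rw [hdl] at e1
    have e2 : τ / Φ ≤ α ^ (1 - γ) := by
      rw [div_le_iff₀ hΦ, Real.rpow_sub hα0, Real.rpow_one, div_mul_eq_mul_div,
        le_div_iff₀ (Real.rpow_pos_of_pos hα0 _)]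
      have e3 : ρ * τ * (lam / (2 * P)) ^ 2
          = (r * lam ^ 2 / (4 * P ^ 2)) * (τ * α ^ γ) := by rw [hρ]; field_simp; ring
      have e4 : y * (r * Φ * lam ^ 2) = (r * lam ^ 2 / (4 * P ^ 2)) * (α * Φ) := by
        rw [hα]; field_simp
      rw [e3, e4] at e1
      exact le_of_mul_le_mul_left e1 (by positivity)
    rw [← hβ]
    calc (τ / Φ) ^ β ≤ (α ^ (1 - γ)) ^ β :=
          Real.rpow_le_rpow (by positivity) e2 hβ0.le
      _ = α ^ a := by rw [← Real.rpow_mul hα0.le, hβγ]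
  · -- times after `(s + s') / 2` have distance at least `ε h / (8 P)` from the base time `s`
    intro t htT hts
    have hθ : 0 < ε / (8 * P) := by positivity
    have hθ1 : ε / (8 * P) ≤ 1 := (div_le_one (by positivity)).2 (by linarith)
    refine (L.lintegral_memory_le hσ' hσσ' hσ hθ hθ1 hs1 ?_ htT hRσ.le hX0 hG0 hX hG).trans
      (ENNReal.ofReal_le_ofReal (div_le_div_of_nonneg_right ?_ hr.le))
    · have : ε / (8 * P) * h = (s' - s) / 2 := by rw [hds]; field_simp; ring
      show ε / (8 * P) * h ≤ t - s
      linarith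
    · exact memory_const_le hc₀ hcη hm hη hε0 hP hlam hlG hlX

lemma iterationConst_pos {C₀ : ℝ}
    (L : LocalSetting k l ν Λ η cbar c₀ cη ω p₀ r Φ T x₀ u Du Q u₀) :
    0 < iterationConst ν Λ η cbar c₀ cη C₀ := by
  have := L.ν_pos; have := L.η_pos; have := L.min_pos; have := L.c₀_pos; have := L.cη_pos
  have := L.one_lt_cbar
  have : 0 < max 1 η := lt_of_lt_of_le one_pos (le_max_left _ _)
  rw [iterationConst]; positivity

/-- The bound for a level that dominates the tail, the mean value and the mean square. -/
lemma le_of_levelEnergy_le {C₀ : ℝ} (hC₀ : HasCutoffs C₀)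
    (L : LocalSetting k l ν Λ η cbar c₀ cη ω p₀ r Φ T x₀ u Du Q u₀)
    (hσ' : 0 < σ') (hσσ' : σ' < σ) (hσ : σ ≤ 1) (hX0 : 0 ≤ X) (hG0 : 0 ≤ G)
    (hX : mass u T x₀ (T - σ * (η * Φ)) (r * σ) ≤ ENNReal.ofReal (r * Φ * X))
    (hG : pastTail k u u₀ T x₀ (T - σ * (η * Φ)) (r * σ) ≤ ENNReal.ofReal (G / r))
    (hlam : 0 < lam) (hlG : (2 / (σ - σ')) ^ ω * G ≤ lam) (hlX : X / (σ - σ') ^ 2 ≤ lam)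
    {a : ℝ} (ha : a = 2 * (1 - 1 / p₀) / (2 + (1 - 1 / p₀)))
    (hY : levelEnergy u T x₀ 0 (T - σ * (η * Φ)) (r * σ)
      ≤ ((256 : ℝ) ^ (-(1 / a)) / (iterationConst ν Λ η cbar c₀ cη C₀ / (σ - σ') ^ 2)) ^ (1 / a)
        * (r * Φ * lam ^ 2)) :
    ∀ᵐ z ∂(volume.restrict (Ioo (T - σ' * (η * Φ)) T ×ˢ Ioo (x₀ - r * σ') (x₀ + r * σ'))),
      u z ≤ lam := by
  have hh := L.h_pos
  have hr := L.r_pos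
  have hp0 : 0 < p₀ := by linarith [L.one_lt_p₀]
  have hβ0 : 0 < 1 - 1 / p₀ := sub_pos.2 ((div_lt_one hp0).2 L.one_lt_p₀)
  have ha0 : 0 < a := by rw [ha]; positivity
  have hε0 : 0 < σ - σ' := sub_pos.2 hσσ'
  have hεh : 0 < (σ - σ') * (η * Φ) := mul_pos hε0 hh
  have hC := L.iterationConst_pos (C₀ := C₀)
  set Y : ℕ → ℝ := fun j => levelEnergy u T x₀ (lam * (1 - 1 / 2 ^ j))
      (T - σ * (η * Φ) + (σ - σ') * (η * Φ) * (1 - 1 / (2 * 2 ^ j)))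
      (r * (σ' + (σ - σ') / (2 * 2 ^ j))) with hYdef
  have hpow : ∀ j : ℕ, (1 : ℝ) ≤ 2 ^ j := fun j => one_le_pow₀ (by norm_num)
  have hlim : Tendsto Y atTop (𝓝 0) := by
    refine tendsto_zero_of_superlinear (N := r * Φ * lam ^ 2) ha0 (div_pos hC (pow_pos hε0 2))
      (fun j => ExtendedSubsolution.levelEnergy_nonneg _ _ _ _ _ _) (fun j y hy hYj => ?_) ?_
    · have := L.levelEnergy_scale_step hC₀ hσ' hσσ' hσ hX0 hG0 hX hG hlam hlG hlX (hpow j) hy hYj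
      rw [← ha] at this
      have e1 : (2 : ℝ) ^ (j + 1) = 2 * 2 ^ j := by rw [pow_succ]; ring
      have e2 : (256 : ℝ) ^ j = (2 ^ j) ^ 8 := by rw [← pow_mul, mul_comm, pow_mul]; norm_num
      simp only [hYdef]
      rw [e1, e2, show (2 : ℝ) * (2 * 2 ^ j) = 4 * 2 ^ j by ring]
      exact this
    · refine le_trans ?_ hY
      simp only [hYdef]
      refine levelEnergy_mono L.subsolution le_rfl (by simp) ?_ ?_
      · have : (0 : ℝ) ≤ 1 - 1 / (2 * 2 ^ 0) := by norm_num
        have := mul_nonneg hεh.le this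
        linarith
      · refine mul_le_mul_of_nonneg_left ?_ hr.le
        norm_num; linarith
  have hzero : levelEnergy u T x₀ lam (T - σ' * (η * Φ)) (r * σ') ≤ 0 := by
    refine ge_of_tendsto' hlim fun j => ?_
    have hj := hpow j
    have hj1 : 1 / (2 : ℝ) ^ j ≤ 1 := (div_le_one (by positivity)).2 hj
    refine levelEnergy_mono L.subsolution (mul_nonneg hlam.le (by linarith)) ?_ ?_ ?_
    · exact mul_le_of_le_one_right hlam.le (by linarith [show 0 < 1 / (2 : ℝ) ^ j by positivity])
    · have : 0 < (σ - σ') * (η * Φ) * (1 / (2 * 2 ^ j)) := by positivity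
      linarith
    · refine mul_le_mul_of_nonneg_left ?_ hr.le
      have : 0 < (σ - σ') / (2 * 2 ^ j) := by positivity
      linarith
  have h0 : levelEnergy u T x₀ lam (T - σ' * (η * Φ)) (r * σ') = 0 :=
    le_antisymm hzero (ExtendedSubsolution.levelEnergy_nonneg _ _ _ _ _ _)
  have hae := (integral_eq_zero_iff_of_nonneg (fun z => sq_nonneg (truncation lam u z))
    (L.subsolution.integrableOn_truncation_sq hlam.le _)).1 h0
  filter_upwards [hae] with z hz
  have : truncation lam u z = 0 := by simpa using hz
  have := le_max_left (u z - lam) 0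
  rw [truncation] at *
  linarith

end LocalSetting

/-! ### From the mean square to the mean -/

/-- The reciprocal of the exponent `a = 2 β / (2 + β)` in the iteration inequality, where
`β = 1 - 1 / p₀`. -/
def iterationExponent (p₀ : ℝ) : ℝ := (2 + (1 - 1 / p₀)) / (2 * (1 - 1 / p₀))

/-- The power with which the mean square bound depends on the gap between the cylinders. -/
def gapExponent (ω p₀ : ℝ) : ℝ := iterationExponent p₀ ^ 2 + iterationExponent p₀ + ω + 2

lemma iterationExponent_pos {p₀ : ℝ} (hp : 1 < p₀) : 0 < iterationExponent p₀ := by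
  have hp0 : 0 < p₀ := by linarith
  have hβ0 : 0 < 1 - 1 / p₀ := sub_pos.2 ((div_lt_one hp0).2 hp)
  rw [iterationExponent]; positivity

lemma two_le_gapExponent {ω p₀ : ℝ} (hω : 0 < ω) (hp : 1 < p₀) : 2 ≤ gapExponent ω p₀ := by
  have := iterationExponent_pos hp
  rw [gapExponent]; nlinarith

/-- Moving the base time of the tail forward costs a multiple of the mass. -/
lemma pastTail_le_add {k : ℝ → ℝ} {u : ℝ × ℝ → ℝ} {u₀ : ℝ → ℝ} {T x₀ t₁ t₂ R R' q : ℝ}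
    (h12 : t₁ ≤ t₂) (h2T : t₂ ≤ T) (hR : R' ≤ R)
    (hq : ∀ τ ∈ Ico t₁ t₂, -kdot k (T - τ) ≤ q) :
    pastTail k u u₀ T x₀ t₂ R'
      ≤ pastTail k u u₀ T x₀ t₁ R + ENNReal.ofReal q * mass u T x₀ t₁ R := by
  have hsub : Ioo (x₀ - R') (x₀ + R') ⊆ Ioo (x₀ - R) (x₀ + R) :=
    Ioo_subset_Ioo (by linarith) (by linarith)
  have hss : Ioo 0 t₂ ⊆ Ioo 0 t₁ ∪ Ico t₁ t₂ := fun τ hτ => by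
    rcases lt_or_ge τ t₁ with h | h
    · exact Or.inl ⟨hτ.1, h⟩
    · exact Or.inr ⟨h, hτ.2⟩
  rw [pastTail, pastTail, add_assoc]
  refine add_le_add (mul_le_mul' (kRight_anti k h12) (lintegral_mono_set hsub)) ?_
  refine (lintegral_mono_set hss).trans ((lintegral_union_le _ _ _).trans (add_le_add ?_ ?_))
  · exact lintegral_mono fun τ => mul_le_mul' le_rfl (lintegral_mono_set hsub)
  · rw [mass, ← lintegral_const_mul' _ _ ENNReal.ofReal_ne_top]
    refine (setLIntegral_mono' measurableSet_Ico fun τ hτ =>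
      mul_le_mul' (ENNReal.ofReal_le_ofReal (hq τ hτ)) (lintegral_mono_set hsub)).trans ?_
    rw [← restrict_Ioo_eq_restrict_Ico]
    exact lintegral_mono_set (Ioo_subset_Ioo_right h2T)

lemma mass_mono {u : ℝ × ℝ → ℝ} {T x₀ t₁ t₂ R R' : ℝ} (h12 : t₁ ≤ t₂) (hR : R' ≤ R) :
    mass u T x₀ t₂ R' ≤ mass u T x₀ t₁ R :=
  (lintegral_mono_set (Ioo_subset_Ioo_left h12)).trans (lintegral_mono fun _ =>
    lintegral_mono_set (Ioo_subset_Ioo (by linarith) (by linarith)))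

/-- The mean square is at most the supremum times the mean. -/
lemma ExtendedSubsolution.levelEnergy_zero_le {k : ℝ → ℝ} {T a b : ℝ} {u Du Q : ℝ × ℝ → ℝ}
    {u₀ : ℝ → ℝ} (D : ExtendedSubsolution k T a b u Du Q u₀) {x₀ s R V Y : ℝ} (hV : 0 ≤ V)
    (hY : 0 ≤ Y) (hu : ∀ᵐ z ∂(volume.restrict (Ioo s T ×ˢ Ioo (x₀ - R) (x₀ + R))), u z ≤ V)
    (hX : mass u T x₀ s R ≤ ENNReal.ofReal Y) :
    levelEnergy u T x₀ 0 s R ≤ V * Y := by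
  refine (ENNReal.ofReal_le_ofReal_iff (mul_nonneg hV hY)).1 ?_
  rw [levelEnergy, ofReal_integral_eq_lintegral_ofReal (D.integrableOn_truncation_sq le_rfl _)
    (ae_of_all _ fun z => sq_nonneg _), ENNReal.ofReal_mul hV]
  have hm : Measurable fun z => ENNReal.ofReal (u z) := D.meas.ennreal_ofReal
  have e1 : ∫⁻ z in Ioo s T ×ˢ Ioo (x₀ - R) (x₀ + R), ENNReal.ofReal (truncation 0 u z ^ 2)
      ≤ ∫⁻ z in Ioo s T ×ˢ Ioo (x₀ - R) (x₀ + R), ENNReal.ofReal V * ENNReal.ofReal (u z) := by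
    refine lintegral_mono_ae (hu.mono fun z hz => ?_)
    rw [← ENNReal.ofReal_mul hV, truncation, sub_zero, max_eq_left (D.nonneg z), sq]
    exact ENNReal.ofReal_le_ofReal (mul_le_mul_of_nonneg_right hz (D.nonneg z))
  refine e1.trans ?_
  rw [lintegral_const_mul _ hm]
  refine mul_le_mul' le_rfl (le_trans (le_of_eq ?_) hX)
  rw [Measure.volume_eq_prod, ← Measure.prod_restrict, lintegral_prod _ hm.aemeasurable, mass]

namespace LocalSetting

variable {k l : ℝ → ℝ} {ν Λ η cbar c₀ cη ω p₀ r Φ T x₀ : ℝ} {u Du Q : ℝ × ℝ → ℝ} {u₀ : ℝ → ℝ}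
  {σ σ' X G A C₄ C₀ : ℝ}

/-- The bound of the supremum by the root mean square, the mean and the tail: the level in
`le_of_levelEnergy_le` is chosen such that all its hypotheses hold. -/
lemma le_rpow_mul_add (hC₀ : HasCutoffs C₀)
    (L : LocalSetting k l ν Λ η cbar c₀ cη ω p₀ r Φ T x₀ u Du Q u₀)
    (hC16 : 16 ≤ C₄) (hC₄ : iterationConst ν Λ η cbar c₀ cη C₀ ≤ C₄)
    (hσ' : 0 < σ') (hσσ' : σ' < σ) (hσ : σ ≤ 1) (hA0 : 0 ≤ A) (hX0 : 0 ≤ X) (hG0 : 0 ≤ G)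
    (hA : levelEnergy u T x₀ 0 (T - σ * (η * Φ)) (r * σ) ≤ r * Φ * A ^ 2)
    (hX : mass u T x₀ (T - σ * (η * Φ)) (r * σ) ≤ ENNReal.ofReal (r * Φ * X))
    (hG : pastTail k u u₀ T x₀ (T - σ * (η * Φ)) (r * σ) ≤ ENNReal.ofReal (G / r)) :
    ∀ᵐ z ∂(volume.restrict (Ioo (T - σ' * (η * Φ)) T ×ˢ Ioo (x₀ - r * σ') (x₀ + r * σ'))),
      u z ≤ (C₄ / (σ - σ')) ^ gapExponent ω p₀ * (A + X + G) := by
  have hε0 : 0 < σ - σ' := sub_pos.2 hσσ'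
  have hε1 : σ - σ' ≤ 1 := by linarith
  have hC := L.iterationConst_pos (C₀ := C₀)
  have hN := iterationExponent_pos L.one_lt_p₀
  have hr := L.r_pos
  have hΦ := L.Φ_pos
  set ε := σ - σ' with hε
  set C₃ := iterationConst ν Λ η cbar c₀ cη C₀ with hC₃
  set m := gapExponent ω p₀ with hm
  set N := iterationExponent p₀ with hNdef
  set B := C₄ / ε with hB
  have hB16 : 16 ≤ B := hC16.trans ((le_div_iff₀ hε0).2 (by nlinarith))
  have hB0 : 0 < B := by linarith
  have hB1 : 1 ≤ B := by linarith
  have hmN : m = N ^ 2 + N + ω + 2 := rfl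
  have hω := L.ω_pos
  have hBm : ∀ q, q ≤ m → B ^ q ≤ B ^ m := fun q hq => Real.rpow_le_rpow_of_exponent_le hB1 hq
  have g1 : (2 / ε) ^ ω ≤ B ^ m := by
    refine le_trans (Real.rpow_le_rpow (by positivity) ?_ hω.le) (hBm ω (by nlinarith))
    exact div_le_div_of_nonneg_right (by linarith) hε0.le
  have g2 : 1 / ε ^ 2 ≤ B ^ m := by
    refine le_trans ?_ (hBm 2 (by nlinarith))
    rw [Real.rpow_two, hB, div_pow]
    exact div_le_div_of_nonneg_right (by nlinarith) (by positivity)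
  have g3 : B ^ (-(2 * m)) ≤ ((256 : ℝ) ^ (-N) / (C₃ / ε ^ 2)) ^ N := by
    have e1 : B ^ (-(2 * N)) ≤ (256 : ℝ) ^ (-N) := by
      rw [show (256 : ℝ) = 16 ^ (2 : ℝ) by norm_num, ← Real.rpow_mul (by norm_num), mul_neg]
      exact Real.rpow_le_rpow_of_nonpos (by norm_num) hB16 (by linarith)
    have e2 : C₃ / ε ^ 2 ≤ B ^ (2 : ℝ) := by
      rw [Real.rpow_two, hB, div_pow]
      exact div_le_div_of_nonneg_right (by nlinarith) (by positivity)
    have e3 : B ^ (-(2 * N)) / B ^ (2 : ℝ) ≤ (256 : ℝ) ^ (-N) / (C₃ / ε ^ 2) :=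
      div_le_div₀ (by positivity) e1 (by positivity) e2
    rw [← Real.rpow_sub hB0] at e3
    refine le_trans ?_ (Real.rpow_le_rpow (by positivity) e3 hN.le)
    rw [← Real.rpow_mul hB0.le]
    refine Real.rpow_le_rpow_of_exponent_le hB1 ?_
    rw [hmN]; nlinarith
  have hBm0 : 0 < B ^ m := Real.rpow_pos_of_pos hB0 _
  -- the number `θ` makes the level positive even if `A`, `X` and `G` vanish
  have key : ∀ θ : ℝ, 0 < θ →
      ∀ᵐ z ∂(volume.restrict (Ioo (T - σ' * (η * Φ)) T ×ˢ Ioo (x₀ - r * σ') (x₀ + r * σ'))),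
        u z ≤ B ^ m * (A + X + G) + θ := by
    intro θ hθ
    have hAB : 0 ≤ B ^ m * A := mul_nonneg hBm0.le hA0
    have hXB : 0 ≤ B ^ m * X := mul_nonneg hBm0.le hX0
    have hGB : 0 ≤ B ^ m * G := mul_nonneg hBm0.le hG0
    have hlamA : B ^ m * A ≤ B ^ m * (A + X + G) + θ := by linarith
    refine L.le_of_levelEnergy_le hC₀ hσ' hσσ' hσ hX0 hG0 hX hG (by linarith) ?_ ?_
      (a := 1 / N) ?_ ?_
    · have := mul_le_mul_of_nonneg_right g1 hG0
      linarith
    · have := mul_le_mul_of_nonneg_right g2 hX0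
      rw [one_div_mul_eq_div] at this
      linarith
    · rw [hNdef, iterationExponent, one_div_div]
    · rw [one_div_one_div]
      refine hA.trans ?_
      have e1 : A ^ 2 ≤ B ^ (-(2 * m)) * (B ^ m * (A + X + G) + θ) ^ 2 := by
        have e2 := pow_le_pow_left₀ hAB hlamA 2
        have e3 : B ^ (-(2 * m)) * (B ^ m * A) ^ 2 = A ^ 2 := by
          rw [mul_pow, ← Real.rpow_natCast (B ^ m), ← Real.rpow_mul hB0.le, ← mul_assoc,
            ← Real.rpow_add hB0]
          have : -(2 * m) + m * ((2 : ℕ) : ℝ) = 0 := by push_cast; ring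
          rw [this, Real.rpow_zero, one_mul]
        rw [← e3]
        exact mul_le_mul_of_nonneg_left e2 (Real.rpow_nonneg hB0.le _)
      have e4 := mul_le_mul_of_nonneg_right g3
        (sq_nonneg (B ^ m * (A + X + G) + θ))
      have e5 := mul_le_mul_of_nonneg_left (e1.trans e4) (show 0 ≤ r * Φ by positivity)
      linarith
  have key2 : ∀ j : ℕ,
      ∀ᵐ z ∂(volume.restrict (Ioo (T - σ' * (η * Φ)) T ×ˢ Ioo (x₀ - r * σ') (x₀ + r * σ'))),
        u z ≤ B ^ m * (A + X + G) + 1 / ((j : ℝ) + 1) := fun j => key _ (by positivity)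
  filter_upwards [ae_all_iff.2 key2] with z hz
  have := (tendsto_one_div_add_atTop_nhds_zero_nat (𝕜 := ℝ)).const_add (B ^ m * (A + X + G))
  rw [add_zero] at this
  exact ge_of_tendsto' this hz

/-- Elementary form of the interpolation step, for the gap `e` and a bound `M` at the scale
`e ^ (-2 m)`. -/
lemma interpolation_step {K m e ε M X Z : ℝ} (hK : 0 < K) (hm : 0 ≤ m) (he : 0 < e) (heε : e ≤ ε)
    (hM : 0 ≤ M) (hX : 0 ≤ X) (hZ : 0 ≤ Z) :
    K * (e / 2) ^ (-m) * (Real.sqrt ((e / 2) ^ (-(2 * m)) * M * X) + Z)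
      ≤ e ^ (-(2 * m)) * (M / 2 + (K ^ 2 * 16 ^ m * X / 2 + K * 2 ^ m * ε ^ m * Z)) := by
  set p := e ^ (-m) with hp
  have hp0 : 0 < p := Real.rpow_pos_of_pos he _
  set q := (2 : ℝ) ^ m with hq
  have hq0 : 0 < q := Real.rpow_pos_of_pos (by norm_num) _
  have e1 : (e / 2) ^ (-m) = p * q := by
    rw [Real.div_rpow he.le (by norm_num), Real.rpow_neg (by norm_num : (0 : ℝ) ≤ 2), div_inv_eq_mul]
  have e2 : e ^ (-(2 * m)) = p ^ 2 := by
    rw [hp, ← Real.rpow_natCast, ← Real.rpow_mul he.le]; congr 1; push_cast; ring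
  have e3 : (e / 2) ^ (-(2 * m)) = (p * q) ^ 2 := by
    rw [← e1, ← Real.rpow_natCast, ← Real.rpow_mul (by positivity)]; congr 1; push_cast; ring
  have e4 : (16 : ℝ) ^ m = q ^ 4 := by
    rw [hq, ← Real.rpow_natCast, ← Real.rpow_mul (by norm_num), mul_comm,
      Real.rpow_mul (by norm_num)]
    norm_num
  have e5 : 1 ≤ p * ε ^ m := by
    rw [hp, Real.rpow_neg he.le, inv_mul_eq_div, one_le_div (Real.rpow_pos_of_pos he _)]
    exact Real.rpow_le_rpow he.le heε hm
  rw [e1, e2, e3, e4, mul_assoc ((p * q) ^ 2), Real.sqrt_mul (sq_nonneg _),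
    Real.sqrt_sq (by positivity)]
  have e6 : Real.sqrt (M * X) * (K * q ^ 2) ≤ M / 2 + K ^ 2 * q ^ 4 * X / 2 := by
    rw [Real.sqrt_mul hM]
    have h1 := Real.sq_sqrt hM
    have h2 := Real.sq_sqrt hX
    have h3 : (Real.sqrt M - K * q ^ 2 * Real.sqrt X) ^ 2 = Real.sqrt M ^ 2
        + K ^ 2 * q ^ 4 * Real.sqrt X ^ 2
        - 2 * (Real.sqrt M * Real.sqrt X * (K * q ^ 2)) := by ring
    rw [h1, h2] at h3
    linarith [sq_nonneg (Real.sqrt M - K * q ^ 2 * Real.sqrt X)]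
  have e7 := mul_le_mul_of_nonneg_left e6 (show 0 ≤ p ^ 2 by positivity)
  have e8 := mul_le_mul_of_nonneg_left e5 (show 0 ≤ p * K * q * Z by positivity)
  linarith

set_option maxHeartbeats 400000 in
/-- The bound of the supremum by the mean and the tail, by interpolation between nested
cylinders. -/
lemma le_mean_add_tail {δ : ℝ} (hC₀ : HasCutoffs C₀)
    (L : LocalSetting k l ν Λ η cbar c₀ cη ω p₀ r Φ T x₀ u Du Q u₀)
    (hC16 : 16 ≤ C₄) (hC₄ : iterationConst ν Λ η cbar c₀ cη C₀ ≤ C₄)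
    (hδ : 0 < δ) (hδσ : δ ≤ σ') (hσσ' : σ' < σ) (hσ : σ ≤ 1) (hX0 : 0 ≤ X) (hG0 : 0 ≤ G)
    (hX : mass u T x₀ (T - σ * (η * Φ)) (r * σ) ≤ ENNReal.ofReal (r * Φ * X))
    (hG : pastTail k u u₀ T x₀ (T - σ * (η * Φ)) (r * σ) ≤ ENNReal.ofReal (G / r)) :
    ∀ᵐ z ∂(volume.restrict (Ioo (T - σ' * (η * Φ)) T ×ˢ Ioo (x₀ - r * σ') (x₀ + r * σ'))),
      u z ≤ (16 * C₄ ^ 2) ^ gapExponent ω p₀ * (3 + 2 * (c₀ / (δ ^ 2 * η * min 1 η))) *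
        ((σ - σ') ^ (-(2 * gapExponent ω p₀)) * X + (σ - σ') ^ (-gapExponent ω p₀) * G) := by
  have hε0 : 0 < σ - σ' := sub_pos.2 hσσ'
  have hσ'0 : 0 < σ' := hδ.trans_le hδσ
  have hε1 : σ - σ' ≤ 1 := by linarith
  have hr := L.r_pos
  have hΦ := L.Φ_pos
  have hh := L.h_pos
  have hη := L.η_pos
  have hmin := L.min_pos
  have hc₀ := L.c₀_pos
  have hm2 := two_le_gapExponent L.ω_pos L.one_lt_p₀
  have hstar := fun {σ₁ σ₂ A X G : ℝ} => L.le_rpow_mul_add hC₀ hC16 hC₄ (σ' := σ₁) (σ := σ₂)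
    (A := A) (X := X) (G := G)
  set m := gapExponent ω p₀ with hm
  set ε := σ - σ' with hε
  set Cδ := c₀ / (δ ^ 2 * η * min 1 η) with hCδ
  have hCδ0 : 0 < Cδ := by positivity
  have hC0 : 0 < C₄ := by linarith
  set K := C₄ ^ m with hK
  have hK0 : 0 < K := Real.rpow_pos_of_pos hC0 _
  have hKe : ∀ e : ℝ, 0 < e → (C₄ / e) ^ m = K * e ^ (-m) := fun e he => by
    rw [Real.div_rpow hC0.le he.le, Real.rpow_neg he.le, div_eq_mul_inv]
  set Z := X + (G + Cδ * X) with hZ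
  have hZ0 : 0 ≤ Z := by positivity
  set c := K ^ 2 * 16 ^ m * X / 2 + K * 2 ^ m * ε ^ m * Z with hc
  have h16 : (0 : ℝ) < 16 ^ m := Real.rpow_pos_of_pos (by norm_num) _
  have h2m : (0 : ℝ) < 2 ^ m := Real.rpow_pos_of_pos (by norm_num) _
  have hεm : 0 < ε ^ m := Real.rpow_pos_of_pos hε0 _
  have hc0 : 0 ≤ c := by positivity
  -- without a rate, the mean square provides the starting value of the iteration below
  obtain ⟨A, hA0, hA⟩ : ∃ A, 0 ≤ A ∧
      levelEnergy u T x₀ 0 (T - σ * (η * Φ)) (r * σ) ≤ r * Φ * A ^ 2 := by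
    refine ⟨_, Real.sqrt_nonneg
      (levelEnergy u T x₀ 0 (T - σ * (η * Φ)) (r * σ) / (r * Φ)), ?_⟩
    rw [Real.sq_sqrt (div_nonneg (ExtendedSubsolution.levelEnergy_nonneg _ _ _ _ _ _)
      (by positivity)), mul_div_cancel₀ _ (by positivity)]
  set M₀ := K * (A + X + G) with hM₀
  have hM₀0 : 0 ≤ M₀ := by positivity
  -- each step turns a bound `M` for the weighted suprema into `M / 2 + c`
  have hbound : ∀ (n : ℕ) (s : ℝ), σ' ≤ s → s < σ →
      ∀ᵐ z ∂(volume.restrict (Ioo (T - s * (η * Φ)) T ×ˢ Ioo (x₀ - r * s) (x₀ + r * s))),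
        u z ≤ (σ - s) ^ (-(2 * m)) * (M₀ / 2 ^ n + 2 * c) := by
    intro n
    induction n with
    | zero =>
      intro s hs hsσ
      have he0 : 0 < σ - s := sub_pos.2 hsσ
      filter_upwards [hstar (hσ'0.trans_le hs) hsσ hσ hA0 hX0 hG0 hA hX hG] with z hz
      refine hz.trans ?_
      have e1 : (σ - s) ^ (-m) ≤ (σ - s) ^ (-(2 * m)) :=
        Real.rpow_le_rpow_of_exponent_ge he0 (by linarith) (by linarith)
      rw [hKe _ he0]
      calc K * (σ - s) ^ (-m) * (A + X + G) = (σ - s) ^ (-m) * M₀ := by rw [hM₀]; ring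
        _ ≤ (σ - s) ^ (-(2 * m)) * M₀ := mul_le_mul_of_nonneg_right e1 hM₀0
        _ ≤ _ := mul_le_mul_of_nonneg_left (by rw [pow_zero, div_one]; linarith)
            (Real.rpow_nonneg he0.le _)
    | succ n ih =>
      intro s hs hsσ
      have he0 : 0 < σ - s := sub_pos.2 hsσ
      have hs0 : 0 < s := hσ'0.trans_le hs
      set s₁ := (s + σ) / 2 with hs₁
      have hss₁ : s < s₁ := by rw [hs₁]; linarith
      have hs₁σ : s₁ < σ := by rw [hs₁]; linarith
      have hσs : σ - s₁ = (σ - s) / 2 := by rw [hs₁]; ring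
      have hss : s₁ - s = (σ - s) / 2 := by rw [hs₁]; ring
      have hi := ih s₁ (by linarith) hs₁σ
      rw [hσs] at hi
      set M := M₀ / 2 ^ n + 2 * c with hM
      have hM0 : 0 ≤ M := by positivity
      have ht : T - σ * (η * Φ) ≤ T - s₁ * (η * Φ) := by
        have := mul_le_mul_of_nonneg_right hs₁σ.le hh.le
        linarith
      have hRR : r * s₁ ≤ r * σ := mul_le_mul_of_nonneg_left hs₁σ.le hr.le
      have hX' := (mass_mono (u := u) (T := T) (x₀ := x₀) ht hRR).trans hX
      have hV0 : 0 ≤ ((σ - s) / 2) ^ (-(2 * m)) * M := by positivity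
      have hA' : levelEnergy u T x₀ 0 (T - s₁ * (η * Φ)) (r * s₁)
          ≤ r * Φ * Real.sqrt (((σ - s) / 2) ^ (-(2 * m)) * M * X) ^ 2 := by
        rw [Real.sq_sqrt (mul_nonneg hV0 hX0)]
        have := L.subsolution.levelEnergy_zero_le hV0 (by positivity) hi hX'
        linarith
      have hG' : pastTail k u u₀ T x₀ (T - s₁ * (η * Φ)) (r * s₁)
          ≤ ENNReal.ofReal ((G + Cδ * X) / r) := by
        refine (pastTail_le_add (q := Cδ / (Φ * r ^ 2)) ht
          (by have := mul_pos (hs0.trans hss₁) hh; linarith) hRR fun τ hτ => ?_).trans ?_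
        · refine L.kdot_le hδ (by linarith) ?_
          have h1 : δ * (η * Φ) ≤ s₁ * (η * Φ) :=
            mul_le_mul_of_nonneg_right (by linarith) hh.le
          linarith [hτ.2]
        · refine (add_le_add hG (mul_le_mul' le_rfl hX)).trans ?_
          rw [← ENNReal.ofReal_mul (by positivity), ← ENNReal.ofReal_add (by positivity)
            (by positivity)]
          refine ENNReal.ofReal_le_ofReal (le_of_eq ?_)
          field_simp
      have hb := hstar hs0 hss₁ (by linarith) (Real.sqrt_nonneg _) hX0
        (by positivity : 0 ≤ G + Cδ * X) hA' hX' hG'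
      rw [hss, hKe _ (by linarith)] at hb
      filter_upwards [hb] with z hz
      refine hz.trans ?_
      have := interpolation_step (K := K) (m := m) (e := σ - s) (ε := ε) (M := M) (X := X) (Z := Z)
        hK0 (by linarith) he0 (by rw [hε]; linarith) hM0 hX0 hZ0
      rw [add_assoc (Real.sqrt _)]
      refine this.trans (le_of_eq ?_)
      rw [← hc, hM, pow_succ]
      ring
  have hfin : ∀ᵐ z ∂(volume.restrict
      (Ioo (T - σ' * (η * Φ)) T ×ˢ Ioo (x₀ - r * σ') (x₀ + r * σ'))),
        u z ≤ ε ^ (-(2 * m)) * (2 * c) := by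
    filter_upwards [ae_all_iff.2 fun n => hbound n σ' le_rfl hσσ'] with z hz
    have h1 : Tendsto (fun n : ℕ => M₀ / 2 ^ n) atTop (𝓝 0) := by
      have := (tendsto_pow_atTop_nhds_zero_of_lt_one (r := (1 / 2 : ℝ)) (by norm_num)
        (by norm_num)).const_mul M₀
      simpa [div_eq_mul_inv] using this
    have h2 := (h1.add_const (2 * c)).const_mul (ε ^ (-(2 * m)))
    rw [zero_add] at h2
    exact ge_of_tendsto' h2 hz
  filter_upwards [hfin] with z hz
  refine hz.trans ?_
  set p := ε ^ (-m) with hp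
  have hp1 : p * ε ^ m = 1 := by
    rw [hp, ← Real.rpow_add hε0, neg_add_cancel, Real.rpow_zero]
  have hp2 : ε ^ (-(2 * m)) = p ^ 2 := by
    rw [hp, ← Real.rpow_natCast, ← Real.rpow_mul hε0.le]; congr 1; push_cast; ring
  have hpge : 1 ≤ p := Real.one_le_rpow_of_pos_of_le_one_of_nonpos hε0 hε1 (by linarith)
  have hD : (16 * C₄ ^ 2) ^ m = K ^ 2 * 16 ^ m := by
    rw [Real.mul_rpow (by norm_num) (by positivity), hK, ← Real.rpow_natCast, ← Real.rpow_mul hC0.le,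
      ← Real.rpow_natCast, ← Real.rpow_mul hC0.le, mul_comm (2 : ℕ).cast m, mul_comm]
  have hKD : K * 2 ^ m ≤ K ^ 2 * 16 ^ m := by
    have h1 : 1 ≤ K := Real.one_le_rpow (by linarith) (by linarith)
    have h2 : (2 : ℝ) ^ m ≤ 16 ^ m := Real.rpow_le_rpow (by norm_num) (by norm_num) (by linarith)
    calc K * 2 ^ m ≤ K * 16 ^ m := mul_le_mul_of_nonneg_left h2 hK0.le
      _ ≤ K ^ 2 * 16 ^ m := mul_le_mul_of_nonneg_right (le_self_pow₀ h1 two_ne_zero) h16.le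
  rw [hp2, hD]
  set D := K ^ 2 * 16 ^ m with hDdef
  have hD0 : 0 < D := by positivity
  have e1 : p ^ 2 * (2 * c) = p ^ 2 * (D * X) + p * (p * ε ^ m) * (2 * (K * 2 ^ m)) * Z := by
    rw [hc]; ring
  rw [e1, hp1, mul_one]
  have e2 : p * (2 * (K * 2 ^ m)) * Z ≤ p * (2 * D) * Z := by gcongr
  have e3 : p * (2 * D) * Z = 2 * D * (1 + Cδ) * (p * X) + 2 * D * (p * G) := by rw [hZ]; ring
  have e4 : p * X ≤ p ^ 2 * X := mul_le_mul_of_nonneg_right (le_self_pow₀ hpge two_ne_zero) hX0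
  have e5 := mul_le_mul_of_nonneg_left e4 (show 0 ≤ 2 * D * (1 + Cδ) by positivity)
  have e6 : 0 ≤ D * (1 + 2 * Cδ) * (p * G) := by positivity
  calc _ ≤ p ^ 2 * (D * X) + (2 * D * (1 + Cδ) * (p ^ 2 * X) + 2 * D * (p * G))
        + D * (1 + 2 * Cδ) * (p * G) := by linarith
    _ = _ := by ring

end LocalSetting

/-! ### The intrinsic time -/

namespace IsKernelPair

variable {k l : ℝ → ℝ}

lemma conv_one_pos (H : IsKernelPair k l) {t : ℝ} (ht : 0 < t) : 0 < conv (fun _ => 1) l t := by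
  refine (H.conv_one_nonneg ht.le).lt_of_ne fun h0 => ?_
  have hl : ∀ s ∈ Ioc 0 t, l s = 0 := fun s hs => by
    have h1 := H.mul_l_le_conv_one hs.1
    have h2 := H.conv_one_mono hs.1.le hs.2
    have h3 : s * l s ≤ s * 0 := by rw [mul_zero]; linarith
    exact le_antisymm (le_of_mul_le_mul_left h3 hs.1) (H.nonneg_l s hs.1)
  have h1 := H.conv_eq_one t ht
  rw [conv, intervalIntegral.integral_of_le ht.le, setIntegral_eq_zero_of_forall_eq_zero
    fun τ hτ => by rw [hl τ hτ, mul_zero]] at h1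
  exact zero_ne_one h1

lemma continuousOn_conv_one (H : IsKernelPair k l) {τ : ℝ} (hτ : 0 ≤ τ) :
    ContinuousOn (conv (fun _ => 1) l) (Icc 0 τ) := by
  have h1 := intervalIntegral.continuousOn_primitive_interval'
    (H.intervalIntegrable_l le_rfl hτ) (left_mem_uIcc)
  rw [uIcc_of_le hτ] at h1
  exact h1.congr fun t _ => conv_one l t

/-- For radii with `r ^ 2 ≤ L(τ)` the intrinsic time exists and is at most `τ`. -/
lemma Φ_spec (H : IsKernelPair k l) {r τ : ℝ} (hr : 0 < r) (hτ : 0 ≤ τ)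
    (hrτ : r ^ 2 ≤ conv (fun _ => 1) l τ) :
    0 < Φ l r ∧ Φ l r ≤ τ ∧ conv (fun _ => 1) l (Φ l r) = r ^ 2 := by
  have hc := H.continuousOn_conv_one hτ
  have h0 : conv (fun _ => 1) l 0 = 0 := by simp [conv_one]
  have hr2 : 0 < r ^ 2 := by positivity
  set S : Set ℝ := Icc 0 τ ∩ conv (fun _ => 1) l ⁻¹' {r ^ 2} with hS
  have hScl : IsClosed S := hc.preimage_isClosed_of_isClosed isClosed_Icc isClosed_singleton
  have hSc : IsCompact S := isCompact_Icc.of_isClosed_subset hScl inter_subset_left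
  have hSne : S.Nonempty := by
    obtain ⟨t, ht, hte⟩ := intermediate_value_Icc hτ hc (show r ^ 2 ∈ Icc _ _ by
      rw [h0]; exact ⟨hr2.le, hrτ⟩)
    exact ⟨t, ht, hte⟩
  obtain ⟨hmem, hval⟩ := hSc.sInf_mem hSne
  have hpos : 0 < sInf S := hmem.1.lt_of_ne fun h => by
    have : conv (fun _ => 1) l (sInf S) = r ^ 2 := hval
    rw [← h, h0] at this
    exact hr2.ne this
  have hleast : IsLeast {t : ℝ | 0 < t ∧ k₁ l t = (r ^ 2)⁻¹} (sInf S) := by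
    refine ⟨⟨hpos, ?_⟩, fun t ht => ?_⟩
    · rw [k₁, show conv (fun _ => 1) l (sInf S) = r ^ 2 from hval, one_div]
    · rcases le_total t τ with h | h
      · refine csInf_le hSc.bddBelow ⟨⟨ht.1.le, h⟩, ?_⟩
        have := ht.2
        rw [k₁, one_div] at this
        exact inv_injective this
      · exact hmem.2.trans h
  rw [Φ, hleast.csInf_eq]
  exact ⟨hpos, hmem.2, hval⟩

lemma ofReal_sqrt_lt_r₀ (H : IsKernelPair k l) {τ : ℝ} (hτ : 0 < τ) :
    ENNReal.ofReal (Real.sqrt (conv (fun _ => 1) l τ / 2)) < r₀ l := by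
  have hL := H.conv_one_pos hτ
  rw [r₀, Real.sqrt_eq_rpow, ← ENNReal.ofReal_rpow_of_nonneg (by positivity) (by norm_num)]
  refine ENNReal.rpow_lt_rpow ?_ (by norm_num)
  refine lt_of_lt_of_le ((ENNReal.ofReal_lt_ofReal_iff hL).2 (half_lt_self hL)) ?_
  rw [conv_one, intervalIntegral_eq_setIntegral hτ.le, ofReal_integral_eq_lintegral_ofReal
    (H.integrable_l τ hτ) ((ae_restrict_mem measurableSet_Ioo).mono fun x hx => H.nonneg_l x hx.1)]
  exact lintegral_mono_set Ioo_subset_Ioi_self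

end IsKernelPair

/-! ### Collecting the constants -/

/-- The quadratic power of `ε` compensates the power of `D`, by completing the square in the
exponent. The bound does not depend on `m`. -/
lemma rpow_mul_rpow_sq_le {D q ε m : ℝ} (hD : 0 < D) (hq1 : q < 1) (hε : 0 < ε)
    (hεq : ε ≤ q) :
    D ^ m * ε ^ (m ^ 2) ≤ Real.exp (Real.log D ^ 2 / (4 * -Real.log q)) := by
  have hq : 0 < q := hε.trans_le hεq
  have hb : 0 < -Real.log q := neg_pos.2 (Real.log_neg hq hq1)
  have h1 : ε ^ (m ^ 2) ≤ q ^ (m ^ 2) := Real.rpow_le_rpow hε.le hεq (sq_nonneg m)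
  refine (mul_le_mul_of_nonneg_left h1 (Real.rpow_nonneg hD.le _)).trans ?_
  rw [Real.rpow_def_of_pos hD, Real.rpow_def_of_pos hq, ← Real.exp_add]
  refine Real.exp_le_exp.2 ?_
  rw [le_div_iff₀ (by positivity)]
  nlinarith [sq_nonneg (Real.log D - 2 * m * -Real.log q)]

/-- The exponents `m` and `2 m` are enlarged such that the constant no longer depends on `m`. -/
lemma absorb_constant {D q ε m C B X G : ℝ} (hD : 0 < D) (hq1 : q < 1) (hε : 0 < ε)
    (hεq : ε ≤ q) (hB : 0 ≤ B) (hX : 0 ≤ X) (hG : 0 ≤ G)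
    (hC : Real.exp (Real.log D ^ 2 / (4 * -Real.log q)) * B ≤ C) :
    D ^ m * B * (ε ^ (-(2 * m)) * X + ε ^ (-m) * G)
      ≤ C * ε ^ (-2 * (m + m ^ 2)) * X + C / ε ^ (m + m ^ 2) * G := by
  have hDm := rpow_mul_rpow_sq_le (m := m) hD hq1 hε hεq
  have hDB : D ^ m * B ≤ C * ε ^ (-(m ^ 2)) := by
    have hp := Real.rpow_pos_of_pos hε (m ^ 2)
    rw [Real.rpow_neg hε.le, ← div_eq_mul_inv, le_div_iff₀ hp]
    calc D ^ m * B * ε ^ (m ^ 2) = D ^ m * ε ^ (m ^ 2) * B := by ring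
      _ ≤ _ := mul_le_mul_of_nonneg_right hDm hB
      _ ≤ _ := hC
  have hC0 : 0 ≤ C := le_trans (by positivity) hC
  have e1 : ε ^ (-(m ^ 2)) ≤ ε ^ (-(2 * m ^ 2)) :=
    Real.rpow_le_rpow_of_exponent_ge hε (by linarith) (by nlinarith [sq_nonneg m])
  have e2 : ε ^ (-2 * (m + m ^ 2)) = ε ^ (-(2 * m ^ 2)) * ε ^ (-(2 * m)) := by
    rw [← Real.rpow_add hε]; ring_nf
  have e3 : C / ε ^ (m + m ^ 2) = C * ε ^ (-(m ^ 2)) * ε ^ (-m) := by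
    rw [mul_assoc, ← Real.rpow_add hε, div_eq_mul_inv, ← Real.rpow_neg hε.le]; ring_nf
  rw [e2, e3]
  have f1 : D ^ m * B * (ε ^ (-(2 * m)) * X) ≤ C * ε ^ (-(2 * m ^ 2)) * (ε ^ (-(2 * m)) * X) :=
    mul_le_mul_of_nonneg_right (hDB.trans (mul_le_mul_of_nonneg_left e1 hC0))
      (mul_nonneg (Real.rpow_nonneg hε.le _) hX)
  have f2 : D ^ m * B * (ε ^ (-m) * G) ≤ C * ε ^ (-(m ^ 2)) * (ε ^ (-m) * G) :=
    mul_le_mul_of_nonneg_right hDB (mul_nonneg (Real.rpow_nonneg hε.le _) hG)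
  linarith

/-- The constant in the final estimate; `C₀` is the constant of the cutoff functions. The maximum
and the absolute value make it positive for all values of the parameters. -/
def harnackConst (ν Λ δ η cbar c₀ cη C₀ : ℝ) : ℝ :=
  Real.exp (Real.log (16 * max 16 (LocalSetting.iterationConst ν Λ η cbar c₀ cη C₀) ^ 2) ^ 2
    / (4 * -Real.log (1 - δ))) * (3 + 2 * (|c₀| / (δ ^ 2 * η * min 1 η)))

lemma harnackConst_pos {ν Λ δ η cbar c₀ cη C₀ : ℝ} (hδ : 0 < δ) (hη : 0 < η) :
    0 < harnackConst ν Λ δ η cbar c₀ cη C₀ := by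
  have : 0 < min 1 η := lt_min one_pos hη
  rw [harnackConst]; positivity

/-- The estimate of the supremum, with values in `[0,∞]`. -/
lemma LocalSetting.ofReal_le_mass_add_pastTail {k l : ℝ → ℝ}
    {ν Λ η cbar c₀ cη ω p₀ r Φ T x₀ δ σ σ' C₀ : ℝ} {u Du Q : ℝ × ℝ → ℝ} {u₀ : ℝ → ℝ}
    (hC₀ : HasCutoffs C₀)
    (L : LocalSetting k l ν Λ η cbar c₀ cη ω p₀ r Φ T x₀ u Du Q u₀) (hδ : 0 < δ)
    (hδσ : δ ≤ σ') (hσσ' : σ' < σ) (hσ : σ ≤ 1) :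
    ∀ᵐ z ∂(volume.restrict (Ioo (T - σ' * (η * Φ)) T ×ˢ Ioo (x₀ - r * σ') (x₀ + r * σ'))),
      ENNReal.ofReal (u z) ≤
        ENNReal.ofReal (harnackConst ν Λ δ η cbar c₀ cη C₀
          * (σ - σ') ^ (-2 * (gapExponent ω p₀ + gapExponent ω p₀ ^ 2)) * (1 / (r * Φ)))
          * mass u T x₀ (T - σ * (η * Φ)) (r * σ) +
        ENNReal.ofReal (harnackConst ν Λ δ η cbar c₀ cη C₀
          / (σ - σ') ^ (gapExponent ω p₀ + gapExponent ω p₀ ^ 2))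
          * (ENNReal.ofReal r * pastTail k u u₀ T x₀ (T - σ * (η * Φ)) (r * σ)) := by
  have hε0 : 0 < σ - σ' := sub_pos.2 hσσ'
  have hr := L.r_pos
  have hΦ := L.Φ_pos
  have hC := harnackConst_pos (ν := ν) (Λ := Λ) (cbar := cbar) (c₀ := c₀) (cη := cη) (C₀ := C₀)
    hδ L.η_pos
  have hm := L.min_pos
  set m := gapExponent ω p₀ with hmdef
  set C := harnackConst ν Λ δ η cbar c₀ cη C₀ with hCdef
  have hp1 : 0 < C * (σ - σ') ^ (-2 * (m + m ^ 2)) * (1 / (r * Φ)) := by positivity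
  have hp2 : 0 < C / (σ - σ') ^ (m + m ^ 2) := by positivity
  -- if the right-hand side is infinite, there is nothing to prove
  by_cases h1 : mass u T x₀ (T - σ * (η * Φ)) (r * σ) = ∞
  · refine ae_of_all _ fun z => ?_
    rw [h1, ENNReal.mul_top (ENNReal.ofReal_pos.2 hp1).ne', top_add]
    exact le_top
  by_cases h2 : pastTail k u u₀ T x₀ (T - σ * (η * Φ)) (r * σ) = ∞
  · refine ae_of_all _ fun z => ?_
    rw [h2, ENNReal.mul_top (ENNReal.ofReal_pos.2 hr).ne',
      ENNReal.mul_top (ENNReal.ofReal_pos.2 hp2).ne', add_top]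
    exact le_top
  obtain ⟨M, hM0, hM⟩ : ∃ M : ℝ, 0 ≤ M ∧
      mass u T x₀ (T - σ * (η * Φ)) (r * σ) = ENNReal.ofReal M :=
    ⟨_, ENNReal.toReal_nonneg, (ENNReal.ofReal_toReal h1).symm⟩
  obtain ⟨P, hP0, hP⟩ : ∃ P : ℝ, 0 ≤ P ∧
      pastTail k u u₀ T x₀ (T - σ * (η * Φ)) (r * σ) = ENNReal.ofReal P :=
    ⟨_, ENNReal.toReal_nonneg, (ENNReal.ofReal_toReal h2).symm⟩
  have hmain := L.le_mean_add_tail (X := M / (r * Φ)) (G := r * P) hC₀ (le_max_left 16 _)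
    (le_max_right _ _) hδ hδσ hσσ' hσ (by positivity) (by positivity)
    (by rw [hM, mul_div_cancel₀ _ (by positivity)])
    (by rw [hP, mul_div_cancel_left₀ _ hr.ne'])
  filter_upwards [hmain] with z hz
  have hη := L.η_pos
  have hc₀ := L.c₀_pos
  have habs := absorb_constant (m := m) (D := 16 * max 16 (iterationConst ν Λ η cbar c₀ cη C₀) ^ 2)
    (q := 1 - δ) (ε := σ - σ') (B := 3 + 2 * (c₀ / (δ ^ 2 * η * min 1 η))) (C := C)
    (X := M / (r * Φ)) (G := r * P) (by have := le_max_left 16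
                                          (iterationConst ν Λ η cbar c₀ cη C₀)
                                        positivity) (by linarith) hε0 (by linarith)
    (by positivity) (by positivity) (by positivity)
    (by rw [hCdef, harnackConst, abs_of_pos hc₀])
  refine (ENNReal.ofReal_le_ofReal (hz.trans habs)).trans (le_of_eq ?_)
  rw [hM, hP, ← ENNReal.ofReal_mul hr.le, ← ENNReal.ofReal_mul hp1.le,
    ← ENNReal.ofReal_mul hp2.le, ← ENNReal.ofReal_add (by positivity) (by positivity)]
  congr 2
  rw [mul_assoc _ (1 / (r * Φ)), one_div_mul_eq_div]

/-! ### Representatives -/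

lemma IsH1.congr {I : Set ℝ} {f f' g g' : ℝ → ℝ} (h : IsH1 I f f')
    (h1 : f =ᵐ[volume.restrict I] g) (h2 : f' =ᵐ[volume.restrict I] g') : IsH1 I g g' where
  memLp := h.memLp.ae_eq h1
  memLp_deriv := h.memLp_deriv.ae_eq h2
  weak φ hφ := by
    have e1 : ∫ x in I, f x * deriv φ x = ∫ x in I, g x * deriv φ x :=
      integral_congr_ae (h1.mul EventuallyEq.rfl)
    have e2 : ∫ x in I, f' x * φ x = ∫ x in I, g' x * φ x :=
      integral_congr_ae (h2.mul EventuallyEq.rfl)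
    rw [← e1, ← e2]
    exact h.weak φ hφ

lemma ae_ae_of_ae_cyl {T a b : ℝ} {p : ℝ × ℝ → Prop} (h : ∀ᵐ z ∂(cyl T (Ioo a b)), p z) :
    ∀ᵐ t ∂(volume.restrict (Ioo 0 T)), ∀ᵐ x ∂(volume.restrict (Ioo a b)), p (t, x) := by
  rw [cyl, Measure.volume_eq_prod, ← Measure.prod_restrict] at h
  exact Measure.ae_ae_of_ae_prod h

lemma ae_ae_swap_of_ae_cyl {T a b : ℝ} {p : ℝ × ℝ → Prop} (h : ∀ᵐ z ∂(cyl T (Ioo a b)), p z) :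
    ∀ᵐ x ∂(volume.restrict (Ioo a b)), ∀ᵐ t ∂(volume.restrict (Ioo 0 T)), p (t, x) := by
  rw [cyl, ae_restrict_iff' (measurableSet_Ioo.prod measurableSet_Ioo)] at h
  filter_upwards [ae_restrict_of_ae (ae_ae_swap h), ae_restrict_mem measurableSet_Ioo] with x hx hxI
  rw [ae_restrict_iff' measurableSet_Ioo]
  filter_upwards [hx] with t ht htT using ht ⟨htT, hxI⟩

lemma ae_cyl_of_ae {T a b : ℝ} {p : ℝ → Prop} (h : ∀ᵐ x ∂(volume.restrict (Ioo a b)), p x) :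
    ∀ᵐ z ∂(cyl T (Ioo a b)), p z.2 := by
  rw [cyl, Measure.volume_eq_prod, ← Measure.prod_restrict]
  exact Measure.quasiMeasurePreserving_snd.ae h

/-- The convolution in time respects almost everywhere equality on the cylinder, because almost all
lines in the direction of time meet an exceptional null set in a null set. -/
lemma timeConv_sub_congr {k : ℝ → ℝ} {T a b : ℝ} {u v : ℝ × ℝ → ℝ} {u₀ v₀ : ℝ → ℝ}
    (h : u =ᵐ[cyl T (Ioo a b)] v) (h₀ : u₀ =ᵐ[volume.restrict (Ioo a b)] v₀) :
    timeConv k (fun y => u y - u₀ y.2) =ᵐ[cyl T (Ioo a b)] timeConv k (fun y => v y - v₀ y.2) := by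
  have h1 : ∀ᵐ x ∂(volume.restrict (Ioo a b)), ∀ t ∈ Ioo 0 T,
      timeConv k (fun y => u y - u₀ y.2) (t, x) = timeConv k (fun y => v y - v₀ y.2) (t, x) := by
    filter_upwards [ae_ae_swap_of_ae_cyl h, h₀] with x hx hx0 t ht
    rw [ae_restrict_iff' measurableSet_Ioo] at hx
    simp only [timeConv, conv]
    refine intervalIntegral.integral_congr_ae ?_
    have hne : ∀ᵐ τ : ℝ, τ ≠ t := by simp [ae_iff]
    filter_upwards [hx, hne] with τ hτ hτt hτI
    rw [uIoc_of_le ht.1.le] at hτI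
    rw [hτ ⟨hτI.1, (lt_of_le_of_ne hτI.2 hτt).trans ht.2⟩, hx0]
  filter_upwards [ae_cyl_of_ae (T := T) h1, ae_restrict_mem (measurableSet_Ioo.prod
    measurableSet_Ioo)] with z hz hzS using hz z.1 hzS.1

/-- A weak subsolution has a representative that is extended by zero and measurable, nonnegative
everywhere. -/
lemma IsWeakSubsolution.exists_extendedSubsolution {k : ℝ → ℝ} {A u : ℝ × ℝ → ℝ} {u₀ : ℝ → ℝ}
    {T a b ν Λ : ℝ} (h : IsWeakSubsolution k A u₀ T (Ioo a b) u)
    (hA : AEStronglyMeasurable A (cyl T (Ioo a b)))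
    (hΛ : ∀ᵐ z ∂(cyl T (Ioo a b)), |A z| ≤ Λ) (hAν : ∀ᵐ z ∂(cyl T (Ioo a b)), ν ≤ A z)
    (hu₀ : MemLp u₀ 2 (volume.restrict (Ioo a b)))
    (hu0 : ∀ᵐ z ∂(cyl T (Ioo a b)), 0 ≤ u z) (hu₀0 : ∀ᵐ x ∂(volume.restrict (Ioo a b)), 0 ≤ u₀ x) :
    ∃ (v Dv Q : ℝ × ℝ → ℝ) (v₀ : ℝ → ℝ), ExtendedSubsolution k T a b v Dv Q v₀ ∧
      u =ᵐ[cyl T (Ioo a b)] v ∧ u₀ =ᵐ[volume.restrict (Ioo a b)] v₀ ∧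
      (∀ᵐ z, ν * Dv z ^ 2 ≤ Q z * Dv z) ∧ ∀ᵐ z, |Q z| ≤ Λ * |Dv z| := by
  obtain ⟨Du, hL, -, hweak⟩ := h
  set S : Set (ℝ × ℝ) := Ioo 0 T ×ˢ Ioo a b with hS
  have hSm : MeasurableSet S := measurableSet_Ioo.prod measurableSet_Ioo
  obtain ⟨w, hw, hwu⟩ := hL.memLp.1
  obtain ⟨Dw, hDw, hDwu⟩ := hL.memLp_deriv.1
  obtain ⟨B, hB, hBA⟩ := hA
  obtain ⟨w₀, hw₀, hwu₀⟩ := hu₀.1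
  have hSae : ∀ᵐ z ∂(cyl T (Ioo a b)), z ∈ S := ae_restrict_mem hSm
  have hv : u =ᵐ[cyl T (Ioo a b)] S.indicator fun z => max (w z) 0 := by
    filter_upwards [hwu, hu0, hSae] with z h1 h2 h3
    rw [indicator_of_mem h3, ← h1, max_eq_left h2]
  have hDv : Du =ᵐ[cyl T (Ioo a b)] S.indicator Dw := by
    filter_upwards [hDwu, hSae] with z h1 h3
    rw [indicator_of_mem h3, ← h1]
  have hQ : (fun z => A z * Du z) =ᵐ[cyl T (Ioo a b)] S.indicator fun z => B z * Dw z := by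
    filter_upwards [hDwu, hBA, hSae] with z h1 h2 h3
    rw [indicator_of_mem h3, ← h1, ← h2]
  have hv₀ : u₀ =ᵐ[volume.restrict (Ioo a b)] (Ioo a b).indicator fun x => max (w₀ x) 0 := by
    filter_upwards [hwu₀, hu₀0, ae_restrict_mem measurableSet_Ioo] with z h1 h2 h3
    rw [indicator_of_mem h3, ← h1, max_eq_left h2]
  have hQL : MemLp (fun z => A z * Du z) 2 (cyl T (Ioo a b)) := by
    refine (hL.memLp_deriv.const_mul Λ).mono (⟨B, hB, hBA⟩ |> fun h : AEStronglyMeasurable A _ =>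
      h.mul hL.memLp_deriv.1) ?_
    filter_upwards [hΛ] with z hz
    rw [norm_mul, norm_mul]
    exact mul_le_mul_of_nonneg_right (hz.trans (le_abs_self _)) (norm_nonneg _)
  have hext : ∀ {f g : ℝ × ℝ → ℝ}, MemLp f 2 (cyl T (Ioo a b)) →
      f =ᵐ[cyl T (Ioo a b)] S.indicator g → MemLp (S.indicator g) 2 volume := by
    intro f g hf hfg
    rw [memLp_indicator_iff_restrict hSm]
    refine hf.ae_eq (hfg.trans ?_)
    filter_upwards [hSae] with z hz using indicator_of_mem hz _
  refine ⟨S.indicator fun z => max (w z) 0, S.indicator Dw, S.indicator fun z => B z * Dw z,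
    (Ioo a b).indicator fun x => max (w₀ x) 0, ?_, hv, hv₀, ?_, ?_⟩
  · exact {
      meas := (hw.measurable.max measurable_const).indicator hSm
      meas_deriv := hDw.measurable.indicator hSm
      meas_flux := (hB.measurable.mul hDw.measurable).indicator hSm
      meas_init := (hw₀.measurable.max measurable_const).indicator measurableSet_Ioo
      memLp := hext hL.memLp hv
      memLp_deriv := hext hL.memLp_deriv hDv
      memLp_flux := hext hQL hQ
      memLp_init := by
        rw [memLp_indicator_iff_restrict measurableSet_Ioo]
        refine hu₀.ae_eq (hv₀.trans ?_)
        filter_upwards [ae_restrict_mem measurableSet_Ioo] with z hz using indicator_of_mem hz _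
      zero := fun z hz => indicator_of_notMem hz _
      zero_flux := fun z hz => indicator_of_notMem hz _
      zero_init := fun z hz => indicator_of_notMem hz _
      nonneg := fun z => indicator_nonneg (fun _ _ => le_max_right _ _) z
      nonneg_init := fun z => indicator_nonneg (fun _ _ => le_max_right _ _) z
      slice := by
        rw [← ae_restrict_iff' measurableSet_Ioo]
        filter_upwards [hL.slice, ae_ae_of_ae_cyl hv, ae_ae_of_ae_cyl hDv] with t h1 h2 h3
        exact h1.congr h2 h3
      weak := fun ψ ψt Dψ hψ => by
        refine le_trans (le_of_eq (integral_congr_ae ?_)) (hweak ψ ψt Dψ hψ)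
        filter_upwards [timeConv_sub_congr (k := k) hv hv₀, hQ] with z h1 h2
        rw [← h1, ← h2] }
  · have hae : ∀ᵐ z ∂(cyl T (Ioo a b)), ν ≤ B z := by
      filter_upwards [hAν, hBA] with z h1 h2
      rwa [← h2]
    rw [cyl, ae_restrict_iff' hSm] at hae
    filter_upwards [hae] with z hz
    by_cases hzS : z ∈ S
    · rw [indicator_of_mem hzS, indicator_of_mem hzS]
      have := mul_le_mul_of_nonneg_right (hz hzS) (sq_nonneg (Dw z))
      linarith
    · rw [indicator_of_notMem hzS, indicator_of_notMem hzS]; simp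
  · have hae : ∀ᵐ z ∂(cyl T (Ioo a b)), |B z| ≤ Λ := by
      filter_upwards [hΛ, hBA] with z h1 h2
      rwa [← h2]
    rw [cyl, ae_restrict_iff' hSm] at hae
    filter_upwards [hae] with z hz
    by_cases hzS : z ∈ S
    · rw [indicator_of_mem hzS, indicator_of_mem hzS, abs_mul]
      exact mul_le_mul_of_nonneg_right (hz hzS) (abs_nonneg _)
    · rw [indicator_of_notMem hzS, indicator_of_notMem hzS]; simp

lemma mass_congr {T a b x₀ t₁ R : ℝ} {u v : ℝ × ℝ → ℝ} (h : u =ᵐ[cyl T (Ioo a b)] v)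
    (ht : 0 ≤ t₁) (ha : a ≤ x₀ - R) (hb : x₀ + R ≤ b) : mass u T x₀ t₁ R = mass v T x₀ t₁ R := by
  refine lintegral_congr_ae (ae_restrict_of_ae_restrict_of_subset (Ioo_subset_Ioo_left ht) ?_)
  filter_upwards [ae_ae_of_ae_cyl h] with t h1
  refine lintegral_congr_ae (ae_restrict_of_ae_restrict_of_subset (Ioo_subset_Ioo ha hb) ?_)
  filter_upwards [h1] with x hx
  rw [hx]

lemma pastTail_congr {k : ℝ → ℝ} {T a b x₀ t₁ R : ℝ} {u v : ℝ × ℝ → ℝ} {u₀ v₀ : ℝ → ℝ}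
    (h : u =ᵐ[cyl T (Ioo a b)] v) (h₀ : u₀ =ᵐ[volume.restrict (Ioo a b)] v₀)
    (ht : t₁ ≤ T) (ha : a ≤ x₀ - R) (hb : x₀ + R ≤ b) :
    pastTail k u u₀ T x₀ t₁ R = pastTail k v v₀ T x₀ t₁ R := by
  have e1 : ∫⁻ x in Ioo (x₀ - R) (x₀ + R), ENNReal.ofReal (u₀ x)
      = ∫⁻ x in Ioo (x₀ - R) (x₀ + R), ENNReal.ofReal (v₀ x) := by
    refine lintegral_congr_ae (ae_restrict_of_ae_restrict_of_subset (Ioo_subset_Ioo ha hb) ?_)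
    filter_upwards [h₀] with x hx
    rw [hx]
  rw [pastTail, pastTail, e1]
  congr 1
  refine lintegral_congr_ae (ae_restrict_of_ae_restrict_of_subset (Ioo_subset_Ioo_right ht) ?_)
  filter_upwards [ae_ae_of_ae_cyl h] with t h1
  congr 1
  refine lintegral_congr_ae (ae_restrict_of_ae_restrict_of_subset (Ioo_subset_Ioo ha hb) ?_)
  filter_upwards [h1] with x hx
  rw [hx]

end Subdiffusion

end

theorem theorem4p3 :
    ∃ τ₁ : ℝ → ℝ → ℝ, (∀ ω p₀ : ℝ, 0 < ω → 1 < p₀ → 0 < τ₁ ω p₀) ∧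
    ∀ ν Λ δ η cbar c₀ cη : ℝ, 0 < ν → 0 < δ → δ < 1 → 0 < η →
    ∃ C : ℝ, 0 < C ∧
    ∀ (k l : ℝ → ℝ) (p₀ ω : ℝ) (c : ℝ → ℝ),
      Subdiffusion.IsKernelPair k l →
      Subdiffusion.HigherIntegrability p₀ cbar l →
      Subdiffusion.DerivativeBounds c₀ ω c k l → c η = cη →
    ∀ (T a b : ℝ) (A : ℝ × ℝ → ℝ) (u₀ : ℝ → ℝ), 0 < T → a < b →
      AEStronglyMeasurable A (Subdiffusion.cyl T (Ioo a b)) →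
      (∀ᵐ z ∂(Subdiffusion.cyl T (Ioo a b)), |A z| ≤ Λ) →
      (∀ᵐ z ∂(Subdiffusion.cyl T (Ioo a b)), ν ≤ A z) →
      MemLp u₀ 2 (volume.restrict (Ioo a b)) →
    ∃ rstar : ℝ, 0 < rstar ∧ ENNReal.ofReal rstar < Subdiffusion.r₀ l ∧
    ∀ r t₀ x₀ : ℝ, 0 < r → r ≤ rstar → 0 < t₀ → t₀ ≤ T →
      0 ≤ t₀ - η * Subdiffusion.Φ l r → Metric.ball x₀ r ⊆ Ioo a b →
    ∀ u : ℝ × ℝ → ℝ,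
      Subdiffusion.IsWeakSubsolution k A u₀ t₀ (Metric.ball x₀ r) u →
      (∀ᵐ z ∂(Subdiffusion.cyl t₀ (Metric.ball x₀ r)), 0 ≤ u z) →
      (∀ᵐ x ∂(volume.restrict (Metric.ball x₀ r)), 0 ≤ u₀ x) →
    ∀ σ' σ : ℝ, δ ≤ σ' → σ' < σ → σ ≤ 1 →
      essSup (fun z => ENNReal.ofReal (u z))
          (volume.restrict (Subdiffusion.U t₀ x₀ r (η * Subdiffusion.Φ l r) σ')) ≤
        ENNReal.ofReal (C * (σ - σ') ^ (-2 * τ₁ ω p₀) * (1 / (r * Subdiffusion.Φ l r))) *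
          (∫⁻ t in Ioo (t₀ - σ * η * Subdiffusion.Φ l r) t₀,
            ∫⁻ x in Metric.ball x₀ (r * σ), ENNReal.ofReal (u (t, x))) +
        ENNReal.ofReal (C / (σ - σ') ^ (τ₁ ω p₀)) *
          (Subdiffusion.kRight k (t₀ - σ * η * Subdiffusion.Φ l r) * ENNReal.ofReal r *
              (∫⁻ x in Metric.ball x₀ (r * σ), ENNReal.ofReal (u₀ x)) +
            ENNReal.ofReal r *
              ∫⁻ τ in Ioo 0 (t₀ - σ * η * Subdiffusion.Φ l r),
                ENNReal.ofReal (-Subdiffusion.kdot k (t₀ - τ)) *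
                  ∫⁻ x in Metric.ball x₀ (r * σ), ENNReal.ofReal (u (τ, x))) := by
  obtain ⟨C₀, -, hC₀⟩ := Subdiffusion.exists_cutoff
  refine ⟨fun ω p₀ => Subdiffusion.gapExponent ω p₀ + Subdiffusion.gapExponent ω p₀ ^ 2,
    fun ω p₀ hω hp => by have := Subdiffusion.two_le_gapExponent hω hp; positivity, ?_⟩
  intro ν Λ δ η cbar c₀ cη hν hδ _ hη
  refine ⟨Subdiffusion.harnackConst ν Λ δ η cbar c₀ cη C₀, Subdiffusion.harnackConst_pos hδ hη, ?_⟩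
  intro k l p₀ ω c H hHI hDB hcη T a b A u₀ hT hab hA hΛ hAν hu₀
  obtain ⟨hp₀, hcbar, s₀, hs₀, hmem, hav⟩ := hHI
  -- all intrinsic times are at most `τ`, where the local assumptions on the kernels are available
  obtain ⟨τ, hτ, hτ1, hτη, hτs⟩ : ∃ τ : ℝ, 0 < τ ∧ τ ≤ 1 ∧ η * τ ≤ 1 ∧ τ ≤ s₀ := by
    refine ⟨min (min 1 s₀) (1 / η), by positivity, (min_le_left _ _).trans (min_le_left _ _), ?_,
      (min_le_left _ _).trans (min_le_right _ _)⟩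
    have := (le_div_iff₀' hη).1 (min_le_right (min 1 s₀) (1 / η))
    exact this
  have hL := H.conv_one_pos hτ
  -- the factor `1 / 2` makes the radius strictly smaller than `r₀`, even if `l` vanishes after `τ`
  refine ⟨Real.sqrt (Subdiffusion.conv (fun _ => 1) l τ / 2), by positivity,
    H.ofReal_sqrt_lt_r₀ hτ, ?_⟩
  intro r t₀ x₀ hr hrs ht₀ ht₀T hηΦ hball u hu hu0 hu₀0 σ' σ hδσ hσσ' hσ
  have hr2 : r ^ 2 ≤ Subdiffusion.conv (fun _ => 1) l τ := by
    have := pow_le_pow_left₀ hr.le hrs 2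
    rw [Real.sq_sqrt (by positivity)] at this
    linarith
  obtain ⟨hΦ0, hΦτ, hLΦ⟩ := H.Φ_spec hr hτ.le hr2
  have hsub : Subdiffusion.cyl t₀ (Metric.ball x₀ r) ≤ Subdiffusion.cyl T (Ioo a b) :=
    Measure.restrict_mono (prod_mono (Ioo_subset_Ioo_right ht₀T) hball) le_rfl
  have hA' := hA.mono_measure hsub
  have hΛ' := ae_mono hsub hΛ
  have hAν' := ae_mono hsub hAν
  have hu₀' := hu₀.mono_measure (Measure.restrict_mono hball le_rfl)
  simp only [Real.ball_eq_Ioo] at hA' hΛ' hAν' hu₀' hu hu0 hu₀0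
  obtain ⟨v, Dv, Q, v₀, D, huv, huv₀, hcoer, hbdd⟩ :=
    hu.exists_extendedSubsolution hA' hΛ' hAν' hu₀' hu0 hu₀0
  have L : Subdiffusion.LocalSetting k l ν Λ η cbar c₀ cη ω p₀ r (Subdiffusion.Φ l r) t₀ x₀
      v Dv Q v₀ :=
    { subsolution := D
      kernel := H
      ν_pos := hν
      coercive := hcoer
      bounded := hbdd
      η_pos := hη
      one_lt_cbar := hcbar
      one_lt_p₀ := hp₀
      c₀_pos := hDB.c₀_pos
      cη_pos := hcη ▸ hDB.c_pos η hη
      ω_pos := hDB.ω_pos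
      r_pos := hr
      Φ_pos := hΦ0
      Φ_le_one := hΦτ.trans hτ1
      mul_Φ_le_one := (mul_le_mul_of_nonneg_left hΦτ hη.le).trans hτη
      mul_Φ_le := by linarith
      conv_one_Φ := hLΦ
      power := fun s hs0 hs => by
        rw [← hLΦ]
        exact H.conv_one_le_rpow hp₀ hcbar hmem hav hΦ0 (hΦτ.trans hτs) hs0 hs
      deriv_bound := hDB.bound
      scaling := hcη ▸ hDB.scaling η hη }
  have hmain := L.ofReal_le_mass_add_pastTail hC₀ hδ hδσ hσσ' hσ
  set h := η * Subdiffusion.Φ l r with hh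
  have hh0 : 0 < h := L.h_pos
  have hσ'0 : 0 < σ' := hδ.trans_le hδσ
  have hσh : 0 < σ * h := mul_pos (hσ'0.trans hσσ') hh0
  have hσh1 : σ * h ≤ h := mul_le_of_le_one_left hh0.le hσ
  have hrσ : r * σ ≤ r := mul_le_of_le_one_right hr.le hσ
  have e1 := Subdiffusion.mass_congr (x₀ := x₀) (t₁ := t₀ - σ * h) (R := r * σ) huv
    (by linarith) (by linarith) (by linarith)
  have e2 := Subdiffusion.pastTail_congr (k := k) (x₀ := x₀) (t₁ := t₀ - σ * h) (R := r * σ) huv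
    huv₀ (by linarith) (by linarith) (by linarith)
  rw [← e1, ← e2] at hmain
  have hae : ∀ᵐ z ∂(volume.restrict (Subdiffusion.U t₀ x₀ r h σ')), u z = v z := by
    refine ae_restrict_of_ae_restrict_of_subset (prod_mono (Ioo_subset_Ioo_left ?_) ?_) huv
    · have := mul_le_mul_of_nonneg_right hσσ'.le hh0.le
      linarith
    · have : r * σ' ≤ r := mul_le_of_le_one_right hr.le (by linarith)
      rw [Real.ball_eq_Ioo]
      exact Ioo_subset_Ioo (by linarith) (by linarith)
  refine essSup_le_of_ae_le _ ?_
  rw [Subdiffusion.U, Real.ball_eq_Ioo] at hae ⊢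
  filter_upwards [hmain, hae] with z hz hzu
  rw [hzu]
  refine hz.trans (le_of_eq ?_)
  rw [Subdiffusion.mass, Subdiffusion.pastTail, mul_assoc σ η, ← hh, Real.ball_eq_Ioo,
    mul_add (ENNReal.ofReal r),
    ← mul_assoc (ENNReal.ofReal r) (Subdiffusion.kRight _ _), mul_comm (ENNReal.ofReal r)
    (Subdiffusion.kRight _ _)]
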